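/- Let $d\in\mathbb{N}$ and $T>0$. Consider on $[0,T]\times\mathbb{R}^d$ the equation \[ \partial_t^3 u+\sum_{j=0}^2\sum_{|\alpha|\le 3-j}a_{j,\alpha}(t)\,\partial_t^j\partial_x^\alpha u=f, \qquad u(0,x)=u_0,\quad \partial_tu(0,x)=u_1,\quad \partial_t^2u(0,x)=u_2 , \] and put $L(t,\tau,\xi)=\tau^3+\sum_{j\le 2,\ j+|\alpha|=3}a_{j,\alpha}(t)\tau^j\xi^\alpha$, $M(t,\tau,\xi)=\sum_{j+|\alpha|=2}a_{j,\alpha}(t)\tau^j\xi^\alpha$, $N(t,\tau,\xi)=\sum_{j+|\alpha|=1}a_{j,\alpha}(t)\tau^j\xi^\alpha$, $p=a_{0,0}$. The coefficients of $L$ are real and belong to $C^2([0,T])$, those of $M$ and $N$ are complex valued and belong to $C^1([0,T])$, and $p\in L^\infty([0,T])$ is complex valued. Assume that, for all $t\in[0,T]$ and $\xi\in\mathbb{R}^d$, all roots of $L(t,\cdot,\xi)$ are real (weak hyperbolicity). Let $\lambda_1\le\lambda_2\le\lambda_3$ be the roots in $\tau$ of \[ \mathcal{L}(t,\tau,\xi)=L(t,\tau,\xi)-\partial_\tau^2L(t,\tau,\xi)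 \] and $\mu_1\le\mu_2$ those of $\partial_\tau\mathcal{L}$ (these roots are real and distinct), and let \[ \check M=M-\tfrac12\,\partial_t\partial_\tau L,\qquad \check N=N-\tfrac12\,\partial_t\partial_\tau M+\tfrac1{12}\,\partial_t^2\partial_\tau^2L . \] Write $\check M_j(t,\xi)=\check M(t,\lambda_j(t,\xi),\xi)$ and $\check N_j(t,\xi)=\check N(t,\mu_j(t,\xi),\xi)$, let $\mathcal S_2=\{(1,2),(2,3),(3,1)\}$ and $\mathcal S_3=\{(1,2,3),(2,3,1),(3,1,2)\}$, and suppose that for $|\xi|$ large the functions $t\mapsto\check N_j(t,\xi)$ are absolutely continuous on $[0,T]$. Assume that there are constants $C,R$ such that for all $\xi\in\mathbb{R}^d$ with $|\xi|\ge R$ each of the following six integrals is at most $C\log(1+|\xi|)$: \begin{gather*} \int_0^T\sum_{(j,k)\in\mathcal S_2}\frac{|\partial_t\lambda_j-\partial_t\lambda_k|}{|\lambda_j-\lambda_k|}\,dt,\qquad \int_0^T\sum_{(j,k)\in\mathcal S_2}\frac{|\partial_t^2\lambda_j-\partial_t^2\lambda_k|}{|\partial_t\lambda_j-\partial_t\lambda_k|+1}\,dt,\\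 \int_0^T\sum_{j=1}^3\frac{|\partial_t\check M_j|}{|\check M_j|+1}\,dt,\qquad \int_0^T\sum_{j=1}^2\frac{|\partial_t\check N_j|}{|\check N_j|+1}\,dt,\\ \int_0^T\sum_{(j,k,l)\in\mathcal S_3}\frac{|\check M_j|}{|\lambda_j-\lambda_k|\,|\lambda_j-\lambda_l|}\,dt,\qquad \int_0^T\sum_{j=1}^2\sqrt{\frac{|\check N_j|}{|\mu_2-\mu_1|}}\,dt . \end{gather*} Then the Cauchy problem is well-posed in $C^\infty$: for all $u_0,u_1,u_2\in C^\infty(\mathbb{R}^d)$ and $f\in C([0,T];C^\infty(\mathbb{R}^d))$ there is one and only one $u\in C^2([0,T];C^\infty(\mathbb{R}^d))$ with $\partial_t^2u(\cdot,x)$ absolutely continuous for every $x$ that satisfies the initial conditions and, for every $x$ and almost every $t\in[0,T]$, the equation; and $u\in C^2([0,T];C^\infty(\mathbb{R}^d))$ depends continuously on $(u_0,u_1,u_2,f)$ for the usual Fréchet topologies (uniform convergence on compact sets of all $x$-derivatives, uniformly in $t$). -/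

import Mathlib

open MeasureTheory Set
open scoped ContDiff

noncomputable section

namespace ThirdOrder

/-- The space `ℝ^d` with its Euclidean norm. -/
abbrev Space (d : ℕ) : Type := EuclideanSpace ℝ (Fin d)

/-- A family of time dependent coefficients `c j α t`, where `j` is the number of time derivatives
and `α` is the multi-index of the space derivatives. -/
abbrev Coeffs (d : ℕ) (K : Type) : Type := ℕ → (Fin d → ℕ) → ℝ → K

/-- The finite set of the multi-indices `α ∈ ℕ^d` with `|α| = k`. -/
def multiIndices (d k : ℕ) : Finset (Fin d → ℕ) := Finset.piAntidiag Finset.univ k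

/-! ### Symbols -/

section Symbols

variable {d : ℕ}

/-- The polynomial in `τ` given by `∑_{j < J} ∑_{|α| = m - j} c_{j,α}(t) ξ^α τ^j`. -/
def symbol {K : Type} [RCLike K] (c : Coeffs d K) (J m : ℕ) (t : ℝ) (ξ : Space d) :
    Polynomial K :=
  ∑ j ∈ Finset.range J, ∑ α ∈ multiIndices d (m - j),
    Polynomial.C (c j α t * ((∏ i, ξ i ^ α i : ℝ) : K)) * Polynomial.X ^ j

/-- Derivatives with respect to `t ∈ [0,T]` of order `k` of all the coefficients. -/
def coeffDeriv {K : Type} [RCLike K] (T : ℝ) (k : ℕ) (c : Coeffs d K) : Coeffs d K :=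
  fun j α t => iteratedDerivWithin k (c j α) (Icc 0 T) t

/-- The principal symbol `L(t,τ,ξ) = τ³ + ∑_{j+|α|=3, j≤2} a_{j,α}(t) τ^j ξ^α`. -/
def symbolL (a : Coeffs d ℝ) (t : ℝ) (ξ : Space d) : Polynomial ℝ :=
  Polynomial.X ^ 3 + symbol a 3 3 t ξ

/-- The symbol `∂_t^k L(t,τ,ξ)`, for `k ≥ 1` (the leading coefficient of `L` is constant). -/
def symbolDtL (T : ℝ) (k : ℕ) (a : Coeffs d ℝ) (t : ℝ) (ξ : Space d) : Polynomial ℝ :=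
  symbol (coeffDeriv T k a) 3 3 t ξ

/-- The symbol `M(t,τ,ξ) = ∑_{j+|α|=2} b_{j,α}(t) τ^j ξ^α`. -/
def symbolM (b : Coeffs d ℂ) (t : ℝ) (ξ : Space d) : Polynomial ℂ := symbol b 3 2 t ξ

/-- The symbol `N(t,τ,ξ) = ∑_{j+|α|=1} b_{j,α}(t) τ^j ξ^α`. -/
def symbolN (b : Coeffs d ℂ) (t : ℝ) (ξ : Space d) : Polynomial ℂ := symbol b 2 1 t ξ

/-- The auxiliary polynomial `𝓛 = L - ∂_τ² L`. -/
def auxL (a : Coeffs d ℝ) (t : ℝ) (ξ : Space d) : Polynomial ℝ :=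
  symbolL a t ξ - (symbolL a t ξ).derivative.derivative

/-- The real roots of a polynomial, with multiplicity, in increasing order, indexed from `0`. -/
def orderedRoot (P : Polynomial ℝ) (j : ℕ) : ℝ := (P.roots.sort (· ≤ ·)).getD j 0

/-- The roots `λ_1 ≤ λ_2 ≤ λ_3` of `𝓛`, indexed by `Fin 3`. -/
def lam (a : Coeffs d ℝ) (j : Fin 3) (t : ℝ) (ξ : Space d) : ℝ := orderedRoot (auxL a t ξ) j

/-- The roots `μ_1 ≤ μ_2` of `∂_τ 𝓛`, indexed by `Fin 2`. -/
def mu (a : Coeffs d ℝ) (j : Fin 2) (t : ℝ) (ξ : Space d) : ℝ :=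
  orderedRoot (auxL a t ξ).derivative j

/-- `M̌ = M - (1/2) ∂_t ∂_τ L`. -/
def checkM (T : ℝ) (a : Coeffs d ℝ) (b : Coeffs d ℂ) (t : ℝ) (ξ : Space d) : Polynomial ℂ :=
  symbolM b t ξ
    - Polynomial.C (1 / 2) * (symbolDtL T 1 a t ξ).derivative.map (algebraMap ℝ ℂ)

/-- `Ň = N - (1/2) ∂_t ∂_τ M + (1/12) ∂_t² ∂_τ² L`. -/
def checkN (T : ℝ) (a : Coeffs d ℝ) (b : Coeffs d ℂ) (t : ℝ) (ξ : Space d) : Polynomial ℂ :=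
  symbolN b t ξ
    - Polynomial.C (1 / 2) * (symbolM (coeffDeriv T 1 b) t ξ).derivative
    + Polynomial.C (1 / 12) *
        (symbolDtL T 2 a t ξ).derivative.derivative.map (algebraMap ℝ ℂ)

/-- The function `M̌(t, λ_j(t,ξ), ξ)`. -/
def checkMLam (T : ℝ) (a : Coeffs d ℝ) (b : Coeffs d ℂ) (j : Fin 3) (t : ℝ) (ξ : Space d) : ℂ :=
  (checkM T a b t ξ).eval (lam a j t ξ : ℂ)

/-- The function `Ň(t, μ_j(t,ξ), ξ)`. -/
def checkNMu (T : ℝ) (a : Coeffs d ℝ) (b : Coeffs d ℂ) (j : Fin 2) (t : ℝ) (ξ : Space d) : ℂ :=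
  (checkN T a b t ξ).eval (mu a j t ξ : ℂ)

/-- The derivative in `t ∈ [0,T]`, of order `k`, of a function of `(t,ξ)` or `(t,x)`. -/
def tDeriv {F : Type} [NormedAddCommGroup F] [NormedSpace ℝ F] (T : ℝ) (k : ℕ)
    (u : ℝ → Space d → F) (t : ℝ) (x : Space d) : F :=
  iteratedDerivWithin k (fun s => u s x) (Icc 0 T) t

/-- The bound `∫_0^T F(t,ξ) dt ≲ log(1+|ξ|)`, for large `|ξ|`. -/
def LogBound (T : ℝ) (F : ℝ → Space d → ℝ) : Prop :=
  ∃ C R : ℝ, ∀ ξ : Space d, R ≤ ‖ξ‖ → ∫ t in (0 : ℝ)..T, F t ξ ≤ C * Real.log (1 + ‖ξ‖)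

end Symbols

/-! ### The Cauchy problem -/

section Cauchy

variable {d : ℕ}

/-- The partial derivative `∂_{x_i}`. -/
def partialDeriv (i : Fin d) (g : Space d → ℂ) (x : Space d) : ℂ :=
  fderiv ℝ g x (EuclideanSpace.single i 1)

/-- The derivative `∂_x^α = ∂_{x_1}^{α_1} ⋯ ∂_{x_d}^{α_d}`. -/
def multiDeriv (α : Fin d → ℕ) (g : Space d → ℂ) : Space d → ℂ :=
  (List.finRange d).foldr (fun i h => (partialDeriv i)^[α i] h) g

/-- The space `C([0,T]; C^∞(ℝ^d))`. -/
def ContSmooth (T : ℝ) (g : ℝ → Space d → ℂ) : Prop :=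
  (∀ t ∈ Icc 0 T, ContDiff ℝ ∞ (g t)) ∧
  ∀ n : ℕ, ContinuousOn (fun p : ℝ × Space d => iteratedFDeriv ℝ n (g p.1) p.2)
    (Icc 0 T ×ˢ univ)

/-- `∂_t³u + ∑_{j≤2} ∑_{|α|=3-j} a_{j,α}(t) ∂_t^j ∂_x^α u
  + ∑_{j≤2} ∑_{|α|≤2-j} b_{j,α}(t) ∂_t^j ∂_x^α u` at the point `(t,x)`. -/
def operator (T : ℝ) (a : Coeffs d ℝ) (b : Coeffs d ℂ) (u : ℝ → Space d → ℂ)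
    (t : ℝ) (x : Space d) : ℂ :=
  tDeriv T 3 u t x
    + ∑ j ∈ Finset.range 3, ∑ α ∈ multiIndices d (3 - j),
        (a j α t : ℂ) * multiDeriv α (tDeriv T j u t) x
    + ∑ j ∈ Finset.range 3, ∑ k ∈ Finset.range (3 - j), ∑ α ∈ multiIndices d k,
        b j α t * multiDeriv α (tDeriv T j u t) x

/-- `u ∈ C²([0,T]; C^∞(ℝ^d))`, with `∂_t² u` absolutely continuous in time, solves the equation
for almost every time and takes the initial data `u₀ 0, u₀ 1, u₀ 2`. As the coefficient of order
zero is only bounded, `∂_t³ u` exists in general only almost everywhere. -/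
structure IsSolution (T : ℝ) (a : Coeffs d ℝ) (b : Coeffs d ℂ) (f : ℝ → Space d → ℂ)
    (u₀ : Fin 3 → Space d → ℂ) (u : ℝ → Space d → ℂ) : Prop where
  contDiffOn : ∀ x, ContDiffOn ℝ 2 (fun t => u t x) (Icc 0 T)
  contSmooth : ∀ k : Fin 3, ContSmooth T (tDeriv T k u)
  absCont : ∀ x, AbsolutelyContinuousOnInterval (fun t => tDeriv T 2 u t x) 0 T
  equation : ∀ x, ∀ᵐ t ∂(volume.restrict (Icc 0 T)), operator T a b u t x = f t x
  initial : ∀ k : Fin 3, ∀ x, tDeriv T k u 0 x = u₀ k x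

/-- Well-posedness in `C^∞`: for all data `u₀ k ∈ C^∞(ℝ^d)` and `f ∈ C([0,T]; C^∞(ℝ^d))` there is a
solution on `[0,T] × ℝ^d`, it is unique, and it depends continuously on the data, for the usual
Fréchet topologies. -/
structure WellPosed (T : ℝ) (a : Coeffs d ℝ) (b : Coeffs d ℂ) : Prop where
  existence : ∀ (f : ℝ → Space d → ℂ) (u₀ : Fin 3 → Space d → ℂ), ContSmooth T f →
    (∀ k, ContDiff ℝ ∞ (u₀ k)) → ∃ u, IsSolution T a b f u₀ u
  uniqueness : ∀ (f : ℝ → Space d → ℂ) (u₀ : Fin 3 → Space d → ℂ), ContSmooth T f →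
    (∀ k, ContDiff ℝ ∞ (u₀ k)) → ∀ u v, IsSolution T a b f u₀ u → IsSolution T a b f u₀ v →
      ∀ t ∈ Icc 0 T, u t = v t
  continuity : ∀ (S : Set (Space d)) (m : ℕ), IsCompact S →
    ∃ (S' : Set (Space d)) (m' : ℕ) (C : ℝ), IsCompact S' ∧
      ∀ (f : ℝ → Space d → ℂ) (u₀ : Fin 3 → Space d → ℂ) (u : ℝ → Space d → ℂ), ContSmooth T f →
        (∀ k, ContDiff ℝ ∞ (u₀ k)) → IsSolution T a b f u₀ u →
        ∀ B : ℝ,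
          (∀ n ≤ m', ∀ x ∈ S', (∀ k, ‖iteratedFDeriv ℝ n (u₀ k) x‖ ≤ B) ∧
            ∀ t ∈ Icc 0 T, ‖iteratedFDeriv ℝ n (f t) x‖ ≤ B) →
          ∀ (k : Fin 3), ∀ n ≤ m, ∀ t ∈ Icc 0 T, ∀ x ∈ S,
            ‖iteratedFDeriv ℝ n (tDeriv T k u t) x‖ ≤ C * B

end Cauchy

end ThirdOrder

end

open ThirdOrder

open MeasureTheory Set
open scoped ContDiff

noncomputable section

set_option linter.unusedSectionVars false

namespace ThirdOrder


/-! ### Cubic polynomials with real roots -/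

section Cubic

open Polynomial

/-! A Fourier transform in `x` turns the equation into a third order ODE in `t` for each frequency.
Well-posedness follows from two bounds of its solution operator: a polynomial bound at real
frequencies, and a bound `C exp(B‖ζ‖)` at complex frequencies.

Polynomial bound. The roots of `L` may coalesce, but those of `𝓛 = L - ∂_τ² L` keep a mutual
distance of at least `√2` (`exists_separated_roots`), and the error `∂_τ² L` has order one: it only
contributes `2 ∑ (u' - iλ_j u)`. The energy is a weighted sum of the squares of the symmetrized
second order factors of `𝓛`, of the first order factors `u' - iλ_j u` and `u' - iμ_k u`, and of `u`.
The equation expresses the derivative of a second order factor (`symmetrized_identity`): besides a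
rotation by `iλ_j` there remain differences of the `λ_j'` and of the `λ_j''`, and lower order terms.
The latter are expanded by Lagrange interpolation, `M̌` at the `λ_j` along second order factors and
`Ň` at the `μ_k` along first order factors; the corrections that distinguish `M̌, Ň` from `M, N` are
those that the symmetrization produces. Every term is then at most a constant times
`SymbolData.rate` (the six integrands plus `1`) times the energy norm, and the logarithmic
derivatives of the weights obey the same bound. Gronwall's inequality (`SymbolData.energy_le`) gives
growth by `exp(c ∫ rate)`, which the logarithmic hypotheses turn into a power of `1 + |ξ|`
(`Regular.poly_bound`).

Exponential bound. In the norm `r²|u| + r|u'| + |u''|` with `r = 1 + 2π‖ζ‖` all terms of the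
equation cost one factor `r`, so a plain Gronwall argument in time suffices (`CoefData.exp_bound`).
Together with a shift of the contour of integration, in the manner of Paley and Wiener, it yields
finite speed of propagation (`FourierSystem.Hyperbolic.sol_eq_zero`).

Conclusion. Smooth data with compact support are solved by the inverse Fourier transform, which
converges because of the polynomial bound. Finite speed of propagation allows arbitrary smooth data
to be cut off, and gives existence, uniqueness and continuous dependence. To run this once for all
times, the triple `(u, u', u'')` is regarded as a function of `x` with values in `C([0,T])³` and the
equation as a Volterra system in time; integrating in time also accommodates the merely bounded
coefficient `p`. -/

/-- The monic cubic polynomial with the given lower coefficients. -/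
def cubic (c₂ c₁ c₀ : ℝ) : ℝ[X] := X ^ 3 + C c₂ * X ^ 2 + C c₁ * X + C c₀

theorem cubic_eval (c₂ c₁ c₀ τ : ℝ) :
    (cubic c₂ c₁ c₀).eval τ = τ ^ 3 + c₂ * τ ^ 2 + c₁ * τ + c₀ := by
  simp [cubic]

theorem cubic_monic (c₂ c₁ c₀ : ℝ) : (cubic c₂ c₁ c₀).Monic := by
  unfold cubic
  monicity!

theorem cubic_natDegree (c₂ c₁ c₀ : ℝ) : (cubic c₂ c₁ c₀).natDegree = 3 := by
  unfold cubic
  compute_degree!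

theorem cubic_of_roots (x y z : ℝ) :
    cubic (-(x + y + z)) (x * y + x * z + y * z) (-(x * y * z))
      = (X - C x) * (X - C y) * (X - C z) := by
  simp only [cubic, C_neg, C_add, C_mul]
  ring

theorem exists_roots_of_cubic_splits {c₂ c₁ c₀ : ℝ} (h : (cubic c₂ c₁ c₀).Splits) :
    ∃ x y z : ℝ, c₂ = -(x + y + z) ∧ c₁ = x * y + x * z + y * z ∧ c₀ = -(x * y * z) := by
  have hcard : (cubic c₂ c₁ c₀).roots.card = 3 := by
    rw [← h.natDegree_eq_card_roots, cubic_natDegree]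
  obtain ⟨x, y, z, hr⟩ := Multiset.card_eq_three.1 hcard
  have hp := h.eq_prod_roots_of_monic (cubic_monic c₂ c₁ c₀)
  rw [hr] at hp
  have he : ∀ τ : ℝ, τ ^ 3 + c₂ * τ ^ 2 + c₁ * τ + c₀ = (τ - x) * (τ - y) * (τ - z) := by
    intro τ
    rw [← cubic_eval, hp]
    simp [mul_assoc]
  -- Two monic cubics differ by a polynomial of degree at most two, so the values at `0, 1, -1`
  -- determine the lower coefficients.
  have h0 := he 0
  have h1 := he 1
  have h2 := he (-1)
  refine ⟨x, y, z, ?_, ?_, ?_⟩ <;> nlinarith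

/-- Divided differences: cancelling `x - y` and `x - z` in differences of the equations leaves two
quadratic relations, and cancelling `y - z` in their difference determines `c₂`. Multiplicities
never enter. -/
theorem vieta_of_three_roots {c₂ c₁ c₀ x y z : ℝ} (hxy : x ≠ y) (hxz : x ≠ z) (hyz : y ≠ z)
    (hx : x ^ 3 + c₂ * x ^ 2 + c₁ * x + c₀ = 0) (hy : y ^ 3 + c₂ * y ^ 2 + c₁ * y + c₀ = 0)
    (hz : z ^ 3 + c₂ * z ^ 2 + c₁ * z + c₀ = 0) :
    c₂ = -(x + y + z) ∧ c₁ = x * y + x * z + y * z ∧ c₀ = -(x * y * z) := by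
  have h1 : x ^ 2 + x * y + y ^ 2 + c₂ * (x + y) + c₁ = 0 :=
    mul_left_cancel₀ (sub_ne_zero.2 hxy) (by linear_combination hx - hy)
  have h2 : x ^ 2 + x * z + z ^ 2 + c₂ * (x + z) + c₁ = 0 :=
    mul_left_cancel₀ (sub_ne_zero.2 hxz) (by linear_combination hx - hz)
  have h3 : x + y + z + c₂ = 0 :=
    mul_left_cancel₀ (sub_ne_zero.2 hyz) (by linear_combination h1 - h2)
  have e2 : c₂ = -(x + y + z) := by linarith
  subst e2
  have e1 : c₁ = x * y + x * z + y * z := by linear_combination h1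
  subst e1
  refine ⟨rfl, rfl, by linear_combination hx⟩

/-- The points `±m` are critical, with values `q ∓ 2m³`, and the values at `±2m` are `q ± 2m³`. As
`|q| < 2m³` the signs at `-2m, -m, m, 2m` alternate. -/
theorem exists_three_roots_depressed {m q : ℝ} (hm : 0 < m) (hq : q ^ 2 < 4 * m ^ 6) :
    ∃ x y z : ℝ, x < y ∧ y < z ∧ x ^ 3 - 3 * m ^ 2 * x + q = 0 ∧ y ^ 3 - 3 * m ^ 2 * y + q = 0 ∧
      z ^ 3 - 3 * m ^ 2 * z + q = 0 := by
  have hq' : |q| < 2 * m ^ 3 := by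
    apply abs_lt_of_sq_lt_sq _ (by positivity)
    nlinarith
  obtain ⟨h1, h2⟩ := abs_lt.1 hq'
  set F : ℝ → ℝ := fun x => x ^ 3 - 3 * m ^ 2 * x + q with hF
  have hc : Continuous F := by fun_prop
  have f1 : F (-2 * m) < 0 := by simp only [hF]; nlinarith
  have f2 : 0 < F (-m) := by simp only [hF]; nlinarith
  have f3 : F m < 0 := by simp only [hF]; nlinarith
  have f4 : 0 < F (2 * m) := by simp only [hF]; nlinarith
  obtain ⟨x, hx, hx0⟩ := intermediate_value_Ioo (by linarith : -2 * m ≤ -m) hc.continuousOn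
    (⟨f1, f2⟩ : (0 : ℝ) ∈ Ioo _ _)
  obtain ⟨y, hy, hy0⟩ := intermediate_value_Ioo' (by linarith : -m ≤ m) hc.continuousOn
    (⟨f3, f2⟩ : (0 : ℝ) ∈ Ioo _ _)
  obtain ⟨z, hz, hz0⟩ := intermediate_value_Ioo (by linarith : m ≤ 2 * m) hc.continuousOn
    (⟨f3, f4⟩ : (0 : ℝ) ∈ Ioo _ _)
  exact ⟨x, y, z, hx.2.trans hy.1, hy.2.trans hz.1, hx0, hy0, hz0⟩

/-- If `u < 2`, then `vw ≤ ((v + w)/2)² ≤ 9Q²` would force `uvw < 18Q²`. Here `u, v, w` are to be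
the squared differences of the roots, whose product is the discriminant. -/
theorem two_le_of_sum_of_prod {Q u v w : ℝ} (hQ : 0 < Q) (hu : 0 ≤ u) (hv : 0 ≤ v) (hw : 0 ≤ w)
    (hsum : u + v + w = 6 * Q) (hprod : 18 * Q ^ 2 ≤ u * v * w) : 2 ≤ u := by
  have h1 : (v + w) ^ 2 ≤ (6 * Q) ^ 2 := pow_le_pow_left₀ (by positivity) (by linarith) 2
  have h2 : v * w ≤ 9 * Q ^ 2 := by nlinarith only [sq_nonneg (v - w), h1]
  have h3 : u * (v * w) ≤ u * (9 * Q ^ 2) := mul_le_mul_of_nonneg_left h2 hu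
  have h4 : 0 < Q ^ 2 := by positivity
  by_contra! hlt
  nlinarith only [mul_pos (sub_pos.2 hlt) h4, h3, hprod]

/-- If all the roots of `L = τ³ + c₂ τ² + c₁ τ + c₀` are real then the roots of `L - L''` are real,
and their mutual distances are at least `√2`. -/
theorem exists_separated_roots {c₂ c₁ c₀ : ℝ} (h : (cubic c₂ c₁ c₀).Splits) :
    ∃ x y z : ℝ, x < y ∧ y < z ∧ 2 ≤ (x - y) ^ 2 ∧ 2 ≤ (y - z) ^ 2 ∧
      c₂ = -(x + y + z) ∧ c₁ - 6 = x * y + x * z + y * z ∧ c₀ - 2 * c₂ = -(x * y * z) := by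
  obtain ⟨a, b, c, h2, h1, h0⟩ := exists_roots_of_cubic_splits h
  set s := (a + b + c) / 3 with hs
  -- In the variable `x = τ - s`, centred at the mean of the roots, `L` is `x³ - P x + q` and `L''`
  -- is `6x`. Hence `L - L''` is `x³ - (P + 6) x + q`: only `P` is changed, and the discriminant
  -- increases.
  set P := ((a - s) ^ 2 + (b - s) ^ 2 + (c - s) ^ 2) / 2 with hP
  set q := -((a - s) * (b - s) * (c - s)) with hq
  have hP0 : 0 ≤ P := by positivity
  have hdisc : 27 * q ^ 2 ≤ 4 * P ^ 3 := by
    have : 4 * P ^ 3 - 27 * q ^ 2 = ((a - b) * (a - c) * (b - c)) ^ 2 := by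
      simp only [hP, hq, hs]; ring
    nlinarith [sq_nonneg ((a - b) * (a - c) * (b - c))]
  set m := √((P + 6) / 3) with hm
  have hm2 : 3 * m ^ 2 = P + 6 := by
    rw [hm, Real.sq_sqrt (by positivity)]; ring
  have hm0 : 0 < m := Real.sqrt_pos.2 (by positivity)
  have hm6 : 27 * m ^ 6 = (P + 6) ^ 3 := by rw [← hm2]; ring
  obtain ⟨x, y, z, hxy, hyz, hx, hy, hz⟩ := exists_three_roots_depressed (q := q) hm0
    (by nlinarith [pow_nonneg hP0 2])
  rw [hm2] at hx hy hz
  have key : ∀ τ : ℝ, τ ^ 3 - (P + 6) * τ + q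
      = (τ + s) ^ 3 + c₂ * (τ + s) ^ 2 + (c₁ - 6) * (τ + s) + (c₀ - 2 * c₂) := by
    intro τ
    simp only [hP, hq, hs, h2, h1, h0]; ring
  clear_value P q m s
  obtain ⟨v2, v1, v0⟩ := vieta_of_three_roots (x := x) (y := y) (z := z) (c₂ := 0)
    (c₁ := -(P + 6)) (c₀ := q) hxy.ne (hxy.trans hyz).ne hyz.ne
    (by linear_combination hx) (by linear_combination hy) (by linear_combination hz)
  have hz' : z = -x - y := by linarith
  have hQ : (x - y) ^ 2 + (y - z) ^ 2 + (z - x) ^ 2 = 6 * (P + 6) := by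
    rw [hz'] at v1 ⊢; linear_combination 6 * v1
  have hD : ((x - y) ^ 2) * ((y - z) ^ 2) * ((z - x) ^ 2) = 4 * (P + 6) ^ 3 - 27 * q ^ 2 := by
    have : P + 6 = -(x * y + x * z + y * z) := by linarith
    rw [this, v0, hz']; ring
  -- Since `27q² ≤ 4P³`, the new discriminant is at least `4((P + 6)³ - P³)`, which exceeds `18(P +
  -- 6)²`.
  have hD' : 18 * (P + 6) ^ 2 ≤ ((x - y) ^ 2) * ((y - z) ^ 2) * ((z - x) ^ 2) := by
    rw [hD]; nlinarith only [hdisc, hP0, mul_nonneg hP0 hP0]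
  have hQ0 : 0 < P + 6 := by linarith
  refine ⟨x + s, y + s, z + s, by linarith, by linarith, ?_, ?_, ?_⟩
  · have := two_le_of_sum_of_prod hQ0 (sq_nonneg _) (sq_nonneg _) (sq_nonneg _) hQ hD'
    simpa using this
  · have := two_le_of_sum_of_prod (u := (y - z) ^ 2) (v := (z - x) ^ 2) (w := (x - y) ^ 2)
      hQ0 (sq_nonneg _) (sq_nonneg _) (sq_nonneg _)
      (by linarith only [hQ]) (by linarith only [hD'])
    simpa using this
  · apply vieta_of_three_roots
    · simpa using hxy.ne
    · simpa using (hxy.trans hyz).ne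
    · simpa using hyz.ne
    · rw [← key]; exact hx
    · rw [← key]; exact hy
    · rw [← key]; exact hz

theorem roots_cubic_of_roots (x y z : ℝ) :
    (cubic (-(x + y + z)) (x * y + x * z + y * z) (-(x * y * z))).roots = {x, y, z} := by
  rw [cubic_of_roots, roots_mul, roots_mul]
  · simp only [roots_X_sub_C]; rfl
  · exact mul_ne_zero (X_sub_C_ne_zero _) (X_sub_C_ne_zero _)
  · exact mul_ne_zero (mul_ne_zero (X_sub_C_ne_zero _) (X_sub_C_ne_zero _)) (X_sub_C_ne_zero _)

theorem orderedRoot_cubic {x y z : ℝ} (hxy : x < y) (hyz : y < z) (j : Fin 3) :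
    orderedRoot (cubic (-(x + y + z)) (x * y + x * z + y * z) (-(x * y * z))) j
      = ![x, y, z] j := by
  have : ((({x, y, z} : Multiset ℝ)).sort (· ≤ ·)) = [x, y, z] := by
    have h : ({x, y, z} : Multiset ℝ) = (([x, y, z] : List ℝ) : Multiset ℝ) := rfl
    rw [h]
    exact List.mergeSort_of_pairwise (by simp; grind)
  rw [orderedRoot, roots_cubic_of_roots, this]
  fin_cases j <;> rfl

theorem orderedRoot_quadratic {k x y : ℝ} (hk : k ≠ 0) (hxy : x ≤ y) (j : Fin 2) :
    orderedRoot (C k * ((X - C x) * (X - C y))) j = ![x, y] j := by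
  have hr : (C k * ((X - C x) * (X - C y))).roots = {x, y} := by
    rw [roots_C_mul _ hk, roots_mul (mul_ne_zero (X_sub_C_ne_zero _) (X_sub_C_ne_zero _))]
    simp only [roots_X_sub_C]; rfl
  have : ((({x, y} : Multiset ℝ)).sort (· ≤ ·)) = [x, y] := by
    have h : ({x, y} : Multiset ℝ) = (([x, y] : List ℝ) : Multiset ℝ) := rfl
    rw [h]
    exact List.mergeSort_of_pairwise (by simpa using hxy)
  rw [orderedRoot, hr, this]
  fin_cases j <;> rfl

end Cubic


/-! ### Regularity of simple roots with respect to a parameter -/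

section Regularity

open Filter Topology

/-- The cubic is negative on `(-∞, x) ∪ (y, z)` and positive on `(x, y) ∪ (z, ∞)`. The signs `- + +
- - +` at six increasing points change three times, and each change encloses one root. -/
theorem roots_mem_of_signs {x y z τ₁ τ₂ τ₃ τ₄ τ₅ τ₆ : ℝ} (hxy : x < y) (hyz : y < z)
    (h12 : τ₁ < τ₂) (h23 : τ₂ < τ₃) (h34 : τ₃ < τ₄) (h45 : τ₄ < τ₅) (h56 : τ₅ < τ₆)
    (s₁ : (τ₁ - x) * (τ₁ - y) * (τ₁ - z) < 0) (s₂ : 0 < (τ₂ - x) * (τ₂ - y) * (τ₂ - z))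
    (s₃ : 0 < (τ₃ - x) * (τ₃ - y) * (τ₃ - z)) (s₄ : (τ₄ - x) * (τ₄ - y) * (τ₄ - z) < 0)
    (s₅ : (τ₅ - x) * (τ₅ - y) * (τ₅ - z) < 0) (s₆ : 0 < (τ₆ - x) * (τ₆ - y) * (τ₆ - z)) :
    x ∈ Ioo τ₁ τ₂ ∧ y ∈ Ioo τ₃ τ₄ ∧ z ∈ Ioo τ₅ τ₆ := by
  have neg : ∀ τ, (τ - x) * (τ - y) * (τ - z) < 0 → τ < x ∨ (y < τ ∧ τ < z) := by
    intro τ h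
    by_contra! hc
    obtain ⟨h1, h2⟩ := hc
    rcases le_or_gt τ y with hy | hy
    · have := mul_nonneg (mul_nonneg (sub_nonneg.2 h1) (sub_nonneg.2 hy))
        (by linarith : 0 ≤ z - τ)
      nlinarith
    · have := mul_nonneg (mul_nonneg (sub_nonneg.2 h1) (sub_nonneg.2 hy.le))
        (sub_nonneg.2 (h2 hy))
      nlinarith
  have pos : ∀ τ, 0 < (τ - x) * (τ - y) * (τ - z) → (x < τ ∧ τ < y) ∨ z < τ := by
    intro τ h
    by_contra! hc
    obtain ⟨h1, h2⟩ := hc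
    rcases le_or_gt τ x with hx | hx
    · have := mul_nonneg (mul_nonneg (sub_nonneg.2 hx) (by linarith : 0 ≤ y - τ))
        (by linarith : 0 ≤ z - τ)
      nlinarith
    · have := mul_nonneg (mul_nonneg (sub_nonneg.2 hx.le) (sub_nonneg.2 (h1 hx)))
        (sub_nonneg.2 h2)
      nlinarith
  have n₁ := neg _ s₁
  have p₂ := pos _ s₂
  have p₃ := pos _ s₃
  have n₄ := neg _ s₄
  have n₅ := neg _ s₅
  have p₆ := pos _ s₆
  simp only [mem_Ioo]
  grind

/-- For fixed `τ` the value of the cubic at `τ` depends only on the symmetric functions, so it is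
continuous in time and its sign persists nearby. The signs at `x ± η, y ± η, z ± η` then trap the
roots at neighbouring times. -/
theorem continuousOn_roots {s : Set ℝ} {x y z : ℝ → ℝ} (hxy : ∀ t ∈ s, x t < y t)
    (hyz : ∀ t ∈ s, y t < z t) (h₂ : ContinuousOn (fun t => x t + y t + z t) s)
    (h₁ : ContinuousOn (fun t => x t * y t + x t * z t + y t * z t) s)
    (h₀ : ContinuousOn (fun t => x t * y t * z t) s) :
    ContinuousOn x s ∧ ContinuousOn y s ∧ ContinuousOn z s := by
  have hF : ∀ τ : ℝ, ContinuousOn (fun t => (τ - x t) * (τ - y t) * (τ - z t)) s := by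
    intro τ
    have : ContinuousOn (fun t => τ ^ 3 - (x t + y t + z t) * τ ^ 2
        + (x t * y t + x t * z t + y t * z t) * τ - x t * y t * z t) s := by fun_prop
    refine this.congr fun t _ => by ring
  have key : ∀ t ∈ s, ∀ ε > 0, ∀ᶠ r in 𝓝[s] t, |x r - x t| < ε ∧ |y r - y t| < ε ∧
      |z r - z t| < ε := by
    intro t ht ε hε
    have g1 := hxy t ht
    have g2 := hyz t ht
    -- A third of each gap keeps the three intervals of radius `η` disjoint.
    obtain ⟨η, hη, hηε, hη1, hη2⟩ : ∃ η > 0, η ≤ ε ∧ 2 * η < y t - x t ∧ 2 * η < z t - y t := by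
      refine ⟨min ε (min ((y t - x t) / 3) ((z t - y t) / 3)), ?_, min_le_left _ _, ?_, ?_⟩
      · refine lt_min hε (lt_min ?_ ?_) <;> linarith
      · have := (min_le_right ε (min ((y t - x t) / 3) ((z t - y t) / 3))).trans (min_le_left _ _)
        linarith
      · have := (min_le_right ε (min ((y t - x t) / 3) ((z t - y t) / 3))).trans (min_le_right _ _)
        linarith
    have ev_neg : ∀ τ, (τ - x t) * (τ - y t) * (τ - z t) < 0 →
        ∀ᶠ r in 𝓝[s] t, (τ - x r) * (τ - y r) * (τ - z r) < 0 := fun τ h =>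
      (hF τ t ht).eventually (gt_mem_nhds h)
    have ev_pos : ∀ τ, 0 < (τ - x t) * (τ - y t) * (τ - z t) →
        ∀ᶠ r in 𝓝[s] t, 0 < (τ - x r) * (τ - y r) * (τ - z r) := fun τ h =>
      (hF τ t ht).eventually (lt_mem_nhds h)
    have pm : ∀ a b c : ℝ, a < 0 → b < 0 → c < 0 → a * b * c < 0 := fun a b c ha hb hc =>
      mul_neg_of_pos_of_neg (mul_pos_of_neg_of_neg ha hb) hc
    filter_upwards [self_mem_nhdsWithin,
      ev_neg (x t - η) (pm _ _ _ (by linarith) (by linarith) (by linarith)),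
      ev_pos (x t + η) (mul_pos_of_neg_of_neg (mul_neg_of_pos_of_neg (by linarith) (by linarith))
        (by linarith)),
      ev_pos (y t - η) (mul_pos_of_neg_of_neg (mul_neg_of_pos_of_neg (by linarith) (by linarith))
        (by linarith)),
      ev_neg (y t + η) (mul_neg_of_pos_of_neg (mul_pos (by linarith) (by linarith)) (by linarith)),
      ev_neg (z t - η) (mul_neg_of_pos_of_neg (mul_pos (by linarith) (by linarith)) (by linarith)),
      ev_pos (z t + η) (mul_pos (mul_pos (by linarith) (by linarith)) (by linarith))]
      with r hr s1 s2 s3 s4 s5 s6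
    obtain ⟨hx, hy, hz⟩ := roots_mem_of_signs (hxy r hr) (hyz r hr) (by linarith) (by linarith)
      (by linarith) (by linarith) (by linarith) s1 s2 s3 s4 s5 s6
    refine ⟨abs_lt.2 ⟨?_, ?_⟩, abs_lt.2 ⟨?_, ?_⟩, abs_lt.2 ⟨?_, ?_⟩⟩ <;>
      linarith [hx.1, hx.2, hy.1, hy.2, hz.1, hz.2]
  refine ⟨fun t ht => ?_, fun t ht => ?_, fun t ht => ?_⟩ <;> rw [ContinuousWithinAt,
    Metric.tendsto_nhds] <;> intro ε hε <;> filter_upwards [key t ht ε hε] with r hr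
  · exact hr.1
  · exact hr.2.1
  · exact hr.2.2

/-- A simple root of a cubic polynomial with differentiable coefficients is differentiable. -/
theorem hasDerivWithinAt_root {s : Set ℝ} {c₂ c₁ c₀ r : ℝ → ℝ} {c₂' c₁' c₀' t : ℝ} (ht : t ∈ s)
    (h₂ : HasDerivWithinAt c₂ c₂' s t) (h₁ : HasDerivWithinAt c₁ c₁' s t)
    (h₀ : HasDerivWithinAt c₀ c₀' s t) (hr : ContinuousWithinAt r s t)
    (hroot : ∀ t ∈ s, r t ^ 3 + c₂ t * r t ^ 2 + c₁ t * r t + c₀ t = 0)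
    (hsimple : 3 * r t ^ 2 + 2 * c₂ t * r t + c₁ t ≠ 0) :
    HasDerivWithinAt r (-(c₂' * r t ^ 2 + c₁' * r t + c₀') / (3 * r t ^ 2 + 2 * c₂ t * r t + c₁ t))
      s t := by
  -- The divided difference of the cubic at time `u` between `r u` and `r t`. Subtracting the
  -- equations at `u` and `t` shows that `(r u - r t)` times it is minus the increment of the
  -- coefficients taken at the fixed point `r t`; it tends to the derivative of the cubic, which is
  -- not zero.
  have hQ : Tendsto (fun u => r u ^ 2 + r u * r t + r t ^ 2 + c₂ u * (r u + r t) + c₁ u)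
      (𝓝[s \ {t}] t) (𝓝 (3 * r t ^ 2 + 2 * c₂ t * r t + c₁ t)) := by
    have h2c := h₂.continuousWithinAt
    have h1c := h₁.continuousWithinAt
    have : ContinuousWithinAt
        (fun u => r u ^ 2 + r u * r t + r t ^ 2 + c₂ u * (r u + r t) + c₁ u) s t := by fun_prop
    have h := this.tendsto.mono_left (nhdsWithin_mono t (sdiff_subset (s := s) (t := {t})))
    convert! h using 2
    ring
  have hG := (((h₂.mul_const (r t ^ 2)).add (h₁.mul_const (r t))).add h₀).neg
  rw [hasDerivWithinAt_iff_tendsto_slope] at hG ⊢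
  refine (hG.div hQ hsimple).congr' ?_
  filter_upwards [self_mem_nhdsWithin, hQ.eventually_ne hsimple] with u hu hne
  have hut : u - t ≠ 0 := sub_ne_zero.2 hu.2
  simp only [Pi.div_apply, slope_def_field, Pi.neg_apply, Pi.add_apply]
  rw [div_div, div_eq_div_iff (mul_ne_zero hut hne) hut]
  linear_combination (-(u - t)) * hroot u hu.1 + (u - t) * hroot t ht

/-- Bootstrap: the formula for `r'` is a quotient of expressions in `r`, the coefficients and their
first derivatives, so `r'` is as regular as `r`, up to order one. Two rounds lead from continuity to
class `C²`. -/
theorem contDiffOn_root {T : ℝ} (hT : 0 < T) {c₂ c₁ c₀ r : ℝ → ℝ}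
    (h₂ : ContDiffOn ℝ 2 c₂ (Icc 0 T)) (h₁ : ContDiffOn ℝ 2 c₁ (Icc 0 T))
    (h₀ : ContDiffOn ℝ 2 c₀ (Icc 0 T)) (hr : ContinuousOn r (Icc 0 T))
    (hroot : ∀ t ∈ Icc 0 T, r t ^ 3 + c₂ t * r t ^ 2 + c₁ t * r t + c₀ t = 0)
    (hsimple : ∀ t ∈ Icc 0 T, 3 * r t ^ 2 + 2 * c₂ t * r t + c₁ t ≠ 0) :
    ContDiffOn ℝ 2 r (Icc 0 T) := by
  have hu : UniqueDiffOn ℝ (Icc 0 T) := uniqueDiffOn_Icc hT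
  have hd : ∀ t ∈ Icc 0 T, HasDerivWithinAt r (-(derivWithin c₂ (Icc 0 T) t * r t ^ 2
      + derivWithin c₁ (Icc 0 T) t * r t + derivWithin c₀ (Icc 0 T) t)
      / (3 * r t ^ 2 + 2 * c₂ t * r t + c₁ t)) (Icc 0 T) t := fun t ht =>
    hasDerivWithinAt_root ht ((h₂.differentiableOn (by norm_num) t ht).hasDerivWithinAt)
      ((h₁.differentiableOn (by norm_num) t ht).hasDerivWithinAt)
      ((h₀.differentiableOn (by norm_num) t ht).hasDerivWithinAt) (hr t ht) hroot (hsimple t ht)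
  have hdiff : DifferentiableOn ℝ r (Icc 0 T) := fun t ht => (hd t ht).differentiableWithinAt
  have d₂ : ContDiffOn ℝ 1 (derivWithin c₂ (Icc 0 T)) (Icc 0 T) := h₂.derivWithin hu (by norm_num)
  have d₁ : ContDiffOn ℝ 1 (derivWithin c₁ (Icc 0 T)) (Icc 0 T) := h₁.derivWithin hu (by norm_num)
  have d₀ : ContDiffOn ℝ 1 (derivWithin c₀ (Icc 0 T)) (Icc 0 T) := h₀.derivWithin hu (by norm_num)
  have step : ∀ n : ℕ∞ω, n ≤ 1 → ContDiffOn ℝ n r (Icc 0 T) →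
      ContDiffOn ℝ n (derivWithin r (Icc 0 T)) (Icc 0 T) := by
    intro n hn h
    have e₂ := d₂.of_le hn
    have e₁ := d₁.of_le hn
    have e₀ := d₀.of_le hn
    have f₂ := h₂.of_le (hn.trans one_le_two)
    have f₁ := h₁.of_le (hn.trans one_le_two)
    have hnum : ContDiffOn ℝ n (fun t => -(derivWithin c₂ (Icc 0 T) t * r t ^ 2
      + derivWithin c₁ (Icc 0 T) t * r t + derivWithin c₀ (Icc 0 T) t)) (Icc 0 T) := by fun_prop
    have hden : ContDiffOn ℝ n (fun t => 3 * r t ^ 2 + 2 * c₂ t * r t + c₁ t) (Icc 0 T) := by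
      fun_prop
    exact (hnum.div hden hsimple).congr fun t ht => (hd t ht).derivWithin (hu t ht)
  have h1 : ContDiffOn ℝ 1 r (Icc 0 T) := by
    have := (contDiffOn_succ_iff_derivWithin (n := 0) hu).2
      ⟨hdiff, by simp, step 0 (by simp) (contDiffOn_zero.2 hr)⟩
    simpa using this
  have := (contDiffOn_succ_iff_derivWithin (n := 1) hu).2 ⟨hdiff, by simp, step 1 le_rfl h1⟩
  simpa [one_add_one_eq_two] using this

end Regularity


/-! ### Absolutely continuous functions and a Gronwall inequality -/

section Energy

open Filter Topology Complex

theorem absolutelyContinuousOnInterval_comp {X Y : Type*} [PseudoMetricSpace X]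
    [PseudoMetricSpace Y] {f : ℝ → X} {g : X → Y} {K : NNReal} {a b : ℝ} {s : Set X}
    (hf : AbsolutelyContinuousOnInterval f a b) (hg : LipschitzOnWith K g s)
    (hs : ∀ t ∈ uIcc a b, f t ∈ s) : AbsolutelyContinuousOnInterval (fun t => g (f t)) a b := by
  have h0 := Tendsto.const_mul (K : ℝ) hf
  rw [mul_zero] at h0
  refine squeeze_zero' (Eventually.of_forall fun _ => Finset.sum_nonneg fun _ _ => dist_nonneg)
    ?_ h0
  refine eventually_inf_principal.2 (Eventually.of_forall fun p hp => ?_)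
  rw [Finset.mul_sum]
  exact Finset.sum_le_sum fun i hi =>
    hg.dist_le_mul _ (hs _ (hp.1 i hi).1) _ (hs _ (hp.1 i hi).2)

theorem absolutelyContinuousOnInterval_norm {F : Type*} [NormedAddCommGroup F] {f : ℝ → F}
    {a b : ℝ} (hf : AbsolutelyContinuousOnInterval f a b) :
    AbsolutelyContinuousOnInterval (fun t => ‖f t‖) a b :=
  absolutelyContinuousOnInterval_comp hf lipschitzWith_one_norm.lipschitzOnWith
    fun _ _ => mem_univ _

theorem absolutelyContinuousOnInterval_normSq {z : ℝ → ℂ} {a b : ℝ}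
    (hz : AbsolutelyContinuousOnInterval z a b) :
    AbsolutelyContinuousOnInterval (fun t => ‖z t‖ ^ 2) a b := by
  have h := absolutelyContinuousOnInterval_norm hz
  simpa [pow_two] using h.fun_mul h

theorem absolutelyContinuousOnInterval_congr {X : Type*} [PseudoMetricSpace X] {f g : ℝ → X}
    {a b : ℝ} (hf : AbsolutelyContinuousOnInterval f a b) (h : ∀ t ∈ uIcc a b, g t = f t) :
    AbsolutelyContinuousOnInterval g a b := by
  refine Tendsto.congr' ?_ hf
  refine eventually_inf_principal.2 (Eventually.of_forall fun p hp => ?_)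
  exact Finset.sum_congr rfl fun i hi => by rw [h _ (hp.1 i hi).1, h _ (hp.1 i hi).2]

theorem absolutelyContinuousOnInterval_sum {ι : Type*} {s : Finset ι} {f : ι → ℝ → ℝ} {a b : ℝ}
    (hf : ∀ i ∈ s, AbsolutelyContinuousOnInterval (f i) a b) :
    AbsolutelyContinuousOnInterval (fun t => ∑ i ∈ s, f i t) a b := by
  classical
  induction s using Finset.induction_on with
  | empty =>
    simpa using (contDiffOn_const (c := (0 : ℝ))).absolutelyContinuousOnInterval
  | insert i s hi ih =>
    simp only [Finset.sum_insert hi]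
    exact (hf i (by simp)).fun_add (ih fun j hj => hf j (by simp [hj]))

/-- Lebesgue's theorem for real functions, applied to the real and the imaginary part. -/
theorem ae_hasDerivAt_of_absolutelyContinuous {z : ℝ → ℂ} {a b : ℝ}
    (hz : AbsolutelyContinuousOnInterval z a b) :
    ∀ᵐ t, t ∈ uIcc a b → DifferentiableAt ℝ z t := by
  have hre : AbsolutelyContinuousOnInterval (fun t => (z t).re) a b :=
    absolutelyContinuousOnInterval_comp hz reCLM.lipschitz.lipschitzOnWith fun _ _ => mem_univ _
  have him : AbsolutelyContinuousOnInterval (fun t => (z t).im) a b :=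
    absolutelyContinuousOnInterval_comp hz imCLM.lipschitz.lipschitzOnWith fun _ _ => mem_univ _
  filter_upwards [hre.ae_differentiableAt, him.ae_differentiableAt] with t h1 h2 ht
  have h := ((ofRealCLM.differentiableAt.comp t (h1 ht))).add
    ((ofRealCLM.differentiableAt.comp t (h2 ht)).mul_const I)
  refine h.congr_of_eventuallyEq (Eventually.of_forall fun s => ?_)
  simp [re_add_im]

/-- The reverse triangle inequality for difference quotients, in the limit. The norm is assumed
differentiable, since this can fail at a zero of `f`; for absolutely continuous functions it holds
almost everywhere. -/
theorem abs_le_norm_of_hasDerivAt_norm {F : Type*} [NormedAddCommGroup F] [NormedSpace ℝ F]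
    {f : ℝ → F} {f' : F} {r' t : ℝ} (hf : HasDerivAt f f' t)
    (hr : HasDerivAt (fun s => ‖f s‖) r' t) : |r'| ≤ ‖f'‖ := by
  have h1 := (hasDerivAt_iff_tendsto_slope.1 hr).abs
  have h2 := (hasDerivAt_iff_tendsto_slope.1 hf).norm
  refine le_of_tendsto_of_tendsto h1 h2 (Eventually.of_forall fun s => ?_)
  simp only [slope_def_module, norm_smul, smul_eq_mul, abs_mul, Real.norm_eq_abs]
  exact mul_le_mul_of_nonneg_left (abs_norm_sub_norm_le _ _) (abs_nonneg _)

/-- Absolute continuity is what makes the fundamental theorem of calculus available when the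
derivative exists only almost everywhere. -/
theorem le_of_ae_deriv_nonpos {h : ℝ → ℝ} {T : ℝ} (hh : AbsolutelyContinuousOnInterval h 0 T)
    (hd : ∀ᵐ t, t ∈ Ioo 0 T → ∃ h', HasDerivAt h h' t ∧ h' ≤ 0) {t : ℝ} (ht : t ∈ Icc 0 T) :
    h t ≤ h 0 := by
  have hsub : uIcc 0 t ⊆ uIcc 0 T := by
    rw [uIcc_of_le ht.1, uIcc_of_le (ht.1.trans ht.2)]; exact Icc_subset_Icc_right ht.2
  have hint := (hh.mono hsub).integral_deriv_eq_sub
  have : ∫ x in (0 : ℝ)..t, deriv h x ≤ 0 := by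
    rw [intervalIntegral.integral_of_le ht.1, integral_Ioc_eq_integral_Ioo]
    refine integral_nonpos_of_ae ((ae_restrict_iff' measurableSet_Ioo).2 ?_)
    filter_upwards [hd] with s hs hst
    obtain ⟨h', h1, h2⟩ := hs ⟨hst.1, hst.2.trans_le ht.2⟩
    simpa [h1.deriv] using h2
  linarith

/-- The term `iθz` is orthogonal to `z` because `θ` is real, so only `g` contributes. This is where
the reality of the roots enters the energy estimate. -/
theorem hasDerivAt_normSq {z : ℝ → ℂ} {g : ℂ} {θ t : ℝ}
    (hz : HasDerivAt z (I * θ * z t + g) t) :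
    HasDerivAt (fun s => ‖z s‖ ^ 2) (2 * ((starRingEnd ℂ (z t)) * g).re) t := by
  have hre : HasDerivAt (fun s => (z s).re) (I * θ * z t + g).re t :=
    (reCLM.hasFDerivAt.comp_hasDerivAt t hz)
  have him : HasDerivAt (fun s => (z s).im) (I * θ * z t + g).im t :=
    (imCLM.hasFDerivAt.comp_hasDerivAt t hz)
  have h := (hre.mul hre).add (him.mul him)
  refine (h.congr_of_eventuallyEq (Eventually.of_forall fun s => ?_)).congr_deriv ?_
  · simp [← normSq_eq_norm_sq, normSq_apply]
  · simp; ring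

/-- A Gronwall inequality for an energy `∑ wᵢ |zᵢ|²` whose terms satisfy
`zᵢ' = i θᵢ zᵢ + gᵢ` with real `θᵢ`. -/
theorem energy_gronwall {ι : Type*} [Fintype ι] {T : ℝ} (hT : 0 ≤ T) {w : ι → ℝ → ℝ}
    {z : ι → ℝ → ℂ} {ρ : ℝ → ℝ} {F : ℝ}
    (hw : ∀ i, AbsolutelyContinuousOnInterval (w i) 0 T)
    (hz : ∀ i, AbsolutelyContinuousOnInterval (z i) 0 T)
    (hw0 : ∀ i, ∀ t ∈ Icc 0 T, 0 ≤ w i t) (hρ : IntervalIntegrable ρ volume 0 T)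
    (hρ0 : ∀ t ∈ Icc 0 T, 0 ≤ ρ t)
    (hd : ∀ᵐ t, t ∈ Ioo 0 T → ∀ i, ∃ (w' θ : ℝ) (g : ℂ), HasDerivAt (w i) w' t ∧
      HasDerivAt (z i) (I * θ * z i t + g) t ∧ |w'| ≤ ρ t * w i t ∧
      √(w i t) * ‖g‖ ≤ ρ t * √(∑ j, w j t * ‖z j t‖ ^ 2) + F) {t : ℝ} (ht : t ∈ Icc 0 T) :
    ∑ i, w i t * ‖z i t‖ ^ 2 ≤
      Real.exp ((2 * Fintype.card ι + 1) * (∫ s in (0 : ℝ)..T, ρ s) + Fintype.card ι * T)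
        * (∑ i, w i 0 * ‖z i 0‖ ^ 2 + Fintype.card ι * T * F ^ 2) := by
  set n : ℝ := (Fintype.card ι : ℝ) with hn
  set E : ℝ → ℝ := fun t => ∑ i, w i t * ‖z i t‖ ^ 2 with hE
  have hn0 : 0 ≤ n := by simp [hn]
  have hE0 : ∀ s ∈ Icc 0 T, 0 ≤ E s := fun s hs =>
    Finset.sum_nonneg fun i _ => mul_nonneg (hw0 i s hs) (by positivity)
  -- The weights contribute `ρE` in total, and each of the `n` inhomogeneous terms contributes `(2ρ
  -- + 1)E + F²`.
  set σ : ℝ → ℝ := fun t => (2 * n + 1) * ρ t + n with hσ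
  have hσi : IntervalIntegrable σ volume 0 T := (hρ.const_mul _).add intervalIntegrable_const
  have hσ0 : ∀ s ∈ Icc 0 T, 0 ≤ σ s := fun s hs => by
    have := hρ0 s hs
    simp only [hσ]; positivity
  set R : ℝ → ℝ := fun t => ∫ s in (0 : ℝ)..t, σ s with hR
  have hRac : AbsolutelyContinuousOnInterval R 0 T :=
    hσi.absolutelyContinuousOnInterval_intervalIntegral (by simp)
  have hR0 : ∀ s ∈ Icc 0 T, 0 ≤ R s := fun s hs =>
    intervalIntegral.integral_nonneg hs.1 fun r hr => hσ0 r ⟨hr.1, hr.2.trans hs.2⟩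
  have hRT : ∀ s ∈ Icc 0 T, R s ≤ R T := by
    intro s hs
    have hsub : IntervalIntegrable σ volume 0 s := hσi.mono_set (by
      rw [uIcc_of_le hs.1, uIcc_of_le hT]; exact Icc_subset_Icc_right hs.2)
    have := intervalIntegral.integral_interval_sub_left hσi hsub
    have h2 : 0 ≤ ∫ r in s..T, σ r :=
      intervalIntegral.integral_nonneg hs.2 fun r hr => hσ0 r ⟨hs.1.trans hr.1, hr.2⟩
    simp only [hR]; linarith
  -- The function `exp(-x)` is Lipschitz only on half lines bounded below; since `R ≥ 0` the half
  -- line `[0, ∞)` is enough to preserve absolute continuity.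
  have hexpL : LipschitzOnWith 1 (fun x : ℝ => Real.exp (-x)) (Ici 0) := by
    refine (convex_Ici (0 : ℝ)).lipschitzOnWith_of_nnnorm_hasDerivWithin_le
      (f' := fun x => -Real.exp (-x)) (fun x hx => ?_) (fun x hx => ?_)
    · have := ((Real.hasDerivAt_exp (-x)).comp x (hasDerivAt_neg x))
      simpa using! this.hasDerivWithinAt
    · rw [← NNReal.coe_le_coe]
      simpa using hx
  have hEac : AbsolutelyContinuousOnInterval E 0 T :=
    absolutelyContinuousOnInterval_sum fun i _ =>
      (hw i).fun_mul (absolutelyContinuousOnInterval_normSq (hz i))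
  have hexpac : AbsolutelyContinuousOnInterval (fun t => Real.exp (-R t)) 0 T :=
    absolutelyContinuousOnInterval_comp (g := fun x : ℝ => Real.exp (-x)) hRac hexpL fun s hs =>
      hR0 s (by rwa [uIcc_of_le hT] at hs)
  have hlin : AbsolutelyContinuousOnInterval (fun t : ℝ => n * F ^ 2 * t) 0 T := by
    apply ContDiffOn.absolutelyContinuousOnInterval; fun_prop
  -- The integrating factor `exp(-R)` absorbs `σE`, and subtracting `nF²t` absorbs the remaining
  -- source, because `exp(-R) ≤ 1`.
  have hmain := le_of_ae_deriv_nonpos (h := fun t => E t * Real.exp (-R t) - n * F ^ 2 * t)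
    ((hEac.fun_mul hexpac).fun_sub hlin) ?_ ht
  · have h1 : E t * Real.exp (-R t) ≤ E 0 + n * T * F ^ 2 := by
      have h00 : R 0 = 0 := by simp [hR]
      have : n * F ^ 2 * t ≤ n * F ^ 2 * T := mul_le_mul_of_nonneg_left ht.2 (by positivity)
      simp only [h00, neg_zero, Real.exp_zero, mul_one, mul_zero, sub_zero] at hmain
      nlinarith
    have h2 : R T = (2 * n + 1) * (∫ s in (0 : ℝ)..T, ρ s) + n * T := by
      simp only [hR, hσ]
      rw [intervalIntegral.integral_add (hρ.const_mul _) intervalIntegrable_const,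
        intervalIntegral.integral_const_mul, intervalIntegral.integral_const]
      simp [mul_comm]
    rw [← h2]
    calc E t = Real.exp (R t) * (E t * Real.exp (-R t)) := by
          rw [Real.exp_neg]; field_simp
      _ ≤ Real.exp (R t) * (E 0 + n * T * F ^ 2) :=
          mul_le_mul_of_nonneg_left h1 (Real.exp_pos _).le
      _ ≤ Real.exp (R T) * (E 0 + n * T * F ^ 2) := by
          refine mul_le_mul_of_nonneg_right (Real.exp_le_exp.2 (hRT t ht)) ?_
          have := hE0 0 ⟨le_rfl, hT⟩
          positivity
  · filter_upwards [hd, hσi.ae_hasDerivAt_integral] with s hs hRd hsT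
    have hsI : s ∈ Icc 0 T := Ioo_subset_Icc_self hsT
    have hR' : HasDerivAt R (σ s) s := hRd (by rwa [uIcc_of_le hT]) 0 (by simp)
    choose w' θ g h1 h2 h3 h4 using hs hsT
    have hE' : HasDerivAt E (∑ i, (w' i * ‖z i s‖ ^ 2
        + w i s * (2 * ((starRingEnd ℂ (z i s)) * g i).re))) s :=
      HasDerivAt.fun_sum fun i _ => (h1 i).mul (hasDerivAt_normSq (h2 i))
    have hx := (hE'.mul hR'.neg.exp).sub ((hasDerivAt_id s).const_mul (n * F ^ 2))
    refine ⟨_, hx, ?_⟩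
    have hes : √(E s) ^ 2 = E s := Real.sq_sqrt (hE0 s hsI)
    have hbound : ∑ i, (w' i * ‖z i s‖ ^ 2
        + w i s * (2 * ((starRingEnd ℂ (z i s)) * g i).re)) ≤ σ s * E s + n * F ^ 2 := by
      have hterm : ∀ i, w' i * ‖z i s‖ ^ 2 + w i s * (2 * ((starRingEnd ℂ (z i s)) * g i).re) ≤
          ρ s * (w i s * ‖z i s‖ ^ 2) + ((2 * ρ s + 1) * E s + F ^ 2) := by
        intro i
        have a1 : w' i * ‖z i s‖ ^ 2 ≤ ρ s * w i s * ‖z i s‖ ^ 2 :=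
          mul_le_mul_of_nonneg_right ((le_abs_self _).trans (h3 i)) (by positivity)
        have a2 : ((starRingEnd ℂ (z i s)) * g i).re ≤ ‖z i s‖ * ‖g i‖ := by
          refine (re_le_norm _).trans ?_
          simp
        have hwi := hw0 i s hsI
        have a3 : √(w i s) * ‖z i s‖ ≤ √(E s) := by
          rw [← Real.sqrt_sq (norm_nonneg (z i s)), ← Real.sqrt_mul hwi]
          refine Real.sqrt_le_sqrt ?_
          exact Finset.single_le_sum (f := fun i => w i s * ‖z i s‖ ^ 2)
            (fun j _ => mul_nonneg (hw0 j s hsI) (by positivity)) (Finset.mem_univ i)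
        have a4 : w i s * (‖z i s‖ * ‖g i‖) = (√(w i s) * ‖z i s‖) * (√(w i s) * ‖g i‖) := by
          nth_rewrite 1 [← Real.mul_self_sqrt hwi]; ring
        have a5 : (√(w i s) * ‖z i s‖) * (√(w i s) * ‖g i‖) ≤ √(E s) * (ρ s * √(E s) + F) := by
          have h4i : √(w i s) * ‖g i‖ ≤ ρ s * √(E s) + F := h4 i
          exact mul_le_mul a3 h4i (by positivity) (Real.sqrt_nonneg _)
        have a6 : w i s * (2 * ((starRingEnd ℂ (z i s)) * g i).re) ≤
            2 * (√(E s) * (ρ s * √(E s) + F)) := by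
          rw [← a4] at a5
          have := mul_le_mul_of_nonneg_left a2 hwi
          linarith
        have a7 : 2 * (√(E s) * (ρ s * √(E s) + F)) ≤ (2 * ρ s + 1) * E s + F ^ 2 := by
          rw [← hes]
          simp only [Real.sqrt_sq (Real.sqrt_nonneg _)]
          nlinarith only [sq_nonneg (√(E s) - F)]
        linarith only [a1, a6, a7]
      refine (Finset.sum_le_sum fun i _ => hterm i).trans ?_
      rw [Finset.sum_add_distrib, ← Finset.mul_sum, Finset.sum_const, Finset.card_univ,
        nsmul_eq_mul, ← hn]
      simp only [hσ, hE]
      apply le_of_eq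
      ring
    have he1 : Real.exp (-R s) ≤ 1 := Real.exp_le_one_iff.2 (neg_nonpos.2 (hR0 s hsI))
    have he0 := Real.exp_pos (-R s)
    have hnF : 0 ≤ n * F ^ 2 := by positivity
    have := mul_le_mul_of_nonneg_right hbound he0.le
    have h6 := mul_le_mul_of_nonneg_left he1 hnF
    simp only [mul_one, Pi.neg_apply] at h6 ⊢
    linarith only [this, h6]

end Energy


/-! ### The factorized operators -/

section Factors

open Complex

/-- The first order factor `u' - i λ u`. -/
def firstFactor (l : ℝ) (u₀ u₁ : ℂ) : ℂ := u₁ - I * l * u₀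

/-- The symmetrized second order factor of `(∂ - i λ_{j+1}) (∂ - i λ_{j+2})`. -/
def secondFactor (l l' : Fin 3 → ℝ) (u₀ u₁ u₂ : ℂ) (j : Fin 3) : ℂ :=
  u₂ - I * (l (j + 1) + l (j + 2)) * u₁ - l (j + 1) * l (j + 2) * u₀
    - I / 2 * (l' (j + 1) + l' (j + 2)) * u₀

/-- The second order factors with indices `j` and `j + 1` share the factor `∂ - iλ_{j+2}`, so their
difference is `i(λ_j - λ_{j+1})` times it, up to the symmetrization terms. As the gaps are at least
one, first order factors are recovered from second order ones. -/
theorem sub_mul_firstFactor (l l' : Fin 3 → ℝ) (u₀ u₁ u₂ : ℂ) (j : Fin 3) :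
    I * (l j - l (j + 1)) * firstFactor (l (j + 2)) u₀ u₁
      = secondFactor l l' u₀ u₁ u₂ j - secondFactor l l' u₀ u₁ u₂ (j + 1)
        - I / 2 * (l' j - l' (j + 1)) * u₀ := by
  have h1 : j + 1 + 1 = j + 2 := by fin_cases j <;> rfl
  have h2 : j + 1 + 2 = j := by fin_cases j <;> rfl
  simp only [firstFactor, secondFactor, h1, h2]
  linear_combination (-(l j - l (j + 1)) * l (j + 2) * u₀ : ℂ) * I_sq

/-- The algebraic identity behind the energy estimate: `d j` stands for `i λ_j`. -/
theorem symmetrized_identity (d d' d'' m m' : Fin 3 → ℂ) (ν n : Fin 2 → ℂ)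
    {u₀ u₁ u₂ u₃ f p B₂ B₁ B₀ C₁ C₀ B₂' B₁' : ℂ}
    (hu : u₃ = f - p * u₀ + (d 0 + d 1 + d 2) * u₂ - (d 0 * d 1 + d 0 * d 2 + d 1 * d 2) * u₁
      + d 0 * d 1 * d 2 * u₀ + 2 * (3 * u₁ - (d 0 + d 1 + d 2) * u₀)
      - (B₂ * u₂ + B₁ * u₁ + B₀ * u₀) - (C₁ * u₁ + C₀ * u₀))
    (h₂ : m 0 + m 1 + m 2 = B₂)
    (h₁ : m 0 * (d 1 + d 2) + m 1 * (d 2 + d 0) + m 2 * (d 0 + d 1)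
      = -(B₁ + (d' 0 + d' 1 + d' 2)))
    (h₀ : m 0 * (d 1 * d 2) + m 1 * (d 2 * d 0) + m 2 * (d 0 * d 1)
      = B₀ - 1 / 2 * (d' 0 * d 1 + d 0 * d' 1 + d' 0 * d 2 + d 0 * d' 2 + d' 1 * d 2 + d 1 * d' 2))
    (h₂' : m' 0 + m' 1 + m' 2 = B₂')
    (h₁' : m' 0 * (d 1 + d 2) + m' 1 * (d 2 + d 0) + m' 2 * (d 0 + d 1)
      + (m 0 * (d' 1 + d' 2) + m 1 * (d' 2 + d' 0) + m 2 * (d' 0 + d' 1))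
      = -(B₁' + (d'' 0 + d'' 1 + d'' 2)))
    (hn₁ : n 0 + n 1 = C₁ - B₂')
    (hn₀ : n 0 * ν 1 + n 1 * ν 0 = -(C₀ - 1 / 2 * B₁' - (d'' 0 + d'' 1 + d'' 2) / 6))
    (j : Fin 3) :
    u₃ - (d' (j + 1) + d' (j + 2)) * u₁ - (d (j + 1) + d (j + 2)) * u₂
      + (d' (j + 1) * d (j + 2) + d (j + 1) * d' (j + 2)) * u₀ + d (j + 1) * d (j + 2) * u₁
      - 1 / 2 * (d'' (j + 1) + d'' (j + 2)) * u₀ - 1 / 2 * (d' (j + 1) + d' (j + 2)) * u₁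
      = d j * (u₂ - (d (j + 1) + d (j + 2)) * u₁ + d (j + 1) * d (j + 2) * u₀
          - 1 / 2 * (d' (j + 1) + d' (j + 2)) * u₀)
        + (f - p * u₀ + 2 * ∑ i, (u₁ - d i * u₀)
          - ∑ i, (m i * (u₂ - (d (i + 1) + d (i + 2)) * u₁ + d (i + 1) * d (i + 2) * u₀
              - 1 / 2 * (d' (i + 1) + d' (i + 2)) * u₀)
            + 1 / 2 * m' i * ((u₁ - d (i + 1) * u₀) + (u₁ - d (i + 2) * u₀)))
          - (n 0 * (u₁ - ν 1 * u₀) + n 1 * (u₁ - ν 0 * u₀))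
          + 1 / 2 * (d' j - d' (j + 1)) * (u₁ - d (j + 2) * u₀)
          + 1 / 2 * (d' j - d' (j + 2)) * (u₁ - d (j + 1) * u₀)
          + 1 / 6 * ((d'' j - d'' (j + 1)) + (d'' j - d'' (j + 2))) * u₀) := by
  subst hu
  have e1 : (1 : Fin 3) + 1 = 2 := rfl
  have e2 : (1 : Fin 3) + 2 = 0 := rfl
  have e3 : (2 : Fin 3) + 1 = 0 := rfl
  have e4 : (2 : Fin 3) + 2 = 1 := rfl
  fin_cases j <;>
    simp only [Fin.sum_univ_three, Fin.zero_eta, Fin.mk_one, Fin.reduceFinMk, zero_add, e1, e2, e3,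
      e4, Fin.isValue] <;>
    -- The relations `h₂, h₁, h₀` compare the coefficients of `u₂, u₁, u₀` in the interpolation of
    -- `M̌`. The terms with `m'` together with the symmetrization terms in the second factors sum to
    -- `B₂' u₁ + (B₁' + ∑ d'')u₀/2` by `h₂', h₁'`; this, with the second derivatives left over on
    -- the other side, is what turns `N` into `Ň`, whose interpolation is `hn₁, hn₀`.
    linear_combination u₂ * h₂ - u₁ * h₁ + u₀ * h₀ + u₁ * h₂' - (1 / 2) * u₀ * h₁' + u₁ * hn₁
      - u₀ * hn₀

/-- Lagrange interpolation of a quadratic polynomial at three points. -/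
theorem lagrange_three {x y z X Y Z b₂ b₁ b₀ : ℂ} (hxy : x ≠ y) (hyz : y ≠ z) (hzx : z ≠ x)
    (hX : X = b₂ * x ^ 2 + b₁ * x + b₀) (hY : Y = b₂ * y ^ 2 + b₁ * y + b₀)
    (hZ : Z = b₂ * z ^ 2 + b₁ * z + b₀) :
    (X / ((x - y) * (x - z)) + Y / ((y - z) * (y - x)) + Z / ((z - x) * (z - y)) = b₂) ∧
    (X / ((x - y) * (x - z)) * (y + z) + Y / ((y - z) * (y - x)) * (z + x)
      + Z / ((z - x) * (z - y)) * (x + y) = -b₁) ∧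
    (X / ((x - y) * (x - z)) * (y * z) + Y / ((y - z) * (y - x)) * (z * x)
      + Z / ((z - x) * (z - y)) * (x * y) = b₀) := by
  have h1 := sub_ne_zero.2 hxy
  have h2 := sub_ne_zero.2 hyz
  have h3 := sub_ne_zero.2 hzx
  have h1' := sub_ne_zero.2 hxy.symm
  have h2' := sub_ne_zero.2 hyz.symm
  have h3' := sub_ne_zero.2 hzx.symm
  have e1 : y - x = -(x - y) := by ring
  have e2 : z - y = -(y - z) := by ring
  have e3 : x - z = -(z - x) := by ring
  rw [e1, e2, e3]
  subst hX hY hZ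
  refine ⟨?_, ?_, ?_⟩ <;> field_simp <;> ring

theorem lagrange_two {x y X Y b₁ b₀ : ℂ} (hxy : x ≠ y) (hX : X = b₁ * x + b₀)
    (hY : Y = b₁ * y + b₀) :
    X / (x - y) + Y / (y - x) = b₁ ∧ X / (x - y) * y + Y / (y - x) * x = -b₀ := by
  have h1 := sub_ne_zero.2 hxy
  have e1 : y - x = -(x - y) := by ring
  rw [e1]
  subst hX hY
  refine ⟨?_, ?_⟩ <;> field_simp <;> ring

end Factors


/-! ### The energy estimate for one frequency -/

section EnergyEstimate

open Complex Filter

theorem absolutelyContinuousOnInterval_of_hasDerivWithinAt {F : Type*} [NormedAddCommGroup F]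
    [NormedSpace ℝ F] {T : ℝ} (hT : 0 ≤ T) {f f' : ℝ → F}
    (hf : ∀ t ∈ Icc 0 T, HasDerivWithinAt f (f' t) (Icc 0 T) t) (hc : ContinuousOn f' (Icc 0 T)) :
    AbsolutelyContinuousOnInterval f 0 T := by
  obtain ⟨C, hC⟩ := isCompact_Icc.exists_bound_of_continuousOn hc
  have hL : LipschitzOnWith (Real.toNNReal C) f (Icc 0 T) :=
    (convex_Icc 0 T).lipschitzOnWith_of_nnnorm_hasDerivWithin_le hf fun t ht => by
      rw [← NNReal.coe_le_coe]
      exact (hC t ht).trans (Real.le_coe_toNNReal C)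
  refine LipschitzOnWith.absolutelyContinuousOnInterval (K := Real.toNNReal C) ?_
  rwa [uIcc_of_le hT]

theorem absolutelyContinuousOnInterval_ofReal {f : ℝ → ℝ} {a b : ℝ}
    (hf : AbsolutelyContinuousOnInterval f a b) :
    AbsolutelyContinuousOnInterval (fun t => (f t : ℂ)) a b :=
  absolutelyContinuousOnInterval_comp hf ofRealCLM.lipschitz.lipschitzOnWith fun _ _ => mem_univ _

theorem absolutelyContinuousOnInterval_mul {f g : ℝ → ℂ} {a b : ℝ}
    (hf : AbsolutelyContinuousOnInterval f a b) (hg : AbsolutelyContinuousOnInterval g a b) :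
    AbsolutelyContinuousOnInterval (fun t => f t * g t) a b :=
  hf.fun_smul hg

theorem absolutelyContinuousOnInterval_const {F : Type*} [NormedAddCommGroup F] [NormedSpace ℝ F]
    (c : F) (a b : ℝ) : AbsolutelyContinuousOnInterval (fun _ => c) a b :=
  contDiffOn_const.absolutelyContinuousOnInterval

/-- `w` is differentiable at `t` and `|w'| ≤ R w`. -/
def LogDerivBound (w : ℝ → ℝ) (R t : ℝ) : Prop := ∃ w', HasDerivAt w w' t ∧ |w'| ≤ R * w t

theorem LogDerivBound.mul {w₁ w₂ : ℝ → ℝ} {R₁ R₂ t : ℝ} (h₁ : LogDerivBound w₁ R₁ t)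
    (h₂ : LogDerivBound w₂ R₂ t) (p₁ : 0 ≤ w₁ t) (p₂ : 0 ≤ w₂ t) :
    LogDerivBound (fun s => w₁ s * w₂ s) (R₁ + R₂) t := by
  obtain ⟨a, ha, ha'⟩ := h₁
  obtain ⟨b, hb, hb'⟩ := h₂
  refine ⟨_, ha.mul hb, (abs_add_le _ _).trans ?_⟩
  rw [abs_mul, abs_mul, abs_of_nonneg p₁, abs_of_nonneg p₂]
  nlinarith [mul_le_mul_of_nonneg_right ha' p₂, mul_le_mul_of_nonneg_left hb' p₁]

theorem LogDerivBound.mono {w : ℝ → ℝ} {R R' t : ℝ} (h : LogDerivBound w R t) (hw : 0 ≤ w t)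
    (hR : R ≤ R') : LogDerivBound w R' t :=
  let ⟨w', h1, h2⟩ := h
  ⟨w', h1, h2.trans (mul_le_mul_of_nonneg_right hR hw)⟩

/-- Used with `c = 1` for the quantities `|f| + 1` of the hypotheses, and with `c = 0` for inverses
of functions bounded away from zero. -/
theorem logDerivBound_norm_add {F : Type*} [NormedAddCommGroup F] [NormedSpace ℝ F] {f : ℝ → F}
    {f' : F} {R t c : ℝ} (hf : HasDerivAt f f' t) (hd : DifferentiableAt ℝ (fun s => ‖f s‖) t)
    (hb : ‖f'‖ ≤ R * (‖f t‖ + c)) : LogDerivBound (fun s => ‖f s‖ + c) R t :=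
  ⟨_, hd.hasDerivAt.add_const c, (abs_le_norm_of_hasDerivAt_norm hf hd.hasDerivAt).trans hb⟩

/-- The symbols of the equation along the roots, for one frequency: `l` are the roots of `𝓛`,
`M` and `N` the values of the modified lower order symbols, and `B₂, B₁, B₀, C₁, C₀` the
coefficients of the lower order symbols. A prime denotes a time derivative. -/
structure SymbolData (T : ℝ) where
  (l l' l'' : Fin 3 → ℝ → ℝ)
  (M M' : Fin 3 → ℝ → ℂ)
  (N N' : Fin 2 → ℝ → ℂ)
  (B₂ B₁ B₀ C₁ C₀ B₂' B₁' : ℝ → ℂ)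
  hl : ∀ j, ∀ t ∈ Icc 0 T, HasDerivWithinAt (l j) (l' j t) (Icc 0 T) t
  hl' : ∀ j, ∀ t ∈ Icc 0 T, HasDerivWithinAt (l' j) (l'' j t) (Icc 0 T) t
  hl'' : ∀ j, ContinuousOn (l'' j) (Icc 0 T)
  sq_gap : ∀ j, ∀ t ∈ Icc 0 T, 2 ≤ (l j t - l (j + 1) t) ^ 2
  hM : ∀ j, ∀ t ∈ Icc 0 T, HasDerivWithinAt (M j) (M' j t) (Icc 0 T) t
  hM' : ∀ j, ContinuousOn (M' j) (Icc 0 T)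
  hB₂ : ∀ t ∈ Icc 0 T, HasDerivWithinAt B₂ (B₂' t) (Icc 0 T) t
  hB₁ : ∀ t ∈ Icc 0 T, HasDerivWithinAt B₁ (B₁' t) (Icc 0 T) t
  M_eq : ∀ j, ∀ t ∈ Icc 0 T, M j t = B₂ t * (l j t : ℂ) ^ 2
    + (B₁ t + (l' 0 t + l' 1 t + l' 2 t)) * l j t
    + (B₀ t - 1 / 2 * (l' 0 t * l 1 t + l 0 t * l' 1 t + l' 0 t * l 2 t + l 0 t * l' 2 t
      + l' 1 t * l 2 t + l 1 t * l' 2 t))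
  N_ac : ∀ k, AbsolutelyContinuousOnInterval (N k) 0 T
  hN : ∀ k, ∀ᵐ t, t ∈ Ioo 0 T → HasDerivAt (N k) (N' k t) t
  N_eq : ∀ k, ∀ t ∈ Icc 0 T, N k t = (C₁ t - B₂' t) *
      (((l 0 t + l 1 t + l 2 t) / 3 + (![-1, 1] : Fin 2 → ℝ) k *
        √(2 / 9 * ∑ j, (l j t - l (j + 1) t) ^ 2) / 2 : ℝ) : ℂ)
      + (C₀ t - 1 / 2 * B₁' t - (l'' 0 t + l'' 1 t + l'' 2 t) / 6)

namespace SymbolData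

variable {T : ℝ} (S : SymbolData T)

/-- The distance `μ₂ - μ₁`. -/
def delta (t : ℝ) : ℝ := √(2 / 9 * ∑ j, (S.l j t - S.l (j + 1) t) ^ 2)

/-- The roots of `∂_τ 𝓛`. -/
def mu (k : Fin 2) (t : ℝ) : ℝ :=
  (S.l 0 t + S.l 1 t + S.l 2 t) / 3 + (![-1, 1] : Fin 2 → ℝ) k * S.delta t / 2

/-- The product `(λ_j - λ_{j+1}) (λ_j - λ_{j+2})`. -/
def gaps (j : Fin 3) (t : ℝ) : ℝ := (S.l j t - S.l (j + 1) t) * (S.l j t - S.l (j + 2) t)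

/-- The sum of the integrands of the six conditions, and `1`. -/
def rate (t : ℝ) : ℝ :=
  ∑ j : Fin 3, |S.l' j t - S.l' (j + 1) t| / |S.l j t - S.l (j + 1) t|
  + ∑ j : Fin 3, |S.l'' j t - S.l'' (j + 1) t| / (|S.l' j t - S.l' (j + 1) t| + 1)
  + ∑ j : Fin 3, ‖S.M' j t‖ / (‖S.M j t‖ + 1)
  + ∑ k : Fin 2, ‖S.N' k t‖ / (‖S.N k t‖ + 1)
  + ∑ j : Fin 3, ‖S.M j t‖ / (|S.l j t - S.l (j + 1) t| * |S.l j t - S.l (j + 2) t|)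
  + ∑ k : Fin 2, √(‖S.N k t‖ / S.delta t) + 1

/-- The index set of the terms of the energy. -/
abbrev Index : Type := (Fin 3 ⊕ Fin 3) ⊕ (Fin 3 ⊕ Fin 3) ⊕ Fin 2

/-- The weights of the energy. -/
def weight : Index → ℝ → ℝ
  | .inl (.inl _), _ => 1
  | .inl (.inr j), t => (‖S.l' j t - S.l' (j + 1) t‖ + 1) * (‖S.l' j t - S.l' (j + 1) t‖ + 1)
  -- The square of `(|M̌_j| + 1)/|(λ_j - λ_{j+1})(λ_j - λ_{j+2})|`, attached to both first order
  -- factors that accompany the derivative of the interpolation coefficient of index `j`. The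
  -- summand `0` gives both factors the shape `‖f‖ + c`, so that one lemma bounds their logarithmic
  -- derivatives.
  | .inr (.inl (.inl j)), t | .inr (.inl (.inr j)), t =>
    ((‖S.M j t‖ + 1) * (‖(S.gaps j t)⁻¹‖ + 0)) * ((‖S.M j t‖ + 1) * (‖(S.gaps j t)⁻¹‖ + 0))
  | .inr (.inr k), t => (‖S.N k t‖ + 1) * (‖(S.delta t)⁻¹‖ + 0)

/-- The quantities controlled by the energy. -/
def term (u₀ u₁ u₂ : ℝ → ℂ) : Index → ℝ → ℂ
  | .inl (.inl j), t =>
    secondFactor (fun i => S.l i t) (fun i => S.l' i t) (u₀ t) (u₁ t) (u₂ t) j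
  | .inl (.inr _), t => u₀ t
  | .inr (.inl (.inl j)), t => firstFactor (S.l (j + 1) t) (u₀ t) (u₁ t)
  | .inr (.inl (.inr j)), t => firstFactor (S.l (j + 2) t) (u₀ t) (u₁ t)
  | .inr (.inr k), t => firstFactor (S.mu (1 - k) t) (u₀ t) (u₁ t)

/-- The energy. -/
def energy (u₀ u₁ u₂ : ℝ → ℂ) (t : ℝ) : ℝ :=
  ∑ i, S.weight i t * ‖S.term u₀ u₁ u₂ i t‖ ^ 2

theorem gap (j : Fin 3) {t : ℝ} (ht : t ∈ Icc 0 T) : 1 ≤ |S.l j t - S.l (j + 1) t| :=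
  (one_le_sq_iff_one_le_abs _).1 (by linarith [S.sq_gap j t ht])

theorem gap' (j : Fin 3) {t : ℝ} (ht : t ∈ Icc 0 T) : 1 ≤ |S.l j t - S.l (j + 2) t| := by
  have h := S.gap (j + 2) ht
  have e : j + 2 + 1 = j := by fin_cases j <;> rfl
  rwa [e, abs_sub_comm] at h

theorem one_le_abs_gaps (j : Fin 3) {t : ℝ} (ht : t ∈ Icc 0 T) : 1 ≤ |S.gaps j t| := by
  rw [gaps, abs_mul]
  exact one_le_mul_of_one_le_of_one_le (S.gap j ht) (S.gap' j ht)

theorem gaps_ne_zero (j : Fin 3) {t : ℝ} (ht : t ∈ Icc 0 T) : S.gaps j t ≠ 0 := by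
  have := S.one_le_abs_gaps j ht
  intro h
  simp [h] at this
  linarith

theorem sq_delta (t : ℝ) : S.delta t ^ 2 = 2 / 9 * ∑ j, (S.l j t - S.l (j + 1) t) ^ 2 :=
  Real.sq_sqrt (by positivity)

theorem delta_nonneg (t : ℝ) : 0 ≤ S.delta t := Real.sqrt_nonneg _

/-- By `sq_delta` a single gap is at most `(3/√2)` times `delta`; `9/4` is a rational constant above
`3/√2`. -/
theorem abs_sub_le_delta (j : Fin 3) (t : ℝ) :
    |S.l j t - S.l (j + 1) t| ≤ 9 / 4 * S.delta t := by
  apply abs_le_of_sq_le_sq _ (mul_nonneg (by norm_num) (S.delta_nonneg t))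
  have h1 := S.sq_delta t
  have h2 := Finset.single_le_sum (f := fun j => (S.l j t - S.l (j + 1) t) ^ 2)
    (fun i _ => sq_nonneg _) (Finset.mem_univ j)
  nlinarith

/-- Three squared gaps of size at least `2` give `delta² ≥ 4/3`. -/
theorem one_le_delta {t : ℝ} (ht : t ∈ Icc 0 T) : 1 ≤ S.delta t := by
  have h := S.sq_delta t
  rw [Fin.sum_univ_three] at h
  nlinarith [S.sq_gap 0 t ht, S.sq_gap 1 t ht, S.sq_gap 2 t ht, S.delta_nonneg t]

/-- All summands of the rate are nonnegative, so each is at most the whole. No condition on `t` is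
needed, because a quotient by zero is zero. -/
theorem rate_bounds (t : ℝ) : 1 ≤ S.rate t ∧
    (∀ j, |S.l' j t - S.l' (j + 1) t| / |S.l j t - S.l (j + 1) t| ≤ S.rate t) ∧
    (∀ j, |S.l'' j t - S.l'' (j + 1) t| ≤ S.rate t * (|S.l' j t - S.l' (j + 1) t| + 1)) ∧
    (∀ j, ‖S.M' j t‖ ≤ S.rate t * (‖S.M j t‖ + 1)) ∧
    (∀ k, ‖S.N' k t‖ ≤ S.rate t * (‖S.N k t‖ + 1)) ∧
    (∀ j, ‖S.M j t‖ * ‖(S.gaps j t)⁻¹‖ ≤ S.rate t) ∧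
    (∀ k, √(‖S.N k t‖ / S.delta t) ≤ S.rate t) := by
  have hδ := S.delta_nonneg t
  have p1 : ∀ j : Fin 3, 0 ≤ |S.l' j t - S.l' (j + 1) t| / |S.l j t - S.l (j + 1) t| :=
    fun j => by positivity
  have p2 : ∀ j : Fin 3, 0 ≤ |S.l'' j t - S.l'' (j + 1) t| / (|S.l' j t - S.l' (j + 1) t| + 1) :=
    fun j => by positivity
  have p3 : ∀ j : Fin 3, 0 ≤ ‖S.M' j t‖ / (‖S.M j t‖ + 1) := fun j => by positivity
  have p4 : ∀ k : Fin 2, 0 ≤ ‖S.N' k t‖ / (‖S.N k t‖ + 1) := fun j => by positivity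
  have p5 : ∀ j : Fin 3,
      0 ≤ ‖S.M j t‖ / (|S.l j t - S.l (j + 1) t| * |S.l j t - S.l (j + 2) t|) :=
    fun j => by positivity
  have p6 : ∀ k : Fin 2, 0 ≤ √(‖S.N k t‖ / S.delta t) := fun j => by positivity
  have q1 := Finset.sum_nonneg fun j (_ : j ∈ Finset.univ) => p1 j
  have q2 := Finset.sum_nonneg fun j (_ : j ∈ Finset.univ) => p2 j
  have q3 := Finset.sum_nonneg fun j (_ : j ∈ Finset.univ) => p3 j
  have q4 := Finset.sum_nonneg fun j (_ : j ∈ Finset.univ) => p4 j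
  have q5 := Finset.sum_nonneg fun j (_ : j ∈ Finset.univ) => p5 j
  have q6 := Finset.sum_nonneg fun j (_ : j ∈ Finset.univ) => p6 j
  have s1 := fun j => Finset.single_le_sum (fun j _ => p1 j) (Finset.mem_univ j)
  have s2 := fun j => Finset.single_le_sum (fun j _ => p2 j) (Finset.mem_univ j)
  have s3 := fun j => Finset.single_le_sum (fun j _ => p3 j) (Finset.mem_univ j)
  have s4 := fun j => Finset.single_le_sum (fun j _ => p4 j) (Finset.mem_univ j)
  have s5 := fun j => Finset.single_le_sum (fun j _ => p5 j) (Finset.mem_univ j)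
  have s6 := fun j => Finset.single_le_sum (fun j _ => p6 j) (Finset.mem_univ j)
  refine ⟨?_, fun j => ?_, fun j => ?_, fun j => ?_, fun j => ?_, fun j => ?_, fun j => ?_⟩
  · unfold rate; linarith only [q1, q2, q3, q4, q5, q6]
  · unfold rate; linarith only [q1, q2, q3, q4, q5, q6, s1 j]
  · rw [← div_le_iff₀ (by positivity)]
    unfold rate; linarith only [q1, q2, q3, q4, q5, q6, s2 j]
  · rw [← div_le_iff₀ (by positivity)]
    unfold rate; linarith only [q1, q2, q3, q4, q5, q6, s3 j]
  · rw [← div_le_iff₀ (by positivity)]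
    unfold rate; linarith only [q1, q2, q3, q4, q5, q6, s4 j]
  · have e : ‖S.M j t‖ * ‖(S.gaps j t)⁻¹‖
        = ‖S.M j t‖ / (|S.l j t - S.l (j + 1) t| * |S.l j t - S.l (j + 2) t|) := by
      rw [norm_inv, Real.norm_eq_abs, gaps, abs_mul, div_eq_mul_inv]
    rw [e]
    unfold rate; linarith only [q1, q2, q3, q4, q5, q6, s5 j]
  · unfold rate; linarith only [q1, q2, q3, q4, q5, q6, s6 j]

theorem weight_pos (i : Index) {t : ℝ} (ht : t ∈ Icc 0 T) : 0 < S.weight i t := by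
  have h1 : ∀ j, 0 < ‖(S.gaps j t)⁻¹‖ := fun j => norm_pos_iff.2 (inv_ne_zero (S.gaps_ne_zero j ht))
  have h2 : 0 < ‖(S.delta t)⁻¹‖ :=
    norm_pos_iff.2 (inv_ne_zero (by linarith [S.one_le_delta ht] : S.delta t ≠ 0))
  rcases i with (j | j) | (j | j) | k
  · exact one_pos
  · simp only [weight]; positivity
  · have := h1 j
    simp only [weight]; positivity
  · have := h1 j
    simp only [weight]; positivity
  · simp only [weight]; positivity

/-- The derivative of `gaps`. -/
def gaps' (j : Fin 3) (t : ℝ) : ℝ :=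
  (S.l' j t - S.l' (j + 1) t) * (S.l j t - S.l (j + 2) t)
    + (S.l j t - S.l (j + 1) t) * (S.l' j t - S.l' (j + 2) t)

theorem hasDerivWithinAt_gaps (j : Fin 3) {t : ℝ} (ht : t ∈ Icc 0 T) :
    HasDerivWithinAt (S.gaps j) (S.gaps' j t) (Icc 0 T) t :=
  ((S.hl j t ht).sub (S.hl (j + 1) t ht)).mul ((S.hl j t ht).sub (S.hl (j + 2) t ht))

/-- The derivative of `delta`. -/
def delta' (t : ℝ) : ℝ :=
  (2 / 9 * ∑ j, (S.l j t - S.l (j + 1) t) * (S.l' j t - S.l' (j + 1) t)) / S.delta t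

theorem hasDerivWithinAt_delta {t : ℝ} (ht : t ∈ Icc 0 T) :
    HasDerivWithinAt S.delta (S.delta' t) (Icc 0 T) t := by
  have h : HasDerivWithinAt (fun s => 2 / 9 * ∑ j, (S.l j s - S.l (j + 1) s) ^ 2)
      (2 / 9 * ∑ j, (2 * (S.l j t - S.l (j + 1) t) * (S.l' j t - S.l' (j + 1) t)))
      (Icc 0 T) t := by
    refine HasDerivWithinAt.const_mul _ (HasDerivWithinAt.fun_sum fun j _ => ?_)
    have := ((S.hl j t ht).sub (S.hl (j + 1) t ht)).pow 2
    simpa using! this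
  have hne : 2 / 9 * ∑ j, (S.l j t - S.l (j + 1) t) ^ 2 ≠ 0 := by
    rw [← sq_delta]
    have := S.one_le_delta ht
    positivity
  have h2 := h.sqrt hne
  refine h2.congr_deriv ?_
  rw [delta', show √(2 / 9 * ∑ j, (S.l j t - S.l (j + 1) t) ^ 2) = S.delta t from rfl]
  have : ∀ j : Fin 3, 2 * (S.l j t - S.l (j + 1) t) * (S.l' j t - S.l' (j + 1) t)
    = 2 * ((S.l j t - S.l (j + 1) t) * (S.l' j t - S.l' (j + 1) t)) := fun j => by ring
  simp only [this, ← Finset.mul_sum]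
  have := S.one_le_delta ht
  field_simp

/-- The constant is `2/9 · 9/4`. Differences of the `λ_j'` are what the weights of `u` control, so
this form suits terms with a factor `u`. -/
theorem abs_delta'_le {t : ℝ} (ht : t ∈ Icc 0 T) :
    |S.delta' t| ≤ 1 / 2 * ∑ j, |S.l' j t - S.l' (j + 1) t| := by
  have hδ := S.one_le_delta ht
  rw [delta', abs_div, abs_of_pos (by linarith : 0 < S.delta t), div_le_iff₀ (by linarith),
    abs_mul, abs_of_pos (by norm_num : (0 : ℝ) < 2 / 9)]
  have h1 : |∑ j, (S.l j t - S.l (j + 1) t) * (S.l' j t - S.l' (j + 1) t)|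
      ≤ ∑ j, 9 / 4 * S.delta t * |S.l' j t - S.l' (j + 1) t| := by
    refine (Finset.abs_sum_le_sum_abs _ _).trans (Finset.sum_le_sum fun j _ => ?_)
    rw [abs_mul]
    exact mul_le_mul_of_nonneg_right (S.abs_sub_le_delta j t) (abs_nonneg _)
  rw [← Finset.mul_sum] at h1
  linarith

/-- Replacing each `|λ_j' - λ_k'|` by `rate · |λ_j - λ_k|` restores the sum of squares that defines
`delta²`. -/
theorem abs_delta'_le_rate {t : ℝ} (ht : t ∈ Icc 0 T) : |S.delta' t| ≤ S.rate t * S.delta t := by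
  have hδ := S.one_le_delta ht
  have hr := (S.rate_bounds t).2.1
  rw [delta', abs_div, abs_of_pos (by linarith : 0 < S.delta t), div_le_iff₀ (by linarith),
    abs_mul, abs_of_pos (by norm_num : (0 : ℝ) < 2 / 9), mul_assoc, ← pow_two, sq_delta]
  have h1 : |∑ j, (S.l j t - S.l (j + 1) t) * (S.l' j t - S.l' (j + 1) t)|
      ≤ ∑ j, S.rate t * (S.l j t - S.l (j + 1) t) ^ 2 := by
    refine (Finset.abs_sum_le_sum_abs _ _).trans (Finset.sum_le_sum fun j _ => ?_)
    have h2 := hr j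
    have hg := S.gap j ht
    rw [div_le_iff₀ (by linarith)] at h2
    rw [abs_mul, ← sq_abs (S.l j t - S.l (j + 1) t)]
    nlinarith
  rw [← Finset.mul_sum] at h1
  linarith

theorem abs_sub_le_rate {t : ℝ} (ht : t ∈ Icc 0 T) (j : Fin 3) :
    |S.l' j t - S.l' (j + 1) t| ≤ S.rate t * |S.l j t - S.l (j + 1) t| := by
  have h := (S.rate_bounds t).2.1 j
  rwa [div_le_iff₀ (by linarith [S.gap j ht])] at h

theorem abs_sub_le_rate' {t : ℝ} (ht : t ∈ Icc 0 T) (j : Fin 3) :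
    |S.l' j t - S.l' (j + 2) t| ≤ S.rate t * |S.l j t - S.l (j + 2) t| := by
  have h := S.abs_sub_le_rate ht (j + 2)
  have e : j + 2 + 1 = j := by fin_cases j <;> rfl
  rwa [e, abs_sub_comm, abs_sub_comm (S.l (j + 2) t)] at h

theorem abs_gaps'_le {t : ℝ} (ht : t ∈ Icc 0 T) (j : Fin 3) :
    |S.gaps' j t| ≤ 2 * S.rate t * |S.gaps j t| := by
  refine (abs_add_le _ _).trans ?_
  rw [gaps, abs_mul, abs_mul, abs_mul]
  have h1 := mul_le_mul_of_nonneg_right (S.abs_sub_le_rate ht j)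
    (abs_nonneg (S.l j t - S.l (j + 2) t))
  have h2 := mul_le_mul_of_nonneg_left (S.abs_sub_le_rate' ht j)
    (abs_nonneg (S.l j t - S.l (j + 1) t))
  linarith

/-- A function and its inverse have opposite logarithmic derivatives. -/
theorem logDerivBound_inv {g : ℝ → ℝ} {g' R t : ℝ} (hg : HasDerivAt g g' t)
    (h0 : g t ≠ 0) (hb : |g'| ≤ R * |g t|) (hd : DifferentiableAt ℝ (fun s => ‖(g s)⁻¹‖) t) :
    LogDerivBound (fun s => ‖(g s)⁻¹‖ + 0) R t := by
  refine logDerivBound_norm_add (hg.fun_inv h0) hd ?_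
  have h1 : 0 < |g t| := abs_pos.2 h0
  rw [norm_div, norm_neg, norm_inv, norm_pow, Real.norm_eq_abs, Real.norm_eq_abs, add_zero,
    div_le_iff₀ (by positivity)]
  calc |g'| ≤ R * |g t| := hb
    _ = R * |g t|⁻¹ * |g t| ^ 2 := by field_simp

end SymbolData

end EnergyEstimate


/-! ### Absolute continuity and logarithmic derivatives of the weights -/

section EnergyEstimate

open Complex Filter

namespace SymbolData

variable {T : ℝ} (S : SymbolData T)

theorem continuousOn_l (j : Fin 3) : ContinuousOn (S.l j) (Icc 0 T) :=
  fun t ht => (S.hl j t ht).continuousWithinAt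

theorem continuousOn_l' (j : Fin 3) : ContinuousOn (S.l' j) (Icc 0 T) :=
  fun t ht => (S.hl' j t ht).continuousWithinAt

theorem l_ac (hT : 0 ≤ T) (j : Fin 3) : AbsolutelyContinuousOnInterval (S.l j) 0 T :=
  absolutelyContinuousOnInterval_of_hasDerivWithinAt hT (S.hl j) (S.continuousOn_l' j)

theorem l'_ac (hT : 0 ≤ T) (j : Fin 3) : AbsolutelyContinuousOnInterval (S.l' j) 0 T :=
  absolutelyContinuousOnInterval_of_hasDerivWithinAt hT (S.hl' j) (S.hl'' j)

theorem delta_ne_zero {t : ℝ} (ht : t ∈ Icc 0 T) : S.delta t ≠ 0 := by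
  linarith [S.one_le_delta ht]

theorem continuousOn_delta : ContinuousOn S.delta (Icc 0 T) :=
  fun _ ht => (S.hasDerivWithinAt_delta ht).continuousWithinAt

theorem continuousOn_delta' : ContinuousOn S.delta' (Icc 0 T) := by
  have h1 := S.continuousOn_l
  have h2 := S.continuousOn_l'
  unfold delta'
  refine ContinuousOn.div (by fun_prop) S.continuousOn_delta fun t ht => S.delta_ne_zero ht

theorem delta_ac (hT : 0 ≤ T) : AbsolutelyContinuousOnInterval S.delta 0 T :=
  absolutelyContinuousOnInterval_of_hasDerivWithinAt hT
    (fun _ ht => S.hasDerivWithinAt_delta ht) S.continuousOn_delta'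

theorem inv_ac {g g' : ℝ → ℝ} (hT : 0 ≤ T)
    (hg : ∀ t ∈ Icc 0 T, HasDerivWithinAt g (g' t) (Icc 0 T) t) (hc : ContinuousOn g' (Icc 0 T))
    (h0 : ∀ t ∈ Icc 0 T, g t ≠ 0) : AbsolutelyContinuousOnInterval (fun t => ‖(g t)⁻¹‖) 0 T := by
  have hgc : ContinuousOn g (Icc 0 T) := fun t ht => (hg t ht).continuousWithinAt
  refine absolutelyContinuousOnInterval_norm (absolutelyContinuousOnInterval_of_hasDerivWithinAt hT
    (fun t ht => (hg t ht).fun_inv (h0 t ht)) ?_)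
  exact ContinuousOn.div hc.neg (hgc.pow 2) fun t ht => pow_ne_zero 2 (h0 t ht)

theorem inv_delta_ac (hT : 0 ≤ T) :
    AbsolutelyContinuousOnInterval (fun t => ‖(S.delta t)⁻¹‖) 0 T :=
  inv_ac hT (fun _ ht => S.hasDerivWithinAt_delta ht) S.continuousOn_delta'
    fun _ ht => S.delta_ne_zero ht

theorem inv_gaps_ac (hT : 0 ≤ T) (j : Fin 3) :
    AbsolutelyContinuousOnInterval (fun t => ‖(S.gaps j t)⁻¹‖) 0 T := by
  have h1 := S.continuousOn_l
  have h2 := S.continuousOn_l'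
  refine inv_ac hT (fun _ ht => S.hasDerivWithinAt_gaps j ht) ?_ fun _ ht => S.gaps_ne_zero j ht
  unfold gaps'
  fun_prop

theorem M_ac (hT : 0 ≤ T) (j : Fin 3) : AbsolutelyContinuousOnInterval (S.M j) 0 T :=
  absolutelyContinuousOnInterval_of_hasDerivWithinAt hT (S.hM j) (S.hM' j)

theorem weight_ac (hT : 0 ≤ T) (i : Index) : AbsolutelyContinuousOnInterval (S.weight i) 0 T := by
  have c1 := absolutelyContinuousOnInterval_const (1 : ℝ) 0 T
  have c0 := absolutelyContinuousOnInterval_const (0 : ℝ) 0 T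
  rcases i with (j | j) | (j | j) | k
  · exact c1
  · have h := (absolutelyContinuousOnInterval_norm
      ((S.l'_ac hT j).fun_sub (S.l'_ac hT (j + 1)))).fun_add c1
    exact h.fun_mul h
  · have h := ((absolutelyContinuousOnInterval_norm (S.M_ac hT j)).fun_add c1).fun_mul
      ((S.inv_gaps_ac hT j).fun_add c0)
    exact h.fun_mul h
  · have h := ((absolutelyContinuousOnInterval_norm (S.M_ac hT j)).fun_add c1).fun_mul
      ((S.inv_gaps_ac hT j).fun_add c0)
    exact h.fun_mul h
  · exact ((absolutelyContinuousOnInterval_norm (S.N_ac k)).fun_add c1).fun_mul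
      ((S.inv_delta_ac hT).fun_add c0)

theorem mu_ac (hT : 0 ≤ T) (k : Fin 2) : AbsolutelyContinuousOnInterval (S.mu k) 0 T := by
  have h := (((S.l_ac hT 0).fun_add (S.l_ac hT 1)).fun_add (S.l_ac hT 2)).const_mul (1 / 3)
  have h2 := (S.delta_ac hT).const_mul ((![-1, 1] : Fin 2 → ℝ) k / 2)
  refine absolutelyContinuousOnInterval_congr (h.fun_add h2) fun t _ => ?_
  simp only [mu]
  ring

theorem firstFactor_ac {r : ℝ → ℝ} {u₀ u₁ : ℝ → ℂ} (hr : AbsolutelyContinuousOnInterval r 0 T)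
    (h0 : AbsolutelyContinuousOnInterval u₀ 0 T) (h1 : AbsolutelyContinuousOnInterval u₁ 0 T) :
    AbsolutelyContinuousOnInterval (fun t => firstFactor (r t) (u₀ t) (u₁ t)) 0 T :=
  h1.fun_sub (absolutelyContinuousOnInterval_mul (absolutelyContinuousOnInterval_mul
    (absolutelyContinuousOnInterval_const I 0 T) (absolutelyContinuousOnInterval_ofReal hr)) h0)

theorem term_ac (hT : 0 ≤ T) {u₀ u₁ u₂ : ℝ → ℂ} (h0 : AbsolutelyContinuousOnInterval u₀ 0 T)
    (h1 : AbsolutelyContinuousOnInterval u₁ 0 T) (h2 : AbsolutelyContinuousOnInterval u₂ 0 T)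
    (i : Index) : AbsolutelyContinuousOnInterval (S.term u₀ u₁ u₂ i) 0 T := by
  have hl := fun j => absolutelyContinuousOnInterval_ofReal (S.l_ac hT j)
  have hl' := fun j => absolutelyContinuousOnInterval_ofReal (S.l'_ac hT j)
  rcases i with (j | j) | (j | j) | k
  · have c := fun z : ℂ => absolutelyContinuousOnInterval_const z 0 T
    exact ((h2.fun_sub (absolutelyContinuousOnInterval_mul (absolutelyContinuousOnInterval_mul
      (c I) ((hl (j + 1)).fun_add (hl (j + 2)))) h1)).fun_sub (absolutelyContinuousOnInterval_mul
      (absolutelyContinuousOnInterval_mul (hl (j + 1)) (hl (j + 2))) h0)).fun_sub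
      (absolutelyContinuousOnInterval_mul (absolutelyContinuousOnInterval_mul (c (I / 2))
        ((hl' (j + 1)).fun_add (hl' (j + 2)))) h0)
  · exact h0
  · exact firstFactor_ac (S.l_ac hT _) h0 h1
  · exact firstFactor_ac (S.l_ac hT _) h0 h1
  · exact firstFactor_ac (S.mu_ac hT _) h0 h1

/-- The functions entering the weights are differentiable at `t`. -/
structure WeightDiff (t : ℝ) : Prop where
  l' : ∀ j, DifferentiableAt ℝ (fun s => ‖S.l' j s - S.l' (j + 1) s‖) t
  M : ∀ j, DifferentiableAt ℝ (fun s => ‖S.M j s‖) t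
  gaps : ∀ j, DifferentiableAt ℝ (fun s => ‖(S.gaps j s)⁻¹‖) t
  N : ∀ k, DifferentiableAt ℝ (fun s => ‖S.N k s‖) t
  delta : DifferentiableAt ℝ (fun s => ‖(S.delta s)⁻¹‖) t
  hN : ∀ k, HasDerivAt (S.N k) (S.N' k t) t

/-- A norm can fail to be differentiable where its argument vanishes, but the norm of an absolutely
continuous function is absolutely continuous, hence differentiable almost everywhere. -/
theorem ae_weightDiff (hT : 0 ≤ T) : ∀ᵐ t, t ∈ Ioo 0 T → S.WeightDiff t := by
  have a1 := ae_all_iff.2 fun j => (absolutelyContinuousOnInterval_norm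
      ((S.l'_ac hT j).fun_sub (S.l'_ac hT (j + 1)))).ae_differentiableAt
  have a2 := ae_all_iff.2 fun j => (absolutelyContinuousOnInterval_norm
    (S.M_ac hT j)).ae_differentiableAt
  have a3 := ae_all_iff.2 fun j => (S.inv_gaps_ac hT j).ae_differentiableAt
  have a4 := ae_all_iff.2 fun k => (absolutelyContinuousOnInterval_norm
    (S.N_ac k)).ae_differentiableAt
  have a5 := (S.inv_delta_ac hT).ae_differentiableAt
  filter_upwards [a1, a2, a3, a4, a5, ae_all_iff.2 S.hN] with t h1 h2 h3 h4 h5 h6 ht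
  have ht' : t ∈ uIcc 0 T := by rw [uIcc_of_le hT]; exact Ioo_subset_Icc_self ht
  exact ⟨fun j => h1 j ht', fun j => h2 j ht', fun j => h3 j ht', fun k => h4 k ht', h5 ht',
    fun k => h6 k ht⟩

theorem hasDerivAt_of_mem {F : Type*} [NormedAddCommGroup F] [NormedSpace ℝ F] {f : ℝ → F} {f' : F}
    {t : ℝ} (ht : t ∈ Ioo 0 T) (h : HasDerivWithinAt f f' (Icc 0 T) t) : HasDerivAt f f' t :=
  h.hasDerivAt (Icc_mem_nhds ht.1 ht.2)

/-- Logarithmic derivatives add up: `1` for `|M̌_j| + 1` and `2` for the product of two gaps,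
doubled by the square, give the constant `6`, the largest among the weights. -/
theorem logDerivBound_weight {t : ℝ} (ht : t ∈ Ioo 0 T) (hd : S.WeightDiff t) (i : Index) :
    LogDerivBound (S.weight i) (6 * S.rate t) t := by
  have htI := Ioo_subset_Icc_self ht
  obtain ⟨r1, -, r2, r3, r4, -, -⟩ := S.rate_bounds t
  have hω : ∀ j, LogDerivBound (fun s => ((‖S.M j s‖ + 1) * (‖(S.gaps j s)⁻¹‖ + 0)) *
      ((‖S.M j s‖ + 1) * (‖(S.gaps j s)⁻¹‖ + 0))) (6 * S.rate t) t := by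
    intro j
    have h1 := logDerivBound_norm_add (hasDerivAt_of_mem ht (S.hM j t htI)) (hd.M j) (r3 j)
    have h2 := logDerivBound_inv (hasDerivAt_of_mem ht (S.hasDerivWithinAt_gaps j htI))
      (S.gaps_ne_zero j htI) (S.abs_gaps'_le htI j) (hd.gaps j)
    have h3 := h1.mul h2 (by positivity) (by positivity)
    exact (h3.mul h3 (by positivity) (by positivity)).mono (by positivity) (by linarith)
  rcases i with (j | j) | (j | j) | k
  · refine ⟨0, hasDerivAt_const _ _, ?_⟩
    simp only [abs_zero, weight, mul_one]
    linarith
  · have h := logDerivBound_norm_add (c := 1) ((hasDerivAt_of_mem ht (S.hl' j t htI)).fun_sub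
      (hasDerivAt_of_mem ht (S.hl' (j + 1) t htI))) (hd.l' j) (r2 j)
    exact (h.mul h (by positivity) (by positivity)).mono (S.weight_pos (.inl (.inr j)) htI).le
      (by linarith)
  · exact hω j
  · exact hω j
  · have h1 := logDerivBound_norm_add (hd.hN k) (hd.N k) (r4 k)
    have h2 := logDerivBound_inv (hasDerivAt_of_mem ht (S.hasDerivWithinAt_delta htI))
      (S.delta_ne_zero htI)
      ((S.abs_delta'_le_rate htI).trans (by rw [abs_of_nonneg (S.delta_nonneg t)])) hd.delta
    exact (h1.mul h2 (by positivity) (by positivity)).mono (S.weight_pos (.inr (.inr k)) htI).le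
      (by linarith)

theorem energy_nonneg (u₀ u₁ u₂ : ℝ → ℂ) {t : ℝ} (ht : t ∈ Icc 0 T) : 0 ≤ S.energy u₀ u₁ u₂ t :=
  Finset.sum_nonneg fun i _ => mul_nonneg (S.weight_pos i ht).le (by positivity)

theorem sqrt_weight_mul_le (u₀ u₁ u₂ : ℝ → ℂ) {t : ℝ} (ht : t ∈ Icc 0 T) (i : Index) :
    √(S.weight i t) * ‖S.term u₀ u₁ u₂ i t‖ ≤ √(S.energy u₀ u₁ u₂ t) := by
  rw [← Real.sqrt_sq (norm_nonneg (S.term u₀ u₁ u₂ i t)), ← Real.sqrt_mul (S.weight_pos i ht).le]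
  refine Real.sqrt_le_sqrt ?_
  exact Finset.single_le_sum (f := fun i => S.weight i t * ‖S.term u₀ u₁ u₂ i t‖ ^ 2)
    (fun j _ => mul_nonneg (S.weight_pos j ht).le (by positivity)) (Finset.mem_univ i)

/-- The weight `(|M_j| + 1) / |(λ_j - λ_{j+1}) (λ_j - λ_{j+2})|`. -/
def omega (j : Fin 3) (t : ℝ) : ℝ := (‖S.M j t‖ + 1) * ‖(S.gaps j t)⁻¹‖

theorem omega_nonneg (j : Fin 3) (t : ℝ) : 0 ≤ S.omega j t := by unfold omega; positivity

theorem sqrt_weight_omega (j : Fin 3) (t : ℝ) :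
    √(S.weight (.inr (.inl (.inl j))) t) = S.omega j t ∧
    √(S.weight (.inr (.inl (.inr j))) t) = S.omega j t := by
  simp only [weight, add_zero]
  exact ⟨Real.sqrt_mul_self (S.omega_nonneg j t), Real.sqrt_mul_self (S.omega_nonneg j t)⟩

/-- The part `|M̌_j|/|gaps|` is the integrand of the fifth condition; the part `1/|gaps|` is at most
`1`, hence at most the rate. -/
theorem omega_le {t : ℝ} (ht : t ∈ Icc 0 T) (j : Fin 3) : S.omega j t ≤ 2 * S.rate t := by
  obtain ⟨r1, -, -, -, -, r5, -⟩ := S.rate_bounds t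
  have h1 : ‖(S.gaps j t)⁻¹‖ ≤ 1 := by
    rw [norm_inv]
    exact inv_le_one_of_one_le₀ (S.one_le_abs_gaps j ht)
  have := r5 j
  unfold omega
  linarith

theorem sqrt_add_le {x y : ℝ} (hx : 0 ≤ x) (hy : 0 ≤ y) : √(x + y) ≤ √x + √y := by
  refine Real.sqrt_le_iff.2 ⟨by positivity, ?_⟩
  nlinarith [Real.sq_sqrt hx, Real.sq_sqrt hy, mul_nonneg (Real.sqrt_nonneg x) (Real.sqrt_nonneg y)]

/-- The weight is `|Ň_k|/δ + 1/δ`; the square root of the first part is the integrand of the sixth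
condition and the second part is at most one. -/
theorem sqrt_weight_N_le {t : ℝ} (ht : t ∈ Icc 0 T) (k : Fin 2) :
    √(S.weight (.inr (.inr k)) t) ≤ 2 * S.rate t := by
  obtain ⟨r1, -, -, -, -, -, r6⟩ := S.rate_bounds t
  have hδ := S.one_le_delta ht
  have e : S.weight (.inr (.inr k)) t = ‖S.N k t‖ / S.delta t + (S.delta t)⁻¹ := by
    simp only [weight, add_zero, norm_inv, Real.norm_eq_abs, abs_of_nonneg (S.delta_nonneg t)]
    field_simp
  rw [e]
  refine (sqrt_add_le (by positivity) (by positivity)).trans ?_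
  have h1 : √((S.delta t)⁻¹) ≤ 1 := Real.sqrt_le_one.2 (inv_le_one_of_one_le₀ hδ)
  linarith [r6 k]

end SymbolData

end EnergyEstimate


/-! ### Interpolation of the lower order symbols, and quantities bounded by the energy -/

section EnergyEstimate

open Complex Filter

theorem hasDerivAt_firstFactor {r : ℝ → ℝ} {r' : ℝ} {u₀ u₁ : ℝ → ℂ} {u₂ : ℂ} {t : ℝ}
    (hr : HasDerivAt r r' t) (h0 : HasDerivAt u₀ (u₁ t) t) (h1 : HasDerivAt u₁ u₂ t) :
    HasDerivAt (fun s => firstFactor (r s) (u₀ s) (u₁ s))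
      (u₂ - I * r' * u₀ t - I * r t * u₁ t) t := by
  have h := h1.sub (((hr.ofReal_comp.const_mul I)).mul h0)
  refine h.congr_deriv ?_
  ring

theorem secondFactor_eq (l l' : Fin 3 → ℝ) (u₀ u₁ u₂ : ℂ) (j : Fin 3) :
    secondFactor l l' u₀ u₁ u₂ j = u₂ - (I * l (j + 1) + I * l (j + 2)) * u₁
      + (I * l (j + 1)) * (I * l (j + 2)) * u₀
      - 1 / 2 * (I * l' (j + 1) + I * l' (j + 2)) * u₀ := by
  rw [secondFactor]
  linear_combination (-(l (j + 1)) * l (j + 2) * u₀ : ℂ) * I_sq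

namespace SymbolData

variable {T : ℝ} (S : SymbolData T)

/-- The right hand side of the equation, solved for `u'''`. -/
def rhs (f p : ℝ → ℂ) (u₀ u₁ u₂ : ℝ → ℂ) (t : ℝ) : ℂ :=
  f t - p t * u₀ t + (I * S.l 0 t + I * S.l 1 t + I * S.l 2 t) * u₂ t
    - ((I * S.l 0 t) * (I * S.l 1 t) + (I * S.l 0 t) * (I * S.l 2 t)
      + (I * S.l 1 t) * (I * S.l 2 t)) * u₁ t
    + (I * S.l 0 t) * (I * S.l 1 t) * (I * S.l 2 t) * u₀ t
    + 2 * (3 * u₁ t - (I * S.l 0 t + I * S.l 1 t + I * S.l 2 t) * u₀ t)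
    - (S.B₂ t * u₂ t + I * S.B₁ t * u₁ t + (-S.B₀ t) * u₀ t)
    - (S.C₁ t * u₁ t + I * S.C₀ t * u₀ t)

/-- The coefficients of the Lagrange interpolation of the modified second order symbol. -/
def m (j : Fin 3) (t : ℝ) : ℂ := S.M j t / (S.gaps j t : ℂ)

/-- The derivative of `m`. -/
def m' (j : Fin 3) (t : ℝ) : ℂ :=
  (S.M' j t * (S.gaps j t : ℂ) - S.M j t * (S.gaps' j t : ℂ)) / (S.gaps j t : ℂ) ^ 2

/-- The coefficients of the Lagrange interpolation of the modified first order symbol. -/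
def n (k : Fin 2) (t : ℝ) : ℂ := S.N k t / ((S.mu k t : ℂ) - S.mu (1 - k) t)

theorem hasDerivWithinAt_m (j : Fin 3) {t : ℝ} (ht : t ∈ Icc 0 T) :
    HasDerivWithinAt (S.m j) (S.m' j t) (Icc 0 T) t :=
  (S.hM j t ht).div (S.hasDerivWithinAt_gaps j ht).ofReal_comp
    (ofReal_ne_zero.2 (S.gaps_ne_zero j ht))

theorem lagrange_m {t : ℝ} (ht : t ∈ Icc 0 T) :
    S.m 0 t + S.m 1 t + S.m 2 t = S.B₂ t ∧
    S.m 0 t * (S.l 1 t + S.l 2 t) + S.m 1 t * (S.l 2 t + S.l 0 t) + S.m 2 t * (S.l 0 t + S.l 1 t)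
      = -(S.B₁ t + (S.l' 0 t + S.l' 1 t + S.l' 2 t)) ∧
    S.m 0 t * (S.l 1 t * S.l 2 t) + S.m 1 t * (S.l 2 t * S.l 0 t)
      + S.m 2 t * (S.l 0 t * S.l 1 t)
      = S.B₀ t - 1 / 2 * (S.l' 0 t * S.l 1 t + S.l 0 t * S.l' 1 t + S.l' 0 t * S.l 2 t
        + S.l 0 t * S.l' 2 t + S.l' 1 t * S.l 2 t + S.l 1 t * S.l' 2 t) := by
  have hne : ∀ j, (S.l j t : ℂ) ≠ S.l (j + 1) t := fun j h => by
    have := S.gap j ht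
    rw [ofReal_inj.1 h] at this
    simp at this
    linarith
  have h := lagrange_three (hne 0) (hne 1) (hne 2) (S.M_eq 0 t ht) (S.M_eq 1 t ht) (S.M_eq 2 t ht)
  simp only [m, gaps, ofReal_mul, ofReal_sub]
  exact h

/-- The first two interpolation identities, differentiated in time; derivatives within `[0,T]` are
unique also at the end points. -/
theorem lagrange_m' {t : ℝ} (hT : 0 < T) (ht : t ∈ Icc 0 T) :
    S.m' 0 t + S.m' 1 t + S.m' 2 t = S.B₂' t ∧
    S.m' 0 t * (S.l 1 t + S.l 2 t) + S.m' 1 t * (S.l 2 t + S.l 0 t)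
      + S.m' 2 t * (S.l 0 t + S.l 1 t)
      + (S.m 0 t * (S.l' 1 t + S.l' 2 t) + S.m 1 t * (S.l' 2 t + S.l' 0 t)
        + S.m 2 t * (S.l' 0 t + S.l' 1 t))
      = -(S.B₁' t + (S.l'' 0 t + S.l'' 1 t + S.l'' 2 t)) := by
  have hu : UniqueDiffWithinAt ℝ (Icc 0 T) t := uniqueDiffOn_Icc hT t ht
  have hm := fun j => S.hasDerivWithinAt_m j ht
  have hl := fun j => (S.hl j t ht).ofReal_comp
  have hl' := fun j => (S.hl' j t ht).ofReal_comp
  constructor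
  · have h := ((hm 0).add (hm 1)).add (hm 2)
    exact hu.eq_deriv _ (h.congr_of_mem (fun s hs => (S.lagrange_m hs).1.symm) ht) (S.hB₂ t ht)
  · have h := ((((hm 0).mul ((hl 1).add (hl 2))).add ((hm 1).mul ((hl 2).add (hl 0)))).add
      ((hm 2).mul ((hl 0).add (hl 1))))
    have h2 := ((S.hB₁ t ht).add (((hl' 0).add (hl' 1)).add (hl' 2))).neg
    have := hu.eq_deriv _ (h.congr_of_mem (fun s hs => (S.lagrange_m hs).2.1.symm) ht) h2
    rw [← this]
    simp only [Pi.add_apply]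
    ring

theorem mu_sub (k : Fin 2) (t : ℝ) :
    S.mu k t - S.mu (1 - k) t = (![-1, 1] : Fin 2 → ℝ) k * S.delta t := by
  fin_cases k <;> simp [mu] <;> ring

theorem lagrange_n {t : ℝ} (ht : t ∈ Icc 0 T) :
    S.n 0 t + S.n 1 t = S.C₁ t - S.B₂' t ∧
    S.n 0 t * S.mu 1 t + S.n 1 t * S.mu 0 t
      = -(S.C₀ t - 1 / 2 * S.B₁' t - (S.l'' 0 t + S.l'' 1 t + S.l'' 2 t) / 6) := by
  have hne : (S.mu 0 t : ℂ) ≠ S.mu 1 t := fun h => by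
    have h1 := S.mu_sub 0 t
    have h2 := S.one_le_delta ht
    have h3 := ofReal_inj.1 h
    simp at h1
    linarith
  have h := lagrange_two hne (S.N_eq 0 t ht) (S.N_eq 1 t ht)
  exact h

theorem norm_n_le {t : ℝ} (ht : t ∈ Icc 0 T) (k : Fin 2) :
    ‖S.n k t‖ ≤ S.weight (.inr (.inr k)) t := by
  have h : ‖(S.mu k t : ℂ) - S.mu (1 - k) t‖ = S.delta t := by
    rw [← ofReal_sub, S.mu_sub, norm_real, norm_mul, Real.norm_eq_abs, Real.norm_eq_abs,
      abs_of_nonneg (S.delta_nonneg t)]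
    fin_cases k <;> simp
  have hδ := S.one_le_delta ht
  rw [n, norm_div, h]
  simp only [weight, add_zero, norm_inv, Real.norm_eq_abs, abs_of_nonneg (S.delta_nonneg t)]
  rw [div_eq_mul_inv]
  exact mul_le_mul_of_nonneg_right (by linarith) (by positivity)

theorem norm_m_le (t : ℝ) (j : Fin 3) : ‖S.m j t‖ ≤ S.rate t := by
  refine le_trans (le_of_eq ?_) ((S.rate_bounds t).2.2.2.2.2.1 j)
  rw [m, norm_div, norm_real, norm_inv, div_eq_mul_inv]

/-- Quotient rule: the term with `M'` contributes `rate · omega`, and the term with the derivative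
of the gaps contributes `2 · rate · omega`. -/
theorem norm_m'_le {t : ℝ} (ht : t ∈ Icc 0 T) (j : Fin 3) :
    ‖S.m' j t‖ ≤ 3 * S.rate t * S.omega j t := by
  have hg := S.one_le_abs_gaps j ht
  have h3 := (S.rate_bounds t).2.2.2.1 j
  have h0 := (S.rate_bounds t).1
  have hg' := S.abs_gaps'_le ht j
  rw [m', norm_div, norm_pow, norm_real, Real.norm_eq_abs, omega, norm_inv, Real.norm_eq_abs,
    div_le_iff₀ (by positivity)]
  refine (norm_sub_le _ _).trans ?_
  rw [norm_mul, norm_mul, norm_real, norm_real, Real.norm_eq_abs, Real.norm_eq_abs]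
  have e : 3 * S.rate t * ((‖S.M j t‖ + 1) * |S.gaps j t|⁻¹) * |S.gaps j t| ^ 2
      = 3 * S.rate t * (‖S.M j t‖ + 1) * |S.gaps j t| := by field_simp
  rw [e]
  have a1 := mul_le_mul_of_nonneg_right h3 (abs_nonneg (S.gaps j t))
  have a2 := mul_le_mul_of_nonneg_left hg' (norm_nonneg (S.M j t))
  have a3 : 0 ≤ S.rate t * |S.gaps j t| := by positivity
  nlinarith

variable (u₀ u₁ u₂ : ℝ → ℂ)

theorem norm_u₀_le {t : ℝ} (ht : t ∈ Icc 0 T) (j : Fin 3) :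
    (|S.l' j t - S.l' (j + 1) t| + 1) * ‖u₀ t‖ ≤ √(S.energy u₀ u₁ u₂ t) := by
  have h := S.sqrt_weight_mul_le u₀ u₁ u₂ ht (.inl (.inr j))
  simp only [weight, term] at h
  rwa [Real.sqrt_mul_self (by positivity)] at h

theorem norm_secondFactor_le {t : ℝ} (ht : t ∈ Icc 0 T) (j : Fin 3) :
    ‖secondFactor (fun i => S.l i t) (fun i => S.l' i t) (u₀ t) (u₁ t) (u₂ t) j‖
      ≤ √(S.energy u₀ u₁ u₂ t) := by
  have h := S.sqrt_weight_mul_le u₀ u₁ u₂ ht (.inl (.inl j))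
  simpa only [weight, term, Real.sqrt_one, one_mul] using h

/-- In `sub_mul_firstFactor` the two second order factors and the term with `u` each cost one energy
norm; the weight `|λ_j' - λ_{j+1}'| + 1` of `u` is made for the last one. -/
theorem norm_firstFactor_le {t : ℝ} (ht : t ∈ Icc 0 T) (j : Fin 3) :
    |S.l j t - S.l (j + 1) t| * ‖firstFactor (S.l (j + 2) t) (u₀ t) (u₁ t)‖
      ≤ 3 * √(S.energy u₀ u₁ u₂ t) := by
  have h := congrArg norm (sub_mul_firstFactor (fun i => S.l i t) (fun i => S.l' i t) (u₀ t) (u₁ t)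
    (u₂ t) j)
  rw [norm_mul, norm_mul, norm_I, one_mul, ← ofReal_sub, norm_real, Real.norm_eq_abs] at h
  rw [h]
  refine (norm_sub_le _ _).trans ?_
  have h1 := norm_sub_le (secondFactor (fun i => S.l i t) (fun i => S.l' i t) (u₀ t) (u₁ t) (u₂ t)
    j) (secondFactor (fun i => S.l i t) (fun i => S.l' i t) (u₀ t) (u₁ t) (u₂ t) (j + 1))
  have h2 : ‖I / 2 * ((S.l' j t : ℂ) - S.l' (j + 1) t) * u₀ t‖
      ≤ (|S.l' j t - S.l' (j + 1) t| + 1) * ‖u₀ t‖ := by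
    rw [norm_mul, norm_mul, norm_div, norm_I, ← ofReal_sub, norm_real, Real.norm_eq_abs]
    refine mul_le_mul_of_nonneg_right ?_ (norm_nonneg _)
    have := abs_nonneg (S.l' j t - S.l' (j + 1) t)
    norm_num
    linarith
  linarith [S.norm_u₀_le u₀ u₁ u₂ ht j, S.norm_secondFactor_le u₀ u₁ u₂ ht j,
    S.norm_secondFactor_le u₀ u₁ u₂ ht (j + 1)]

theorem norm_firstFactor_le' {t : ℝ} (ht : t ∈ Icc 0 T) (j : Fin 3) :
    ‖firstFactor (S.l j t) (u₀ t) (u₁ t)‖ ≤ 3 * √(S.energy u₀ u₁ u₂ t) := by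
  have h := S.norm_firstFactor_le u₀ u₁ u₂ ht (j + 1)
  have e : j + 1 + 2 = j := by fin_cases j <;> rfl
  rw [e] at h
  refine le_trans ?_ h
  exact le_mul_of_one_le_left (norm_nonneg _) (S.gap _ ht)

/-- The first condition trades `|λ_j' - λ_{j+1}'|` for `rate · |λ_j - λ_{j+1}|`, and the gap is then
absorbed by `norm_firstFactor_le`. -/
theorem sub_mul_firstFactor_le {t : ℝ} (ht : t ∈ Icc 0 T) (j : Fin 3) :
    |S.l' j t - S.l' (j + 1) t| * ‖firstFactor (S.l (j + 2) t) (u₀ t) (u₁ t)‖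
      ≤ 3 * S.rate t * √(S.energy u₀ u₁ u₂ t) := by
  have h1 := mul_le_mul_of_nonneg_right (S.abs_sub_le_rate ht j)
    (norm_nonneg (firstFactor (S.l (j + 2) t) (u₀ t) (u₁ t)))
  have h2 := mul_le_mul_of_nonneg_left (S.norm_firstFactor_le u₀ u₁ u₂ ht j)
    (by linarith [(S.rate_bounds t).1] : 0 ≤ S.rate t)
  linarith

theorem omega_mul_le {t : ℝ} (ht : t ∈ Icc 0 T) (j : Fin 3) :
    S.omega j t * ‖firstFactor (S.l (j + 1) t) (u₀ t) (u₁ t)‖ ≤ √(S.energy u₀ u₁ u₂ t) ∧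
    S.omega j t * ‖firstFactor (S.l (j + 2) t) (u₀ t) (u₁ t)‖ ≤ √(S.energy u₀ u₁ u₂ t) := by
  have h1 := S.sqrt_weight_mul_le u₀ u₁ u₂ ht (.inr (.inl (.inl j)))
  have h2 := S.sqrt_weight_mul_le u₀ u₁ u₂ ht (.inr (.inl (.inr j)))
  rw [(S.sqrt_weight_omega j t).1] at h1
  rw [(S.sqrt_weight_omega j t).2] at h2
  exact ⟨h1, h2⟩

/-- The interpolation coefficient is at most the weight itself, written as a product of two square
roots: one goes into the energy, the other is bounded by the rate. This is why the sixth condition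
involves a square root. -/
theorem norm_n_mul_le {t : ℝ} (ht : t ∈ Icc 0 T) (k : Fin 2) :
    ‖S.n k t * firstFactor (S.mu (1 - k) t) (u₀ t) (u₁ t)‖
      ≤ 2 * S.rate t * √(S.energy u₀ u₁ u₂ t) := by
  rw [norm_mul]
  have h1 := S.sqrt_weight_mul_le u₀ u₁ u₂ ht (.inr (.inr k))
  have h2 := S.sqrt_weight_N_le ht k
  have h3 := S.norm_n_le ht k
  have hw := (S.weight_pos (.inr (.inr k)) ht).le
  simp only [term] at h1
  calc ‖S.n k t‖ * ‖firstFactor (S.mu (1 - k) t) (u₀ t) (u₁ t)‖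
      ≤ S.weight (.inr (.inr k)) t * ‖firstFactor (S.mu (1 - k) t) (u₀ t) (u₁ t)‖ :=
        mul_le_mul_of_nonneg_right h3 (norm_nonneg _)
    _ = √(S.weight (.inr (.inr k)) t) * (√(S.weight (.inr (.inr k)) t)
        * ‖firstFactor (S.mu (1 - k) t) (u₀ t) (u₁ t)‖) := by
        rw [← mul_assoc, Real.mul_self_sqrt hw]
    _ ≤ 2 * S.rate t * √(S.energy u₀ u₁ u₂ t) :=
        mul_le_mul h2 h1 (by positivity) (by linarith [(S.rate_bounds t).1])

end SymbolData

end EnergyEstimate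


/-! ### Derivatives of the terms of the energy, and the energy estimate -/

section EnergyEstimate

open Complex Filter

namespace SymbolData

variable {T : ℝ} (S : SymbolData T)

/-- The inhomogeneous term of the first order equation satisfied by `secondFactor`. -/
def source (f p u₀ u₁ u₂ : ℝ → ℂ) (j : Fin 3) (t : ℝ) : ℂ :=
  f t - p t * u₀ t + 2 * ∑ i, firstFactor (S.l i t) (u₀ t) (u₁ t)
    - ∑ i, (S.m i t * secondFactor (fun i => S.l i t) (fun i => S.l' i t) (u₀ t) (u₁ t) (u₂ t) i
      + 1 / 2 * S.m' i t * (firstFactor (S.l (i + 1) t) (u₀ t) (u₁ t)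
        + firstFactor (S.l (i + 2) t) (u₀ t) (u₁ t)))
    - (S.n 0 t * firstFactor (S.mu 1 t) (u₀ t) (u₁ t)
      + S.n 1 t * firstFactor (S.mu 0 t) (u₀ t) (u₁ t))
    + 1 / 2 * (I * S.l' j t - I * S.l' (j + 1) t) * firstFactor (S.l (j + 2) t) (u₀ t) (u₁ t)
    + 1 / 2 * (I * S.l' j t - I * S.l' (j + 2) t) * firstFactor (S.l (j + 1) t) (u₀ t) (u₁ t)
    + 1 / 6 * ((I * S.l'' j t - I * S.l'' (j + 1) t) + (I * S.l'' j t - I * S.l'' (j + 2) t))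
      * u₀ t

theorem hasDerivAt_secondFactor {f p u₀ u₁ u₂ : ℝ → ℂ} {t : ℝ} (ht : t ∈ Ioo 0 T)
    (h0 : HasDerivAt u₀ (u₁ t) t) (h1 : HasDerivAt u₁ (u₂ t) t)
    (h2 : HasDerivAt u₂ (S.rhs f p u₀ u₁ u₂ t) t) (j : Fin 3) :
    HasDerivAt (S.term u₀ u₁ u₂ (.inl (.inl j)))
      (I * S.l j t * S.term u₀ u₁ u₂ (.inl (.inl j)) t + S.source f p u₀ u₁ u₂ j t) t := by
  have htI := Ioo_subset_Icc_self ht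
  have hT : 0 < T := ht.1.trans ht.2
  have hl := fun i => (hasDerivAt_of_mem ht (S.hl i t htI)).ofReal_comp.const_mul I
  have hl' := fun i => (hasDerivAt_of_mem ht (S.hl' i t htI)).ofReal_comp.const_mul I
  obtain ⟨m₂, m₁, m₀⟩ := S.lagrange_m htI
  obtain ⟨m₂', m₁'⟩ := S.lagrange_m' hT htI
  obtain ⟨n₁, n₀⟩ := S.lagrange_n htI
  -- The identity is stated in the variables `d_j = iλ_j`, so a relation homogeneous of degree `k`
  -- in the roots is multiplied by `i^k`. This is the origin of `I * S.B₁`, `-S.B₀` and `I * S.C₀`.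
  have key := symmetrized_identity (fun i => I * S.l i t) (fun i => I * S.l' i t)
    (fun i => I * S.l'' i t) (fun i => S.m i t) (fun i => S.m' i t) (fun k => I * S.mu k t)
    (fun k => S.n k t) (u₀ := u₀ t) (u₁ := u₁ t) (u₂ := u₂ t) (u₃ := S.rhs f p u₀ u₁ u₂ t)
    (f := f t) (p := p t) (B₂ := S.B₂ t) (B₁ := I * S.B₁ t) (B₀ := -S.B₀ t) (C₁ := S.C₁ t)
    (C₀ := I * S.C₀ t) (B₂' := S.B₂' t) (B₁' := I * S.B₁' t) rfl m₂
    (by linear_combination I * m₁)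
    (by
      simp only [mul_mul_mul_comm I _ I, I_mul_I]
      linear_combination - m₀)
    m₂' (by linear_combination I * m₁') n₁ (by linear_combination I * n₀) j
  have hd := ((h2.sub (((hl (j + 1)).add (hl (j + 2))).mul h1)).add
    (((hl (j + 1)).mul (hl (j + 2))).mul h0)).sub
    ((((hl' (j + 1)).add (hl' (j + 2))).const_mul (1 / 2)).mul h0)
  have e : S.term u₀ u₁ u₂ (.inl (.inl j)) = fun t => u₂ t
      - (I * S.l (j + 1) t + I * S.l (j + 2) t) * u₁ t
      + (I * S.l (j + 1) t) * (I * S.l (j + 2) t) * u₀ t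
      - 1 / 2 * (I * S.l' (j + 1) t + I * S.l' (j + 2) t) * u₀ t := by
    funext s
    rw [term, secondFactor_eq]
  have e2 := congrFun e t
  rw [e2, e]
  refine HasDerivAt.congr_deriv hd ?_
  simp only [source, secondFactor_eq, firstFactor, Pi.add_apply, Pi.mul_apply]
  linear_combination key

/-- The contributions to the factor of `rate · √energy` are `P` from the term of order zero, `18`
from `∂_τ² L`, `12` from `M̌`, `4` from `Ň`, `3` from the differences of the `λ_j'` and `1` from
those of the `λ_j''`; they add up to less than `P + 40`. -/
theorem norm_source_le {f p u₀ u₁ u₂ : ℝ → ℂ} {t P F : ℝ} (ht : t ∈ Icc 0 T) (hp : ‖p t‖ ≤ P)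
    (hf : ‖f t‖ ≤ F) (j : Fin 3) :
    ‖S.source f p u₀ u₁ u₂ j t‖ ≤ (P + 40) * S.rate t * √(S.energy u₀ u₁ u₂ t) + F := by
  set e := √(S.energy u₀ u₁ u₂ t) with he
  set R := S.rate t with hR
  have he0 : 0 ≤ e := Real.sqrt_nonneg _
  have hR1 : 1 ≤ R := (S.rate_bounds t).1
  have hP : 0 ≤ P := (norm_nonneg _).trans hp
  have hRe : e ≤ R * e := le_mul_of_one_le_left he0 hR1
  have hu := fun j => S.norm_u₀_le u₀ u₁ u₂ ht j
  have hu0 : ‖u₀ t‖ ≤ e := by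
    refine le_trans ?_ (hu 0)
    exact le_mul_of_one_le_left (norm_nonneg _) (by linarith [abs_nonneg (S.l' 0 t - S.l' (0 + 1) t)])
  have t1 : ‖p t * u₀ t‖ ≤ P * (R * e) := by
    rw [norm_mul]
    exact mul_le_mul hp (hu0.trans hRe) (norm_nonneg _) hP
  have t2 : ‖2 * ∑ i, firstFactor (S.l i t) (u₀ t) (u₁ t)‖ ≤ 18 * (R * e) := by
    rw [norm_mul]
    have := norm_sum_le_of_le Finset.univ
      fun i (_ : i ∈ Finset.univ) => S.norm_firstFactor_le' u₀ u₁ u₂ ht i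
    simp at this ⊢
    linarith
  have t3 : ‖∑ i, (S.m i t * secondFactor (fun i => S.l i t) (fun i => S.l' i t) (u₀ t) (u₁ t)
      (u₂ t) i + 1 / 2 * S.m' i t * (firstFactor (S.l (i + 1) t) (u₀ t) (u₁ t)
        + firstFactor (S.l (i + 2) t) (u₀ t) (u₁ t)))‖ ≤ 12 * (R * e) := by
    have hi : ∀ i ∈ Finset.univ, ‖S.m i t * secondFactor (fun i => S.l i t) (fun i => S.l' i t)
        (u₀ t) (u₁ t) (u₂ t) i + 1 / 2 * S.m' i t * (firstFactor (S.l (i + 1) t) (u₀ t) (u₁ t)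
        + firstFactor (S.l (i + 2) t) (u₀ t) (u₁ t))‖ ≤ 4 * (R * e) := by
      intro i _
      refine (norm_add_le _ _).trans ?_
      have a1 : ‖S.m i t * secondFactor (fun i => S.l i t) (fun i => S.l' i t)
        (u₀ t) (u₁ t) (u₂ t) i‖ ≤ R * e := by
        rw [norm_mul]
        exact mul_le_mul (S.norm_m_le t i) (S.norm_secondFactor_le u₀ u₁ u₂ ht i) (norm_nonneg _)
          (by linarith)
      have a2 : ∀ k, S.omega i t * ‖firstFactor (S.l k t) (u₀ t) (u₁ t)‖ ≤ e →
          ‖S.m' i t‖ * ‖firstFactor (S.l k t) (u₀ t) (u₁ t)‖ ≤ 3 * (R * e) := by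
        intro k hk
        have b1 := mul_le_mul_of_nonneg_right (S.norm_m'_le ht i)
          (norm_nonneg (firstFactor (S.l k t) (u₀ t) (u₁ t)))
        have b2 := mul_le_mul_of_nonneg_left hk (by linarith : 0 ≤ 3 * R)
        linarith
      have a3 : ‖1 / 2 * S.m' i t * (firstFactor (S.l (i + 1) t) (u₀ t) (u₁ t)
        + firstFactor (S.l (i + 2) t) (u₀ t) (u₁ t))‖ ≤ 3 * (R * e) := by
        rw [norm_mul, norm_mul]
        have c1 := norm_add_le (firstFactor (S.l (i + 1) t) (u₀ t) (u₁ t))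
          (firstFactor (S.l (i + 2) t) (u₀ t) (u₁ t))
        have c2 := mul_le_mul_of_nonneg_left c1 (norm_nonneg (S.m' i t))
        have c3 := a2 _ (S.omega_mul_le u₀ u₁ u₂ ht i).1
        have c4 := a2 _ (S.omega_mul_le u₀ u₁ u₂ ht i).2
        norm_num
        linarith
      linarith
    have := norm_sum_le_of_le Finset.univ hi
    simp only [Finset.sum_const, Finset.card_univ, Fintype.card_fin, nsmul_eq_mul] at this
    push_cast at this
    linarith
  have t4 : ‖S.n 0 t * firstFactor (S.mu 1 t) (u₀ t) (u₁ t)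
      + S.n 1 t * firstFactor (S.mu 0 t) (u₀ t) (u₁ t)‖ ≤ 4 * (R * e) := by
    have h1 := S.norm_n_mul_le u₀ u₁ u₂ ht 0
    have h2 := S.norm_n_mul_le u₀ u₁ u₂ ht 1
    rw [show (1 : Fin 2) - 0 = 1 from rfl] at h1
    rw [show (1 : Fin 2) - 1 = 0 from rfl] at h2
    exact (norm_add_le _ _).trans (by linarith)
  have hI : ∀ a b : ℝ, ‖I * (a : ℂ) - I * b‖ = |a - b| := fun a b => by
    rw [← mul_sub, norm_mul, norm_I, one_mul, ← ofReal_sub, norm_real, Real.norm_eq_abs]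
  have e1 : j + 2 + 1 = j := by fin_cases j <;> rfl
  have e2 : j + 2 + 2 = j + 1 := by fin_cases j <;> rfl
  have t5 : ‖1 / 2 * (I * S.l' j t - I * S.l' (j + 1) t) * firstFactor (S.l (j + 2) t) (u₀ t)
      (u₁ t)‖ ≤ 3 / 2 * (R * e) := by
    have := S.sub_mul_firstFactor_le u₀ u₁ u₂ ht j
    rw [norm_mul, norm_mul, hI]
    norm_num
    linarith
  have t6 : ‖1 / 2 * (I * S.l' j t - I * S.l' (j + 2) t) * firstFactor (S.l (j + 1) t) (u₀ t)
      (u₁ t)‖ ≤ 3 / 2 * (R * e) := by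
    have := S.sub_mul_firstFactor_le u₀ u₁ u₂ ht (j + 2)
    rw [e1, e2, abs_sub_comm] at this
    rw [norm_mul, norm_mul, hI]
    norm_num
    linarith
  have h'' : ∀ j, |S.l'' j t - S.l'' (j + 1) t| * ‖u₀ t‖ ≤ R * e := by
    intro j
    have b1 := mul_le_mul_of_nonneg_right ((S.rate_bounds t).2.2.1 j) (norm_nonneg (u₀ t))
    have b2 := mul_le_mul_of_nonneg_left (hu j) (by linarith : 0 ≤ R)
    linarith
  have t7 : ‖1 / 6 * ((I * S.l'' j t - I * S.l'' (j + 1) t) + (I * S.l'' j t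
      - I * S.l'' (j + 2) t)) * u₀ t‖ ≤ R * e := by
    have b1 := h'' j
    have b2 := h'' (j + 2)
    rw [e1, abs_sub_comm] at b2
    have b3 := norm_add_le (I * (S.l'' j t : ℂ) - I * S.l'' (j + 1) t)
      (I * S.l'' j t - I * S.l'' (j + 2) t)
    rw [hI, hI] at b3
    have b4 := mul_le_mul_of_nonneg_right b3 (norm_nonneg (u₀ t))
    have b5 : 0 ≤ R * e := by positivity
    rw [norm_mul, norm_mul]
    norm_num
    linarith
  unfold source
  refine (norm_add_le _ _).trans ?_
  refine (add_le_add_left (norm_add_le _ _) _).trans ?_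
  refine (add_le_add_left (add_le_add_left (norm_add_le _ _) _) _).trans ?_
  refine (add_le_add_left (add_le_add_left (add_le_add_left (norm_sub_le _ _) _) _) _).trans ?_
  refine (add_le_add_left (add_le_add_left (add_le_add_left (add_le_add_left
    (norm_sub_le _ _) _) _) _) _).trans ?_
  refine (add_le_add_left (add_le_add_left (add_le_add_left (add_le_add_left (add_le_add_left
    (norm_add_le _ _) _) _) _) _) _).trans ?_
  refine (add_le_add_left (add_le_add_left (add_le_add_left (add_le_add_left (add_le_add_left
    (add_le_add_left (norm_sub_le _ _) _) _) _) _) _) _).trans ?_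
  have : 0 ≤ R * e := by positivity
  linarith

/-- Applying `∂ - iλ_{j+2}` to `u' - iλ_{j+1}u` gives the second order factor of index `j`, except
that the derivative falls on `λ_{j+1}` alone instead of on the mean of the two roots. -/
theorem hasDerivAt_firstFactor_fst {u₀ u₁ u₂ : ℝ → ℂ} {t : ℝ} (ht : t ∈ Ioo 0 T)
    (h0 : HasDerivAt u₀ (u₁ t) t) (h1 : HasDerivAt u₁ (u₂ t) t) (j : Fin 3) :
    HasDerivAt (S.term u₀ u₁ u₂ (.inr (.inl (.inl j))))
      (I * S.l (j + 2) t * S.term u₀ u₁ u₂ (.inr (.inl (.inl j))) t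
        + (S.term u₀ u₁ u₂ (.inl (.inl j)) t + I / 2 * (S.l' (j + 2) t - S.l' (j + 1) t) * u₀ t))
      t := by
  have h := hasDerivAt_firstFactor
    (hasDerivAt_of_mem ht (S.hl (j + 1) t (Ioo_subset_Icc_self ht))) h0 h1
  refine HasDerivAt.congr_deriv h ?_
  simp only [term, firstFactor, secondFactor]
  linear_combination (S.l (j + 2) t * S.l (j + 1) t * u₀ t : ℂ) * I_sq

theorem hasDerivAt_firstFactor_snd {u₀ u₁ u₂ : ℝ → ℂ} {t : ℝ} (ht : t ∈ Ioo 0 T)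
    (h0 : HasDerivAt u₀ (u₁ t) t) (h1 : HasDerivAt u₁ (u₂ t) t) (j : Fin 3) :
    HasDerivAt (S.term u₀ u₁ u₂ (.inr (.inl (.inr j))))
      (I * S.l (j + 1) t * S.term u₀ u₁ u₂ (.inr (.inl (.inr j))) t
        + (S.term u₀ u₁ u₂ (.inl (.inl j)) t + I / 2 * (S.l' (j + 1) t - S.l' (j + 2) t) * u₀ t))
      t := by
  have h := hasDerivAt_firstFactor
    (hasDerivAt_of_mem ht (S.hl (j + 2) t (Ioo_subset_Icc_self ht))) h0 h1
  refine HasDerivAt.congr_deriv h ?_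
  simp only [term, firstFactor, secondFactor]
  linear_combination (S.l (j + 2) t * S.l (j + 1) t * u₀ t : ℂ) * I_sq

/-- The derivative of `mu`. -/
def mu' (k : Fin 2) (t : ℝ) : ℝ :=
  (S.l' 0 t + S.l' 1 t + S.l' 2 t) / 3 + (![-1, 1] : Fin 2 → ℝ) k * S.delta' t / 2

theorem hasDerivAt_mu (k : Fin 2) {t : ℝ} (ht : t ∈ Ioo 0 T) :
    HasDerivAt (S.mu k) (S.mu' k t) t := by
  have htI := Ioo_subset_Icc_self ht
  have hl := fun i => hasDerivAt_of_mem ht (S.hl i t htI)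
  exact ((((hl 0).add (hl 1)).add (hl 2)).div_const 3).add
    (((hasDerivAt_of_mem ht (S.hasDerivWithinAt_delta htI)).const_mul _).div_const 2)

/-- Since `3(τ - μ₁)(τ - μ₂) = ∂_τ 𝓛` is the sum of the products `(τ - λ_k)(τ - λ_l)`, applying `∂ -
iμ_k` to the other first order factor gives a third of the sum of the second order factors, with an
error in `delta'` from the symmetrization. -/
theorem hasDerivAt_firstFactor_mu {u₀ u₁ u₂ : ℝ → ℂ} {t : ℝ} (ht : t ∈ Ioo 0 T)
    (h0 : HasDerivAt u₀ (u₁ t) t) (h1 : HasDerivAt u₁ (u₂ t) t) (k : Fin 2) :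
    HasDerivAt (S.term u₀ u₁ u₂ (.inr (.inr k)))
      (I * S.mu k t * S.term u₀ u₁ u₂ (.inr (.inr k)) t
        + (1 / 3 * ∑ j, S.term u₀ u₁ u₂ (.inl (.inl j)) t
          + I / 2 * ((![-1, 1] : Fin 2 → ℝ) k * S.delta' t : ℝ) * u₀ t)) t := by
  have h := hasDerivAt_firstFactor (S.hasDerivAt_mu (1 - k) ht) h0 h1
  refine HasDerivAt.congr_deriv h ?_
  have e0 : S.mu 0 t + S.mu 1 t = 2 / 3 * (S.l 0 t + S.l 1 t + S.l 2 t) := by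
    simp [mu]; ring
  have e1 : S.mu 0 t * S.mu 1 t
      = (S.l 0 t * S.l 1 t + S.l 0 t * S.l 2 t + S.l 1 t * S.l 2 t) / 3 := by
    have := S.sq_delta t
    simp only [Fin.sum_univ_three] at this
    simp [mu]
    have a1 : (1 : Fin 3) + 1 = 2 := rfl
    have a2 : (2 : Fin 3) + 1 = 0 := rfl
    rw [zero_add, a1, a2] at this
    linear_combination (-1 / 4) * this
  have e0' : (S.mu 0 t : ℂ) + S.mu 1 t = 2 / 3 * (S.l 0 t + S.l 1 t + S.l 2 t) := by
    have := congrArg (fun x : ℝ => (x : ℂ)) e0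
    push_cast at this
    exact this
  have e1' : (S.mu 0 t : ℂ) * S.mu 1 t
      = (S.l 0 t * S.l 1 t + S.l 0 t * S.l 2 t + S.l 1 t * S.l 2 t) / 3 := by
    have := congrArg (fun x : ℝ => (x : ℂ)) e1
    push_cast at this
    exact this
  have a1 : (1 : Fin 3) + 1 = 2 := rfl
  have a2 : (1 : Fin 3) + 2 = 0 := rfl
  have a3 : (2 : Fin 3) + 1 = 0 := rfl
  have a4 : (2 : Fin 3) + 2 = 1 := rfl
  have b1 : (1 : Fin 2) - 1 = 0 := rfl
  fin_cases k <;>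
    simp only [term, firstFactor, secondFactor, mu', Fin.sum_univ_three, zero_add, a1, a2, a3, a4,
      b1, Fin.zero_eta, Fin.mk_one, sub_zero, Matrix.cons_val_zero, Matrix.cons_val_one,
      ofReal_add, ofReal_mul, ofReal_div, ofReal_neg, ofReal_one, ofReal_ofNat, Fin.isValue] <;>
    linear_combination (S.mu 0 t * S.mu 1 t * u₀ t : ℂ) * I_sq - I * u₁ t * e0' - u₀ t * e1'

/-- The energy estimate for one frequency. -/
theorem energy_le (hT : 0 < T) {f p u₀ u₁ u₂ : ℝ → ℂ} {P F : ℝ} (hP : 0 ≤ P) (hF : 0 ≤ F)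
    (hrate : IntervalIntegrable S.rate volume 0 T)
    (h0 : ∀ t ∈ Icc 0 T, HasDerivWithinAt u₀ (u₁ t) (Icc 0 T) t)
    (h1 : ∀ t ∈ Icc 0 T, HasDerivWithinAt u₁ (u₂ t) (Icc 0 T) t)
    (h2 : AbsolutelyContinuousOnInterval u₂ 0 T) (hp : ∀ᵐ t, t ∈ Ioo 0 T → ‖p t‖ ≤ P)
    (hf : ∀ t ∈ Icc 0 T, ‖f t‖ ≤ F)
    (heq : ∀ᵐ t, t ∈ Ioo 0 T → HasDerivAt u₂ (S.rhs f p u₀ u₁ u₂ t) t) {t : ℝ}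
    (ht : t ∈ Icc 0 T) :
    S.energy u₀ u₁ u₂ t ≤
      Real.exp (29 * ((P + 40) * ∫ s in (0 : ℝ)..T, S.rate s) + 14 * T)
        * (S.energy u₀ u₁ u₂ 0 + 14 * T * F ^ 2) := by
  have hu₁ : ContinuousOn u₁ (Icc 0 T) := fun s hs => (h1 s hs).continuousWithinAt
  have hu₂ : ContinuousOn u₂ (Icc 0 T) := by
    have := h2.continuousOn
    rwa [uIcc_of_le hT.le] at this
  have ac0 := absolutelyContinuousOnInterval_of_hasDerivWithinAt hT.le h0 hu₁
  have ac1 := absolutelyContinuousOnInterval_of_hasDerivWithinAt hT.le h1 hu₂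
  -- The energy has `3 + 3 + 3 + 3 + 2` terms; `29 = 2 · 14 + 1` is the constant of
  -- `energy_gronwall`.
  have hcard : (Fintype.card Index : ℝ) = 14 := by
    simp [Index]
  have main := energy_gronwall (ι := Index) hT.le (w := S.weight) (z := S.term u₀ u₁ u₂)
    (ρ := fun s => (P + 40) * S.rate s) (F := F) (S.weight_ac hT.le) (S.term_ac hT.le ac0 ac1 h2)
    (fun i s hs => (S.weight_pos i hs).le) (hrate.const_mul _)
    (fun s _ => mul_nonneg (by linarith) (by linarith [(S.rate_bounds s).1])) ?_ ht
  · rw [intervalIntegral.integral_const_mul, hcard] at main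
    rw [show (2 * 14 + 1 : ℝ) = 29 by norm_num] at main
    exact main
  · filter_upwards [hp, heq, S.ae_weightDiff hT.le] with s hps heqs hws hs i
    have hsI := Ioo_subset_Icc_self hs
    have d0 := hasDerivAt_of_mem hs (h0 s hsI)
    have d1 := hasDerivAt_of_mem hs (h1 s hsI)
    obtain ⟨w', hw', hwb⟩ := S.logDerivBound_weight hs (hws hs) i
    have hR1 := (S.rate_bounds s).1
    have hwp := S.weight_pos i hsI
    have hwb' : |w'| ≤ (P + 40) * S.rate s * S.weight i s := by
      refine hwb.trans (mul_le_mul_of_nonneg_right ?_ hwp.le)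
      exact mul_le_mul_of_nonneg_right (by linarith) (by linarith)
    set e := √(∑ j, S.weight j s * ‖S.term u₀ u₁ u₂ j s‖ ^ 2) with he
    have he0 : 0 ≤ e := Real.sqrt_nonneg _
    -- The constant `P + 40` is dictated by the second order factors; all the other terms of the
    -- energy need at most `6`.
    have fin : ∀ x, x ≤ 6 * S.rate s * e → x ≤ (P + 40) * S.rate s * e + F := by
      intro x hx
      have h3 : 0 ≤ S.rate s * e := by positivity
      have h4 : 0 ≤ P * (S.rate s * e) := mul_nonneg hP h3
      linarith
    have hu : ∀ j, (|S.l' j s - S.l' (j + 1) s| + 1) * ‖u₀ s‖ ≤ e :=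
      fun j => S.norm_u₀_le u₀ u₁ u₂ hsI j
    have hv : ∀ j, ‖S.term u₀ u₁ u₂ (.inl (.inl j)) s‖ ≤ e :=
      fun j => S.norm_secondFactor_le u₀ u₁ u₂ hsI j
    have hg : ∀ j, ∀ a : ℝ, |a| = |S.l' (j + 1) s - S.l' (j + 2) s| →
        ‖S.term u₀ u₁ u₂ (.inl (.inl j)) s + I / 2 * a * u₀ s‖ ≤ 2 * e := by
      intro j a ha
      have e1 : j + 1 + 1 = j + 2 := by fin_cases j <;> rfl
      have b1 := hu (j + 1)
      rw [e1] at b1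
      refine (norm_add_le _ _).trans ?_
      have b2 : ‖I / 2 * a * u₀ s‖ ≤ e := by
        rw [norm_mul, norm_mul, norm_div, norm_I, norm_real, Real.norm_eq_abs, ha]
        refine le_trans ?_ b1
        refine mul_le_mul_of_nonneg_right ?_ (norm_nonneg _)
        have := abs_nonneg (S.l' (j + 1) s - S.l' (j + 2) s)
        norm_num
        linarith
      linarith [hv j]
    rcases i with (j | j) | (j | j) | k
    · refine ⟨w', S.l j s, _, hw', S.hasDerivAt_secondFactor hs d0 d1 (heqs hs) j, hwb', ?_⟩
      simp only [weight, Real.sqrt_one, one_mul]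
      exact S.norm_source_le hsI (hps hs) (hf s hsI) j
    -- The choice `θ = λ_{j+2}` pairs the weight, which contains `|λ_j' - λ_{j+1}'|`, with the first
    -- order factor that `sub_mul_firstFactor_le` controls.
    · refine ⟨w', S.l (j + 2) s, firstFactor (S.l (j + 2) s) (u₀ s) (u₁ s), hw', ?_, hwb', ?_⟩
      · refine HasDerivAt.congr_deriv d0 ?_
        simp only [term, firstFactor]
        ring
      · simp only [weight]
        rw [Real.sqrt_mul_self (by positivity)]
        apply fin
        have b1 := S.sub_mul_firstFactor_le u₀ u₁ u₂ hsI j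
        have b2 := S.norm_firstFactor_le' u₀ u₁ u₂ hsI (j + 2)
        change _ ≤ 3 * S.rate s * e at b1
        change _ ≤ 3 * e at b2
        have b3 : e ≤ S.rate s * e := le_mul_of_one_le_left he0 hR1
        rw [Real.norm_eq_abs]
        linarith
    · refine ⟨w', S.l (j + 2) s, _, hw', S.hasDerivAt_firstFactor_fst hs d0 d1 j, hwb', ?_⟩
      rw [(S.sqrt_weight_omega j s).1]
      apply fin
      rw [← ofReal_sub]
      have b1 := mul_le_mul (S.omega_le hsI j) (hg j _ (abs_sub_comm _ _)) (norm_nonneg _)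
        (by linarith)
      have b2 : 0 ≤ S.rate s * e := by positivity
      linarith
    · refine ⟨w', S.l (j + 1) s, _, hw', S.hasDerivAt_firstFactor_snd hs d0 d1 j, hwb', ?_⟩
      rw [(S.sqrt_weight_omega j s).2]
      apply fin
      rw [← ofReal_sub]
      have b1 := mul_le_mul (S.omega_le hsI j) (hg j _ rfl) (norm_nonneg _) (by linarith)
      have b2 : 0 ≤ S.rate s * e := by positivity
      linarith
    · refine ⟨w', S.mu k s, _, hw', S.hasDerivAt_firstFactor_mu hs d0 d1 k, hwb', ?_⟩
      apply fin
      have b0 : ‖1 / 3 * ∑ j, S.term u₀ u₁ u₂ (.inl (.inl j)) s‖ ≤ e := by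
        have := norm_sum_le_of_le Finset.univ fun j (_ : j ∈ Finset.univ) => hv j
        rw [norm_mul]
        simp at this ⊢
        linarith
      have b1 : ‖I / 2 * ((![-1, 1] : Fin 2 → ℝ) k * S.delta' s : ℝ) * u₀ s‖ ≤ e := by
        have c1 : |(![-1, 1] : Fin 2 → ℝ) k * S.delta' s| = |S.delta' s| := by
          rw [abs_mul]
          fin_cases k <;> simp
        rw [norm_mul, norm_mul, norm_div, norm_I, norm_real, Real.norm_eq_abs, c1]
        have c2 := S.abs_delta'_le hsI
        rw [Fin.sum_univ_three] at c2
        have c3 := mul_le_mul_of_nonneg_right c2 (norm_nonneg (u₀ s))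
        have := hu 0
        have := hu 1
        have := hu 2
        have := norm_nonneg (u₀ s)
        norm_num
        linarith
      have b2 := (norm_add_le _ _).trans (add_le_add b0 b1)
      have b3 := mul_le_mul (S.sqrt_weight_N_le hsI k) b2 (norm_nonneg _) (by linarith)
      have b4 : 0 ≤ S.rate s * e := by positivity
      linarith

end SymbolData

end EnergyEstimate


/-! ### Volterra operators -/

section Volterra

open Filter Topology

/-- An essentially bounded function on `[0,T]`. -/
structure EssBounded (T : ℝ) (c : ℝ → ℂ) : Prop where
  meas : AEStronglyMeasurable c (volume.restrict (Icc 0 T))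
  bdd : ∃ K : ℝ, 0 ≤ K ∧ ∀ᵐ s ∂(volume.restrict (Icc 0 T)), ‖c s‖ ≤ K

theorem EssBounded.of_memLp {T : ℝ} {c : ℝ → ℂ} (h : MemLp c ⊤ (volume.restrict (Icc 0 T))) :
    EssBounded T c := by
  refine ⟨h.1, (eLpNorm c ⊤ (volume.restrict (Icc 0 T))).toReal, ENNReal.toReal_nonneg, ?_⟩
  rw [eLpNorm_exponent_top]
  have hfin : eLpNormEssSup c (volume.restrict (Icc 0 T)) ≠ ⊤ := by
    rw [← eLpNorm_exponent_top]; exact h.2.ne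
  filter_upwards [ae_le_eLpNormEssSup (f := c) (μ := volume.restrict (Icc 0 T))] with s hs
  rw [← toReal_enorm]
  exact ENNReal.toReal_mono hfin hs

theorem EssBounded.of_continuousOn {T : ℝ} {c : ℝ → ℂ} (h : ContinuousOn c (Icc 0 T)) :
    EssBounded T c := by
  obtain ⟨K, hK⟩ := isCompact_Icc.exists_bound_of_continuousOn h
  refine ⟨h.aestronglyMeasurable measurableSet_Icc, max K 0, le_max_right _ _, ?_⟩
  exact (ae_restrict_iff' measurableSet_Icc).2 (Eventually.of_forall fun s hs =>
    (hK s hs).trans (le_max_left _ _))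

theorem EssBounded.intervalIntegrable {T : ℝ} (hT : 0 ≤ T) {c : ℝ → ℂ} (h : EssBounded T c) :
    IntervalIntegrable c volume 0 T := by
  obtain ⟨K, hK0, hK⟩ := h.bdd
  rw [intervalIntegrable_iff_integrableOn_Icc_of_le hT]
  exact Integrable.of_bound h.meas K hK

variable {T : ℝ} (hT : 0 ≤ T)

/-- The extension of a continuous function on `[0,T]` to the real line. -/
def extend (g : C(Icc (0 : ℝ) T, ℂ)) (s : ℝ) : ℂ := g (projIcc 0 T hT s)

theorem continuous_extend (g : C(Icc (0 : ℝ) T, ℂ)) : Continuous (extend hT g) :=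
  g.continuous.comp continuous_projIcc

theorem extend_of_mem (g : C(Icc (0 : ℝ) T, ℂ)) {s : ℝ} (hs : s ∈ Icc 0 T) :
    extend hT g s = g ⟨s, hs⟩ := by
  rw [extend, projIcc_of_mem]

theorem intervalIntegrable_mul_extend {c : ℝ → ℂ} (hc : EssBounded T c)
    (g : C(Icc (0 : ℝ) T, ℂ)) : IntervalIntegrable (fun s => c s * extend hT g s) volume 0 T :=
  (hc.intervalIntegrable hT).mul_continuousOn (continuous_extend hT g).continuousOn

theorem intervalIntegrable_left {F : Type*} [NormedAddCommGroup F] {f : ℝ → F}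
    (hf : IntervalIntegrable f volume 0 T) {t : ℝ} (ht : t ∈ Icc 0 T) :
    IntervalIntegrable f volume 0 t :=
  hf.mono_set (by
    rw [uIcc_of_le ht.1, uIcc_of_le (ht.1.trans ht.2)]; exact Icc_subset_Icc_right ht.2)

theorem norm_integral_mul_extend_le {c : ℝ → ℂ} {K : ℝ} (hK0 : 0 ≤ K)
    (hK : ∀ᵐ s ∂(volume.restrict (Icc 0 T)), ‖c s‖ ≤ K) {g : C(Icc (0 : ℝ) T, ℂ)} {φ : ℝ → ℝ}
    (hφ : ContinuousOn φ (Icc 0 T)) (hg : ∀ s, ‖g s‖ ≤ φ s) {t : ℝ} (ht : t ∈ Icc 0 T) :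
    ‖∫ s in (0 : ℝ)..t, c s * extend hT g s‖ ≤ K * ∫ s in (0 : ℝ)..t, φ s := by
  rw [← intervalIntegral.integral_const_mul]
  have hφt : ContinuousOn φ (uIcc 0 t) :=
    hφ.mono (by rw [uIcc_of_le ht.1]; exact Icc_subset_Icc_right ht.2)
  refine intervalIntegral.norm_integral_le_of_norm_le ht.1 ?_ (hφt.intervalIntegrable.const_mul K)
  filter_upwards [(ae_restrict_iff' measurableSet_Icc).1 hK] with s hs hst
  have hsI : s ∈ Icc 0 T := ⟨hst.1.le, hst.2.trans ht.2⟩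
  rw [norm_mul, extend_of_mem hT g hsI]
  exact mul_le_mul (hs hsI) (hg ⟨s, hsI⟩) (norm_nonneg _) hK0

/-- The function `t ↦ ∫₀ᵗ c g`. -/
def volterraFun (c : ℝ → ℂ) (hc : EssBounded T c) (g : C(Icc (0 : ℝ) T, ℂ)) :
    C(Icc (0 : ℝ) T, ℂ) where
  toFun t := ∫ s in (0 : ℝ)..t, c s * extend hT g s
  continuous_toFun := by
    have h := intervalIntegral.continuousOn_primitive_interval'
      (intervalIntegrable_mul_extend hT hc g) (left_mem_uIcc)
    rw [uIcc_of_le hT] at h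
    exact h.comp_continuous continuous_subtype_val fun t => t.2

theorem volterraFun_apply (c : ℝ → ℂ) (hc : EssBounded T c) (g : C(Icc (0 : ℝ) T, ℂ))
    (t : Icc (0 : ℝ) T) : volterraFun hT c hc g t = ∫ s in (0 : ℝ)..t, c s * extend hT g s := rfl

/-- The operator `g ↦ ∫₀ᵗ c g`. -/
def volterra (c : ℝ → ℂ) (hc : EssBounded T c) :
    C(Icc (0 : ℝ) T, ℂ) →L[ℂ] C(Icc (0 : ℝ) T, ℂ) :=
  LinearMap.mkContinuousOfExistsBound
    { toFun := volterraFun hT c hc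
      map_add' := fun g h => by
        ext t
        rw [ContinuousMap.add_apply]
        simp only [volterraFun_apply]
        rw [← intervalIntegral.integral_add
          (intervalIntegrable_left (intervalIntegrable_mul_extend hT hc g) t.2)
          (intervalIntegrable_left (intervalIntegrable_mul_extend hT hc h) t.2)]
        simp [extend, mul_add]
      map_smul' := fun r g => by
        ext t
        rw [RingHom.id_apply, ContinuousMap.smul_apply, smul_eq_mul]
        simp only [volterraFun_apply]
        rw [← intervalIntegral.integral_const_mul]
        simp [extend, mul_left_comm] }
    (by
      obtain ⟨K, hK0, hK⟩ := hc.bdd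
      refine ⟨K * T, fun g => ?_⟩
      refine (ContinuousMap.norm_le _ (by positivity)).2 fun t => ?_
      refine (norm_integral_mul_extend_le hT hK0 hK (φ := fun _ => ‖g‖) continuousOn_const
        (fun s => g.norm_coe_le_norm s) t.2).trans ?_
      rw [intervalIntegral.integral_const, smul_eq_mul, sub_zero, mul_assoc]
      exact mul_le_mul_of_nonneg_left (mul_le_mul_of_nonneg_right t.2.2 (norm_nonneg g)) hK0)

theorem volterra_apply {c : ℝ → ℂ} (hc : EssBounded T c) (g : C(Icc (0 : ℝ) T, ℂ))
    (t : Icc (0 : ℝ) T) : volterra hT c hc g t = ∫ s in (0 : ℝ)..t, c s * extend hT g s := rfl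

theorem essBounded_one : EssBounded T (fun _ => 1) := EssBounded.of_continuousOn continuousOn_const

/-- The operator `g ↦ ∫₀ᵗ g`. -/
def primitive : C(Icc (0 : ℝ) T, ℂ) →L[ℂ] C(Icc (0 : ℝ) T, ℂ) :=
  volterra hT (fun _ => 1) essBounded_one

theorem primitive_apply (g : C(Icc (0 : ℝ) T, ℂ)) (t : Icc (0 : ℝ) T) :
    primitive hT g t = ∫ s in (0 : ℝ)..t, extend hT g s := by
  simp [primitive, volterra_apply]

/-- The space of the triples `(u, ∂_t u, ∂_t² u)`. -/
abbrev Sol (T : ℝ) : Type := Fin 3 → C(Icc (0 : ℝ) T, ℂ)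

/-- `W` is dominated by an integration in time. -/
def IsVolterra (K : ℝ) (W : Sol T →L[ℂ] Sol T) : Prop :=
  ∀ (y : Sol T) (φ : ℝ → ℝ), ContinuousOn φ (Icc 0 T) → (∀ j s, ‖y j s‖ ≤ φ s) →
    ∀ j t, ‖W y j t‖ ≤ K * ∫ s in (0 : ℝ)..t, φ s

-- Iterating the domination from the constant `‖y‖` produces the iterated integrals `(Kt)^n/n!`.
include hT in
theorem IsVolterra.norm_pow_le {K : ℝ} (hK : 0 ≤ K) {W : Sol T →L[ℂ] Sol T} (hW : IsVolterra K W)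
    (n : ℕ) : ‖W ^ n‖ ≤ (K * T) ^ n / n.factorial := by
  have key : ∀ (y : Sol T) (j : Fin 3) (t : Icc (0 : ℝ) T),
      ‖(W ^ n) y j t‖ ≤ (K * t) ^ n / n.factorial * ‖y‖ := by
    intro y
    induction n with
    | zero =>
      intro j t
      simpa using ((y j).norm_coe_le_norm t).trans (norm_le_pi_norm y j)
    | succ n ih =>
      intro j t
      rw [pow_succ', mul_apply_eq_comp]
      refine (hW _ (fun s => (K * s) ^ n / n.factorial * ‖y‖) (by fun_prop) ih j t).trans ?_
      rw [intervalIntegral.integral_mul_const, intervalIntegral.integral_div]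
      simp only [mul_pow]
      rw [intervalIntegral.integral_const_mul, integral_pow]
      apply le_of_eq
      rw [Nat.factorial_succ]
      push_cast
      field_simp
      ring
  refine ContinuousLinearMap.opNorm_le_bound _ (by positivity) fun y => ?_
  refine (pi_norm_le_iff_of_nonneg (by positivity)).2 fun j => ?_
  refine (ContinuousMap.norm_le _ (by positivity)).2 fun t => (key y j t).trans ?_
  have h1 : K * (t : ℝ) ≤ K * T := mul_le_mul_of_nonneg_left t.2.2 hK
  have h0 : 0 ≤ K * (t : ℝ) := mul_nonneg hK t.2.1
  gcongr

/-- The element `1 - w` is a factor of `1 - w^n`, and it commutes with the cofactor, a geometric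
sum. -/
theorem isUnit_one_sub_of_pow {R : Type*} [Ring R] {w : R} {n : ℕ} (h : IsUnit (1 - w ^ n)) :
    IsUnit (1 - w) := by
  rw [← mul_neg_geom_sum] at h
  have hcomm : Commute (1 - w) (∑ i ∈ Finset.range n, w ^ i) := by
    rw [Commute, SemiconjBy, mul_neg_geom_sum, geom_sum_mul_neg]
  exact (hcomm.isUnit_mul_iff.1 h).1

-- No smallness of `W` is needed: some power of it has norm less than one, because factorials win
-- over powers.
include hT in
theorem IsVolterra.isUnit {K : ℝ} (hK : 0 ≤ K) {W : Sol T →L[ℂ] Sol T} (hW : IsVolterra K W) :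
    IsUnit (1 - W) := by
  have h := FloorSemiring.tendsto_pow_div_factorial_atTop (K * T)
  obtain ⟨n, hn⟩ := (h.eventually (gt_mem_nhds one_pos)).exists
  exact isUnit_one_sub_of_pow <|
    isUnit_one_sub_of_norm_lt_one (R := Sol T →L[ℂ] Sol T) ((hW.norm_pow_le hT hK n).trans_lt hn)

/-- A Gronwall inequality in integral form. -/
theorem le_of_integral_ineq {φ : ℝ → ℝ} {c b : ℝ} (hT : 0 ≤ T) (hb : 0 < b) (hc : 0 ≤ c)
    (hφ : ContinuousOn φ (Icc 0 T)) (hφ0 : ∀ t ∈ Icc 0 T, 0 ≤ φ t)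
    (h : ∀ t ∈ Icc 0 T, φ t ≤ c + b * ∫ s in (0 : ℝ)..t, φ s) {t : ℝ} (ht : t ∈ Icc 0 T) :
    φ t ≤ 2 * c * Real.exp (2 * b * T) := by
  -- The maximum of `φ(t) exp(-2bt)` is examined. With the exponent `2b` the integral term
  -- contributes at most half of the left side at the maximum, and can be absorbed.
  have hψ : ContinuousOn (fun t => φ t * Real.exp (-(2 * b * t))) (Icc 0 T) := by fun_prop
  obtain ⟨r, hr, hmax⟩ := isCompact_Icc.exists_isMaxOn ⟨0, left_mem_Icc.2 hT⟩ hψ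
  set M := φ r * Real.exp (-(2 * b * r)) with hM
  have hM0 : 0 ≤ M := mul_nonneg (hφ0 r hr) (Real.exp_pos _).le
  have hle : ∀ s ∈ Icc 0 T, φ s ≤ M * Real.exp (2 * b * s) := by
    intro s hs
    have h1 : φ s * Real.exp (-(2 * b * s)) ≤ M := hmax hs
    calc φ s = φ s * Real.exp (-(2 * b * s)) * Real.exp (2 * b * s) := by
          rw [mul_assoc, ← Real.exp_add]; simp
      _ ≤ _ := mul_le_mul_of_nonneg_right h1 (Real.exp_pos _).le
  have hint : ∫ s in (0 : ℝ)..r, φ s ≤ M * ((Real.exp (2 * b * r) - 1) / (2 * b)) := by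
    have h2 : ∫ s in (0 : ℝ)..r, M * Real.exp (2 * b * s)
        = M * ((Real.exp (2 * b * r) - 1) / (2 * b)) := by
      rw [intervalIntegral.integral_const_mul, intervalIntegral.integral_comp_mul_left
        (fun x => Real.exp x) (by positivity), integral_exp]
      rw [mul_zero, Real.exp_zero, smul_eq_mul]
      ring
    rw [← h2]
    refine intervalIntegral.integral_mono_on hr.1 ?_ ?_ fun s hs => hle s ⟨hs.1, hs.2.trans hr.2⟩
    · refine (hφ.mono ?_).intervalIntegrable
      rw [uIcc_of_le hr.1]; exact Icc_subset_Icc_right hr.2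
    · exact Continuous.intervalIntegrable (by fun_prop) _ _
  have hMr : φ r = M * Real.exp (2 * b * r) := by
    rw [hM, mul_assoc, ← Real.exp_add]; simp
  have h3 := h r hr
  have h4 := mul_le_mul_of_nonneg_left hint hb.le
  have h5 : b * (M * ((Real.exp (2 * b * r) - 1) / (2 * b)))
      = M * (Real.exp (2 * b * r) - 1) / 2 := by field_simp
  have h6 : 1 ≤ Real.exp (2 * b * r) := Real.one_le_exp (by have := hr.1; positivity)
  have hM2 : M ≤ 2 * c := by nlinarith
  refine (hle t ht).trans ?_
  have h7 : Real.exp (2 * b * t) ≤ Real.exp (2 * b * T) :=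
    Real.exp_le_exp.2 (mul_le_mul_of_nonneg_left ht.2 (by positivity))
  exact mul_le_mul hM2 h7 (Real.exp_pos _).le (by positivity)

end Volterra


/-! ### Multi-index derivatives of vector valued functions -/

section MultiDeriv

variable {d : ℕ} {F G : Type*} [NormedAddCommGroup F] [NormedSpace ℝ F]
  [NormedAddCommGroup G] [NormedSpace ℝ G]

/-- The partial derivative `∂_{x_i}` of a vector valued function. -/
def partialD (i : Fin d) (g : Space d → F) (x : Space d) : F :=
  fderiv ℝ g x (EuclideanSpace.single i 1)

/-- The derivative `∂_x^α` of a vector valued function. -/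
def mDeriv (α : Fin d → ℕ) (g : Space d → F) : Space d → F :=
  (List.finRange d).foldr (fun i h => (partialD i)^[α i] h) g

/-- The induction over coordinates and orders is done once, for a relation between two functions,
possibly with different target spaces; smoothness, locality and commutation with linear maps are
instances. -/
theorem mDeriv_rel (Rel : (Space d → F) → (Space d → G) → Prop)
    (step : ∀ i g h, Rel g h → Rel (partialD i g) (partialD i h)) (α : Fin d → ℕ)
    {g : Space d → F} {h : Space d → G} (hgh : Rel g h) : Rel (mDeriv α g) (mDeriv α h) := by
  unfold mDeriv
  induction List.finRange d with
  | nil => exact hgh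
  | cons i l ih =>
    simp only [List.foldr_cons]
    induction α i with
    | zero => exact ih
    | succ n ihn =>
      rw [Function.iterate_succ_apply', Function.iterate_succ_apply']
      exact step _ _ _ ihn

theorem contDiff_partialD {g : Space d → F} (hg : ContDiff ℝ ∞ g) (i : Fin d) :
    ContDiff ℝ ∞ (partialD i g) :=
  (hg.fderiv_right (m := ∞) (by simp)).clm_apply contDiff_const

theorem contDiff_mDeriv {g : Space d → F} (hg : ContDiff ℝ ∞ g) (α : Fin d → ℕ) :
    ContDiff ℝ ∞ (mDeriv α g) :=
  mDeriv_rel (fun g _ => ContDiff ℝ ∞ g) (fun i _ _ h => contDiff_partialD h i) α (h := g) hg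

theorem mDeriv_clm (L : F →L[ℝ] G) {g : Space d → F} (hg : ContDiff ℝ ∞ g) (α : Fin d → ℕ) :
    mDeriv α (fun x => L (g x)) = fun x => L (mDeriv α g x) := by
  refine (mDeriv_rel (fun g h => ContDiff ℝ ∞ g ∧ h = fun x => L (g x)) ?_ α
    (g := g) ⟨hg, rfl⟩).2
  rintro i g h ⟨hg, rfl⟩
  refine ⟨contDiff_partialD hg i, funext fun x => ?_⟩
  have h1 : HasFDerivAt (fun x => L (g x)) (L.comp (fderiv ℝ g x)) x :=
    L.hasFDerivAt.comp x ((hg.differentiable (by simp)) x).hasFDerivAt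
  simp [partialD, h1.fderiv]

theorem mDeriv_eqOn {s : Set (Space d)} (hs : IsOpen s) {g h : Space d → F} (hgh : EqOn g h s)
    (α : Fin d → ℕ) : EqOn (mDeriv α g) (mDeriv α h) s := by
  refine mDeriv_rel (fun g h => EqOn g h s) (fun i g h hgh x hx => ?_) α hgh
  have h1 : g =ᶠ[nhds x] h := Filter.eventuallyEq_of_mem (hs.mem_nhds hx) hgh
  rw [partialD, partialD, h1.fderiv_eq]

theorem mDeriv_zero_fun (α : Fin d → ℕ) : mDeriv α (fun _ => (0 : F)) = fun _ => 0 := by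
  have h := mDeriv_clm (0 : F →L[ℝ] F) (g := fun _ : Space d => (0 : F)) contDiff_const α
  simpa using h

theorem hasCompactSupport_mDeriv {g : Space d → F} (hg : HasCompactSupport g) (α : Fin d → ℕ) :
    HasCompactSupport (mDeriv α g) := by
  refine HasCompactSupport.intro hg fun x hx => ?_
  have h : EqOn g (fun _ => 0) (tsupport g)ᶜ := fun y hy => image_eq_zero_of_notMem_tsupport hy
  have := mDeriv_eqOn (isClosed_tsupport g).isOpen_compl h α hx
  rwa [mDeriv_zero_fun] at this

end MultiDeriv

/-! ### Fourier transform of functions with rapid decay -/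

section RapidDecay

open FourierTransform

variable {d : ℕ} {F G : Type*} [NormedAddCommGroup F] [NormedSpace ℂ F]
  [NormedAddCommGroup G] [NormedSpace ℂ G]

section Decay

variable {F G : Type*} [NormedAddCommGroup F] [NormedAddCommGroup G]

/-- A continuous function that decays faster than any polynomial. -/
structure RapidDecay (h : Space d → F) : Prop where
  cont : Continuous h
  decay : ∀ N : ℕ, ∃ C : ℝ, ∀ ξ, (1 + ‖ξ‖) ^ N * ‖h ξ‖ ≤ C

theorem RapidDecay.of_le {h : Space d → F} (hh : RapidDecay h) {g : Space d → G}
    (hg : Continuous g) {C : ℝ} (hC : 0 ≤ C) {K : ℕ} (hle : ∀ ξ, ‖g ξ‖ ≤ C * (1 + ‖ξ‖) ^ K * ‖h ξ‖) :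
    RapidDecay g := by
  refine ⟨hg, fun N => ?_⟩
  obtain ⟨B, hB⟩ := hh.decay (N + K)
  refine ⟨C * B, fun ξ => ?_⟩
  calc (1 + ‖ξ‖) ^ N * ‖g ξ‖ ≤ (1 + ‖ξ‖) ^ N * (C * (1 + ‖ξ‖) ^ K * ‖h ξ‖) := by
        gcongr; exact hle ξ
    _ = C * ((1 + ‖ξ‖) ^ (N + K) * ‖h ξ‖) := by ring
    _ ≤ C * B := mul_le_mul_of_nonneg_left (hB ξ) hC

theorem integrable_one_add_norm_pow (d : ℕ) :
    Integrable (fun ξ : Space d => ((1 + ‖ξ‖) ^ (d + 1))⁻¹) := by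
  have h := integrable_one_add_norm (E := Space d) (μ := volume) (r := (d + 1 : ℕ)) (by simp)
  refine h.congr (Filter.Eventually.of_forall fun ξ => ?_)
  simp only
  rw [Real.rpow_neg (by positivity), Real.rpow_natCast]

theorem RapidDecay.integrable_pow {h : Space d → F} (hh : RapidDecay h) (n : ℕ) :
    Integrable (fun ξ => ‖ξ‖ ^ n * ‖h ξ‖) := by
  -- The `d + 1` additional powers make the remaining weight integrable in dimension `d`.
  obtain ⟨C, hC⟩ := hh.decay (n + (d + 1))
  refine ((integrable_one_add_norm_pow d).const_mul C).mono' ?_ ?_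
  · exact (Continuous.aestronglyMeasurable
      ((continuous_norm.pow n).mul hh.cont.norm))
  · refine Filter.Eventually.of_forall fun ξ => ?_
    rw [Real.norm_of_nonneg (by positivity), ← div_eq_mul_inv, le_div_iff₀ (by positivity)]
    refine le_trans ?_ (hC ξ)
    rw [pow_add (1 + ‖ξ‖) n (d + 1), mul_right_comm]
    gcongr
    linarith

theorem RapidDecay.integrable {h : Space d → F} (hh : RapidDecay h) : Integrable h := by
  have := hh.integrable_pow 0
  simp only [pow_zero, one_mul] at this
  exact (integrable_norm_iff hh.cont.aestronglyMeasurable).1 this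

theorem RapidDecay.comp_neg {h : Space d → F} (hh : RapidDecay h) : RapidDecay fun ξ => h (-ξ) := by
  refine ⟨hh.cont.comp continuous_neg, fun N => ?_⟩
  obtain ⟨C, hC⟩ := hh.decay N
  exact ⟨C, fun ξ => by simpa using hC (-ξ)⟩

end Decay

theorem rapidDecay_schwartz (f : SchwartzMap (Space d) F) : RapidDecay f := by
  refine ⟨f.continuous, fun N => ?_⟩
  have hk : ∀ k, ∃ C, ∀ ξ, ‖ξ‖ ^ k * ‖f ξ‖ ≤ C := fun k => by
    obtain ⟨C, -, hC⟩ := f.decay k 0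
    exact ⟨C, fun ξ => by simpa using hC ξ⟩
  choose C hC using hk
  refine ⟨∑ k ∈ Finset.range (N + 1), C k * N.choose k, fun ξ => ?_⟩
  rw [add_comm, add_pow, Finset.sum_mul]
  refine Finset.sum_le_sum fun k _ => ?_
  rw [one_pow, mul_one, mul_right_comm]
  exact mul_le_mul_of_nonneg_right (hC k ξ) (by positivity)

theorem rapidDecay_fourier {D : Space d → F} (hD : ContDiff ℝ ∞ D) (hc : HasCompactSupport D) :
    RapidDecay (𝓕 D) := by
  have h := rapidDecay_schwartz (𝓕 (hc.toSchwartzMap hD))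
  rwa [SchwartzMap.fourier_coe] at h

theorem contDiff_fourierInv {h : Space d → F} (hh : RapidDecay h) : ContDiff ℝ ∞ (𝓕⁻ h) := by
  rw [Real.fourierInv_eq_fourier_comp_neg]
  exact Real.contDiff_fourier (N := ⊤) fun n _ => hh.comp_neg.integrable_pow n

theorem norm_iteratedFDeriv_fourierInv_le {h : Space d → F} (hh : RapidDecay h) (n : ℕ)
    (x : Space d) :
    ‖iteratedFDeriv ℝ n (𝓕⁻ h) x‖ ≤ ∫ ξ, (2 * Real.pi) ^ n * (‖ξ‖ ^ n * ‖h ξ‖) := by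
  rw [Real.fourierInv_eq_fourier_comp_neg, Real.iteratedFDeriv_fourier (N := ⊤)
    (fun n _ => hh.comp_neg.integrable_pow n) hh.comp_neg.cont.aestronglyMeasurable le_top,
    Real.fourier_eq]
  rw [← integral_neg_eq_self (μ := volume) (fun ξ => (2 * Real.pi) ^ n * (‖ξ‖ ^ n * ‖h ξ‖))]
  refine norm_integral_le_of_norm_le ((hh.integrable_pow n).const_mul _).comp_neg
    (Filter.Eventually.of_forall fun ξ => ?_)
  rw [Circle.norm_smul]
  refine (VectorFourier.norm_fourierPowSMulRight_le _ _ _ _).trans ?_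
  have h1 : ‖(innerSL ℝ : Space d →L[ℝ] Space d →L[ℝ] ℝ)‖ ≤ 1 := norm_innerSL_le ℝ
  rw [norm_neg, mul_assoc]
  refine mul_le_mul_of_nonneg_right ?_ (by positivity)
  exact pow_le_pow_left₀ (by positivity) (mul_le_of_le_one_right (by positivity) h1) n

/-- The symbol `(2πiζ)^α` of `∂_x^α`. -/
def freqMonomial (α : Fin d → ℕ) (ζ : Fin d → ℂ) : ℂ :=
  ∏ i, (2 * Real.pi * Complex.I * ζ i) ^ α i

/-- A real frequency as a complex vector. -/
def toComplex (ξ : Space d) : Fin d → ℂ := fun i => (ξ i : ℂ)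

theorem continuous_toComplex : Continuous (toComplex : Space d → Fin d → ℂ) := by
  unfold toComplex; fun_prop

theorem inner_single_one (v : Space d) (i : Fin d) :
    inner ℝ v (EuclideanSpace.single i (1 : ℝ)) = v i := by
  simp [EuclideanSpace.inner_single_right]

theorem partialD_fourierInv {h : Space d → F} (hh : RapidDecay h) (i : Fin d) :
    partialD i (𝓕⁻ h) = 𝓕⁻ fun ξ => (2 * Real.pi * Complex.I * (ξ i : ℂ)) • h ξ := by
  funext x
  rw [Real.fourierInv_eq_fourier_comp_neg, Real.fourierInv_eq_fourier_comp_neg]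
  have hint : Integrable fun v : Space d => ‖v‖ * ‖h (-v)‖ := by
    simpa using hh.comp_neg.integrable_pow 1
  rw [partialD, Real.fderiv_fourier hh.comp_neg.integrable hint,
    Real.fourier_continuousLinearMap_apply]
  · refine congrFun (congrArg 𝓕 (funext fun v => ?_)) x
    rw [VectorFourier.fourierSMulRight_apply, innerSL_apply_apply, inner_single_one,
      ← Complex.coe_smul, smul_smul]
    simp
  · have hsm : AEStronglyMeasurable (VectorFourier.fourierSMulRight
        (innerSL ℝ : Space d →L[ℝ] Space d →L[ℝ] ℝ) fun v => h (-v)) volume :=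
      hh.comp_neg.cont.aestronglyMeasurable.fourierSMulRight
    refine (hint.const_mul (2 * Real.pi)).mono' hsm (Filter.Eventually.of_forall fun v => ?_)
    rw [VectorFourier.norm_fourierSMulRight, innerSL_apply_norm, mul_assoc]

theorem RapidDecay.smul_coord {h : Space d → F} (hh : RapidDecay h) (i : Fin d) :
    RapidDecay fun ξ => (2 * Real.pi * Complex.I * (ξ i : ℂ)) • h ξ := by
  refine hh.of_le (C := 2 * Real.pi) (K := 1) ?_ (by positivity) fun ξ => ?_
  · exact Continuous.smul (by fun_prop) hh.cont
  · rw [norm_smul, pow_one]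
    gcongr
    have h1 : ‖ξ i‖ ≤ ‖ξ‖ := PiLp.norm_apply_le ξ i
    simp only [norm_mul, Complex.norm_ofNat, Complex.norm_real, Complex.norm_I, mul_one]
    rw [Real.norm_of_nonneg Real.pi_pos.le]
    gcongr
    linarith

/-- Each differentiation under the integral needs rapid decay of the current integrand, so both
statements are carried through the same induction. -/
theorem mDeriv_fourierInv {h : Space d → F} (hh : RapidDecay h) (α : Fin d → ℕ) :
    (mDeriv α (𝓕⁻ h) = 𝓕⁻ fun ξ => freqMonomial α (toComplex ξ) • h ξ) ∧
      RapidDecay fun ξ => freqMonomial α (toComplex ξ) • h ξ := by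
  simp only [mDeriv, freqMonomial, Fin.prod_univ_def, toComplex]
  induction List.finRange d with
  | nil => simpa using hh
  | cons i l ih =>
    simp only [List.foldr_cons, List.map_cons, List.prod_cons]
    induction α i with
    | zero => simpa using ih
    | succ n ihn =>
      rw [Function.iterate_succ_apply', ihn.1, partialD_fourierInv ihn.2]
      have := ihn.2.smul_coord i
      simp only [smul_smul] at this ⊢
      simp only [pow_succ', mul_assoc] at this ⊢
      exact ⟨trivial, this⟩

theorem fourier_partialD {V : Space d → F} (hV : ContDiff ℝ ∞ V) (hc : HasCompactSupport V)
    (i : Fin d) : 𝓕 (partialD i V) = fun ξ => (2 * Real.pi * Complex.I * (ξ i : ℂ)) • 𝓕 V ξ := by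
  funext ξ
  have hint : Integrable (fderiv ℝ V) :=
    (hV.continuous_fderiv (by simp)).integrable_of_hasCompactSupport (hc.fderiv ℝ)
  have h1 := congrFun (Real.fourier_fderiv (hV.continuous.integrable_of_hasCompactSupport hc)
    (hV.differentiable (by simp)) hint) ξ
  have h2 : 𝓕 (partialD i V) ξ = 𝓕 (fderiv ℝ V) ξ (EuclideanSpace.single i 1) :=
    (Real.fourier_continuousLinearMap_apply hint).symm
  rw [h2, h1]
  rw [VectorFourier.fourierSMulRight_apply, neg_apply, neg_apply, innerSL_apply_apply,
    inner_single_one, ← Complex.coe_smul, smul_smul]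
  simp

theorem fourier_mDeriv {V : Space d → F} (hV : ContDiff ℝ ∞ V) (hc : HasCompactSupport V)
    (α : Fin d → ℕ) : 𝓕 (mDeriv α V) = fun ξ => freqMonomial α (toComplex ξ) • 𝓕 V ξ := by
  simp only [mDeriv, freqMonomial, Fin.prod_univ_def, toComplex]
  suffices h : ∀ l : List (Fin d),
      let v := l.foldr (fun i h => (partialD i)^[α i] h) V
      ContDiff ℝ ∞ v ∧ HasCompactSupport v ∧ 𝓕 v =
        fun ξ => (l.map fun i => (2 * Real.pi * Complex.I * (ξ i : ℂ)) ^ α i).prod • 𝓕 V ξ from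
    (h _).2.2
  intro l
  induction l with
  | nil => simpa using ⟨hV, hc⟩
  | cons i l ih =>
    simp only [List.foldr_cons, List.map_cons, List.prod_cons]
    induction α i with
    | zero => simpa using ih
    | succ n ihn =>
      rw [Function.iterate_succ_apply']
      refine ⟨contDiff_partialD ihn.1 i, (ihn.2.1.fderiv_apply ℝ _), ?_⟩
      rw [fourier_partialD ihn.1 ihn.2.1, ihn.2.2]
      simp only [smul_smul, pow_succ', mul_assoc]

theorem fourier_clm [CompleteSpace F] [CompleteSpace G] (L : F →L[ℂ] G) {h : Space d → F}
    (hh : Integrable h) (x : Space d) : 𝓕 (fun ξ => L (h ξ)) x = L (𝓕 h x) := by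
  rw [Real.fourier_eq, Real.fourier_eq, ← L.integral_comp_comm]
  · simp [Circle.smul_def]
  · exact (Real.fourierIntegral_convergent_iff x).2 hh

theorem fourierInv_clm [CompleteSpace F] [CompleteSpace G] (L : F →L[ℂ] G) {h : Space d → F}
    (hh : Integrable h) (x : Space d) : 𝓕⁻ (fun ξ => L (h ξ)) x = L (𝓕⁻ h x) := by
  rw [Real.fourierInv_eq_fourier_neg, Real.fourierInv_eq_fourier_neg, fourier_clm L hh]

theorem fourier_add {g h : Space d → F} (hg : Integrable g) (hh : Integrable h) (x : Space d) :
    𝓕 (fun ξ => g ξ + h ξ) x = 𝓕 g x + 𝓕 h x := by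
  simp only [Real.fourier_eq, smul_add]
  exact integral_add ((Real.fourierIntegral_convergent_iff x).2 hg)
    ((Real.fourierIntegral_convergent_iff x).2 hh)

theorem fourierInv_add {g h : Space d → F} (hg : Integrable g) (hh : Integrable h) (x : Space d) :
    𝓕⁻ (fun ξ => g ξ + h ξ) x = 𝓕⁻ g x + 𝓕⁻ h x := by
  simp only [Real.fourierInv_eq_fourier_neg, fourier_add hg hh]

end RapidDecay


/-! ### Systems with constant coefficients in space, solved by Fourier transform -/

open FourierTransform in
/-- The equation `U = J D + Q₀ U + J ∑_{α ∈ A} q_α ∂_x^α U` for a function `U : ℝ^d → Y`. -/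
structure FourierSystem (d : ℕ) (X Y : Type*) [NormedAddCommGroup X] [NormedSpace ℂ X]
    [NormedAddCommGroup Y] [NormedSpace ℂ Y] where
  /-- the multi-indices that occur -/
  A : Finset (Fin d → ℕ)
  /-- the map that sends data to sources -/
  J : X →L[ℂ] Y
  /-- the term of order zero -/
  Q₀ : Y →L[ℂ] Y
  /-- the coefficients -/
  q : (Fin d → ℕ) → Y →L[ℂ] X

namespace FourierSystem

open FourierTransform

variable {d : ℕ} {X Y : Type*} [NormedAddCommGroup X] [NormedSpace ℂ X] [CompleteSpace X]
    [NormedAddCommGroup Y] [NormedSpace ℂ Y] [CompleteSpace Y] (S : FourierSystem d X Y)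

/-- The symbol of the right hand side of the equation. -/
def W (ζ : Fin d → ℂ) : Y →L[ℂ] Y :=
  S.Q₀ + S.J.comp (∑ α ∈ S.A, freqMonomial α ζ • S.q α)

/-- The solution operator at the frequency `ζ`. -/
def R (ζ : Fin d → ℂ) : X →L[ℂ] Y := (Ring.inverse (1 - S.W ζ)).comp S.J

/-- The equation is solvable at all complex frequencies, with a solution operator that grows at
most exponentially, and polynomially at real frequencies. -/
structure Hyperbolic : Prop where
  isUnit : ∀ ζ, IsUnit (1 - S.W ζ)
  exp_bound : ∃ C B : ℝ, 0 ≤ C ∧ 0 ≤ B ∧ ∀ ζ, ‖S.R ζ‖ ≤ C * Real.exp (B * ‖ζ‖)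
  poly_bound : ∃ C : ℝ, 0 ≤ C ∧ ∃ K : ℕ, ∀ ξ, ‖S.R (toComplex ξ)‖ ≤ C * (1 + ‖ξ‖) ^ K

/-- `U` solves the equation with data `D`. -/
def Solves (D : Space d → X) (U : Space d → Y) : Prop :=
  ∀ x, U x = S.J (D x) + S.Q₀ (U x) + S.J (∑ α ∈ S.A, S.q α (mDeriv α U x))

/-- The solution given by the Fourier transform. -/
def sol (D : Space d → X) : Space d → Y := 𝓕⁻ fun ξ => S.R (toComplex ξ) (𝓕 D ξ)

variable {S}

theorem W_apply (ζ : Fin d → ℂ) (y : Y) :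
    S.W ζ y = S.Q₀ y + S.J (∑ α ∈ S.A, freqMonomial α ζ • S.q α y) := by
  simp [W]

theorem differentiable_freqMonomial (α : Fin d → ℕ) : Differentiable ℂ (freqMonomial α) := by
  unfold freqMonomial
  fun_prop

theorem differentiable_W : Differentiable ℂ S.W := by
  have h : Differentiable ℂ fun ζ => ∑ α ∈ S.A, freqMonomial α ζ • S.q α :=
    Differentiable.fun_sum fun α _ => (differentiable_freqMonomial α).smul_const _
  exact ((differentiable_const S.J).clm_comp h).const_add _

/-- The symbol `W` is a polynomial in `ζ`, and inversion is holomorphic at units. Holomorphy of `R`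
is what permits shifting contours. -/
theorem Hyperbolic.differentiable_R (hS : S.Hyperbolic) : Differentiable ℂ S.R := by
  intro ζ
  have h1 : DifferentiableAt ℂ (fun ζ => Ring.inverse (1 - S.W ζ)) ζ :=
    DifferentiableAt.comp (f := fun ζ => 1 - S.W ζ) ζ (differentiableAt_inverse (hS.isUnit ζ))
      ((differentiableAt_const (1 : Y →L[ℂ] Y)).fun_sub (differentiable_W ζ))
  exact h1.clm_comp (differentiableAt_const S.J)

theorem Hyperbolic.sub_W_R (hS : S.Hyperbolic) (ζ : Fin d → ℂ) (D : X) :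
    S.R ζ D - S.W ζ (S.R ζ D) = S.J D := by
  have h := Ring.mul_inverse_cancel _ (hS.isUnit ζ)
  have h' := congrArg (fun L : Y →L[ℂ] Y => L (S.J D)) h
  simpa [R] using h'

theorem Hyperbolic.eq_R (hS : S.Hyperbolic) {ζ : Fin d → ℂ} {D : X} {y : Y}
    (h : y - S.W ζ y = S.J D) : y = S.R ζ D := by
  have h1 := Ring.inverse_mul_cancel _ (hS.isUnit ζ)
  have h' := congrArg (fun L : Y →L[ℂ] Y => L y) h1
  rw [R, ContinuousLinearMap.comp_apply, ← h]
  simpa using h'.symm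

theorem Hyperbolic.continuous_R (hS : S.Hyperbolic) :
    Continuous fun ξ : Space d => S.R (toComplex ξ) :=
  hS.differentiable_R.continuous.comp continuous_toComplex

theorem Hyperbolic.rapidDecay (hS : S.Hyperbolic) {h : Space d → X} (hh : RapidDecay h) :
    RapidDecay fun ξ => S.R (toComplex ξ) (h ξ) := by
  obtain ⟨C, hC, K, hK⟩ := hS.poly_bound
  refine hh.of_le (hS.continuous_R.clm_apply hh.cont) hC (K := K) fun ξ => ?_
  exact (ContinuousLinearMap.le_opNorm _ _).trans
    (mul_le_mul_of_nonneg_right (hK ξ) (norm_nonneg _))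

theorem RapidDecay.clm {F G : Type*} [NormedAddCommGroup F] [NormedSpace ℂ F]
    [NormedAddCommGroup G] [NormedSpace ℂ G] (L : F →L[ℂ] G) {h : Space d → F}
    (hh : RapidDecay h) : RapidDecay fun ξ => L (h ξ) :=
  hh.of_le (L.continuous.comp hh.cont) (norm_nonneg L) (K := 0)
    fun ξ => by simpa using L.le_opNorm (h ξ)

variable {D : Space d → X}

theorem Hyperbolic.contDiff_sol (hS : S.Hyperbolic) (hD : ContDiff ℝ ∞ D)
    (hc : HasCompactSupport D) : ContDiff ℝ ∞ (S.sol D) :=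
  contDiff_fourierInv (hS.rapidDecay (rapidDecay_fourier hD hc))

theorem fourierInv_fourier_eq {F : Type*} [NormedAddCommGroup F] [NormedSpace ℂ F]
    [CompleteSpace F] {V : Space d → F} (hV : ContDiff ℝ ∞ V) (hc : HasCompactSupport V) :
    𝓕⁻ (𝓕 V) = V :=
  hV.continuous.fourierInv_fourier_eq (hV.continuous.integrable_of_hasCompactSupport hc)
    (rapidDecay_fourier hV hc).integrable

theorem fourier_sum {F : Type*} [NormedAddCommGroup F] [NormedSpace ℂ F] {ι : Type*} (s : Finset ι)
    {h : ι → Space d → F} (hh : ∀ i ∈ s, Integrable (h i)) (x : Space d) :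
    𝓕 (fun ξ => ∑ i ∈ s, h i ξ) x = ∑ i ∈ s, 𝓕 (h i) x := by
  simp only [Real.fourier_eq, Finset.smul_sum]
  exact integral_finsetSum s fun i hi => (Real.fourierIntegral_convergent_iff x).2 (hh i hi)

theorem fourierInv_sum {F : Type*} [NormedAddCommGroup F] [NormedSpace ℂ F] {ι : Type*}
    (s : Finset ι) {h : ι → Space d → F} (hh : ∀ i ∈ s, Integrable (h i)) (x : Space d) :
    𝓕⁻ (fun ξ => ∑ i ∈ s, h i ξ) x = ∑ i ∈ s, 𝓕⁻ (h i) x := by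
  simp only [Real.fourierInv_eq_fourier_neg, fourier_sum s hh]

/-- The equation holds at each real frequency by definition of `R`; rapid decay justifies inverting
the Fourier transform term by term. -/
theorem Hyperbolic.solves_sol (hS : S.Hyperbolic) (hD : ContDiff ℝ ∞ D)
    (hc : HasCompactSupport D) : S.Solves D (S.sol D) := by
  intro x
  have hr := rapidDecay_fourier hD hc
  have hh := hS.rapidDecay hr
  set h := fun ξ => S.R (toComplex ξ) (𝓕 D ξ) with hdef
  have hα : ∀ α, RapidDecay fun ξ => freqMonomial α (toComplex ξ) • h ξ :=
    fun α => (mDeriv_fourierInv hh α).2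
  have hq : ∀ α, RapidDecay fun ξ => S.q α (freqMonomial α (toComplex ξ) • h ξ) :=
    fun α => RapidDecay.clm _ (hα α)
  have hsum : Integrable fun ξ => ∑ α ∈ S.A, S.q α (freqMonomial α (toComplex ξ) • h ξ) :=
    integrable_finsetSum _ fun α _ => (hq α).integrable
  have e1 : S.sol D x = 𝓕⁻ (fun ξ => (S.J (𝓕 D ξ) + S.Q₀ (h ξ))
      + S.J (∑ α ∈ S.A, S.q α (freqMonomial α (toComplex ξ) • h ξ))) x := by
    refine congrFun (congrArg 𝓕⁻ (funext fun ξ => ?_)) x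
    have := hS.sub_W_R (toComplex ξ) (𝓕 D ξ)
    rw [sub_eq_iff_eq_add, W_apply] at this
    rw [this, add_assoc]
    simp [h]
  have e2 : S.sol D = 𝓕⁻ h := rfl
  have i1 := (RapidDecay.clm S.J hr).integrable
  have i2 := (RapidDecay.clm S.Q₀ hh).integrable
  have i3 : Integrable fun ξ => S.J (𝓕 D ξ) + S.Q₀ (h ξ) := i1.add i2
  refine e1.trans ?_
  rw [fourierInv_add i3 (S.J.integrable_comp hsum), fourierInv_add i1 i2, fourierInv_clm _ hr.integrable, fourierInv_clm _ hh.integrable,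
    fourierInv_clm _ hsum, fourierInv_sum _ fun α _ => (hq α).integrable,
    fourierInv_fourier_eq hD hc, e2]
  congr 2
  refine Finset.sum_congr rfl fun α _ => ?_
  rw [fourierInv_clm _ (hα α).integrable, (mDeriv_fourierInv hh α).1]

/-- The Fourier transform of a compactly supported solution solves the equation at each real
frequency, where the solution is unique. -/
theorem Hyperbolic.eq_sol (hS : S.Hyperbolic) (hD : ContDiff ℝ ∞ D) (hc : HasCompactSupport D)
    {V : Space d → Y} (hV : ContDiff ℝ ∞ V) (hVc : HasCompactSupport V) (h : S.Solves D V) :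
    V = S.sol D := by
  have iD := hD.continuous.integrable_of_hasCompactSupport (μ := volume) hc
  have iV := hV.continuous.integrable_of_hasCompactSupport (μ := volume) hVc
  have iα : ∀ α, Integrable (mDeriv α V) volume := fun α =>
    (contDiff_mDeriv hV α).continuous.integrable_of_hasCompactSupport (hasCompactSupport_mDeriv hVc α)
  have hsum : Integrable fun x => ∑ α ∈ S.A, S.q α (mDeriv α V x) :=
    integrable_finsetSum _ fun α _ => (S.q α).integrable_comp (iα α)
  rw [← fourierInv_fourier_eq hV hVc, sol]
  congr 1
  funext ξ
  refine hS.eq_R ?_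
  have e1 : 𝓕 V ξ = 𝓕 (fun x => (S.J (D x) + S.Q₀ (V x))
      + S.J (∑ α ∈ S.A, S.q α (mDeriv α V x))) ξ :=
    congrFun (congrArg 𝓕 (funext h)) ξ
  have i3 : Integrable fun x => S.J (D x) + S.Q₀ (V x) :=
    (S.J.integrable_comp iD).add (S.Q₀.integrable_comp iV)
  rw [fourier_add i3 (S.J.integrable_comp hsum), fourier_add (S.J.integrable_comp iD) (S.Q₀.integrable_comp iV),
    fourier_clm _ iD, fourier_clm _ iV, fourier_clm _ hsum,
    fourier_sum _ fun α _ => (S.q α).integrable_comp (iα α)] at e1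
  rw [W_apply, sub_eq_iff_eq_add, ← add_assoc]
  refine e1.trans ?_
  congr 2
  refine Finset.sum_congr rfl fun α _ => ?_
  rw [fourier_clm _ (iα α), fourier_mDeriv hV hVc, map_smul]

theorem Hyperbolic.sol_add (hS : S.Hyperbolic) {D' : Space d → X} (hD : ContDiff ℝ ∞ D)
    (hc : HasCompactSupport D) (hD' : ContDiff ℝ ∞ D') (hc' : HasCompactSupport D') (x : Space d) :
    S.sol (fun y => D y + D' y) x = S.sol D x + S.sol D' x := by
  have iD := hD.continuous.integrable_of_hasCompactSupport (μ := volume) hc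
  have iD' := hD'.continuous.integrable_of_hasCompactSupport (μ := volume) hc'
  simp only [sol, fourier_add iD iD', map_add]
  exact fourierInv_add (hS.rapidDecay (rapidDecay_fourier hD hc)).integrable
    (hS.rapidDecay (rapidDecay_fourier hD' hc')).integrable x

/-- Derivatives of the solution are bounded by those of the data, for data with support in a fixed
compact set. -/
theorem Hyperbolic.norm_iteratedFDeriv_sol_le (hS : S.Hyperbolic) {K : Set (Space d)}
    (hK : IsCompact K) (n : ℕ) :
    ∃ (m : ℕ) (C : ℝ), 0 ≤ C ∧ ∀ (D : Space d → X) (B : ℝ), ContDiff ℝ ∞ D → tsupport D ⊆ K →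
      (∀ k ≤ m, ∀ x, ‖iteratedFDeriv ℝ k D x‖ ≤ B) →
        ∀ x, ‖iteratedFDeriv ℝ n (S.sol D) x‖ ≤ C * B := by
  obtain ⟨CR, hCR, KR, hKR⟩ := hS.poly_bound
  -- `n` powers of `ξ` for the derivatives of the solution, `KR` for the growth of `R`, and `d + 1`
  -- for integrability.
  set m := n + KR + (d + 1) with hm
  set c : ℝ := 2 ^ m * ((m + 1) * volume.real K) with hc
  have hc0 : 0 ≤ c := by positivity
  refine ⟨m, (2 * Real.pi) ^ n * (CR * (2 ^ m * (2 * c))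
    * ∫ ξ : Space d, ((1 + ‖ξ‖) ^ (d + 1))⁻¹), ?_, fun D B hD hsupp hB x => ?_⟩
  · have : 0 ≤ ∫ ξ : Space d, ((1 + ‖ξ‖) ^ (d + 1))⁻¹ :=
      integral_nonneg fun ξ => by positivity
    positivity
  have hB0 : 0 ≤ B := (norm_nonneg _).trans (hB 0 (Nat.zero_le _) 0)
  have hcs : HasCompactSupport D := hK.of_isClosed_subset (isClosed_tsupport D) hsupp
  have hr := rapidDecay_fourier hD hcs
  have hint : ∀ p : ℕ, p ≤ m → ∫ v, ‖iteratedFDeriv ℝ p D v‖ ≤ B * volume.real K := by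
    intro p hp
    have hz : ∀ v, v ∉ K → ‖iteratedFDeriv ℝ p D v‖ = 0 := fun v hv => by
      rw [norm_eq_zero]
      exact image_eq_zero_of_notMem_tsupport
        fun h => hv (hsupp (tsupport_iteratedFDeriv_subset p h))
    rw [← setIntegral_eq_integral_of_forall_compl_eq_zero hz]
    refine (le_abs_self _).trans ?_
    rw [← Real.norm_eq_abs]
    exact norm_setIntegral_le_of_norm_le_const hK.measure_lt_top
      fun v _ => by simpa using hB p hp v
  -- Powers of `ξ` times the Fourier transform are bounded by `L¹` norms of derivatives of `D`,
  -- hence by their suprema times the volume of the support.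
  have hF : ∀ k ≤ m, ∀ ξ, ‖ξ‖ ^ k * ‖𝓕 D ξ‖ ≤ c * B := by
    intro k hk ξ
    have h := Real.pow_mul_norm_iteratedFDeriv_fourier_le (f := D) (K := 0) (N := ⊤) hD
      (fun i p hi _ => by
        have hi0 : i = 0 := by simpa using hi
        subst hi0
        simpa using ((hD.continuous_iteratedFDeriv (m := p)
          (by exact_mod_cast le_top)).integrable_of_hasCompactSupport
            (hcs.iteratedFDeriv p)).norm) (k := 0) (n := k) le_rfl le_top ξ
    simp only [norm_iteratedFDeriv_zero, pow_zero, one_mul, Nat.cast_zero, mul_zero, zero_add] at h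
    refine h.trans ?_
    rw [Finset.sum_product]
    simp only [Finset.range_one, Finset.sum_singleton, pow_zero, one_mul]
    have h2 : ∑ p ∈ Finset.range (k + 1), ∫ v, ‖iteratedFDeriv ℝ p D v‖
        ≤ (k + 1) * (B * volume.real K) := by
      refine (Finset.sum_le_sum fun p hp =>
        hint p ((Finset.mem_range_succ_iff.1 hp).trans hk)).trans ?_
      simp
    have hk' : (k : ℝ) ≤ m := by exact_mod_cast hk
    have h3 : (2 : ℝ) ^ k ≤ 2 ^ m := pow_le_pow_right₀ one_le_two hk
    calc (2 : ℝ) ^ k * ∑ p ∈ Finset.range (k + 1), ∫ v, ‖iteratedFDeriv ℝ p D v‖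
        ≤ 2 ^ m * ((m + 1) * (B * volume.real K)) := by
          refine mul_le_mul h3 (h2.trans ?_) (Finset.sum_nonneg fun p _ =>
            integral_nonneg fun v => norm_nonneg _) (by positivity)
          gcongr
      _ = c * B := by rw [hc]; ring
  have hF' : ∀ ξ, (1 + ‖ξ‖) ^ m * ‖𝓕 D ξ‖ ≤ 2 ^ m * (2 * c) * B := by
    intro ξ
    have h1 : (1 + ‖ξ‖) ^ m ≤ 2 ^ m * (1 + ‖ξ‖ ^ m) := by
      rcases le_total ‖ξ‖ 1 with h | h
      · calc (1 + ‖ξ‖) ^ m ≤ 2 ^ m := by gcongr; linarith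
          _ ≤ _ := le_mul_of_one_le_right (by positivity) (by simp)
      · calc (1 + ‖ξ‖) ^ m ≤ (2 * ‖ξ‖) ^ m := by gcongr; linarith
          _ = 2 ^ m * ‖ξ‖ ^ m := mul_pow _ _ _
          _ ≤ _ := by gcongr; linarith
    calc (1 + ‖ξ‖) ^ m * ‖𝓕 D ξ‖ ≤ 2 ^ m * (1 + ‖ξ‖ ^ m) * ‖𝓕 D ξ‖ := by gcongr
      _ = 2 ^ m * (‖ξ‖ ^ 0 * ‖𝓕 D ξ‖ + ‖ξ‖ ^ m * ‖𝓕 D ξ‖) := by ring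
      _ ≤ 2 ^ m * (c * B + c * B) :=
        mul_le_mul_of_nonneg_left (add_le_add (hF 0 (Nat.zero_le _) ξ) (hF m le_rfl ξ))
          (by positivity)
      _ = _ := by ring
  refine (norm_iteratedFDeriv_fourierInv_le (hS.rapidDecay hr) n x).trans ?_
  have hfin : ∀ ξ, (2 * Real.pi) ^ n * (‖ξ‖ ^ n * ‖S.R (toComplex ξ) (𝓕 D ξ)‖) ≤
      (2 * Real.pi) ^ n * (CR * (2 ^ m * (2 * c))) * B * ((1 + ‖ξ‖) ^ (d + 1))⁻¹ := by
    intro ξ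
    rw [← div_eq_mul_inv, le_div_iff₀ (by positivity)]
    have h1 : ‖S.R (toComplex ξ) (𝓕 D ξ)‖ ≤ CR * (1 + ‖ξ‖) ^ KR * ‖𝓕 D ξ‖ :=
      (ContinuousLinearMap.le_opNorm _ _).trans
        (mul_le_mul_of_nonneg_right (hKR ξ) (norm_nonneg _))
    have h2 : ‖ξ‖ ^ n ≤ (1 + ‖ξ‖) ^ n := by gcongr; linarith
    calc (2 * Real.pi) ^ n * (‖ξ‖ ^ n * ‖S.R (toComplex ξ) (𝓕 D ξ)‖) * (1 + ‖ξ‖) ^ (d + 1)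
        ≤ (2 * Real.pi) ^ n * ((1 + ‖ξ‖) ^ n * (CR * (1 + ‖ξ‖) ^ KR * ‖𝓕 D ξ‖))
          * (1 + ‖ξ‖) ^ (d + 1) := by gcongr
      _ = (2 * Real.pi) ^ n * CR * ((1 + ‖ξ‖) ^ m * ‖𝓕 D ξ‖) := by rw [hm]; ring
      _ ≤ (2 * Real.pi) ^ n * CR * (2 ^ m * (2 * c) * B) :=
        mul_le_mul_of_nonneg_left (hF' ξ) (by positivity)
      _ = _ := by ring
  refine (integral_mono (((hS.rapidDecay hr).integrable_pow n).const_mul _)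
    ((integrable_one_add_norm_pow d).const_mul _) hfin).trans (le_of_eq ?_)
  rw [integral_const_mul]
  ring

end FourierSystem


/-! ### Finite speed of propagation: half spaces -/

section Contour

open Filter Topology Complex

variable {Y : Type*} [NormedAddCommGroup Y] [NormedSpace ℂ Y]

/-- Phragmén–Lindelöf in the right half plane for `(1 + w)² g(w)`: it has exponential type, is
bounded on the positive real axis, and is bounded by `M` on the imaginary axis, where `|1 + is|² = 1
+ s²`. -/
theorem norm_le_of_exp_decay {g : ℂ → Y} (hg : Differentiable ℂ g)
    (hexp : ∃ C B : ℝ, ∀ w, ‖g w‖ ≤ C * Real.exp (B * ‖w‖))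
    (hreal : ∃ C : ℝ, ∀ x : ℝ, 0 ≤ x → ‖g x‖ ≤ C * Real.exp (-x))
    {M : ℝ} (him : ∀ s : ℝ, (1 + s ^ 2) * ‖g (s * I)‖ ≤ M) {w : ℂ} (hw : 0 ≤ w.re) :
    ‖1 + w‖ ^ 2 * ‖g w‖ ≤ M := by
  obtain ⟨C, B, hC⟩ := hexp
  obtain ⟨C', hC'⟩ := hreal
  -- The polynomial factor is paid for with one exponential, which the decay on the real axis
  -- supplies.
  have hsq : ∀ r : ℝ, 0 ≤ r → (1 + r) ^ 2 ≤ 4 * Real.exp r := fun r hr => by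
    have h1 : 1 + r / 2 ≤ Real.exp (r / 2) := by linarith [Real.add_one_le_exp (r / 2)]
    have h2 : Real.exp r = Real.exp (r / 2) ^ 2 := by rw [← Real.exp_nat_mul]; congr 1; ring
    rw [h2]
    nlinarith
  have h := PhragmenLindelof.right_half_plane_of_bounded_on_real (C := M) (z := w)
    (f := fun w => (1 + w) ^ 2 • g w) ?_ ?_ ?_ ?_ hw
  · simpa [norm_smul] using h
  · exact Differentiable.diffContOnCl (by fun_prop)
  · refine ⟨1, by norm_num, B + 1, Asymptotics.IsBigO.of_bound (4 * C) (Eventually.of_forall ?_)⟩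
    intro z
    rw [norm_smul, norm_pow, Real.norm_of_nonneg (Real.exp_pos _).le, Real.rpow_one]
    have h1 : ‖1 + z‖ ^ 2 ≤ 4 * Real.exp ‖z‖ := by
      refine le_trans ?_ (hsq ‖z‖ (norm_nonneg _))
      gcongr
      simpa using norm_add_le 1 z
    calc ‖1 + z‖ ^ 2 * ‖g z‖ ≤ (4 * Real.exp ‖z‖) * (C * Real.exp (B * ‖z‖)) :=
          mul_le_mul h1 (hC z) (norm_nonneg _) (by positivity)
      _ = 4 * C * Real.exp ((B + 1) * ‖z‖) := by
          rw [show (B + 1) * ‖z‖ = ‖z‖ + B * ‖z‖ by ring, Real.exp_add]; ring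
  · refine ⟨4 * C', eventually_map.2 ?_⟩
    filter_upwards [eventually_ge_atTop 0] with x hx
    have h0 : ‖(1 : ℂ) + x‖ = 1 + x := by
      rw [← ofReal_one, ← ofReal_add, norm_real, Real.norm_of_nonneg (by positivity)]
    rw [norm_smul, norm_pow, h0]
    calc (1 + x) ^ 2 * ‖g x‖ ≤ (4 * Real.exp x) * (C' * Real.exp (-x)) :=
          mul_le_mul (hsq x hx) (hC' x hx) (norm_nonneg _) (by positivity)
      _ = 4 * C' * (Real.exp x * Real.exp (-x)) := by ring
      _ = 4 * C' := by rw [← Real.exp_add]; simp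
  · intro s
    rw [norm_smul, norm_pow]
    have h0 : ‖(1 : ℂ) + s * I‖ ^ 2 = 1 + s ^ 2 := by
      rw [← normSq_eq_norm_sq, normSq_apply]; simp; ring
    rw [h0]
    exact him s

/-- The contour of integration can be moved to infinity. -/
theorem integral_imaginary_axis_eq_zero [CompleteSpace Y] {g : ℂ → Y} (hg : Differentiable ℂ g)
    (hexp : ∃ C B : ℝ, ∀ w, ‖g w‖ ≤ C * Real.exp (B * ‖w‖))
    (hreal : ∃ C : ℝ, ∀ x : ℝ, 0 ≤ x → ‖g x‖ ≤ C * Real.exp (-x))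
    (him : ∃ M : ℝ, ∀ s : ℝ, (1 + s ^ 2) * ‖g (s * I)‖ ≤ M) : ∫ s : ℝ, g (s * I) = 0 := by
  obtain ⟨M, hM⟩ := him
  have hcont : Continuous fun s : ℝ => g (s * I) := hg.continuous.comp (by fun_prop)
  have hint : Integrable fun s : ℝ => g (s * I) := by
    refine (integrable_inv_one_add_sq.const_mul M).mono' hcont.aestronglyMeasurable
      (Eventually.of_forall fun s => ?_)
    rw [← div_eq_mul_inv, le_div_iff₀ (by positivity), mul_comm]
    exact hM s
  have hM0 : 0 ≤ M := (by positivity : 0 ≤ (1 + (0 : ℝ) ^ 2) * ‖g ((0 : ℝ) * I)‖).trans (hM 0)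
  have hb : ∀ S : ℝ, 0 < S → ∀ w : ℂ, 0 ≤ w.re → (S ≤ w.re ∨ S ≤ |w.im|) →
      ‖g w‖ ≤ M / S ^ 2 := by
    intro S hS w hw h
    rw [le_div_iff₀ (by positivity), mul_comm]
    refine le_trans ?_ (norm_le_of_exp_decay hg hexp hreal hM hw)
    gcongr
    rcases h with h | h
    · refine h.trans (le_trans ?_ (re_le_norm _)); simp
    · refine h.trans (le_trans ?_ (abs_im_le_norm _)); simp
  have hlim := intervalIntegral_tendsto_integral hint tendsto_neg_atTop_atBot tendsto_id
  refine tendsto_nhds_unique hlim ?_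
  have hle : ∀ S : ℝ, 0 < S → ‖∫ s in (-S)..S, g (s * I)‖ ≤ 4 * M * S⁻¹ := by
    intro S hS
    -- Cauchy's theorem on the rectangle `[0, S] × [-S, S]`. The three sides off the imaginary axis
    -- have total length `4S`, and `g` is at most `M/S²` there.
    have h := integral_boundary_rect_eq_zero_of_differentiableOn g (-S * I) (S + S * I)
      hg.differentiableOn
    simp only [neg_mul, neg_re, mul_re, ofReal_re, I_re, mul_zero, ofReal_im, I_im, mul_one,
      sub_self, neg_zero, add_re, add_zero, neg_im, mul_im, add_im, zero_add, ofReal_zero,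
      ofReal_neg] at h
    rw [sub_eq_zero] at h
    have e1 : ‖∫ x in (0 : ℝ)..S, g (x + -(S * I))‖ ≤ M / S ^ 2 * |S - 0| := by
      refine intervalIntegral.norm_integral_le_of_norm_le_const fun x hx => ?_
      rw [uIoc_of_le hS.le] at hx
      exact hb S hS _ (by simpa using hx.1.le) (Or.inr (by simpa using le_abs_self S))
    have e2 : ‖∫ x in (0 : ℝ)..S, g (x + S * I)‖ ≤ M / S ^ 2 * |S - 0| := by
      refine intervalIntegral.norm_integral_le_of_norm_le_const fun x hx => ?_
      rw [uIoc_of_le hS.le] at hx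
      exact hb S hS _ (by simpa using hx.1.le) (Or.inr (by simpa using le_abs_self S))
    have e3 : ‖∫ y in (-S)..S, g (S + y * I)‖ ≤ M / S ^ 2 * |S - -S| := by
      refine intervalIntegral.norm_integral_le_of_norm_le_const fun x hx => ?_
      exact hb S hS _ (by simpa using hS.le) (Or.inl (by simp))
    have h' := congrArg norm h
    rw [norm_smul, norm_I, one_mul] at h'
    rw [← h']
    refine (norm_add_le _ _).trans ?_
    rw [norm_smul, norm_I, one_mul]
    refine (add_le_add ((norm_sub_le _ _).trans (add_le_add e1 e2)) e3).trans (le_of_eq ?_)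
    rw [sub_zero, abs_of_pos hS, sub_neg_eq_add, abs_of_pos (by linarith)]
    field_simp
    ring
  refine squeeze_zero_norm' (a := fun S : ℝ => 4 * M * S⁻¹) ?_ ?_
  · filter_upwards [eventually_gt_atTop 0] with S hS using hle S hS
  · simpa using tendsto_inv_atTop_zero.const_mul (4 * M)

end Contour

/-! ### Integration along one coordinate first -/

section Slices

variable {Y : Type*} [NormedAddCommGroup Y] [NormedSpace ℝ Y]

/-- Fubini's theorem for the splitting of the space into the coordinate `i` and the others. -/
theorem integral_eq_zero_of_slices {d : ℕ} (i : Fin d) {k : Space d → Y} (hk : Integrable k)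
    (h : ∀ ξ : Space d, ∫ s : ℝ, k (WithLp.toLp 2 (Function.update ξ.ofLp i s)) = 0) :
    ∫ ξ, k ξ = 0 := by
  obtain ⟨n, rfl⟩ : ∃ n, d = n + 1 := ⟨d - 1, by have := i.2; omega⟩
  have e1 := (PiLp.volume_preserving_toLp (Fin (n + 1))).integral_comp
    (MeasurableEquiv.toLp 2 (Fin (n + 1) → ℝ)).measurableEmbedding k
  have mp := (volume_preserving_piFinSuccAbove (fun _ : Fin (n + 1) => ℝ) i).symm
  have e2 := mp.integral_comp (MeasurableEquiv.measurableEmbedding _)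
    (fun v : Fin (n + 1) → ℝ => k (WithLp.toLp 2 v))
  have hk1 : Integrable fun v : Fin (n + 1) → ℝ => k (WithLp.toLp 2 v) :=
    (PiLp.volume_preserving_toLp (Fin (n + 1))).integrable_comp_of_integrable hk
  have hk2 := mp.integrable_comp_of_integrable hk1
  rw [← e1, ← e2]
  rw [Measure.volume_eq_prod] at hk2 ⊢
  refine (integral_prod_symm _ hk2).trans ?_
  refine integral_eq_zero_of_ae (Filter.Eventually.of_forall fun r => ?_)
  -- The value `0` at the place `i` is arbitrary, since the slice overwrites it.
  have h1 := h (WithLp.toLp 2 (i.insertNth (0 : ℝ) r : Fin (n + 1) → ℝ))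
  simp only [Fin.update_insertNth] at h1
  exact h1

end Slices

/-! ### The Fourier transform at complex frequencies -/

section ComplexFourier

open Complex

variable {d : ℕ} {X : Type*} [NormedAddCommGroup X] [NormedSpace ℂ X]

/-- Differentiation under the integral: on the unit ball about `w₀` one has `|w| ≤ |w₀| + 1`, and
the compact support of `D` makes the resulting bound integrable. -/
theorem differentiable_integral_exp {p q : Space d → ℂ} (hp : Continuous p) (hq : Continuous q)
    {D : Space d → X} (hD : Continuous D) (hc : HasCompactSupport D) :
    Differentiable ℂ fun w : ℂ => ∫ v, exp (p v + w * q v) • D v := by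
  intro w₀
  have hcont : ∀ w : ℂ, Continuous fun v => exp (p v + w * q v) • D v := fun w =>
    Continuous.smul (by fun_prop) hD
  have hcs : ∀ w : ℂ, HasCompactSupport fun v => exp (p v + w * q v) • D v := fun w =>
    hc.smul_left
  refine (hasDerivAt_integral_of_dominated_loc_of_deriv_le (μ := volume) (Metric.ball_mem_nhds w₀ one_pos)
    (F := fun w v => exp (p v + w * q v) • D v)
    (F' := fun w v => (exp (p v + w * q v) * q v) • D v)
    (bound := fun v => Real.exp (‖p v‖ + (‖w₀‖ + 1) * ‖q v‖) * ‖q v‖ * ‖D v‖)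
    ?_ ?_ ?_ ?_ ?_ ?_).2.differentiableAt
  · exact Filter.Eventually.of_forall fun w => (hcont w).aestronglyMeasurable
  · exact (hcont w₀).integrable_of_hasCompactSupport (hcs w₀)
  · exact (Continuous.smul (by fun_prop) hD).aestronglyMeasurable
  · refine Filter.Eventually.of_forall fun v w hw => ?_
    rw [norm_smul, norm_mul, norm_exp]
    gcongr
    refine (re_le_norm _).trans ((norm_add_le _ _).trans ?_)
    rw [norm_mul]
    gcongr
    have := norm_sub_norm_le w w₀
    rw [Metric.mem_ball, dist_eq_norm] at hw
    linarith
  · refine Continuous.integrable_of_hasCompactSupport ?_ hc.norm.mul_left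
    fun_prop
  · refine Filter.Eventually.of_forall fun v w _ => HasDerivAt.smul_const ?_ _
    have h := (((hasDerivAt_id w).mul_const (q v)).const_add (p v)).cexp
    simpa using h

/-- The Fourier transform at complex frequencies. -/
def complexFourier (D : Space d → X) (ζ : Fin d → ℂ) : X :=
  ∫ v : Space d, exp (-(2 * Real.pi * I) * ∑ j, ζ j * v j) • D v

open FourierTransform in
theorem complexFourier_toComplex (D : Space d → X) (ξ : Space d) :
    complexFourier D (toComplex ξ) = 𝓕 D ξ := by
  rw [Real.fourier_eq', complexFourier]
  congr 1
  funext v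
  congr 2
  simp only [toComplex, PiLp.inner_apply, RCLike.inner_apply, conj_trivial, ofReal_mul, ofReal_sum,
    ofReal_neg, ofReal_ofNat]
  ring

/-- The complex frequency obtained from `ξ` by the replacement of the coordinate `i`. -/
def slice (ξ : Space d) (i : Fin d) (z : ℂ) : Fin d → ℂ := Function.update (toComplex ξ) i z

theorem slice_sum (ξ v : Space d) (i : Fin d) (z : ℂ) :
    ∑ j, slice ξ i z j * v j = ((∑ j, ξ j * v j - ξ i * v i : ℝ) : ℂ) + z * v i := by
  rw [← Finset.add_sum_erase _ _ (Finset.mem_univ i), ← Finset.add_sum_erase Finset.univ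
    (fun j => ξ j * v j) (Finset.mem_univ i), add_sub_cancel_left, add_comm]
  congr 1
  · push_cast
    refine Finset.sum_congr rfl fun j hj => ?_
    simp [slice, Function.update_of_ne (Finset.ne_of_mem_erase hj), toComplex]
  · simp [slice]

theorem slice_ofReal (ξ : Space d) (i : Fin d) (s : ℝ) :
    slice ξ i s = toComplex (WithLp.toLp 2 (Function.update ξ.ofLp i s)) := by
  funext j
  by_cases h : j = i
  · subst h; simp [slice, toComplex]
  · simp [slice, toComplex, Function.update_of_ne h]

theorem norm_slice_le (ξ : Space d) (i : Fin d) (z : ℂ) : ‖slice ξ i z‖ ≤ ‖ξ‖ + ‖z‖ := by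
  refine (pi_norm_le_iff_of_nonneg (by positivity)).2 fun j => ?_
  by_cases h : j = i
  · subst h; simp [slice]
  · have h1 : ‖ξ j‖ ≤ ‖ξ‖ := PiLp.norm_apply_le ξ j
    simp only [slice, Function.update_of_ne h, toComplex, norm_real]
    linarith [norm_nonneg z]

theorem differentiable_complexFourier_slice {D : Space d → X} (hD : Continuous D)
    (hc : HasCompactSupport D) (ξ : Space d) (i : Fin d) (c : ℂ) :
    Differentiable ℂ fun w : ℂ => complexFourier D (slice ξ i (c * w)) := by
  have h := differentiable_integral_exp (d := d)
    (p := fun v => -(2 * Real.pi * I) * ((∑ j, ξ j * v j - ξ i * v i : ℝ) : ℂ))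
    (q := fun v => -(2 * Real.pi * I) * c * v i) (by fun_prop) (by fun_prop) hD hc
  convert h using 2 with w
  rw [complexFourier]
  congr 1
  funext v
  rw [slice_sum]
  congr 2
  ring

/-- The easy half of the Paley–Wiener theorem: the real coordinates of the frequency give factors of
modulus one, and the coordinate `z` gives `exp(2π Im z · v_i)`, which is at most `exp(2πr)` on the
support. -/
theorem norm_complexFourier_slice_le {D : Space d → X} (hD : Continuous D)
    (hc : HasCompactSupport D) (ξ : Space d) (i : Fin d) (z : ℂ) {r : ℝ}
    (hr : ∀ v, D v ≠ 0 → z.im * v i ≤ r) :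
    ‖complexFourier D (slice ξ i z)‖ ≤ Real.exp (2 * Real.pi * r) * ∫ v, ‖D v‖ := by
  rw [← integral_const_mul]
  refine norm_integral_le_of_norm_le
    ((hD.norm.integrable_of_hasCompactSupport hc.norm).const_mul _)
    (Filter.Eventually.of_forall fun v => ?_)
  by_cases hv : D v = 0
  · simp [hv]
  rw [norm_smul, norm_exp, slice_sum]
  gcongr
  have h := hr v hv
  have e : (-(2 * Real.pi * I) * (((∑ j, ξ j * v j - ξ i * v i : ℝ) : ℂ) + z * v i)).re
      = 2 * Real.pi * (z.im * v i) := by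
    simp
  rw [e]
  exact mul_le_mul_of_nonneg_left h (by positivity)

end ComplexFourier

/-! ### Finite speed of propagation for data in a half space -/

namespace FourierSystem

open FourierTransform Complex

variable {d : ℕ} {X Y : Type*} [NormedAddCommGroup X] [NormedSpace ℂ X] [CompleteSpace X]
    [NormedAddCommGroup Y] [NormedSpace ℂ Y] [CompleteSpace Y] {S : FourierSystem d X Y}

/-- Data supported in a half space have a solution supported in a larger half space. -/
theorem Hyperbolic.sol_eq_zero_of_halfSpace (hS : S.Hyperbolic) :
    ∃ ρ : ℝ, 0 < ρ ∧ ∀ (D : Space d → X), ContDiff ℝ ∞ D → HasCompactSupport D →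
      ∀ (i : Fin d) (σ : ℝ), |σ| = 1 → ∀ x : Space d, (∀ v, D v ≠ 0 → σ * x i + ρ ≤ σ * v i) →
        S.sol D x = 0 := by
  obtain ⟨C, B, hC, hB, hCB⟩ := hS.exp_bound
  -- With this distance the support of the data yields a decay `exp(-(B + 1)t)` along the shifted
  -- contour, against the growth `exp(Bt)` of the solution operator; what remains is `exp(-t)`.
  refine ⟨(B + 1) / (2 * Real.pi), by positivity, fun D hD hc i σ hσ x hx => ?_⟩
  have hσ0 : σ ≠ 0 := fun h => by simp [h] at hσ
  -- the integrand at complex frequencies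
  set G : (Fin d → ℂ) → Y := fun ζ =>
    exp (2 * Real.pi * I * ∑ j, ζ j * x j) • S.R ζ (complexFourier D ζ) with hG
  have hr := hS.rapidDecay (rapidDecay_fourier hD hc)
  have hGreal : ∀ ξ : Space d, ‖G (toComplex ξ)‖ = ‖S.R (toComplex ξ) (𝓕 D ξ)‖ := by
    intro ξ
    rw [hG]
    simp only
    rw [norm_smul, complexFourier_toComplex, norm_exp]
    have : (2 * Real.pi * I * ∑ j, toComplex ξ j * (x j : ℂ)).re = 0 := by
      simp only [toComplex, ← ofReal_mul, ← ofReal_sum]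
      simp
    rw [this, Real.exp_zero, one_mul]
  have hsol : S.sol D x = ∫ ξ, G (toComplex ξ) := by
    rw [sol, Real.fourierInv_eq']
    congr 1
    funext ξ
    rw [hG]
    simp only
    rw [complexFourier_toComplex]
    congr 2
    simp only [toComplex, PiLp.inner_apply, RCLike.inner_apply, conj_trivial, ofReal_mul,
      ofReal_sum, ofReal_ofNat, mul_comm (x _ : ℂ)]
    ring
  have hGcont : Continuous fun ξ : Space d => G (toComplex ξ) := by
    simp only [hG, complexFourier_toComplex]
    refine Continuous.smul ?_ hr.cont
    unfold toComplex
    fun_prop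
  have hGint : Integrable fun ξ : Space d => G (toComplex ξ) :=
    (integrable_norm_iff hGcont.aestronglyMeasurable).1 (by
      simp only [hGreal]; exact hr.integrable.norm)
  rw [hsol]
  refine integral_eq_zero_of_slices i hGint fun ξ => ?_
  -- the slice as an integral over the imaginary axis
  have hI : ∫ s : ℝ, G (toComplex (WithLp.toLp 2 (Function.update ξ.ofLp i (σ * s)))) =
      ∫ s : ℝ, G (slice ξ i (-I * σ * ((s : ℂ) * I))) := by
    congr 1
    funext s
    rw [← slice_ofReal]
    congr 2
    push_cast
    linear_combination ((σ : ℂ) * s) * I_mul_I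
  have hscale := Measure.integral_comp_mul_left
    (fun s : ℝ => G (toComplex (WithLp.toLp 2 (Function.update ξ.ofLp i s)))) σ
  rw [abs_inv, hσ, inv_one, one_smul] at hscale
  rw [← hscale, hI]
  have hnw : ∀ w : ℂ, ‖-I * σ * w‖ = ‖w‖ := fun w => by
    simp [hσ]
  obtain ⟨ρ, hρ⟩ := hc.isCompact.isBounded.exists_norm_le
  have hρv : ∀ v, D v ≠ 0 → ‖v i‖ ≤ ρ := fun v hv =>
    (PiLp.norm_apply_le v i).trans (hρ v (subset_tsupport D hv))
  have hnorm : ∀ (w : ℂ) (r : ℝ), (∀ v, D v ≠ 0 → (-I * σ * w).im * v i ≤ r) →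
      ‖G (slice ξ i (-I * σ * w))‖ ≤ Real.exp (-(2 * Real.pi * ((-I * σ * w).im * x i))) *
        ((C * Real.exp (B * (‖ξ‖ + ‖w‖))) * (Real.exp (2 * Real.pi * r) * ∫ v, ‖D v‖)) := by
    intro w r hr
    rw [hG]
    simp only
    rw [norm_smul, norm_exp, slice_sum]
    refine mul_le_mul (le_of_eq ?_) ((ContinuousLinearMap.le_opNorm _ _).trans
      (mul_le_mul ((hCB _).trans ?_) (norm_complexFourier_slice_le hD.continuous hc ξ i _ hr)
        (norm_nonneg _) (by positivity))) (norm_nonneg _) (Real.exp_pos _).le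
    · congr 1
      simp
    · gcongr
      refine (norm_slice_le _ _ _).trans ?_
      rw [hnw]
  have him : ∀ w : ℂ, (-I * σ * w).im = -(σ * w.re) := fun w => by simp
  have hD0 : 0 ≤ ∫ v, ‖D v‖ := integral_nonneg fun v => norm_nonneg _
  refine integral_imaginary_axis_eq_zero (g := fun w => G (slice ξ i (-I * σ * w))) ?_ ?_ ?_ ?_
  · have h1 : Differentiable ℂ fun w : ℂ => slice ξ i (-I * σ * w) := by
      refine differentiable_pi.2 fun j => ?_
      by_cases h : j = i
      · subst h; simp only [slice, Function.update_self]; fun_prop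
      · simp only [slice, Function.update_of_ne h]; fun_prop
    have h2 : Differentiable ℂ fun w : ℂ => S.R (slice ξ i (-I * σ * w)) :=
      hS.differentiable_R.comp h1
    have h3 := differentiable_complexFourier_slice hD.continuous hc ξ i (-I * σ)
    refine Differentiable.smul ?_ (h2.clm_apply h3)
    simp only [slice_sum]
    fun_prop
  · refine ⟨C * Real.exp (B * ‖ξ‖) * ∫ v, ‖D v‖, 2 * Real.pi * |x i| + B + 2 * Real.pi * ρ,
      fun w => ?_⟩
    have hre : |σ * w.re| ≤ ‖w‖ := by
      rw [abs_mul, hσ, one_mul]; exact abs_re_le_norm w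
    refine (hnorm w (‖w‖ * ρ) fun v hv => ?_).trans ?_
    · rw [him]
      refine (le_abs_self _).trans ?_
      rw [abs_mul, abs_neg]
      exact mul_le_mul hre (hρv v hv) (abs_nonneg _) (norm_nonneg _)
    · have h1 : -(2 * Real.pi * ((-I * σ * w).im * x i)) ≤ 2 * Real.pi * |x i| * ‖w‖ := by
        rw [him]
        have h2 : (σ * w.re) * x i ≤ ‖w‖ * |x i| := by
          refine (le_abs_self _).trans ?_
          rw [abs_mul]
          gcongr
        nlinarith [Real.pi_pos]
      calc _ ≤ Real.exp (2 * Real.pi * |x i| * ‖w‖) * ((C * Real.exp (B * (‖ξ‖ + ‖w‖))) *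
            (Real.exp (2 * Real.pi * (‖w‖ * ρ)) * ∫ v, ‖D v‖)) := by gcongr
        _ = C * (∫ v, ‖D v‖) * (Real.exp (2 * Real.pi * |x i| * ‖w‖) *
            Real.exp (B * (‖ξ‖ + ‖w‖)) * Real.exp (2 * Real.pi * (‖w‖ * ρ))) := by ring
        _ = C * (∫ v, ‖D v‖) * (Real.exp (B * ‖ξ‖) *
            Real.exp ((2 * Real.pi * |x i| + B + 2 * Real.pi * ρ) * ‖w‖)) := by
          rw [← Real.exp_add, ← Real.exp_add, ← Real.exp_add]
          congr 2
          ring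
        _ = _ := by ring
  -- Decay along the real axis: the position of the support enters here, while the previous bound
  -- used only its boundedness.
  · refine ⟨C * Real.exp (B * ‖ξ‖) * ∫ v, ‖D v‖, fun t ht => ?_⟩
    refine (hnorm t (-(t * (σ * x i + (B + 1) / (2 * Real.pi)))) fun v hv => ?_).trans ?_
    · rw [him]
      have := mul_le_mul_of_nonneg_left (hx v hv) ht
      simp only [ofReal_re]
      linarith
    · rw [him, norm_real, Real.norm_of_nonneg ht]
      refine le_of_eq ?_
      calc _ = C * (∫ v, ‖D v‖) * (Real.exp (-(2 * Real.pi * (-(σ * (t : ℂ).re) * x i))) *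
            Real.exp (B * (‖ξ‖ + t)) *
            Real.exp (2 * Real.pi * -(t * (σ * x i + (B + 1) / (2 * Real.pi))))) := by ring
        _ = C * (∫ v, ‖D v‖) * (Real.exp (B * ‖ξ‖) * Real.exp (-t)) := by
          rw [← Real.exp_add, ← Real.exp_add, ← Real.exp_add]
          congr 2
          simp only [ofReal_re]
          field_simp
          ring
        _ = _ := by ring
  · obtain ⟨M, hM⟩ := hr.decay 2
    refine ⟨M, fun s => ?_⟩
    have h1 : slice ξ i (-I * σ * ((s : ℂ) * I)) =
        toComplex (WithLp.toLp 2 (Function.update ξ.ofLp i (σ * s))) := by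
      rw [← slice_ofReal]
      congr 1
      push_cast
      linear_combination (-(σ : ℂ) * s) * I_mul_I
    rw [h1, hGreal]
    set η : Space d := WithLp.toLp 2 (Function.update ξ.ofLp i (σ * s))
    refine le_trans ?_ (hM η)
    gcongr
    have h2 : |s| ≤ ‖η‖ := by
      have h3 : ‖η i‖ ≤ ‖η‖ := PiLp.norm_apply_le η i
      have h4 : η i = σ * s := by simp [η]
      rw [h4, Real.norm_eq_abs, abs_mul, hσ, one_mul] at h3
      exact h3
    have := sq_abs s
    nlinarith [abs_nonneg s]

end FourierSystem


/-! ### Well-posedness of Fourier systems in `C^∞` -/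

/-- A smooth function with compact support, equal to `1` on the ball of radius `r`. -/
def cutoff {d : ℕ} (r : ℝ) : Space d → ℝ :=
  (⟨max r 1, max r 1 + 1, by positivity, by linarith⟩ : ContDiffBump (0 : Space d))

section Cutoff

variable {d : ℕ} (r : ℝ)

theorem contDiff_cutoff : ContDiff ℝ ∞ (cutoff r : Space d → ℝ) := ContDiffBump.contDiff _

theorem hasCompactSupport_cutoff : HasCompactSupport (cutoff r : Space d → ℝ) :=
  ContDiffBump.hasCompactSupport _

theorem tsupport_cutoff : tsupport (cutoff r : Space d → ℝ) = Metric.closedBall 0 (max r 1 + 1) :=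
  ContDiffBump.tsupport_eq _

variable {r}

theorem cutoff_eq_one {x : Space d} (hx : ‖x‖ ≤ r) : cutoff r x = 1 := by
  refine ContDiffBump.one_of_mem_closedBall _ ?_
  rw [mem_closedBall_zero_iff]
  exact hx.trans (le_max_left _ _)

end Cutoff

section Smul

variable {d : ℕ} {F : Type*} [NormedAddCommGroup F] [NormedSpace ℝ F] {χ : Space d → ℝ}
  {g : Space d → F}

theorem contDiff_smul_fun (hχ : ContDiff ℝ ∞ χ) (hg : ContDiff ℝ ∞ g) :
    ContDiff ℝ ∞ fun y => χ y • g y := hχ.smul hg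

theorem hasCompactSupport_smul_fun (hχ : HasCompactSupport χ) :
    HasCompactSupport fun y => χ y • g y := hχ.smul_right

theorem hasCompactSupport_smul_fun' (hg : HasCompactSupport g) :
    HasCompactSupport fun y => χ y • g y := hg.smul_left

end Smul

/-! ### Finite speed of propagation, and solutions with arbitrary smooth data -/

namespace FourierSystem

variable {d : ℕ} {X Y : Type*} [NormedAddCommGroup X] [NormedSpace ℂ X] [CompleteSpace X]
    [NormedAddCommGroup Y] [NormedSpace ℂ Y] [CompleteSpace Y] {S : FourierSystem d X Y}

theorem norm_le_of_forall_abs_lt {d : ℕ} {y : Space d} {r : ℝ} (hr : 0 < r)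
    (h : ∀ i, |y i| < r) : ‖y‖ < (d + 1) * r := by
  have h1 : ‖y‖ ^ 2 ≤ d * r ^ 2 := by
    rw [EuclideanSpace.norm_sq_eq]
    calc ∑ i, ‖y i‖ ^ 2 ≤ ∑ _i : Fin d, r ^ 2 := Finset.sum_le_sum fun i _ => by
          have := h i
          rw [← Real.norm_eq_abs] at this
          gcongr
      _ = d * r ^ 2 := by simp
  refine lt_of_pow_lt_pow_left₀ 2 (by positivity) (h1.trans_lt ?_)
  have : (0 : ℝ) ≤ d := Nat.cast_nonneg d
  have h2 : 0 < r ^ 2 := by positivity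
  nlinarith [mul_nonneg this h2.le, mul_nonneg (mul_nonneg this this) h2.le]

/-- Finite speed of propagation. -/
theorem Hyperbolic.sol_eq_zero (hS : S.Hyperbolic) :
    ∃ ρ : ℝ, 0 < ρ ∧ ∀ (D : Space d → X), ContDiff ℝ ∞ D → HasCompactSupport D →
      ∀ x : Space d, (∀ v, ‖v - x‖ < ρ → D v = 0) → S.sol D x = 0 := by
  obtain ⟨ρ, hρ, h⟩ := hS.sol_eq_zero_of_halfSpace
  -- The additional unit is the width of the smooth transitions, and the factor `d + 1` places a
  -- cube inside a ball.
  refine ⟨(d + 1) * (ρ + 1), by positivity, fun D hD hc x hx => ?_⟩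
  -- Induction on the coordinates in which a neighbourhood of `x` is free of data. In the direction
  -- `i` the data are split by smooth transitions into two parts supported in half spaces, which do
  -- not reach `x`, and a middle part, which vanishes under the weaker condition on the remaining
  -- coordinates.
  have key : ∀ (s : Finset (Fin d)) (D : Space d → X), ContDiff ℝ ∞ D → HasCompactSupport D →
      (∀ v, (∀ i ∈ s, |v i - x i| < ρ + 1) → D v = 0) → S.sol D x = 0 := by
    intro s
    induction s using Finset.induction_on with
    | empty =>
      intro D hD hc h0
      have hD0 : D = fun _ => 0 := funext fun v => h0 v (by simp)
      -- Zero data: additivity gives `sol 0 = sol 0 + sol 0`.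
      have h1 := hS.sol_add hD hc hD hc x
      rw [hD0] at h1 ⊢
      simpa using h1
    | insert i s _ ih =>
      intro D hD hc h0
      have hcoord : ContDiff ℝ ∞ fun v : Space d => v i := by fun_prop
      set θ : ℝ → Space d → ℝ := fun σ v => Real.smoothTransition (σ * (v i - x i) - ρ) with hθ
      have hθs : ∀ σ, ContDiff ℝ ∞ (θ σ) := fun σ =>
        Real.smoothTransition.contDiff.comp (by fun_prop)
      have hθ0 : ∀ σ v, σ * (v i - x i) ≤ ρ → θ σ v = 0 := fun σ v hv =>
        Real.smoothTransition.zero_of_nonpos (by linarith)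
      have hθ1 : ∀ σ v, ρ + 1 ≤ σ * (v i - x i) → θ σ v = 1 := fun σ v hv =>
        Real.smoothTransition.one_of_one_le (by linarith)
      have hhalf : ∀ σ : ℝ, |σ| = 1 → S.sol (fun v => θ σ v • D v) x = 0 := fun σ hσ => by
        refine h _ (contDiff_smul_fun (hθs σ) hD) (hasCompactSupport_smul_fun' hc) i σ hσ x fun v hv => ?_
        by_contra hlt
        exact hv (by rw [hθ0 σ v (by linarith), zero_smul])
      have hmid : S.sol (fun v => (1 - θ 1 v - θ (-1) v) • D v) x = 0 := by
        refine ih _ (contDiff_smul_fun ((contDiff_const.sub (hθs 1)).sub (hθs (-1))) hD)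
          (hasCompactSupport_smul_fun' hc)
          fun v hv => ?_
        by_cases hi : |v i - x i| < ρ + 1
        · rw [h0 v (by
            intro j hj
            rcases Finset.mem_insert.1 hj with rfl | hj
            · exact hi
            · exact hv j hj), smul_zero]
        · rcases le_total 0 (v i - x i) with hs | hs
          · rw [abs_of_nonneg hs, not_lt] at hi
            rw [hθ1 1 v (by linarith), hθ0 (-1) v (by linarith)]
            simp
          · rw [abs_of_nonpos hs, not_lt] at hi
            rw [hθ0 1 v (by linarith), hθ1 (-1) v (by linarith)]
            simp
      have e : D = fun v => θ 1 v • D v + (θ (-1) v • D v + (1 - θ 1 v - θ (-1) v) • D v) := by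
        funext v
        rw [← add_smul, ← add_smul]
        simp
      have hm := contDiff_smul_fun ((contDiff_const (c := (1 : ℝ)).sub (hθs 1)).sub (hθs (-1))) hD
      have hcθ : ∀ χ : Space d → ℝ, HasCompactSupport fun v => χ v • D v :=
        fun χ => hasCompactSupport_smul_fun' hc
      have hsθ : ∀ σ, ContDiff ℝ ∞ fun v => θ σ v • D v := fun σ => contDiff_smul_fun (hθs σ) hD
      have hcm : HasCompactSupport fun v => θ (-1) v • D v + (1 - θ 1 v - θ (-1) v) • D v :=
        (hcθ _).add (hcθ _)
      rw [e, hS.sol_add (hsθ 1) (hcθ _) ((hsθ (-1)).add hm) hcm,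
        hS.sol_add (hsθ (-1)) (hcθ _) hm (hcθ _), hhalf 1 (by simp), hhalf (-1) (by simp), hmid]
      simp
  refine key Finset.univ D hD hc fun v hv => hx v ?_
  exact norm_le_of_forall_abs_lt (by positivity) fun i => by simpa using hv i (Finset.mem_univ i)

variable {D : Space d → X} {U : Space d → Y}

/-- Near the origin, a solution is given by the Fourier transform of the data cut off. -/
theorem Hyperbolic.exists_eq_sol_cutoff (hS : S.Hyperbolic) :
    ∃ ρ : ℝ, 0 < ρ ∧ (∀ (D : Space d → X), ContDiff ℝ ∞ D → HasCompactSupport D →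
      ∀ x : Space d, (∀ v, ‖v - x‖ < ρ → D v = 0) → S.sol D x = 0) ∧
      ∀ (D : Space d → X) (U : Space d → Y), ContDiff ℝ ∞ D → ContDiff ℝ ∞ U → S.Solves D U →
      ∀ (r : ℝ) (x : Space d), ‖x‖ + ρ ≤ r → U x = S.sol (fun y => cutoff r y • D y) x := by
  obtain ⟨ρ, hρ, hfin⟩ := hS.sol_eq_zero
  refine ⟨ρ, hρ, hfin, fun D U hD hU hsol r x hx => ?_⟩
  have hχ : ContDiff ℝ ∞ (cutoff r : Space d → ℝ) := contDiff_cutoff r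
  have hχc : HasCompactSupport (cutoff r : Space d → ℝ) := hasCompactSupport_cutoff r
  set V : Space d → Y := fun y => cutoff r y • U y with hV
  have hVs : ContDiff ℝ ∞ V := hχ.smul hU
  have hVc : HasCompactSupport V := hχc.smul_right
  -- The commutator of the cutoff with the derivatives. With it, `V = χU` solves the equation for
  -- the compactly supported data `χD + E`. It vanishes on the ball of radius `r`, where `χ = 1`, so
  -- it has no influence on points at distance `ρ` from the outside of the ball.
  set E : Space d → X := fun y =>
    -∑ α ∈ S.A, S.q α (mDeriv α V y - cutoff r y • mDeriv α U y) with hE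
  have hEs : ContDiff ℝ ∞ E := by
    refine (ContDiff.sum fun α _ => ?_).neg
    exact ((S.q α).restrictScalars ℝ).contDiff.comp
      ((contDiff_mDeriv hVs α).sub (hχ.smul (contDiff_mDeriv hU α)))
  have hEc : HasCompactSupport E := by
    refine HasCompactSupport.intro hχc fun y hy => ?_
    have h1 : ∀ α, mDeriv α V y = 0 := fun α => by
      refine image_eq_zero_of_notMem_tsupport (f := mDeriv α V) fun h => hy ?_
      have h2 : EqOn V (fun _ => 0) (tsupport (cutoff r : Space d → ℝ))ᶜ := fun z hz => by
        rw [hV]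
        simp only
        rw [image_eq_zero_of_notMem_tsupport hz, zero_smul]
      by_contra hy'
      have hopen := (isClosed_tsupport (cutoff r : Space d → ℝ)).isOpen_compl
      have h3 := mDeriv_eqOn hopen h2 α
      rw [mDeriv_zero_fun] at h3
      have h4 : mDeriv α V =ᶠ[nhds y] fun _ => 0 := Filter.eventuallyEq_of_mem (hopen.mem_nhds hy') h3
      exact (notMem_tsupport_iff_eventuallyEq.2 h4) h
    simp [hE, h1, image_eq_zero_of_notMem_tsupport hy]
  have hχD := contDiff_smul_fun hχ hD
  have hχDc : HasCompactSupport fun y => cutoff r y • D y := hasCompactSupport_smul_fun hχc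
  have hD's : ContDiff ℝ ∞ fun y => cutoff r y • D y + E y := hχD.add hEs
  have hD'c : HasCompactSupport fun y => cutoff r y • D y + E y := hχDc.add hEc
  have hVsol : S.Solves (fun y => cutoff r y • D y + E y) V := by
    intro y
    have h1 := hsol y
    have h2 : V y = cutoff r y • S.J (D y) + cutoff r y • S.Q₀ (U y)
        + cutoff r y • S.J (∑ α ∈ S.A, S.q α (mDeriv α U y)) := by
      rw [hV]
      simp only
      conv_lhs => rw [h1, smul_add, smul_add]
    have h3 : S.Q₀ (V y) = cutoff r y • S.Q₀ (U y) :=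
      ContinuousLinearMap.map_smul_of_tower S.Q₀ _ _
    rw [h3, h2, hE]
    simp only [map_add, map_neg, map_sum, map_sub, ContinuousLinearMap.map_smul_of_tower,
      Finset.sum_sub_distrib, Finset.smul_sum]
    abel
  have hVeq := hS.eq_sol hD's hD'c hVs hVc hVsol
  have hx1 : cutoff r x = 1 := cutoff_eq_one (by linarith)
  have e1 : U x = V x := by rw [hV]; simp only; rw [hx1, one_smul]
  rw [e1, hVeq, hS.sol_add hχD hχDc hEs hEc]
  refine (congrArg _ (hfin E hEs hEc x fun v hv => ?_)).trans (add_zero _)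
  have hvr : v ∈ Metric.ball (0 : Space d) r := by
    rw [mem_ball_zero_iff]
    have := norm_sub_norm_le v x
    linarith
  have h2 : EqOn V U (Metric.ball 0 r) := fun z hz => by
    rw [hV]
    simp only
    rw [cutoff_eq_one (mem_ball_zero_iff.1 hz).le, one_smul]
  have h3 : ∀ α, mDeriv α V v = mDeriv α U v := fun α => mDeriv_eqOn Metric.isOpen_ball h2 α hvr
  simp [hE, h3, cutoff_eq_one (mem_ball_zero_iff.1 hvr).le]

theorem Hyperbolic.unique (hS : S.Hyperbolic) {U' : Space d → Y} (hD : ContDiff ℝ ∞ D)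
    (hU : ContDiff ℝ ∞ U) (hU' : ContDiff ℝ ∞ U') (h : S.Solves D U) (h' : S.Solves D U') :
    U = U' := by
  obtain ⟨ρ, _, -, hcut⟩ := hS.exists_eq_sol_cutoff
  funext x
  rw [hcut D U hD hU h _ x le_rfl, hcut D U' hD hU' h' _ x le_rfl]

/-- The solutions for the data cut off at radius `r` agree at `x` as soon as `r ≥ ‖x‖ + ρ`, by
finite speed of propagation; they are patched together, and near each point a single one of them is
used. -/
theorem Hyperbolic.exists_solution (hS : S.Hyperbolic) (hD : ContDiff ℝ ∞ D) :
    ∃ U : Space d → Y, ContDiff ℝ ∞ U ∧ S.Solves D U := by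
  obtain ⟨ρ, hρ, hfin, hcut⟩ := hS.exists_eq_sol_cutoff
  set V : ℝ → Space d → Y := fun r => S.sol (fun y => cutoff r y • D y) with hV
  have hs : ∀ r, ContDiff ℝ ∞ fun y => cutoff r y • D y := fun r => (contDiff_cutoff r).smul hD
  have hc : ∀ r, HasCompactSupport fun y => cutoff r y • D y := fun r =>
    (hasCompactSupport_cutoff r).smul_right
  have hVs : ∀ r, ContDiff ℝ ∞ (V r) := fun r => hS.contDiff_sol (hs r) (hc r)
  have hVe : ∀ r r' x, ‖x‖ + ρ ≤ r → ‖x‖ + ρ ≤ r' → V r x = V r' x := by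
    intro r r' x hr hr'
    have hE := contDiff_smul_fun ((contDiff_cutoff (d := d) r).sub (contDiff_cutoff r')) hD
    have hEc : HasCompactSupport fun y => (cutoff r y - cutoff r' y) • D y :=
      (HasCompactSupport.sub (hasCompactSupport_cutoff (d := d) r)
        (hasCompactSupport_cutoff r')).smul_right
    have e : (fun y => cutoff r y • D y) =
        fun y => cutoff r' y • D y + (cutoff r y - cutoff r' y) • D y := by
      funext y
      rw [← add_smul]
      simp
    rw [hV]
    simp only
    rw [e, hS.sol_add (hs r') (hc r') hE hEc]
    refine (congrArg _ (hfin _ hE hEc x fun v hv => ?_)).trans (add_zero _)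
    have := norm_sub_norm_le v x
    rw [cutoff_eq_one (by linarith), cutoff_eq_one (by linarith)]
    simp
  set U : Space d → Y := fun x => V (‖x‖ + ρ) x with hU
  have hUV : ∀ r, EqOn U (V (r + ρ)) (Metric.ball 0 r) := fun r x hx =>
    hVe _ _ x le_rfl (by have := mem_ball_zero_iff.1 hx; linarith)
  have hmem : ∀ x : Space d, x ∈ Metric.ball (0 : Space d) (‖x‖ + 1) := fun x => by
    rw [mem_ball_zero_iff]; linarith
  refine ⟨U, contDiff_iff_contDiffAt.2 fun x => ?_, fun x => ?_⟩
  · exact ((hVs (‖x‖ + 1 + ρ)).contDiffAt (x := x)).congr_of_eventuallyEq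
      (Filter.eventuallyEq_of_mem (Metric.isOpen_ball.mem_nhds (hmem x)) (hUV _))
  · have h1 := hS.solves_sol (hs (‖x‖ + 1 + ρ)) (hc _) x
    have h2 : ∀ α, mDeriv α U x = mDeriv α (V (‖x‖ + 1 + ρ)) x := fun α =>
      mDeriv_eqOn Metric.isOpen_ball (hUV _) α (hmem x)
    simp only [h2]
    rw [hUV _ (hmem x)]
    refine Eq.trans h1 ?_
    rw [cutoff_eq_one (by linarith), one_smul]

/-- Near a bounded set the solution coincides with the one for the data cut off at a fixed radius,
and the Leibniz rule bounds the derivatives of the cut off data. -/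
theorem Hyperbolic.continuous_dependence (hS : S.Hyperbolic) {s : Set (Space d)}
    (hs : Bornology.IsBounded s) (n : ℕ) :
    ∃ (r : ℝ) (m : ℕ) (C : ℝ), 0 < r ∧ 0 ≤ C ∧
      ∀ (D : Space d → X) (U : Space d → Y), ContDiff ℝ ∞ D → ContDiff ℝ ∞ U → S.Solves D U →
        ∀ B : ℝ, (∀ k ≤ m, ∀ x ∈ Metric.closedBall (0 : Space d) r,
          ‖iteratedFDeriv ℝ k D x‖ ≤ B) →
        ∀ x ∈ s, ‖iteratedFDeriv ℝ n U x‖ ≤ C * B := by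
  obtain ⟨ρ, hρ, -, hcut⟩ := hS.exists_eq_sol_cutoff
  obtain ⟨b, hb⟩ := hs.exists_norm_le
  set r := b + 1 + ρ with hr
  obtain ⟨m, C, hC, hle⟩ := hS.norm_iteratedFDeriv_sol_le
    (isCompact_closedBall (0 : Space d) (max r 1 + 1)) n
  have hχb : ∀ k : ℕ, ∃ c : ℝ, ∀ x, ‖iteratedFDeriv ℝ k (cutoff r : Space d → ℝ) x‖ ≤ c := fun k =>
    ((contDiff_cutoff r).continuous_iteratedFDeriv
      (by exact_mod_cast le_top)).bounded_above_of_compact_support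
        ((hasCompactSupport_cutoff r).iteratedFDeriv k)
  choose c hc using hχb
  have hc0 : ∀ k, 0 ≤ c k := fun k => (norm_nonneg _).trans (hc k 0)
  set c' : ℝ := ∑ k ∈ Finset.range (m + 1), ∑ i ∈ Finset.range (k + 1), (k.choose i : ℝ) * c i
    with hc'
  have hc'0 : 0 ≤ c' := Finset.sum_nonneg fun k _ => Finset.sum_nonneg fun i _ =>
    mul_nonneg (Nat.cast_nonneg _) (hc0 i)
  refine ⟨max r 1 + 1, m, C * c', by positivity, by positivity, fun D U hD hU h B hB x hx => ?_⟩
  have hB0 : 0 ≤ B := (norm_nonneg _).trans (hB 0 (Nat.zero_le _) 0 (by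
    simp only [Metric.mem_closedBall, dist_self]; positivity))
  have hev : U =ᶠ[nhds x] S.sol fun y => cutoff r y • D y := by
    have hmem : x ∈ Metric.ball (0 : Space d) (b + 1) := by
      rw [mem_ball_zero_iff]; linarith [hb x hx]
    refine Filter.eventuallyEq_of_mem (Metric.isOpen_ball.mem_nhds hmem) fun y hy => ?_
    exact hcut D U hD hU h r y (by have := mem_ball_zero_iff.1 hy; linarith)
  rw [(hev.iteratedFDeriv ℝ n).self_of_nhds, mul_assoc]
  have hsub : tsupport (fun y => cutoff r y • D y) ⊆ Metric.closedBall (0 : Space d) (max r 1 + 1) := by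
    rw [← tsupport_cutoff r]
    exact tsupport_smul_subset_left _ _
  refine hle _ (c' * B) (contDiff_smul_fun (contDiff_cutoff r) hD) hsub (fun k hk y => ?_) x
  by_cases hy : y ∈ Metric.closedBall (0 : Space d) (max r 1 + 1)
  · refine (norm_iteratedFDeriv_smul_le (contDiff_cutoff r) hD y (n := k)
      (by exact_mod_cast le_top)).trans ?_
    calc _ ≤ ∑ i ∈ Finset.range (k + 1), (k.choose i : ℝ) * c i * B := by
          refine Finset.sum_le_sum fun i _ => mul_le_mul (mul_le_mul_of_nonneg_left (hc i y)
            (Nat.cast_nonneg _)) (hB _ ((Nat.sub_le _ _).trans hk) y hy) (norm_nonneg _)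
            (mul_nonneg (Nat.cast_nonneg _) (hc0 i))
      _ = (∑ i ∈ Finset.range (k + 1), (k.choose i : ℝ) * c i) * B := by rw [Finset.sum_mul]
      _ ≤ c' * B := by
        refine mul_le_mul_of_nonneg_right ?_ hB0
        exact Finset.single_le_sum (f := fun k => ∑ i ∈ Finset.range (k + 1), (k.choose i : ℝ) * c i)
          (fun k _ => Finset.sum_nonneg fun i _ => mul_nonneg (Nat.cast_nonneg _) (hc0 i))
          (Finset.mem_range_succ_iff.2 hk)
  · rw [image_eq_zero_of_notMem_tsupport fun h => hy (hsub (tsupport_iteratedFDeriv_subset k h)),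
      norm_zero]
    positivity

end FourierSystem


/-! ### Smooth functions with values in a space of continuous functions -/

section Curves

universe u

variable {E K : Type} [NormedAddCommGroup E] [NormedSpace ℝ E] [FiniteDimensional ℝ E]
  [TopologicalSpace K] [CompactSpace K] {F : Type u} [NormedAddCommGroup F] [NormedSpace ℝ F]

/-- The family of linear maps `t ↦ (y ↦ A y t)`. -/
def curveOfLinearFun (A : E →L[ℝ] C(K, F)) : C(K, E →L[ℝ] F) where
  toFun t := (ContinuousMap.evalCLM ℝ t).comp A
  continuous_toFun := continuous_clm_apply.2 fun y => (A y).continuous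

/-- A linear map into `C(K,F)` as a continuous family of linear maps. -/
def curveOfLinear : (E →L[ℝ] C(K, F)) →L[ℝ] C(K, E →L[ℝ] F) :=
  LinearMap.mkContinuous (σ := RingHom.id ℝ)
    { toFun := (curveOfLinearFun : (E →L[ℝ] C(K, F)) → C(K, E →L[ℝ] F))
      map_add' := fun _ _ => rfl
      map_smul' := fun _ _ => rfl } 1 fun A => by
    refine (ContinuousMap.norm_le _ (by positivity)).2 fun t => ?_
    refine ContinuousLinearMap.opNorm_le_bound _ (by positivity) fun y => ?_
    rw [one_mul]
    exact ((A y).norm_coe_le_norm t).trans (A.le_opNorm y)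

/-- The curve `t ↦ B t y`. -/
def linearOfCurveFun (B : C(K, E →L[ℝ] F)) (y : E) : C(K, F) where
  toFun t := B t y
  continuous_toFun := B.continuous.clm_apply continuous_const

theorem norm_linearOfCurveFun_le (B : C(K, E →L[ℝ] F)) (y : E) :
    ‖linearOfCurveFun B y‖ ≤ ‖B‖ * ‖y‖ :=
  (ContinuousMap.norm_le _ (by positivity)).2 fun t => ((B t).le_opNorm y).trans
    (mul_le_mul_of_nonneg_right (B.norm_coe_le_norm t) (norm_nonneg y))

/-- The linear map `y ↦ (t ↦ B t y)`. -/
def linearOfCurveMap (B : C(K, E →L[ℝ] F)) : E →L[ℝ] C(K, F) :=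
  LinearMap.mkContinuous (σ := RingHom.id ℝ)
    { toFun := linearOfCurveFun B
      map_add' := fun y z => ContinuousMap.ext fun t => (B t).map_add y z
      map_smul' := fun c y => ContinuousMap.ext fun t => (B t).map_smul c y } ‖B‖
    (norm_linearOfCurveFun_le B)

/-- A continuous family of linear maps as a linear map into `C(K,F)`. -/
def linearOfCurve : C(K, E →L[ℝ] F) →L[ℝ] (E →L[ℝ] C(K, F)) :=
  LinearMap.mkContinuous (σ := RingHom.id ℝ)
    { toFun := (linearOfCurveMap : C(K, E →L[ℝ] F) → (E →L[ℝ] C(K, F)))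
      map_add' := fun _ _ => rfl
      map_smul' := fun _ _ => rfl } 1 fun B => by
    refine le_of_le_of_eq ?_ (one_mul ‖B‖).symm
    exact LinearMap.mkContinuous_norm_le _ (norm_nonneg B) (norm_linearOfCurveFun_le B)

/-- A family of smooth functions, continuous together with its derivatives. -/
structure JointSmooth (g : K → E → F) : Prop where
  contDiff : ∀ t, ContDiff ℝ ∞ (g t)
  cont : ∀ n : ℕ, Continuous fun p : K × E => iteratedFDeriv ℝ n (g p.1) p.2

theorem JointSmooth.continuous {g : K → E → F} (hg : JointSmooth g) :
    Continuous fun p : K × E => g p.1 p.2 := by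
  have h := (continuousMultilinearCurryFin0 ℝ E F).continuous.comp (hg.cont 0)
  exact h

theorem JointSmooth.fderiv {g : K → E → F} (hg : JointSmooth g) :
    JointSmooth fun t => fderiv ℝ (g t) := by
  refine ⟨fun t => (hg.contDiff t).fderiv_right (by simp), fun n => ?_⟩
  have h := (continuousMultilinearCurryRightEquiv' ℝ n E F).continuous.comp (hg.cont (n + 1))
  refine h.congr fun p => ?_
  simp only [Function.comp_apply, iteratedFDeriv_succ_eq_comp_right]
  simp

/-- The curve `t ↦ g t x`. -/
def JointSmooth.curve {g : K → E → F} (hg : JointSmooth g) (x : E) : C(K, F) :=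
  ⟨fun t => g t x, hg.continuous.comp (f := fun t => (t, x)) (by fun_prop)⟩

theorem JointSmooth.continuous_curve {g : K → E → F} (hg : JointSmooth g) :
    Continuous hg.curve :=
  (ContinuousMap.curry ⟨fun p : E × K => g p.2 p.1, hg.continuous.comp continuous_swap⟩).continuous

/-- The derivative in `x` is continuous uniformly in `t`, by compactness of `K`, so the mean value
inequality applies for all `t` with the same radius. -/
theorem JointSmooth.hasFDerivAt_curve {g : K → E → F} (hg : JointSmooth g) (x : E) :
    HasFDerivAt hg.curve (linearOfCurve (hg.fderiv.curve x)) x := by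
  rw [hasFDerivAt_iff_isLittleO, Asymptotics.isLittleO_iff]
  intro ε hε
  have h := Metric.continuousAt_iff.1 (hg.fderiv.continuous_curve.continuousAt (x := x)) ε hε
  obtain ⟨δ, hδ, h⟩ := h
  filter_upwards [Metric.ball_mem_nhds x hδ] with y hy
  refine (ContinuousMap.norm_le _ (by positivity)).2 fun t => ?_
  have hb : ∀ z ∈ Metric.ball x δ, ‖_root_.fderiv ℝ (g t) z - _root_.fderiv ℝ (g t) x‖ ≤ ε := by
    intro z hz
    have h1 := h (Metric.mem_ball.1 hz)
    rw [dist_eq_norm] at h1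
    exact (ContinuousMap.norm_coe_le_norm (hg.fderiv.curve z - hg.fderiv.curve x) t).trans h1.le
  exact Convex.norm_image_sub_le_of_norm_hasFDerivWithin_le' (𝕜 := ℝ) (f := g t)
    (fun z _ => (((hg.contDiff t).differentiable (by simp)) z).hasFDerivAt.hasFDerivWithinAt)
    hb (convex_ball x δ) (Metric.mem_ball_self hδ) hy

/-- Induction on the order, with the target `F` replaced by the linear maps from `E` to `F`; for
this reason `F` is generalized. -/
theorem JointSmooth.contDiff_curve {g : K → E → F} (hg : JointSmooth g) :
    ContDiff ℝ ∞ hg.curve := by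
  refine contDiff_infty.2 fun n => ?_
  induction n generalizing F with
  | zero => exact contDiff_zero.2 hg.continuous_curve
  | succ n ih =>
    push_cast
    have h : ContDiff ℝ n fun B : C(K, E →L[ℝ] F) => linearOfCurve B :=
      ContinuousLinearMap.contDiff _
    exact contDiff_succ_iff_hasFDerivAt.2 ⟨fun x => linearOfCurve (hg.fderiv.curve x),
      h.comp (ih hg.fderiv), hg.hasFDerivAt_curve⟩

theorem contDiff_eval {G : E → C(K, F)} (hG : ContDiff ℝ ∞ G) (t : K) :
    ContDiff ℝ ∞ fun x => G x t :=
  (ContinuousMap.evalCLM ℝ t : C(K, F) →L[ℝ] F).contDiff.comp hG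

theorem iteratedFDeriv_eval {G : E → C(K, F)} (hG : ContDiff ℝ ∞ G) (t : K) (n : ℕ) (x : E)
    (v : Fin n → E) : iteratedFDeriv ℝ n (fun y => G y t) x v = iteratedFDeriv ℝ n G x v t := by
  have h := (ContinuousMap.evalCLM ℝ t : C(K, F) →L[ℝ] F).iteratedFDeriv_comp_left
    (hG.contDiffAt (x := x)) (i := n) (by exact_mod_cast le_top)
  have h' := congrArg (fun A => A v) h
  exact h'

/-- Converse of `JointSmooth.contDiff_curve`, by the same induction: the derivative of `G` is read
as a continuous family of linear maps. -/
theorem jointSmooth_of_contDiff {G : E → C(K, F)} (hG : ContDiff ℝ ∞ G) :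
    JointSmooth fun t x => G x t := by
  refine ⟨contDiff_eval hG, fun n => ?_⟩
  induction n generalizing F with
  | zero =>
    have h : Continuous fun p : K × E => G p.2 p.1 :=
      (ContinuousEval.continuous_eval (F := C(K, F))).comp
        ((hG.continuous.comp continuous_snd).prodMk continuous_fst)
    exact (continuousMultilinearCurryFin0 ℝ E F).symm.continuous.comp h
  | succ n ih =>
    have h1 := ih (curveOfLinear.contDiff.comp (hG.fderiv_right (m := ∞) (by simp)))
    have h2 := (continuousMultilinearCurryRightEquiv' ℝ n E F).symm.continuous.comp h1
    refine h2.congr fun p => ?_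
    rw [iteratedFDeriv_succ_eq_comp_right]
    simp only [Function.comp_apply]
    congr 3
    funext y
    have h3 : HasFDerivAt (fun x => G x p.1)
        ((ContinuousMap.evalCLM ℝ p.1 : C(K, F) →L[ℝ] F).comp (fderiv ℝ G y)) y :=
      (ContinuousMap.evalCLM ℝ p.1 : C(K, F) →L[ℝ] F).hasFDerivAt.comp y
        ((hG.differentiable (by simp)) y).hasFDerivAt
    rw [h3.fderiv]
    rfl

theorem norm_iteratedFDeriv_eval_le {G : E → C(K, F)} (hG : ContDiff ℝ ∞ G) (t : K) (n : ℕ)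
    (x : E) : ‖iteratedFDeriv ℝ n (fun y => G y t) x‖ ≤ ‖iteratedFDeriv ℝ n G x‖ := by
  refine ContinuousMultilinearMap.opNorm_le_bound (norm_nonneg _) fun v => ?_
  rw [iteratedFDeriv_eval hG]
  exact (ContinuousMap.norm_coe_le_norm _ t).trans (ContinuousMultilinearMap.le_opNorm _ v)

theorem norm_iteratedFDeriv_le_of_eval {G : E → C(K, F)} (hG : ContDiff ℝ ∞ G) {B : ℝ}
    (hB : 0 ≤ B) (n : ℕ) (x : E) (h : ∀ t, ‖iteratedFDeriv ℝ n (fun y => G y t) x‖ ≤ B) :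
    ‖iteratedFDeriv ℝ n G x‖ ≤ B := by
  refine ContinuousMultilinearMap.opNorm_le_bound hB fun v => ?_
  refine (ContinuousMap.norm_le _ (by positivity)).2 fun t => ?_
  rw [← iteratedFDeriv_eval hG]
  exact (ContinuousMultilinearMap.le_opNorm _ v).trans (by gcongr; exact h t)

end Curves

/-! ### The space `C([0,T]; C^∞)` as smooth functions with values in curves -/

section ContSmooth

variable {d : ℕ} {T : ℝ}

theorem ContSmooth.jointSmooth {g : ℝ → Space d → ℂ} (hg : ContSmooth T g) :
    JointSmooth fun t : Icc (0 : ℝ) T => g t :=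
  ⟨fun t => hg.1 t t.2, fun n => (hg.2 n).comp_continuous
    (f := fun p : Icc (0 : ℝ) T × Space d => ((p.1 : ℝ), p.2)) (by fun_prop)
    fun p => ⟨p.1.2, mem_univ _⟩⟩

theorem JointSmooth.contSmooth (hT : 0 ≤ T) {g : Icc (0 : ℝ) T → Space d → ℂ} (hg : JointSmooth g)
    {h : ℝ → Space d → ℂ} (hgh : ∀ t : Icc (0 : ℝ) T, h t = g t) : ContSmooth T h := by
  refine ⟨fun t ht => by rw [hgh ⟨t, ht⟩]; exact hg.contDiff _, fun n => ?_⟩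
  have h1 : Continuous fun p : ℝ × Space d =>
      iteratedFDeriv ℝ n (g (projIcc 0 T hT p.1)) p.2 :=
    (hg.cont n).comp (((continuous_projIcc (h := hT)).comp continuous_fst).prodMk continuous_snd)
  refine h1.continuousOn.congr fun p hp => ?_
  simp only
  rw [projIcc_of_mem hT hp.1, ← hgh]

end ContSmooth


/-! ### The equation as a Fourier system -/

section System

/-- The space of the data `((u₀, u₁, u₂), f)`. -/
abbrev Data (T : ℝ) : Type := (Fin 3 → ℂ) × C(Icc (0 : ℝ) T, ℂ)

/-- The multi-indices of length at most `3`. -/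
def indices (d : ℕ) : Finset (Fin d → ℕ) := (Finset.range 4).biUnion (multiIndices d)

/-- The coefficients of an equation of order three: `c j α` is bounded if `α = 0` and continuous
otherwise. -/
structure CoefData (d : ℕ) (T : ℝ) where
  /-- the coefficients -/
  c : Fin 3 → (Fin d → ℕ) → ℝ → ℂ
  ess : ∀ j, EssBounded T (c j 0)
  cont : ∀ j α, α ≠ 0 → ContinuousOn (c j α) (Icc 0 T)
  deg : ∀ (j : Fin 3) α, 3 < (j : ℕ) + ∑ i, α i → c j α = 0

namespace CoefData

variable {d : ℕ} {T : ℝ} (P : CoefData d T) (hT : 0 ≤ T)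

/-- The coefficient `c j α` as a continuous function. -/
def coefC (j : Fin 3) (α : Fin d → ℕ) : C(Icc (0 : ℝ) T, ℂ) :=
  open Classical in
  -- The value `0` is a default for a discontinuous coefficient; this can only occur for `α = 0`,
  -- which `system` treats separately.
  if h : ContinuousOn (P.c j α) (Icc 0 T) then
    ⟨fun t => P.c j α t, h.comp_continuous continuous_subtype_val fun t => t.2⟩ else 0

variable {P} in
theorem coefC_apply {j : Fin 3} {α : Fin d → ℕ} (hα : α ≠ 0) (t : Icc (0 : ℝ) T) :
    P.coefC j α t = P.c j α t := by
  rw [coefC, dif_pos (P.cont j α hα)]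
  rfl

/-- The equation, as a system of integral equations for `(u, ∂_t u, ∂_t² u)`. -/
def system : FourierSystem d (Data T) (Sol T) where
  -- The coefficients of terms without space derivatives need not be continuous, so multiplication
  -- by them does not act on continuous curves; they enter through `Q₀`, after an integration in
  -- time.
  A := (indices d).erase 0
  J := ContinuousLinearMap.pi fun j =>
    (ContinuousLinearMap.toSpanSingleton ℂ (1 : C(Icc (0 : ℝ) T, ℂ))).comp
      ((ContinuousLinearMap.proj j).comp (ContinuousLinearMap.fst ℂ _ _)) +
    if j = 2 then (primitive hT).comp (ContinuousLinearMap.snd ℂ _ _) else 0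
  Q₀ := ContinuousLinearMap.pi
    ![(primitive hT).comp (ContinuousLinearMap.proj 1),
      (primitive hT).comp (ContinuousLinearMap.proj 2),
      -∑ j, (volterra hT (P.c j 0) (P.ess j)).comp (ContinuousLinearMap.proj j)]
  q α := (ContinuousLinearMap.inr ℂ _ _).comp
    (-∑ j, (ContinuousLinearMap.mul ℂ _ (P.coefC j α)).comp (ContinuousLinearMap.proj j))

theorem J_apply (g : Fin 3 → ℂ) (h : C(Icc (0 : ℝ) T, ℂ)) (j : Fin 3) (t : Icc (0 : ℝ) T) :
    (P.system hT).J (g, h) j t = g j + if j = 2 then ∫ s in (0 : ℝ)..t, extend hT h s else 0 := by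
  simp only [system, ContinuousLinearMap.coe_pi', add_apply, ContinuousMap.add_apply,
    ContinuousLinearMap.comp_apply, ContinuousLinearMap.toSpanSingleton_apply]
  congr 1
  · simp
  · split_ifs
    · rw [ContinuousLinearMap.comp_apply, primitive_apply]; rfl
    · simp

theorem Q₀_apply_zero (y : Sol T) (t : Icc (0 : ℝ) T) :
    (P.system hT).Q₀ y 0 t = ∫ s in (0 : ℝ)..t, extend hT (y 1) s := primitive_apply hT _ _

theorem Q₀_apply_one (y : Sol T) (t : Icc (0 : ℝ) T) :
    (P.system hT).Q₀ y 1 t = ∫ s in (0 : ℝ)..t, extend hT (y 2) s := primitive_apply hT _ _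

theorem Q₀_apply_two (y : Sol T) (t : Icc (0 : ℝ) T) :
    (P.system hT).Q₀ y 2 t = -∑ j, ∫ s in (0 : ℝ)..t, P.c j 0 s * extend hT (y j) s := by
  have h : (P.system hT).Q₀ y 2 =
    (-∑ j, (volterra hT (P.c j 0) (P.ess j)).comp (ContinuousLinearMap.proj j)) y := rfl
  rw [h]
  simp only [neg_apply, sum_apply, ContinuousMap.neg_apply, ContinuousMap.sum_apply,
    ContinuousLinearMap.comp_apply]
  rfl

theorem q_apply_fst (α : Fin d → ℕ) (y : Sol T) : ((P.system hT).q α y).1 = 0 := rfl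

theorem q_apply_snd {α : Fin d → ℕ} (hα : α ≠ 0) (y : Sol T) (t : Icc (0 : ℝ) T) :
    ((P.system hT).q α y).2 t = -∑ j, P.c j α t * y j t := by
  have h : ((P.system hT).q α y).2 =
    (-∑ j, (ContinuousLinearMap.mul ℂ _ (P.coefC j α)).comp (ContinuousLinearMap.proj j)) y := rfl
  rw [h]
  simp only [neg_apply, sum_apply, ContinuousMap.neg_apply, ContinuousMap.sum_apply,
    ContinuousLinearMap.comp_apply, ContinuousLinearMap.mul_apply', ContinuousMap.mul_apply,
    coefC_apply hα, ContinuousLinearMap.proj_apply]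

theorem intervalIntegrable_rhs (y : Sol T) (h : C(Icc (0 : ℝ) T, ℂ)) :
    IntervalIntegrable (fun s => extend hT h s - ∑ j, P.c j 0 s * extend hT (y j) s) volume 0 T := by
  refine ((continuous_extend hT h).intervalIntegrable 0 T).sub ?_
  have h := IntervalIntegrable.sum (μ := volume) (a := 0) (b := T) Finset.univ
    (f := fun j s => P.c j 0 s * extend hT (y j) s)
    fun j _ => intervalIntegrable_mul_extend hT (P.ess j) (y j)
  exact h.congr fun s _ => by simp

/-- The system, componentwise. -/
theorem eq_J_add_Q₀_iff (y : Sol T) (g : Fin 3 → ℂ) (h : C(Icc (0 : ℝ) T, ℂ)) :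
    y = (P.system hT).J (g, h) + (P.system hT).Q₀ y ↔ ∀ t : Icc (0 : ℝ) T,
      y 0 t = g 0 + ∫ s in (0 : ℝ)..t, extend hT (y 1) s ∧
      y 1 t = g 1 + ∫ s in (0 : ℝ)..t, extend hT (y 2) s ∧
      y 2 t = g 2 + ∫ s in (0 : ℝ)..t, (extend hT h s - ∑ j, P.c j 0 s * extend hT (y j) s) := by
  have e : ∀ t : Icc (0 : ℝ) T,
      ∫ s in (0 : ℝ)..t, (extend hT h s - ∑ j, P.c j 0 s * extend hT (y j) s) =
      (∫ s in (0 : ℝ)..t, extend hT h s) - ∑ j, ∫ s in (0 : ℝ)..t, P.c j 0 s * extend hT (y j) s := by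
    intro t
    have i2 : ∀ j ∈ (Finset.univ : Finset (Fin 3)),
        IntervalIntegrable (fun s => P.c j 0 s * extend hT (y j) s) volume 0 t := fun j _ =>
      intervalIntegrable_left (intervalIntegrable_mul_extend hT (P.ess j) (y j)) t.2
    rw [intervalIntegral.integral_sub ((continuous_extend hT h).intervalIntegrable _ _),
      intervalIntegral.integral_finsetSum i2]
    have h3 := IntervalIntegrable.sum Finset.univ i2
    exact h3.congr fun s _ => by simp
  constructor
  · intro hy t
    refine ⟨?_, ?_, ?_⟩
    · have := congrArg (fun z : Sol T => z 0 t) hy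
      simpa [J_apply, Q₀_apply_zero] using this
    · have := congrArg (fun z : Sol T => z 1 t) hy
      simpa [J_apply, Q₀_apply_one] using this
    · have := congrArg (fun z : Sol T => z 2 t) hy
      simp only [Pi.add_apply, ContinuousMap.add_apply, J_apply, Q₀_apply_two, if_true] at this
      rw [this, e t]
      ring
  · intro hy
    funext j
    ext t
    obtain ⟨h0, h1, h2⟩ := hy t
    rw [Pi.add_apply, ContinuousMap.add_apply, J_apply]
    fin_cases j
    · simpa [Q₀_apply_zero] using h0
    · simpa [Q₀_apply_one] using h1
    · change y 2 t = _ + (P.system hT).Q₀ y 2 t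
      rw [h2, e t, Q₀_apply_two]
      simp
      ring

end CoefData

end System

/-! ### Primitives of integrable functions -/

section Primitive

variable {T : ℝ}

theorem intervalIntegrable_clm_comp {F G : Type*} [NormedAddCommGroup F] [NormedSpace ℝ F]
    [NormedAddCommGroup G] [NormedSpace ℝ G] (L : F →L[ℝ] G) {φ : ℝ → F} {a b : ℝ}
    (hφ : IntervalIntegrable φ volume a b) : IntervalIntegrable (fun s => L (φ s)) volume a b :=
  ⟨L.integrable_comp hφ.1, L.integrable_comp hφ.2⟩

theorem absolutelyContinuousOnInterval_integral (hT : 0 ≤ T) {φ : ℝ → ℂ}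
    (hφ : IntervalIntegrable φ volume 0 T) (c : ℂ) :
    AbsolutelyContinuousOnInterval (fun t => c + ∫ s in (0 : ℝ)..t, φ s) 0 T := by
  have hre := IntervalIntegrable.absolutelyContinuousOnInterval_intervalIntegral
    (f := fun s => (φ s).re) (a := 0) (b := T) (c := 0)
    (intervalIntegrable_clm_comp Complex.reCLM hφ) left_mem_uIcc
  have him := IntervalIntegrable.absolutelyContinuousOnInterval_intervalIntegral
    (f := fun s => (φ s).im) (a := 0) (b := T) (c := 0)
    (intervalIntegrable_clm_comp Complex.imCLM hφ) left_mem_uIcc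
  have h := (absolutelyContinuousOnInterval_const c 0 T).fun_add
    ((absolutelyContinuousOnInterval_ofReal hre).fun_add (absolutelyContinuousOnInterval_mul
      (absolutelyContinuousOnInterval_const Complex.I 0 T)
      (absolutelyContinuousOnInterval_ofReal him)))
  refine absolutelyContinuousOnInterval_congr h fun t ht => ?_
  rw [uIcc_of_le hT] at ht
  have i := intervalIntegrable_left hφ ht
  have e1 := Complex.reCLM.intervalIntegral_comp_comm i
  have e2 := Complex.imCLM.intervalIntegral_comp_comm i
  simp only [Complex.reCLM_apply, Complex.imCLM_apply] at e1 e2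
  rw [e1, e2, mul_comm Complex.I, Complex.re_add_im]

theorem ae_hasDerivAt_integral (hT : 0 ≤ T) {φ : ℝ → ℂ}
    (hφ : IntervalIntegrable φ volume 0 T) (c : ℂ) :
    ∀ᵐ t, t ∈ Ioo 0 T → HasDerivAt (fun t => c + ∫ s in (0 : ℝ)..t, φ s) (φ t) t := by
  filter_upwards [hφ.ae_hasDerivAt_integral] with t ht hmem
  rw [uIcc_of_le hT] at ht
  exact (ht (Ioo_subset_Icc_self hmem) 0 (left_mem_Icc.2 hT)).const_add c

/-- The difference of `u` and the primitive is absolutely continuous with derivative zero almost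
everywhere, hence constant. -/
theorem eq_integral_of_ae_hasDerivAt (hT : 0 ≤ T) {φ u : ℝ → ℂ}
    (hφ : IntervalIntegrable φ volume 0 T) (hu : AbsolutelyContinuousOnInterval u 0 T)
    (hd : ∀ᵐ t, t ∈ Ioo 0 T → HasDerivAt u (φ t) t) {t : ℝ} (ht : t ∈ Icc 0 T) :
    u t = u 0 + ∫ s in (0 : ℝ)..t, φ s := by
  have h1 := hu.fun_sub (absolutelyContinuousOnInterval_integral hT hφ (u 0))
  have h2 := h1.const_of_ae_hasDerivAt_zero (by
    have hne : ∀ᵐ t : ℝ, t ≠ 0 ∧ t ≠ T := by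
      have h0 : ∀ᵐ t : ℝ, t ≠ 0 := Measure.ae_ne volume 0
      have hT' : ∀ᵐ t : ℝ, t ≠ T := Measure.ae_ne volume T
      filter_upwards [h0, hT'] with t a b using ⟨a, b⟩
    filter_upwards [hd, ae_hasDerivAt_integral hT hφ (u 0), hne] with s hs hs' hn hmem
    rw [uIcc_of_le hT] at hmem
    have hI : s ∈ Ioo 0 T := ⟨lt_of_le_of_ne hmem.1 (Ne.symm hn.1), lt_of_le_of_ne hmem.2 hn.2⟩
    simpa using (hs hI).fun_sub (hs' hI))
  obtain ⟨C, hC⟩ := h2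
  have e1 := hC t (by rwa [uIcc_of_le hT])
  have e2 := hC 0 (by rw [uIcc_of_le hT]; exact left_mem_Icc.2 hT)
  simp only [intervalIntegral.integral_same] at e1 e2
  rw [← sub_eq_zero, e1, ← e2]
  ring

theorem hasDerivWithinAt_of_integral {φ u : ℝ → ℂ} (hφ : Continuous φ) {c : ℂ}
    (hu : ∀ t ∈ Icc 0 T, u t = c + ∫ s in (0 : ℝ)..t, φ s) {t : ℝ} (ht : t ∈ Icc 0 T) :
    HasDerivWithinAt u (φ t) (Icc 0 T) t :=
  (((hφ.integral_hasStrictDerivAt 0 t).hasDerivAt.const_add c).hasDerivWithinAt).congr hu (hu t ht)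

theorem eq_integral_of_hasDerivWithinAt {φ u : ℝ → ℂ} (hT : 0 ≤ T)
    (hφ : ContinuousOn φ (Icc 0 T))
    (hu : ∀ t ∈ Icc 0 T, HasDerivWithinAt u (φ t) (Icc 0 T) t) {t : ℝ} (ht : t ∈ Icc 0 T) :
    u t = u 0 + ∫ s in (0 : ℝ)..t, φ s := by
  refine eq_integral_of_ae_hasDerivAt hT (ContinuousOn.intervalIntegrable (by rwa [uIcc_of_le hT]))
    (absolutelyContinuousOnInterval_of_hasDerivWithinAt hT hu hφ)
    (Filter.Eventually.of_forall fun s hs => ?_) ht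
  exact (hu s (Ioo_subset_Icc_self hs)).hasDerivAt (Icc_mem_nhds hs.1 hs.2)

end Primitive


/-! ### Solvability at complex frequencies -/

theorem norm_freqMonomial_le {d : ℕ} (α : Fin d → ℕ) (ζ : Fin d → ℂ) :
    ‖freqMonomial α ζ‖ ≤ (1 + 2 * Real.pi * ‖ζ‖) ^ ∑ i, α i := by
  rw [freqMonomial, norm_prod, ← Finset.prod_pow_eq_pow_sum]
  refine Finset.prod_le_prod (fun i _ => norm_nonneg _) fun i _ => ?_
  rw [norm_pow]
  gcongr
  have h : ‖ζ i‖ ≤ ‖ζ‖ := norm_le_pi_norm ζ i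
  have h' : ‖2 * (Real.pi : ℂ) * Complex.I * ζ i‖ = 2 * Real.pi * ‖ζ i‖ := by
    simp [abs_of_pos Real.pi_pos]
  rw [h']
  nlinarith [Real.pi_pos]

namespace CoefData

variable {d : ℕ} {T : ℝ} (P : CoefData d T) (hT : 0 ≤ T)

/-- The terms with space derivatives, at the frequency `ζ`. -/
def freqSource (ζ : Fin d → ℂ) (y : Sol T) : C(Icc (0 : ℝ) T, ℂ) :=
  ∑ α ∈ (indices d).erase 0, freqMonomial α ζ • ((P.system hT).q α y).2

theorem sum_q (ζ : Fin d → ℂ) (y : Sol T) :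
    ∑ α ∈ (P.system hT).A, freqMonomial α ζ • (P.system hT).q α y = (0, P.freqSource hT ζ y) := by
  refine Prod.ext ?_ ?_
  · rw [Prod.fst_sum]
    exact Finset.sum_eq_zero fun α _ => smul_zero _
  · rw [Prod.snd_sum]
    rfl

theorem W_eq (ζ : Fin d → ℂ) (y : Sol T) : (P.system hT).W ζ y =
    (P.system hT).J (0, P.freqSource hT ζ y) + (P.system hT).Q₀ y := by
  rw [FourierSystem.W_apply, sum_q, add_comm]

theorem q_apply_snd' (α : Fin d → ℕ) (y : Sol T) (t : Icc (0 : ℝ) T) :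
    ((P.system hT).q α y).2 t = -∑ j, P.coefC j α t * y j t := by
  have h : ((P.system hT).q α y).2 =
    (-∑ j, (ContinuousLinearMap.mul ℂ _ (P.coefC j α)).comp (ContinuousLinearMap.proj j)) y := rfl
  rw [h]
  simp only [neg_apply, sum_apply, ContinuousMap.neg_apply, ContinuousMap.sum_apply,
    ContinuousLinearMap.comp_apply, ContinuousLinearMap.mul_apply', ContinuousMap.mul_apply,
    ContinuousLinearMap.proj_apply]

/-- A bound of the continuous coefficients. -/
def coefBound : ℝ := ∑ α ∈ (indices d).erase 0, ∑ j, ‖P.coefC j α‖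

theorem coefBound_nonneg : 0 ≤ P.coefBound :=
  Finset.sum_nonneg fun _ _ => Finset.sum_nonneg fun _ _ => norm_nonneg _

theorem coefC_eq_zero {j : Fin 3} {α : Fin d → ℕ} (h : 3 < (j : ℕ) + ∑ i, α i) :
    P.coefC j α = 0 := by
  unfold coefC
  split_ifs with h1
  · ext t
    simp [P.deg j α h]
  · rfl

/-- A coefficient of `∂_t^j ∂_x^α` can only be nonzero if `|α| ≤ 3 - j`, so its monomial is at most
`r · r^(2-j)`. In the norm with the weights `r^(2-j)` only one factor `r` is lost, which keeps the
growth linear in `‖ζ‖` inside the exponential. -/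
theorem norm_freqSource_le (ζ : Fin d → ℂ) (y : Sol T) (s : Icc (0 : ℝ) T) {r φ : ℝ}
    (hr : r = 1 + 2 * Real.pi * ‖ζ‖) (hφ : ∀ j : Fin 3, r ^ (2 - (j : ℕ)) * ‖y j s‖ ≤ φ) :
    ‖P.freqSource hT ζ y s‖ ≤ r * P.coefBound * φ := by
  have hr1 : 1 ≤ r := by rw [hr]; have := Real.pi_pos; nlinarith [mul_nonneg this.le (norm_nonneg ζ)]
  have hr0 : 0 ≤ r := by linarith
  rw [freqSource, ContinuousMap.sum_apply, coefBound, Finset.mul_sum, Finset.sum_mul]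
  refine (norm_sum_le _ _).trans (Finset.sum_le_sum fun α _ => ?_)
  rw [ContinuousMap.smul_apply, norm_smul, q_apply_snd', norm_neg, Finset.mul_sum, Finset.sum_mul]
  refine (mul_le_mul_of_nonneg_left (norm_sum_le _ _) (norm_nonneg _)).trans ?_
  rw [Finset.mul_sum]
  refine Finset.sum_le_sum fun j _ => ?_
  by_cases h : 3 < (j : ℕ) + ∑ i, α i
  · rw [P.coefC_eq_zero h]
    simp
  · rw [norm_mul]
    have h1 : ‖freqMonomial α ζ‖ ≤ r * r ^ (2 - (j : ℕ)) := by
      refine (norm_freqMonomial_le α ζ).trans ?_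
      rw [← hr, ← pow_succ']
      refine pow_le_pow_right₀ hr1 ?_
      have := j.2
      omega
    have h2 := (P.coefC j α).norm_coe_le_norm s
    calc ‖freqMonomial α ζ‖ * (‖P.coefC j α s‖ * ‖y j s‖)
        ≤ (r * r ^ (2 - (j : ℕ))) * (‖P.coefC j α‖ * ‖y j s‖) := by gcongr
      _ = r * ‖P.coefC j α‖ * (r ^ (2 - (j : ℕ)) * ‖y j s‖) := by ring
      _ ≤ r * ‖P.coefC j α‖ * φ := by gcongr; exact hφ j

theorem norm_integral_extend_le {g : C(Icc (0 : ℝ) T, ℂ)} {φ : ℝ → ℝ}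
    (hφ : ContinuousOn φ (Icc 0 T)) (hg : ∀ s, ‖g s‖ ≤ φ s) {t : ℝ} (ht : t ∈ Icc 0 T) :
    ‖∫ s in (0 : ℝ)..t, extend hT g s‖ ≤ ∫ s in (0 : ℝ)..t, φ s := by
  have h := norm_integral_mul_extend_le hT (c := fun _ => 1) zero_le_one
    (Filter.Eventually.of_forall fun s => by simp) hφ hg ht
  simpa using h

/-- A bound of the coefficients without space derivatives. -/
theorem exists_essBound : ∃ K : ℝ, 0 ≤ K ∧ ∀ (y : Sol T) (φ : ℝ → ℝ), ContinuousOn φ (Icc 0 T) →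
    (∀ j s, ‖y j s‖ ≤ φ s) → ∀ t ∈ Icc 0 T,
      ‖∑ j, ∫ s in (0 : ℝ)..t, P.c j 0 s * extend hT (y j) s‖ ≤ K * ∫ s in (0 : ℝ)..t, φ s := by
  choose K hK0 hK using fun j => (P.ess j).bdd
  refine ⟨∑ j, K j, Finset.sum_nonneg fun j _ => hK0 j, fun y φ hφ hy t ht => ?_⟩
  rw [Finset.sum_mul]
  exact (norm_sum_le _ _).trans (Finset.sum_le_sum fun j _ =>
    norm_integral_mul_extend_le hT (hK0 j) (hK j) hφ (hy j) ht)

/-- At a fixed frequency all terms involve an integration in time; the constant may depend on `ζ` in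
any way, so crude bounds suffice. -/
theorem isUnit_one_sub_W (ζ : Fin d → ℂ) : IsUnit (1 - (P.system hT).W ζ) := by
  obtain ⟨K, hK0, hK⟩ := P.exists_essBound hT
  set r := 1 + 2 * Real.pi * ‖ζ‖ with hr
  have hr1 : 1 ≤ r := by have := Real.pi_pos; nlinarith [mul_nonneg this.le (norm_nonneg ζ)]
  have hc := P.coefBound_nonneg
  refine IsVolterra.isUnit hT (K := 1 + r * P.coefBound * r ^ 2 + K) (by positivity) ?_
  intro y φ hφ hy j t
  have hI0 : 0 ≤ ∫ s in (0 : ℝ)..t, φ s := intervalIntegral.integral_nonneg t.2.1 fun s hs =>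
    (norm_nonneg _).trans (hy 0 ⟨s, hs.1, hs.2.trans t.2.2⟩)
  have hbig : ∫ s in (0 : ℝ)..t, φ s ≤
      (1 + r * P.coefBound * r ^ 2 + K) * ∫ s in (0 : ℝ)..t, φ s := by
    refine le_mul_of_one_le_left hI0 ?_
    have : 0 ≤ r * P.coefBound * r ^ 2 := by positivity
    linarith
  rw [W_eq, Pi.add_apply, ContinuousMap.add_apply, J_apply, Pi.zero_apply, zero_add]
  fin_cases j
  · refine le_trans ?_ hbig
    simpa [Q₀_apply_zero] using norm_integral_extend_le hT hφ (hy 1) t.2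
  · refine le_trans ?_ hbig
    simpa [Q₀_apply_one] using norm_integral_extend_le hT hφ (hy 2) t.2
  · simp only [Fin.reduceFinMk, if_true]
    rw [Q₀_apply_two]
    have h1 : ‖∫ s in (0 : ℝ)..t, extend hT (P.freqSource hT ζ y) s‖ ≤
        ∫ s in (0 : ℝ)..t, r * P.coefBound * r ^ 2 * φ s := by
      refine norm_integral_extend_le hT (φ := fun s => r * P.coefBound * r ^ 2 * φ s)
        (continuousOn_const.mul hφ) (fun s => ?_) t.2
      rw [mul_assoc (r * P.coefBound)]
      refine P.norm_freqSource_le hT ζ y s hr fun j => ?_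
      refine mul_le_mul (pow_le_pow_right₀ hr1 (by omega)) (hy j s) (norm_nonneg _) (by positivity)
    rw [intervalIntegral.integral_const_mul] at h1
    have h2 := hK y φ hφ hy t t.2
    refine (norm_add_le _ _).trans ?_
    rw [norm_neg]
    linarith

/-- A solution at the frequency `ζ`, componentwise. -/
theorem R_components (ζ : Fin d → ℂ) (D : Data T) (t : Icc (0 : ℝ) T) :
    let y := (P.system hT).R ζ D
    y 0 t = D.1 0 + ∫ s in (0 : ℝ)..t, extend hT (y 1) s ∧
    y 1 t = D.1 1 + ∫ s in (0 : ℝ)..t, extend hT (y 2) s ∧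
    y 2 t = D.1 2 + ∫ s in (0 : ℝ)..t, (extend hT (D.2 + P.freqSource hT ζ y) s
      - ∑ j, P.c j 0 s * extend hT (y j) s) := by
  intro y
  have h : y - (P.system hT).W ζ y = (P.system hT).J D := by
    have h := Ring.mul_inverse_cancel _ (P.isUnit_one_sub_W hT ζ)
    have h' := congrArg (fun L : Sol T →L[ℂ] Sol T => L ((P.system hT).J D)) h
    exact h'
  have h2 : y = (P.system hT).J (D.1, D.2 + P.freqSource hT ζ y) + (P.system hT).Q₀ y := by
    rw [sub_eq_iff_eq_add, W_eq, ← add_assoc, ← map_add] at h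
    have e : D + (0, P.freqSource hT ζ y) = (D.1, D.2 + P.freqSource hT ζ y) := by
      ext <;> simp
    rw [e] at h
    exact h
  exact (P.eq_J_add_Q₀_iff hT y _ _).1 h2 t

/-- Gronwall's inequality for `r²|y₀| + r|y₁| + |y₂|`, where the equation costs one factor `r`. An
exponent linear in `‖ζ‖` is what the contour shift requires. -/
theorem exp_bound : ∃ C B : ℝ, 0 ≤ C ∧ 0 ≤ B ∧
    ∀ ζ, ‖(P.system hT).R ζ‖ ≤ C * Real.exp (B * ‖ζ‖) := by
  obtain ⟨K, hK0, hK⟩ := P.exists_essBound hT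
  have hc := P.coefBound_nonneg
  -- The two units come from the equations `y₀' = y₁` and `y₁' = y₂` in the weighted norm, the rest
  -- from the third equation.
  set b₀ : ℝ := 2 + P.coefBound + K with hb₀
  refine ⟨2 * (3 + T) * Real.exp (2 + 2 * b₀ * T), (2 + 2 * b₀ * T) * (2 * Real.pi), by positivity,
    by positivity, fun ζ => ?_⟩
  set r := 1 + 2 * Real.pi * ‖ζ‖ with hr
  have hr1 : 1 ≤ r := by have := Real.pi_pos; nlinarith [mul_nonneg this.le (norm_nonneg ζ)]
  have key : ∀ D : Data T, ‖(P.system hT).R ζ D‖ ≤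
      2 * ((3 + T) * r ^ 2 * ‖D‖) * Real.exp (2 * (r * b₀) * T) := by
    intro D
    set y := (P.system hT).R ζ D with hy
    set φ : ℝ → ℝ := fun s => r ^ 2 * ‖extend hT (y 0) s‖ + r * ‖extend hT (y 1) s‖
      + ‖extend hT (y 2) s‖ with hφ
    have hφc : Continuous φ := by
      have h0 := continuous_extend hT (y 0)
      have h1 := continuous_extend hT (y 1)
      have h2 := continuous_extend hT (y 2)
      fun_prop
    have hφ0 : ∀ s, 0 ≤ φ s := fun s => by positivity
    have hφe : ∀ s : Icc (0 : ℝ) T, φ s = r ^ 2 * ‖y 0 s‖ + r * ‖y 1 s‖ + ‖y 2 s‖ := fun s => by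
      simp only [hφ, extend_of_mem hT _ s.2]
    have hw : ∀ (j : Fin 3) (s : Icc (0 : ℝ) T), r ^ (2 - (j : ℕ)) * ‖y j s‖ ≤ φ s := by
      intro j s
      rw [hφe]
      have n0 : 0 ≤ r ^ 2 * ‖y 0 s‖ := by positivity
      have n1 : 0 ≤ r * ‖y 1 s‖ := by positivity
      have n2 : 0 ≤ ‖y 2 s‖ := by positivity
      fin_cases j
      · change r ^ 2 * ‖y 0 s‖ ≤ _; linarith
      · change r ^ 1 * ‖y 1 s‖ ≤ _; rw [pow_one]; linarith
      · change r ^ 0 * ‖y 2 s‖ ≤ _; rw [pow_zero, one_mul]; linarith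
    have hyφ : ∀ (j : Fin 3) (s : Icc (0 : ℝ) T), ‖y j s‖ ≤ φ s := fun j s =>
      (le_mul_of_one_le_left (norm_nonneg _) (one_le_pow₀ hr1)).trans (hw j s)
    have hD1 : ∀ j, ‖D.1 j‖ ≤ ‖D‖ := fun j => (norm_le_pi_norm D.1 j).trans (norm_fst_le D)
    have hD2 : ∀ s, ‖D.2 s‖ ≤ ‖D‖ := fun s => (D.2.norm_coe_le_norm s).trans (norm_snd_le D)
    have hineq : ∀ t ∈ Icc 0 T, φ t ≤ (3 + T) * r ^ 2 * ‖D‖ + r * b₀ * ∫ s in (0 : ℝ)..t, φ s := by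
      intro t ht
      obtain ⟨e0, e1, e2⟩ := P.R_components hT ζ D ⟨t, ht⟩
      rw [← hy] at e0 e1 e2
      set I := ∫ s in (0 : ℝ)..t, φ s with hI
      have hI0 : 0 ≤ I := intervalIntegral.integral_nonneg ht.1 fun s _ => hφ0 s
      have b0 : r * ‖∫ s in (0 : ℝ)..t, extend hT (y 1) s‖ ≤ I := by
        have h := norm_integral_extend_le hT (g := y 1) (φ := fun s => r⁻¹ * φ s) (by fun_prop)
          (fun s => by rw [← div_eq_inv_mul, le_div_iff₀' (by linarith)]; simpa using hw 1 s) ht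
        rw [intervalIntegral.integral_const_mul, ← div_eq_inv_mul,
          le_div_iff₀' (by linarith)] at h
        exact h
      have b1 : ‖∫ s in (0 : ℝ)..t, extend hT (y 2) s‖ ≤ I :=
        norm_integral_extend_le hT hφc.continuousOn (hyφ 2) ht
      have b2 : ‖∫ s in (0 : ℝ)..t, extend hT D.2 s‖ ≤ T * ‖D‖ := by
        have h := norm_integral_extend_le hT (g := D.2) (φ := fun _ => ‖D‖) (by fun_prop) hD2 ht
        rw [intervalIntegral.integral_const, smul_eq_mul, sub_zero] at h
        exact h.trans (mul_le_mul_of_nonneg_right ht.2 (norm_nonneg _))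
      have b3 : ‖∫ s in (0 : ℝ)..t, extend hT (P.freqSource hT ζ y) s‖ ≤
          r * P.coefBound * I := by
        have h := norm_integral_extend_le hT (g := P.freqSource hT ζ y)
          (φ := fun s => r * P.coefBound * φ s) (by fun_prop)
          (fun s => P.norm_freqSource_le hT ζ y s hr fun j => hw j s) ht
        rwa [intervalIntegral.integral_const_mul] at h
      have b4 := hK y φ hφc.continuousOn hyφ t ht
      have e2' : y 2 ⟨t, ht⟩ = D.1 2 + ((∫ s in (0 : ℝ)..t, extend hT D.2 s)
          + (∫ s in (0 : ℝ)..t, extend hT (P.freqSource hT ζ y) s)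
          - ∑ j, ∫ s in (0 : ℝ)..t, P.c j 0 s * extend hT (y j) s) := by
        rw [e2]
        congr 1
        have i2 : ∀ j ∈ (Finset.univ : Finset (Fin 3)),
            IntervalIntegrable (fun s => P.c j 0 s * extend hT (y j) s) volume 0 t := fun j _ =>
          intervalIntegrable_left (intervalIntegrable_mul_extend hT (P.ess j) (y j)) ht
        have i3 : IntervalIntegrable (fun s => ∑ j, P.c j 0 s * extend hT (y j) s) volume 0 t :=
          (IntervalIntegrable.sum Finset.univ i2).congr fun s _ => by simp
        rw [intervalIntegral.integral_sub ((continuous_extend hT _).intervalIntegrable _ _) i3,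
          intervalIntegral.integral_finsetSum i2, ← intervalIntegral.integral_add
          ((continuous_extend hT _).intervalIntegrable _ _)
          ((continuous_extend hT _).intervalIntegrable _ _)]
        rfl
      have n0 : ‖y 0 ⟨t, ht⟩‖ ≤ ‖D‖ + ‖∫ s in (0 : ℝ)..t, extend hT (y 1) s‖ := by
        rw [e0]; exact (norm_add_le _ _).trans (by gcongr; exact hD1 0)
      have n1 : ‖y 1 ⟨t, ht⟩‖ ≤ ‖D‖ + I := by
        rw [e1]; exact (norm_add_le _ _).trans (add_le_add (hD1 1) b1)
      have n2 : ‖y 2 ⟨t, ht⟩‖ ≤ ‖D‖ + (T * ‖D‖ + r * P.coefBound * I + K * I) := by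
        rw [e2']
        refine (norm_add_le _ _).trans (add_le_add (hD1 2) ((norm_sub_le _ _).trans
          (add_le_add ((norm_add_le _ _).trans (add_le_add b2 b3)) b4)))
      have hφt := hφe ⟨t, ht⟩
      simp only at hφt
      rw [hφt]
      have hr2 : r ≤ r ^ 2 := by nlinarith
      have m0 : r ^ 2 * ‖y 0 ⟨t, ht⟩‖ ≤ r ^ 2 * ‖D‖ + r * I := by
        calc r ^ 2 * ‖y 0 ⟨t, ht⟩‖ ≤ r ^ 2 * (‖D‖ + ‖∫ s in (0 : ℝ)..t, extend hT (y 1) s‖) := by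
              gcongr
          _ = r ^ 2 * ‖D‖ + r * (r * ‖∫ s in (0 : ℝ)..t, extend hT (y 1) s‖) := by ring
          _ ≤ _ := by gcongr
      have m1 : r * ‖y 1 ⟨t, ht⟩‖ ≤ r ^ 2 * ‖D‖ + r * I := by
        calc r * ‖y 1 ⟨t, ht⟩‖ ≤ r * (‖D‖ + I) := by gcongr
          _ = r * ‖D‖ + r * I := by ring
          _ ≤ _ := by gcongr
      have m2 : ‖D‖ + T * ‖D‖ ≤ (1 + T) * r ^ 2 * ‖D‖ := by
        have : 1 ≤ r ^ 2 := one_le_pow₀ hr1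
        calc ‖D‖ + T * ‖D‖ = (1 + T) * 1 * ‖D‖ := by ring
          _ ≤ _ := by gcongr
      have m3 : K * I ≤ r * K * I := by
        have : K * I ≤ r * (K * I) := le_mul_of_one_le_left (by positivity) hr1
        linarith
      rw [hb₀]
      nlinarith
    have hgr : ∀ t ∈ Icc 0 T, φ t ≤ 2 * ((3 + T) * r ^ 2 * ‖D‖) * Real.exp (2 * (r * b₀) * T) :=
      fun t ht => le_of_integral_ineq hT (by positivity) (by positivity) hφc.continuousOn
        (fun s _ => hφ0 s) hineq ht
    refine (pi_norm_le_iff_of_nonneg (by positivity)).2 fun j => ?_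
    exact (ContinuousMap.norm_le _ (by positivity)).2 fun t => (hyφ j t).trans (hgr t t.2)
  refine ContinuousLinearMap.opNorm_le_bound _ (by positivity) fun D => (key D).trans ?_
  -- The factor `r²` lost in passing to the weighted norm of the initial data goes into the
  -- exponential.
  have hr2 : r ^ 2 ≤ Real.exp (2 * r) := by
    have h1 : r ≤ Real.exp r := by linarith [Real.add_one_le_exp r]
    calc r ^ 2 ≤ Real.exp r ^ 2 := by gcongr
      _ = Real.exp (2 * r) := by rw [← Real.exp_nat_mul]; norm_num
  calc 2 * ((3 + T) * r ^ 2 * ‖D‖) * Real.exp (2 * (r * b₀) * T)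
      ≤ 2 * ((3 + T) * Real.exp (2 * r) * ‖D‖) * Real.exp (2 * (r * b₀) * T) := by gcongr
    _ = 2 * (3 + T) * (Real.exp (2 * r) * Real.exp (2 * (r * b₀) * T)) * ‖D‖ := by ring
    _ = 2 * (3 + T) * (Real.exp (2 + 2 * b₀ * T) *
        Real.exp ((2 + 2 * b₀ * T) * (2 * Real.pi) * ‖ζ‖)) * ‖D‖ := by
      rw [← Real.exp_add, ← Real.exp_add]
      congr 3
      rw [hr]
      ring
    _ = _ := by ring

end CoefData


/-! ### The coefficients of the equation -/

section Coefficients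

variable {d : ℕ}

/-- The coefficient of `∂_t^j ∂_x^α`. -/
def coef (a : Coeffs d ℝ) (b : Coeffs d ℂ) (j : ℕ) (α : Fin d → ℕ) (t : ℝ) : ℂ :=
  if j + ∑ i, α i = 3 then (a j α t : ℂ) else if j + ∑ i, α i < 3 then b j α t else 0

theorem mem_multiIndices {k : ℕ} {α : Fin d → ℕ} : α ∈ multiIndices d k ↔ ∑ i, α i = k := by
  simp [multiIndices, Finset.mem_piAntidiag]

theorem sum_indices (F : (Fin d → ℕ) → ℂ) :
    ∑ α ∈ indices d, F α = ∑ k ∈ Finset.range 4, ∑ α ∈ multiIndices d k, F α := by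
  refine Finset.sum_biUnion fun k _ l _ hkl => ?_
  refine Finset.disjoint_left.2 fun α hα hα' => hkl ?_
  rw [← mem_multiIndices.1 hα, ← mem_multiIndices.1 hα']

theorem sum_coef_of_lt (a : Coeffs d ℝ) (b : Coeffs d ℂ) (t : ℝ) (F : (Fin d → ℕ) → ℂ) {j k : ℕ}
    (h : j + k < 3) : ∑ α ∈ multiIndices d k, coef a b j α t * F α =
      ∑ α ∈ multiIndices d k, b j α t * F α := by
  refine Finset.sum_congr rfl fun α hα => ?_
  have := mem_multiIndices.1 hα
  rw [coef, if_neg (by omega), if_pos (by omega)]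

theorem sum_coef_of_eq (a : Coeffs d ℝ) (b : Coeffs d ℂ) (t : ℝ) (F : (Fin d → ℕ) → ℂ) {j k : ℕ}
    (h : j + k = 3) : ∑ α ∈ multiIndices d k, coef a b j α t * F α =
      ∑ α ∈ multiIndices d k, (a j α t : ℂ) * F α := by
  refine Finset.sum_congr rfl fun α hα => ?_
  have := mem_multiIndices.1 hα
  rw [coef, if_pos (by omega)]

theorem sum_coef_of_gt (a : Coeffs d ℝ) (b : Coeffs d ℂ) (t : ℝ) (F : (Fin d → ℕ) → ℂ) {j k : ℕ}
    (h : 3 < j + k) : ∑ α ∈ multiIndices d k, coef a b j α t * F α = 0 := by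
  refine Finset.sum_eq_zero fun α hα => ?_
  have := mem_multiIndices.1 hα
  rw [coef, if_neg (by omega), if_neg (by omega), zero_mul]

theorem sum_coef (a : Coeffs d ℝ) (b : Coeffs d ℂ) (t : ℝ) (F : ℕ → (Fin d → ℕ) → ℂ) :
    ∑ j : Fin 3, ∑ α ∈ indices d, coef a b j α t * F j α =
      ∑ j ∈ Finset.range 3, ∑ α ∈ multiIndices d (3 - j), (a j α t : ℂ) * F j α
      + ∑ j ∈ Finset.range 3, ∑ k ∈ Finset.range (3 - j), ∑ α ∈ multiIndices d k,
          b j α t * F j α := by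
  rw [Fin.sum_univ_eq_sum_range (fun j => ∑ α ∈ indices d, coef a b j α t * F j α) 3]
  simp only [sum_indices, Finset.sum_range_succ, Finset.sum_range_zero, zero_add, tsub_zero,
    Nat.reduceSub]
  rw [sum_coef_of_lt a b t (F 0) (j := 0) (k := 0) (by norm_num),
    sum_coef_of_lt a b t (F 0) (j := 0) (k := 1) (by norm_num),
    sum_coef_of_lt a b t (F 0) (j := 0) (k := 2) (by norm_num),
    sum_coef_of_eq a b t (F 0) (j := 0) (k := 3) (by norm_num),
    sum_coef_of_lt a b t (F 1) (j := 1) (k := 0) (by norm_num),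
    sum_coef_of_lt a b t (F 1) (j := 1) (k := 1) (by norm_num),
    sum_coef_of_eq a b t (F 1) (j := 1) (k := 2) (by norm_num),
    sum_coef_of_gt a b t (F 1) (j := 1) (k := 3) (by norm_num),
    sum_coef_of_lt a b t (F 2) (j := 2) (k := 0) (by norm_num),
    sum_coef_of_eq a b t (F 2) (j := 2) (k := 1) (by norm_num),
    sum_coef_of_gt a b t (F 2) (j := 2) (k := 2) (by norm_num),
    sum_coef_of_gt a b t (F 2) (j := 2) (k := 3) (by norm_num)]
  ring

theorem operator_eq (T : ℝ) (a : Coeffs d ℝ) (b : Coeffs d ℂ) (u : ℝ → Space d → ℂ) (t : ℝ)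
    (x : Space d) : operator T a b u t x = tDeriv T 3 u t x
      + ∑ j : Fin 3, ∑ α ∈ indices d, coef a b j α t * multiDeriv α (tDeriv T j u t) x := by
  rw [sum_coef a b t fun j α => multiDeriv α (tDeriv T j u t) x, operator, add_assoc]

theorem zero_mem_indices : (0 : Fin d → ℕ) ∈ indices d :=
  Finset.mem_biUnion.2 ⟨0, by simp, mem_multiIndices.2 (by simp)⟩

/-- The coefficients of the equation, with their regularity. -/
def coefData {T : ℝ} (a : Coeffs d ℝ) (b : Coeffs d ℂ)
    (hL : ∀ j α, j ≤ 2 → j + ∑ i, α i = 3 → ContDiffOn ℝ 2 (a j α) (Icc 0 T))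
    (hMN : ∀ j α, j + ∑ i, α i = 2 ∨ j + ∑ i, α i = 1 → ContDiffOn ℝ 1 (b j α) (Icc 0 T))
    (hp : MemLp (b 0 0) ⊤ (volume.restrict (Icc 0 T))) : CoefData d T where
  c j α := coef a b j α
  ess j := by
    have hj : coef a b j 0 = b j 0 := by
      funext t
      have := j.2
      rw [coef, if_neg (by simp; omega), if_pos (by simp)]
    rw [hj]
    fin_cases j
    · exact EssBounded.of_memLp hp
    · exact EssBounded.of_continuousOn (hMN 1 0 (by simp)).continuousOn
    · exact EssBounded.of_continuousOn (hMN 2 0 (by simp)).continuousOn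
  cont j α hα := by
    have h0 : ∑ i, α i ≠ 0 := fun h => hα (funext fun i =>
      (Finset.sum_eq_zero_iff.1 h) i (Finset.mem_univ i))
    have := j.2
    unfold coef
    by_cases h1 : (j : ℕ) + ∑ i, α i = 3
    · simp only [if_pos h1]
      exact Complex.continuous_ofReal.comp_continuousOn (hL j α (by omega) h1).continuousOn
    · simp only [if_neg h1]
      by_cases h2 : (j : ℕ) + ∑ i, α i < 3
      · simp only [if_pos h2]
        exact (hMN j α (by omega)).continuousOn
      · simp only [if_neg h2]
        exact continuousOn_const
  deg j α h := by
    funext t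
    rw [coef, if_neg (by omega), if_neg (by omega)]
    rfl

/-! ### The symbols as polynomials in `τ` -/

variable {K : Type} [RCLike K]

/-- The sum `∑_{|α| = k} c_{j,α}(t) ξ^α`. -/
def symCoef (c : Coeffs d K) (j k : ℕ) (ξ : Space d) (t : ℝ) : K :=
  ∑ α ∈ multiIndices d k, c j α t * ((∏ i, ξ i ^ α i : ℝ) : K)

open Polynomial in
theorem symbol_eq (c : Coeffs d K) (J m : ℕ) (t : ℝ) (ξ : Space d) :
    symbol c J m t ξ = ∑ j ∈ Finset.range J, C (symCoef c j (m - j) ξ t) * X ^ j := by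
  unfold symbol symCoef
  refine Finset.sum_congr rfl fun j _ => ?_
  rw [map_sum, Finset.sum_mul]

theorem contDiffOn_symCoef {T : ℝ} {n : ℕ∞} {c : Coeffs d K} {j k : ℕ} (ξ : Space d)
    (h : ∀ α, ∑ i, α i = k → ContDiffOn ℝ n (c j α) (Icc 0 T)) :
    ContDiffOn ℝ n (symCoef c j k ξ) (Icc 0 T) :=
  ContDiffOn.sum fun α hα => (h α (mem_multiIndices.1 hα)).mul contDiffOn_const

theorem symCoef_coeffDeriv {T : ℝ} (hT : 0 < T) {n : ℕ} {c : Coeffs d K} {j k : ℕ} (ξ : Space d)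
    (h : ∀ α, ∑ i, α i = k → ContDiffOn ℝ n (c j α) (Icc 0 T)) {t : ℝ} (ht : t ∈ Icc 0 T) :
    symCoef (coeffDeriv T n c) j k ξ t = iteratedDerivWithin n (symCoef c j k ξ) (Icc 0 T) t := by
  have e : symCoef c j k ξ =
      fun t => ∑ α ∈ multiIndices d k, ((∏ i, ξ i ^ α i : ℝ)) • c j α t := by
    funext t
    refine Finset.sum_congr rfl fun α _ => ?_
    rw [mul_comm, RCLike.real_smul_eq_coe_mul]
  rw [e, iteratedDerivWithin_fun_sum (f := fun α t => (∏ i, ξ i ^ α i : ℝ) • c j α t) ht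
    (uniqueDiffOn_Icc hT) fun α hα => contDiffWithinAt_const.fun_smul (h α (mem_multiIndices.1 hα) t ht)]
  refine Finset.sum_congr rfl fun α hα => ?_
  rw [iteratedDerivWithin_fun_const_smul ht (uniqueDiffOn_Icc hT) _
    ((h α (mem_multiIndices.1 hα)) t ht), coeffDeriv, mul_comm, RCLike.real_smul_eq_coe_mul]

/-- The sums `∑_{|α| = k} c_{j,α}(t) ξ^α` grow polynomially in `ξ`. -/
theorem exists_norm_symCoef_le {T : ℝ} {c : Coeffs d K} {j k : ℕ}
    (h : ∀ α, ∑ i, α i = k → ContinuousOn (c j α) (Icc 0 T)) :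
    ∃ C, 0 ≤ C ∧ ∀ ξ, ∀ t ∈ Icc 0 T, ‖symCoef c j k ξ t‖ ≤ C * (1 + ‖ξ‖) ^ k := by
  choose! C hC using fun α (hα : ∑ i, α i = k) =>
    isCompact_Icc.exists_bound_of_continuousOn (h α hα)
  refine ⟨∑ α ∈ multiIndices d k, |C α|, Finset.sum_nonneg fun α _ => abs_nonneg _,
    fun ξ t ht => ?_⟩
  rw [Finset.sum_mul]
  refine (norm_sum_le _ _).trans (Finset.sum_le_sum fun α hα => ?_)
  have hk := mem_multiIndices.1 hα
  rw [norm_mul]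
  refine mul_le_mul ((hC α hk t ht).trans (le_abs_self _)) ?_ (norm_nonneg _) (abs_nonneg _)
  rw [RCLike.norm_ofReal, Finset.abs_prod, ← hk, ← Finset.prod_pow_eq_pow_sum]
  refine Finset.prod_le_prod (fun i _ => abs_nonneg _) fun i _ => ?_
  rw [abs_pow]
  gcongr
  have : ‖ξ i‖ ≤ ‖ξ‖ := PiLp.norm_apply_le ξ i
  rw [Real.norm_eq_abs] at this
  linarith

/-- The normalization of the Fourier transform makes `∂_x^α` act as `(2πiξ)^α`, so the symbols are
always evaluated at the frequency `2πξ`. -/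
theorem freqMonomial_toComplex (α : Fin d → ℕ) (ξ : Space d) :
    freqMonomial α (toComplex ξ) = Complex.I ^ (∑ i, α i) *
      ((∏ i, ((2 * Real.pi) • ξ) i ^ α i : ℝ) : ℂ) := by
  rw [freqMonomial, ← Finset.prod_pow_eq_pow_sum, Complex.ofReal_prod, ← Finset.prod_mul_distrib]
  refine Finset.prod_congr rfl fun i _ => ?_
  simp only [toComplex, PiLp.smul_apply, smul_eq_mul, Complex.ofReal_pow, Complex.ofReal_mul,
    Complex.ofReal_ofNat]
  rw [← mul_pow]
  ring

theorem sum_freqMonomial (c : Coeffs d ℂ) (j k : ℕ) (ξ : Space d) (t : ℝ) (z : ℂ) :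
    ∑ α ∈ multiIndices d k, c j α t * (freqMonomial α (toComplex ξ) * z) =
      Complex.I ^ k * symCoef c j k ((2 * Real.pi) • ξ) t * z := by
  rw [symCoef, Finset.mul_sum, Finset.sum_mul]
  refine Finset.sum_congr rfl fun α hα => ?_
  rw [freqMonomial_toComplex, mem_multiIndices.1 hα]
  simp only [Complex.coe_algebraMap]
  ring

theorem sum_freqMonomial_ofReal (c : Coeffs d ℝ) (j k : ℕ) (ξ : Space d) (t : ℝ) (z : ℂ) :
    ∑ α ∈ multiIndices d k, (c j α t : ℂ) * (freqMonomial α (toComplex ξ) * z) =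
      Complex.I ^ k * ((symCoef c j k ((2 * Real.pi) • ξ) t : ℝ) : ℂ) * z := by
  rw [symCoef, Complex.ofReal_sum, Finset.mul_sum, Finset.sum_mul]
  refine Finset.sum_congr rfl fun α hα => ?_
  rw [freqMonomial_toComplex, mem_multiIndices.1 hα]
  simp only [Complex.ofReal_mul, RCLike.ofReal_real_eq_id, id]
  ring

/-- The full symbol at a real frequency. -/
theorem sum_coef_freqMonomial (a : Coeffs d ℝ) (b : Coeffs d ℂ) (t : ℝ) (ξ : Space d) (z : ℕ → ℂ) :
    let η := (2 * Real.pi) • ξ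
    ∑ j : Fin 3, ∑ α ∈ indices d, coef a b j α t * (freqMonomial α (toComplex ξ) * z j) =
      Complex.I * symCoef a 2 1 η t * z 2 - symCoef a 1 2 η t * z 1
        - Complex.I * symCoef a 0 3 η t * z 0
      + (symCoef b 2 0 η t * z 2 + Complex.I * symCoef b 1 1 η t * z 1 - symCoef b 0 2 η t * z 0)
      + (symCoef b 1 0 η t * z 1 + Complex.I * symCoef b 0 1 η t * z 0) + b 0 0 t * z 0 := by
  intro η
  have h00 : symCoef b 0 0 η t = b 0 0 t := by
    have : multiIndices d 0 = {0} := by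
      ext α
      rw [mem_multiIndices, Finset.sum_eq_zero_iff, Finset.mem_singleton]
      exact ⟨fun h => funext fun i => h i (Finset.mem_univ i), fun h i _ => by rw [h]; rfl⟩
    simp [symCoef, this]
  rw [sum_coef a b t fun j α => freqMonomial α (toComplex ξ) * z j]
  simp only [Finset.sum_range_succ, Finset.sum_range_zero, zero_add, tsub_zero,
    Nat.reduceSub, sum_freqMonomial, sum_freqMonomial_ofReal]
  simp only [← h00, pow_zero, pow_one, Complex.I_sq, Complex.I_pow_three, η]
  ring

end Coefficients


/-! ### The roots and the symbols at a real frequency -/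

section IteratedDerivWithin

variable {F : Type*} [NormedAddCommGroup F] [NormedSpace ℝ F] {T : ℝ}

theorem hasDerivWithinAt_iteratedDerivWithin (hT : 0 < T) {f : ℝ → F} {n m : ℕ}
    (hf : ContDiffOn ℝ n f (Icc 0 T)) (hm : m < n) {t : ℝ} (ht : t ∈ Icc 0 T) :
    HasDerivWithinAt (iteratedDerivWithin m f (Icc 0 T)) (iteratedDerivWithin (m + 1) f (Icc 0 T) t)
      (Icc 0 T) t := by
  rw [iteratedDerivWithin_succ]
  exact (hf.differentiableOn_iteratedDerivWithin (by exact_mod_cast hm) (uniqueDiffOn_Icc hT) t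
    ht).hasDerivWithinAt

theorem hasDerivWithinAt_iteratedDerivWithin_one (hT : 0 < T) {f : ℝ → F} {n : ℕ}
    (hf : ContDiffOn ℝ n f (Icc 0 T)) (hn : 0 < n) {t : ℝ} (ht : t ∈ Icc 0 T) :
    HasDerivWithinAt f (iteratedDerivWithin 1 f (Icc 0 T) t) (Icc 0 T) t := by
  have h := hasDerivWithinAt_iteratedDerivWithin hT hf hn ht
  rwa [iteratedDerivWithin_zero] at h

theorem iteratedDerivWithin_one_eq (hT : 0 < T) {f : ℝ → F} {f' : F} {t : ℝ} (ht : t ∈ Icc 0 T)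
    (h : HasDerivWithinAt f f' (Icc 0 T) t) : iteratedDerivWithin 1 f (Icc 0 T) t = f' := by
  rw [iteratedDerivWithin_one]
  exact h.derivWithin (uniqueDiffOn_Icc hT t ht)

theorem contDiffOn_iteratedDerivWithin_one (hT : 0 < T) {f : ℝ → F}
    (hf : ContDiffOn ℝ 2 f (Icc 0 T)) :
    ContDiffOn ℝ 1 (iteratedDerivWithin 1 f (Icc 0 T)) (Icc 0 T) := by
  rw [iteratedDerivWithin_one]
  exact hf.derivWithin (uniqueDiffOn_Icc hT) (by norm_num)

end IteratedDerivWithin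

/-- The hypotheses on the coefficients. -/
structure Regular {d : ℕ} (T : ℝ) (a : Coeffs d ℝ) (b : Coeffs d ℂ) : Prop where
  pos : 0 < T
  contDiffOn_a : ∀ j α, j ≤ 2 → j + ∑ i, α i = 3 → ContDiffOn ℝ 2 (a j α) (Icc 0 T)
  contDiffOn_b : ∀ j α, j + ∑ i, α i = 2 ∨ j + ∑ i, α i = 1 → ContDiffOn ℝ 1 (b j α) (Icc 0 T)
  memLp : MemLp (b 0 0) ⊤ (volume.restrict (Icc 0 T))
  splits : ∀ t ∈ Icc 0 T, ∀ ξ : Space d, (symbolL a t ξ).Splits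

namespace Regular

variable {d : ℕ} {T : ℝ} {a : Coeffs d ℝ} {b : Coeffs d ℂ}

theorem symbolL_eq (a : Coeffs d ℝ) (t : ℝ) (ξ : Space d) :
    symbolL a t ξ = cubic (symCoef a 2 1 ξ t) (symCoef a 1 2 ξ t) (symCoef a 0 3 ξ t) := by
  simp only [symbolL, symbol_eq, cubic, Finset.sum_range_succ, Finset.sum_range_zero, zero_add,
    tsub_zero, Nat.reduceSub, pow_zero, pow_one, mul_one]
  ring

open Polynomial in
theorem auxL_eq (a : Coeffs d ℝ) (t : ℝ) (ξ : Space d) :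
    auxL a t ξ = cubic (symCoef a 2 1 ξ t) (symCoef a 1 2 ξ t - 6)
      (symCoef a 0 3 ξ t - 2 * symCoef a 2 1 ξ t) := by
  rw [auxL, symbolL_eq]
  simp only [cubic, derivative_add, derivative_mul, derivative_X_pow, derivative_C, derivative_X,
    C_sub, C_mul]
  simp
  have h6 : (C (6 : ℝ)) = 6 := rfl
  have h3 : (C (3 : ℝ)) = 3 := rfl
  have h2 : (C (2 : ℝ)) = 2 := rfl
  rw [h6, h3, h2]
  ring

theorem lam_spec (h : Regular T a b) (ξ : Space d) {t : ℝ} (ht : t ∈ Icc 0 T) :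
    lam a 0 t ξ < lam a 1 t ξ ∧ lam a 1 t ξ < lam a 2 t ξ ∧
    2 ≤ (lam a 0 t ξ - lam a 1 t ξ) ^ 2 ∧ 2 ≤ (lam a 1 t ξ - lam a 2 t ξ) ^ 2 ∧
    symCoef a 2 1 ξ t = -(lam a 0 t ξ + lam a 1 t ξ + lam a 2 t ξ) ∧
    symCoef a 1 2 ξ t - 6 = lam a 0 t ξ * lam a 1 t ξ + lam a 0 t ξ * lam a 2 t ξ
      + lam a 1 t ξ * lam a 2 t ξ ∧
    symCoef a 0 3 ξ t - 2 * symCoef a 2 1 ξ t = -(lam a 0 t ξ * lam a 1 t ξ * lam a 2 t ξ) := by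
  have hs := h.splits t ht ξ
  rw [symbolL_eq] at hs
  obtain ⟨x, y, z, hxy, hyz, g1, g2, e2, e1, e0⟩ := exists_separated_roots hs
  have hl : ∀ j : Fin 3, lam a j t ξ = ![x, y, z] j := fun j => by
    rw [lam, auxL_eq, e1, e0, e2]
    exact orderedRoot_cubic hxy hyz j
  have h0 : lam a 0 t ξ = x := hl 0
  have h1 : lam a 1 t ξ = y := hl 1
  have h2 : lam a 2 t ξ = z := hl 2
  rw [h0, h1, h2]
  exact ⟨hxy, hyz, g1, g2, e2, e1, e0⟩

theorem two_le_sq_gap (h : Regular T a b) (ξ : Space d) {t : ℝ} (ht : t ∈ Icc 0 T) (j : Fin 3) :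
    2 ≤ (lam a j t ξ - lam a (j + 1) t ξ) ^ 2 := by
  obtain ⟨hxy, hyz, g1, g2, -⟩ := h.lam_spec ξ ht
  fin_cases j
  · exact g1
  · exact g2
  -- Cyclic indices: the last gap is the one between the extreme roots, the sum of the other two.
  · change 2 ≤ (lam a 2 t ξ - lam a 0 t ξ) ^ 2
    nlinarith [mul_pos (sub_pos.2 hxy) (sub_pos.2 hyz)]

-- With elementary symmetric functions `e₁, e₂` of the `λ_j`, the derivative of `𝓛` is `3τ² - 2e₁τ +
-- e₂`, with roots `e₁/3 ± D/2` where `D² = 4(e₁² - 3e₂)/9`; and `2(e₁² - 3e₂)` is the sum of the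
-- squared gaps.
open Polynomial in
theorem mu_eq (h : Regular T a b) (ξ : Space d) {t : ℝ} (ht : t ∈ Icc 0 T) (k : Fin 2) :
    mu a k t ξ = (lam a 0 t ξ + lam a 1 t ξ + lam a 2 t ξ) / 3 + (![-1, 1] : Fin 2 → ℝ) k *
        √(2 / 9 * ∑ j, (lam a j t ξ - lam a (j + 1) t ξ) ^ 2) / 2 := by
  obtain ⟨-, -, -, -, e2, e1, -⟩ := h.lam_spec ξ ht
  set x := lam a 0 t ξ with hx
  set y := lam a 1 t ξ with hy
  set z := lam a 2 t ξ with hz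
  have hsum : ∑ j, (lam a j t ξ - lam a (j + 1) t ξ) ^ 2 =
      (x - y) ^ 2 + (y - z) ^ 2 + (z - x) ^ 2 := by rw [Fin.sum_univ_three]; rfl
  rw [hsum]
  set D := √(2 / 9 * ((x - y) ^ 2 + (y - z) ^ 2 + (z - x) ^ 2)) with hD
  have hD2 : D ^ 2 = 2 / 9 * ((x - y) ^ 2 + (y - z) ^ 2 + (z - x) ^ 2) :=
    Real.sq_sqrt (by positivity)
  have hD0 : 0 ≤ D := Real.sqrt_nonneg _
  have hder : (auxL a t ξ).derivative =
      C 3 * ((X - C ((x + y + z) / 3 - D / 2)) * (X - C ((x + y + z) / 3 + D / 2))) := by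
    rw [auxL_eq, e1, e2]
    have e3 : C 3 * ((X - C ((x + y + z) / 3 - D / 2)) * (X - C ((x + y + z) / 3 + D / 2))) =
        C (3 : ℝ) * X ^ 2 + C (-2 * (x + y + z)) * X
          + C (3 * (((x + y + z) / 3 - D / 2) * ((x + y + z) / 3 + D / 2))) := by
      have : C (-2 * (x + y + z)) = C (3 : ℝ) * (- C ((x + y + z) / 3 - D / 2)
          - C ((x + y + z) / 3 + D / 2)) := by
        rw [← C_neg, ← C_sub, ← C_mul]; congr 1; ring
      rw [this, C_mul, C_mul]
      ring
    have e4 : 3 * (((x + y + z) / 3 - D / 2) * ((x + y + z) / 3 + D / 2)) =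
        x * y + x * z + y * z := by nlinarith
    rw [e3, e4, cubic]
    have e5 : C (-2 * (x + y + z)) = 2 * C (-(x + y + z)) := by
      have : (2 : ℝ[X]) = C 2 := rfl
      rw [this, ← C_mul]; congr 1; ring
    rw [e5]
    have h3 : (C (3 : ℝ)) = 3 := rfl
    have h2 : (C (2 : ℝ)) = 2 := rfl
    simp [h3, h2]
    ring
  rw [mu, hder, orderedRoot_quadratic (by norm_num) (by linarith)]
  fin_cases k
  · simp; ring
  · simp

theorem contDiffOn_symCoef_a (h : Regular T a b) (ξ : Space d) {j k : ℕ} (hj : j ≤ 2)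
    (hjk : j + k = 3) : ContDiffOn ℝ 2 (symCoef a j k ξ) (Icc 0 T) :=
  contDiffOn_symCoef (n := 2) ξ fun α hα => h.contDiffOn_a j α hj (by omega)

theorem contDiffOn_symCoef_b (h : Regular T a b) (ξ : Space d) {j k : ℕ}
    (hjk : j + k = 2 ∨ j + k = 1) : ContDiffOn ℝ 1 (symCoef b j k ξ) (Icc 0 T) :=
  contDiffOn_symCoef (n := 1) ξ fun α hα => h.contDiffOn_b j α (by omega)

theorem continuousOn_lam (h : Regular T a b) (ξ : Space d) (j : Fin 3) :
    ContinuousOn (fun t => lam a j t ξ) (Icc 0 T) := by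
  have c2 := (h.contDiffOn_symCoef_a ξ (j := 2) (k := 1) le_rfl rfl).continuousOn
  have c1 := (h.contDiffOn_symCoef_a ξ (j := 1) (k := 2) (by norm_num) rfl).continuousOn
  have c0 := (h.contDiffOn_symCoef_a ξ (j := 0) (k := 3) (by norm_num) rfl).continuousOn
  have key := continuousOn_roots (s := Icc 0 T) (x := fun t => lam a 0 t ξ)
    (y := fun t => lam a 1 t ξ) (z := fun t => lam a 2 t ξ) (fun t ht => (h.lam_spec ξ ht).1)
    (fun t ht => (h.lam_spec ξ ht).2.1)
    (c2.neg.congr fun t ht => by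
      obtain ⟨-, -, -, -, e2, e1, e0⟩ := h.lam_spec ξ ht
      rw [Pi.neg_apply, e2]; ring)
    ((c1.sub continuousOn_const).congr fun t ht => by
      obtain ⟨-, -, -, -, e2, e1, e0⟩ := h.lam_spec ξ ht
      exact e1.symm)
    (((c2.const_smul (2 : ℝ)).sub c0).congr fun t ht => by
      obtain ⟨-, -, -, -, e2, e1, e0⟩ := h.lam_spec ξ ht
      simp only [Pi.sub_apply, Pi.smul_apply, smul_eq_mul]
      linarith)
  fin_cases j
  · exact key.1
  · exact key.2.1
  · exact key.2.2

/-- The derivative of `𝓛` at a root is the product of its differences to the other two roots. The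
bound makes the roots regular, and bounds the denominator in the formula for their time derivatives
uniformly in `ξ`. -/
theorem lam_simple (h : Regular T a b) (ξ : Space d) {t : ℝ} (ht : t ∈ Icc 0 T) (j : Fin 3) :
    1 ≤ |3 * lam a j t ξ ^ 2 + 2 * symCoef a 2 1 ξ t * lam a j t ξ + (symCoef a 1 2 ξ t - 6)| := by
  obtain ⟨-, -, -, -, e2, e1, e0⟩ := h.lam_spec ξ ht
  have g0 := h.two_le_sq_gap ξ ht 0
  have g1 := h.two_le_sq_gap ξ ht 1
  have g2 := h.two_le_sq_gap ξ ht 2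
  simp only [zero_add, Fin.reduceAdd] at g0 g1 g2
  have aux : ∀ p q : ℝ, 2 ≤ p ^ 2 → 2 ≤ q ^ 2 → 1 ≤ |p * q| := fun p q hp hq =>
    (one_le_sq_iff_one_le_abs _).1 (by rw [mul_pow]; nlinarith)
  rw [e1, e2]
  fin_cases j
  · refine (aux _ _ g0 g2).trans (le_of_eq ?_)
    rw [abs_mul, abs_sub_comm (lam a 2 t ξ), ← abs_mul]
    congr 1; simp; ring
  · refine (aux _ _ g0 g1).trans (le_of_eq ?_)
    rw [abs_mul, abs_sub_comm (lam a 0 t ξ), ← abs_mul]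
    congr 1; simp; ring
  · refine (aux _ _ g1 g2).trans (le_of_eq ?_)
    rw [abs_mul, abs_sub_comm (lam a 1 t ξ), ← abs_mul]
    congr 1; simp; ring

theorem lam_root (h : Regular T a b) (ξ : Space d) {t : ℝ} (ht : t ∈ Icc 0 T) (j : Fin 3) :
    lam a j t ξ ^ 3 + symCoef a 2 1 ξ t * lam a j t ξ ^ 2
      + (symCoef a 1 2 ξ t - 6) * lam a j t ξ
      + (symCoef a 0 3 ξ t - 2 * symCoef a 2 1 ξ t) = 0 := by
  obtain ⟨-, -, -, -, e2, e1, e0⟩ := h.lam_spec ξ ht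
  rw [e0, e1, e2]
  fin_cases j
  · simp; ring
  · simp; ring
  · simp; ring

theorem contDiffOn_lam (h : Regular T a b) (ξ : Space d) (j : Fin 3) :
    ContDiffOn ℝ 2 (fun t => lam a j t ξ) (Icc 0 T) := by
  have c2 := h.contDiffOn_symCoef_a ξ (j := 2) (k := 1) le_rfl rfl
  have c1 := h.contDiffOn_symCoef_a ξ (j := 1) (k := 2) (by norm_num) rfl
  have c0 := h.contDiffOn_symCoef_a ξ (j := 0) (k := 3) (by norm_num) rfl
  refine contDiffOn_root (c₂ := symCoef a 2 1 ξ) (c₁ := fun t => symCoef a 1 2 ξ t - 6)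
    (c₀ := fun t => symCoef a 0 3 ξ t - 2 * symCoef a 2 1 ξ t) h.pos c2 (c1.sub contDiffOn_const)
    (c0.sub (contDiffOn_const.mul c2)) (h.continuousOn_lam ξ j) (fun t ht => h.lam_root ξ ht j)
    fun t ht h0 => ?_
  have := h.lam_simple ξ ht j
  rw [h0, abs_zero] at this
  linarith

/-- The time derivative of a root. -/
theorem tDeriv_lam_eq (h : Regular T a b) (ξ : Space d) {t : ℝ} (ht : t ∈ Icc 0 T) (j : Fin 3) :
    tDeriv T 1 (lam a j) t ξ = -(symCoef (coeffDeriv T 1 a) 2 1 ξ t * lam a j t ξ ^ 2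
      + symCoef (coeffDeriv T 1 a) 1 2 ξ t * lam a j t ξ
      + (symCoef (coeffDeriv T 1 a) 0 3 ξ t - 2 * symCoef (coeffDeriv T 1 a) 2 1 ξ t))
      / (3 * lam a j t ξ ^ 2 + 2 * symCoef a 2 1 ξ t * lam a j t ξ + (symCoef a 1 2 ξ t - 6)) := by
  have hd : ∀ i k, i ≤ 2 → i + k = 3 → HasDerivWithinAt (symCoef a i k ξ)
      (symCoef (coeffDeriv T 1 a) i k ξ t) (Icc 0 T) t := fun i k hi hik => by
    rw [symCoef_coeffDeriv h.pos ξ (n := 1) (fun α hα => (h.contDiffOn_a i α hi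
      (by omega)).of_le (by norm_num)) ht]
    exact hasDerivWithinAt_iteratedDerivWithin_one h.pos (n := 2) (h.contDiffOn_symCoef_a ξ hi hik)
      (by norm_num) ht
  have c2 := hd 2 1 le_rfl rfl
  have c1 := hd 1 2 (by norm_num) rfl
  have c0 := hd 0 3 (by norm_num) rfl
  refine iteratedDerivWithin_one_eq h.pos ht (hasDerivWithinAt_root ht c2 (c1.sub_const 6)
    (c0.sub (c2.const_mul 2)) (h.continuousOn_lam ξ j t ht) (fun t ht => h.lam_root ξ ht j) ?_)
  intro h0
  have := h.lam_simple ξ ht j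
  rw [h0, abs_zero] at this
  linarith

open Polynomial in
theorem eval_checkM (a : Coeffs d ℝ) (b : Coeffs d ℂ) (t : ℝ) (ξ : Space d) (τ : ℝ) :
    (checkM T a b t ξ).eval (τ : ℂ) = symCoef b 2 0 ξ t * (τ : ℂ) ^ 2 + symCoef b 1 1 ξ t * τ
      + symCoef b 0 2 ξ t - 1 / 2 * (2 * (symCoef (coeffDeriv T 1 a) 2 1 ξ t : ℝ) * τ
        + (symCoef (coeffDeriv T 1 a) 1 2 ξ t : ℝ)) := by
  simp only [checkM, symbolM, symbolDtL, symbol_eq, Finset.sum_range_succ, Finset.sum_range_zero,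
    zero_add, tsub_zero, Nat.reduceSub, pow_zero, pow_one, mul_one]
  simp
  ring

open Polynomial in
theorem eval_checkN (a : Coeffs d ℝ) (b : Coeffs d ℂ) (t : ℝ) (ξ : Space d) (τ : ℝ) :
    (checkN T a b t ξ).eval (τ : ℂ) = symCoef b 1 0 ξ t * τ + symCoef b 0 1 ξ t
      - 1 / 2 * (2 * symCoef (coeffDeriv T 1 b) 2 0 ξ t * τ + symCoef (coeffDeriv T 1 b) 1 1 ξ t)
      + 1 / 6 * (symCoef (coeffDeriv T 2 a) 2 1 ξ t : ℝ) := by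
  simp only [checkN, symbolM, symbolN, symbolDtL, symbol_eq, Finset.sum_range_succ,
    Finset.sum_range_zero, zero_add, tsub_zero, Nat.reduceSub, pow_zero, pow_one, mul_one]
  simp
  ring

end Regular


/-! ### Time derivatives of Vieta's formulas, and the symbols along the roots -/

namespace Regular

variable {d : ℕ} {T : ℝ} {a : Coeffs d ℝ} {b : Coeffs d ℂ}

theorem hasDerivWithinAt_lam (h : Regular T a b) (ξ : Space d) (j : Fin 3) {t : ℝ}
    (ht : t ∈ Icc 0 T) :
    HasDerivWithinAt (fun t => lam a j t ξ) (tDeriv T 1 (lam a j) t ξ) (Icc 0 T) t :=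
  hasDerivWithinAt_iteratedDerivWithin_one h.pos (n := 2) (h.contDiffOn_lam ξ j) (by norm_num) ht

theorem hasDerivWithinAt_tDeriv_lam (h : Regular T a b) (ξ : Space d) (j : Fin 3) {t : ℝ}
    (ht : t ∈ Icc 0 T) : HasDerivWithinAt (fun t => tDeriv T 1 (lam a j) t ξ)
      (tDeriv T 2 (lam a j) t ξ) (Icc 0 T) t :=
  hasDerivWithinAt_iteratedDerivWithin h.pos (n := 2) (m := 1) (h.contDiffOn_lam ξ j)
    (by norm_num) ht

theorem symCoef_coeffDeriv_one (h : Regular T a b) (ξ : Space d) {j k : ℕ} (hj : j ≤ 2)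
    (hjk : j + k = 3) {t : ℝ} (ht : t ∈ Icc 0 T) : symCoef (coeffDeriv T 1 a) j k ξ t =
      iteratedDerivWithin 1 (symCoef a j k ξ) (Icc 0 T) t :=
  symCoef_coeffDeriv h.pos ξ (n := 1)
    (fun α hα => (h.contDiffOn_a j α hj (by omega)).of_le (by norm_num)) ht

theorem symCoef_deriv_two_one (h : Regular T a b) (ξ : Space d) {t : ℝ} (ht : t ∈ Icc 0 T) :
    symCoef (coeffDeriv T 1 a) 2 1 ξ t = -(tDeriv T 1 (lam a 0) t ξ + tDeriv T 1 (lam a 1) t ξ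
      + tDeriv T 1 (lam a 2) t ξ) := by
  rw [h.symCoef_coeffDeriv_one ξ le_rfl rfl ht]
  refine iteratedDerivWithin_one_eq h.pos ht ?_
  exact (((h.hasDerivWithinAt_lam ξ 0 ht).add (h.hasDerivWithinAt_lam ξ 1 ht)).add
    (h.hasDerivWithinAt_lam ξ 2 ht)).neg.congr (fun s hs => (h.lam_spec ξ hs).2.2.2.2.1)
    (h.lam_spec ξ ht).2.2.2.2.1

theorem symCoef_deriv_one_two (h : Regular T a b) (ξ : Space d) {t : ℝ} (ht : t ∈ Icc 0 T) :
    symCoef (coeffDeriv T 1 a) 1 2 ξ t =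
      tDeriv T 1 (lam a 0) t ξ * lam a 1 t ξ + lam a 0 t ξ * tDeriv T 1 (lam a 1) t ξ
      + (tDeriv T 1 (lam a 0) t ξ * lam a 2 t ξ + lam a 0 t ξ * tDeriv T 1 (lam a 2) t ξ)
      + (tDeriv T 1 (lam a 1) t ξ * lam a 2 t ξ + lam a 1 t ξ * tDeriv T 1 (lam a 2) t ξ) := by
  rw [h.symCoef_coeffDeriv_one ξ (by norm_num) rfl ht]
  refine iteratedDerivWithin_one_eq h.pos ht ?_
  have e : ∀ s ∈ Icc 0 T, symCoef a 1 2 ξ s = lam a 0 s ξ * lam a 1 s ξ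
      + lam a 0 s ξ * lam a 2 s ξ + lam a 1 s ξ * lam a 2 s ξ + 6 := fun s hs => by
    linarith [(h.lam_spec ξ hs).2.2.2.2.2.1]
  have d0 := h.hasDerivWithinAt_lam ξ 0 ht
  have d1 := h.hasDerivWithinAt_lam ξ 1 ht
  have d2 := h.hasDerivWithinAt_lam ξ 2 ht
  exact ((((d0.mul d1).add (d0.mul d2)).add (d1.mul d2)).add_const 6).congr e (e t ht)

theorem symCoef_deriv_deriv (h : Regular T a b) (ξ : Space d) {t : ℝ} (ht : t ∈ Icc 0 T) :
    symCoef (coeffDeriv T 2 a) 2 1 ξ t = -(tDeriv T 2 (lam a 0) t ξ + tDeriv T 2 (lam a 1) t ξ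
      + tDeriv T 2 (lam a 2) t ξ) := by
  rw [symCoef_coeffDeriv h.pos ξ (n := 2) (fun α hα => h.contDiffOn_a 2 α le_rfl (by omega)) ht,
    iteratedDerivWithin_succ]
  have e : ∀ s ∈ Icc 0 T, iteratedDerivWithin 1 (symCoef a 2 1 ξ) (Icc 0 T) s =
      -(tDeriv T 1 (lam a 0) s ξ + tDeriv T 1 (lam a 1) s ξ + tDeriv T 1 (lam a 2) s ξ) :=
    fun s hs => by
      rw [← h.symCoef_coeffDeriv_one ξ le_rfl rfl hs, h.symCoef_deriv_two_one ξ hs]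
  have := (((h.hasDerivWithinAt_tDeriv_lam ξ 0 ht).add (h.hasDerivWithinAt_tDeriv_lam ξ 1 ht)).add
    (h.hasDerivWithinAt_tDeriv_lam ξ 2 ht)).neg.congr e (e t ht)
  exact this.derivWithin (uniqueDiffOn_Icc h.pos t ht)

theorem contDiffOn_checkMLam (h : Regular T a b) (ξ : Space d) (j : Fin 3) :
    ContDiffOn ℝ 1 (fun t => checkMLam T a b j t ξ) (Icc 0 T) := by
  have hl : ContDiffOn ℝ 1 (fun t => (lam a j t ξ : ℂ)) (Icc 0 T) :=
    Complex.ofRealCLM.contDiff.comp_contDiffOn ((h.contDiffOn_lam ξ j).of_le (by norm_num))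
  have hA : ∀ i k, i ≤ 2 → i + k = 3 → ContDiffOn ℝ 1
      (fun t => ((symCoef (coeffDeriv T 1 a) i k ξ t : ℝ) : ℂ)) (Icc 0 T) := fun i k hi hik =>
    Complex.ofRealCLM.contDiff.comp_contDiffOn
      ((contDiffOn_iteratedDerivWithin_one h.pos (h.contDiffOn_symCoef_a ξ hi hik)).congr
        fun t ht => h.symCoef_coeffDeriv_one ξ hi hik ht)
  have hA2 := hA 2 1 le_rfl rfl
  have hA1 := hA 1 2 (by norm_num) rfl
  have hB2 := h.contDiffOn_symCoef_b ξ (j := 2) (k := 0) (by norm_num)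
  have hB1 := h.contDiffOn_symCoef_b ξ (j := 1) (k := 1) (by norm_num)
  have hB0 := h.contDiffOn_symCoef_b ξ (j := 0) (k := 2) (by norm_num)
  refine ContDiffOn.congr ?_ fun t _ => eval_checkM a b t ξ (lam a j t ξ)
  fun_prop

theorem hasDerivAt_tDeriv_of_mem_Ioo {f : ℝ → Space d → ℂ} {ξ : Space d} {t : ℝ} (ht : t ∈ Ioo 0 T)
    (hf : DifferentiableAt ℝ (fun t => f t ξ) t) :
    HasDerivAt (fun t => f t ξ) (tDeriv T 1 f t ξ) t := by
  rw [tDeriv, iteratedDerivWithin_one, derivWithin_of_mem_nhds (Icc_mem_nhds ht.1 ht.2)]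
  exact hf.hasDerivAt

/-- The symbols along the roots at the frequency `ξ`. -/
def symbolData (h : Regular T a b) (ξ : Space d)
    (hN : ∀ j : Fin 2, AbsolutelyContinuousOnInterval (fun t => checkNMu T a b j t ξ) 0 T) :
    SymbolData T where
  l j t := lam a j t ξ
  l' j t := tDeriv T 1 (lam a j) t ξ
  l'' j t := tDeriv T 2 (lam a j) t ξ
  M j t := checkMLam T a b j t ξ
  M' j t := tDeriv T 1 (checkMLam T a b j) t ξ
  N j t := checkNMu T a b j t ξ
  N' j t := tDeriv T 1 (checkNMu T a b j) t ξ
  B₂ := symCoef b 2 0 ξ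
  B₁ := symCoef b 1 1 ξ
  B₀ := symCoef b 0 2 ξ
  C₁ := symCoef b 1 0 ξ
  C₀ := symCoef b 0 1 ξ
  B₂' := symCoef (coeffDeriv T 1 b) 2 0 ξ
  B₁' := symCoef (coeffDeriv T 1 b) 1 1 ξ
  hl j t ht := h.hasDerivWithinAt_lam ξ j ht
  hl' j t ht := h.hasDerivWithinAt_tDeriv_lam ξ j ht
  hl'' j := (h.contDiffOn_lam ξ j).continuousOn_iteratedDerivWithin (m := 2) le_rfl
    (uniqueDiffOn_Icc h.pos)
  sq_gap j t ht := h.two_le_sq_gap ξ ht j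
  hM j t ht := hasDerivWithinAt_iteratedDerivWithin_one h.pos (n := 1) (h.contDiffOn_checkMLam ξ j)
    one_pos ht
  hM' j := (h.contDiffOn_checkMLam ξ j).continuousOn_iteratedDerivWithin (m := 1) le_rfl
    (uniqueDiffOn_Icc h.pos)
  hB₂ t ht := by
    rw [symCoef_coeffDeriv h.pos ξ (n := 1) (fun α hα => h.contDiffOn_b 2 α (by omega)) ht]
    exact hasDerivWithinAt_iteratedDerivWithin_one h.pos (n := 1)
      (h.contDiffOn_symCoef_b ξ (by norm_num)) one_pos ht
  hB₁ t ht := by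
    rw [symCoef_coeffDeriv h.pos ξ (n := 1) (fun α hα => h.contDiffOn_b 1 α (by omega)) ht]
    exact hasDerivWithinAt_iteratedDerivWithin_one h.pos (n := 1)
      (h.contDiffOn_symCoef_b ξ (by norm_num)) one_pos ht
  M_eq j t ht := by
    rw [checkMLam, eval_checkM, h.symCoef_deriv_two_one ξ ht, h.symCoef_deriv_one_two ξ ht]
    push_cast
    ring
  N_ac := hN
  hN k := by
    filter_upwards [ae_hasDerivAt_of_absolutelyContinuous (hN k)] with t ht hmem
    exact hasDerivAt_tDeriv_of_mem_Ioo hmem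
      (ht (by rw [uIcc_of_le h.pos.le]; exact Ioo_subset_Icc_self hmem))
  N_eq k t ht := by
    rw [checkNMu, eval_checkN, h.symCoef_deriv_deriv ξ ht, h.mu_eq ξ ht]
    push_cast
    ring

/-- The derivatives of the real and imaginary parts are integrable by absolute continuity, and
inside the interval they reassemble to the derivative within `[0,T]` almost everywhere. -/
theorem intervalIntegrable_tDeriv (hT : 0 ≤ T) {f : ℝ → Space d → ℂ} {ξ : Space d}
    (hf : AbsolutelyContinuousOnInterval (fun t => f t ξ) 0 T) :
    IntervalIntegrable (fun t => tDeriv T 1 f t ξ) volume 0 T := by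
  have hre := (absolutelyContinuousOnInterval_comp hf Complex.reCLM.lipschitz.lipschitzOnWith
    (s := univ) fun _ _ => mem_univ _).intervalIntegrable_deriv
  have him := (absolutelyContinuousOnInterval_comp hf Complex.imCLM.lipschitz.lipschitzOnWith
    (s := univ) fun _ _ => mem_univ _).intervalIntegrable_deriv
  have hsum := (intervalIntegrable_clm_comp Complex.ofRealCLM hre).add
    ((intervalIntegrable_clm_comp Complex.ofRealCLM him).mul_const Complex.I)
  refine hsum.congr_ae ?_
  rw [uIoc_of_le hT, Filter.EventuallyEq, ae_restrict_iff' measurableSet_Ioc]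
  filter_upwards [ae_hasDerivAt_of_absolutelyContinuous hf, Measure.ae_ne volume T]
    with t ht hne hmem
  have hI : t ∈ Ioo 0 T := ⟨hmem.1, lt_of_le_of_ne hmem.2 hne⟩
  have hd := hasDerivAt_tDeriv_of_mem_Ioo hI
    (ht (by rw [uIcc_of_le hT]; exact Ioo_subset_Icc_self hI))
  have e1 := (Complex.reCLM.hasFDerivAt.comp_hasDerivAt t hd).deriv
  have e2 := (Complex.imCLM.hasFDerivAt.comp_hasDerivAt t hd).deriv
  simp only [Function.comp_def] at e1 e2
  rw [e1, e2]
  exact Complex.re_add_im _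

end Regular

/-! ### Integrability of the rate -/

namespace SymbolData

variable {T : ℝ} (S : SymbolData T)

/-- Five of the sums are continuous on `[0,T]`, where the gaps and `delta` are at least one; the sum
with `N'` is integrable because `N'` is and the denominators are continuous and at least one.
Integrability is needed to split the integral of the rate into the six integrals of the hypotheses.
-/
theorem intervalIntegrable_summands (hT : 0 ≤ T)
    (hN : ∀ k, IntervalIntegrable (S.N' k) volume 0 T) :
    IntervalIntegrable (fun t => ∑ j : Fin 3,
      |S.l' j t - S.l' (j + 1) t| / |S.l j t - S.l (j + 1) t|) volume 0 T ∧
    IntervalIntegrable (fun t => ∑ j : Fin 3,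
      |S.l'' j t - S.l'' (j + 1) t| / (|S.l' j t - S.l' (j + 1) t| + 1)) volume 0 T ∧
    IntervalIntegrable (fun t => ∑ j : Fin 3, ‖S.M' j t‖ / (‖S.M j t‖ + 1)) volume 0 T ∧
    IntervalIntegrable (fun t => ∑ k : Fin 2, ‖S.N' k t‖ / (‖S.N k t‖ + 1)) volume 0 T ∧
    IntervalIntegrable (fun t => ∑ j : Fin 3,
      ‖S.M j t‖ / (|S.l j t - S.l (j + 1) t| * |S.l j t - S.l (j + 2) t|)) volume 0 T ∧
    IntervalIntegrable (fun t => ∑ k : Fin 2, √(‖S.N k t‖ / S.delta t)) volume 0 T := by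
  have hl := S.continuousOn_l
  have hl' := S.continuousOn_l'
  have hl'' := S.hl''
  have hM : ∀ j, ContinuousOn (S.M j) (Icc 0 T) := fun j t ht => (S.hM j t ht).continuousWithinAt
  have hM' := S.hM'
  have hNc : ∀ k, ContinuousOn (S.N k) (Icc 0 T) := fun k => by
    have := (S.N_ac k).continuousOn
    rwa [uIcc_of_le hT] at this
  have hδ := S.continuousOn_delta
  have hint : ∀ f : ℝ → ℝ, ContinuousOn f (Icc 0 T) → IntervalIntegrable f volume 0 T :=
    fun f hf => ContinuousOn.intervalIntegrable (by rwa [uIcc_of_le hT])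
  refine ⟨hint _ (continuousOn_finsetSum _ fun j _ => ?_),
    hint _ (continuousOn_finsetSum _ fun j _ => ?_), hint _ (continuousOn_finsetSum _ fun j _ => ?_),
    ?_, hint _ (continuousOn_finsetSum _ fun j _ => ?_), hint _ (continuousOn_finsetSum _ fun j _ => ?_)⟩
  · refine ContinuousOn.div (by fun_prop) (by fun_prop) fun t ht => ?_
    linarith [S.gap j ht]
  · exact ContinuousOn.div (by fun_prop) (by fun_prop) fun t ht => by positivity
  · exact ContinuousOn.div (by fun_prop) (by fun_prop) fun t ht => by positivity
  · have h := IntervalIntegrable.sum (μ := volume) (a := 0) (b := T) Finset.univ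
      (f := fun (k : Fin 2) t => ‖S.N' k t‖ * (‖S.N k t‖ + 1)⁻¹) fun k _ =>
        (hN k).norm.mul_continuousOn (by
          rw [uIcc_of_le hT]
          exact ContinuousOn.inv₀ (by fun_prop) fun t ht => by positivity)
    exact h.congr fun t _ => by simp [div_eq_mul_inv]
  · refine ContinuousOn.div (by fun_prop) (by fun_prop) fun t ht => ?_
    have := S.gap j ht
    have := S.gap' j ht
    positivity
  · exact (ContinuousOn.div (by fun_prop) (by fun_prop) fun t ht => S.delta_ne_zero ht).sqrt

theorem intervalIntegrable_rate (hT : 0 ≤ T) (hN : ∀ k, IntervalIntegrable (S.N' k) volume 0 T) :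
    IntervalIntegrable S.rate volume 0 T := by
  obtain ⟨h1, h2, h3, h4, h5, h6⟩ := S.intervalIntegrable_summands hT hN
  exact ((((((h1.add h2).add h3).add h4).add h5).add h6).add intervalIntegrable_const)

theorem integral_rate (hT : 0 ≤ T) (hN : ∀ k, IntervalIntegrable (S.N' k) volume 0 T) :
    ∫ t in (0 : ℝ)..T, S.rate t =
      (∫ t in (0 : ℝ)..T, ∑ j : Fin 3, |S.l' j t - S.l' (j + 1) t| / |S.l j t - S.l (j + 1) t|)
      + (∫ t in (0 : ℝ)..T,
          ∑ j : Fin 3, |S.l'' j t - S.l'' (j + 1) t| / (|S.l' j t - S.l' (j + 1) t| + 1))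
      + (∫ t in (0 : ℝ)..T, ∑ j : Fin 3, ‖S.M' j t‖ / (‖S.M j t‖ + 1))
      + (∫ t in (0 : ℝ)..T, ∑ k : Fin 2, ‖S.N' k t‖ / (‖S.N k t‖ + 1))
      + (∫ t in (0 : ℝ)..T,
          ∑ j : Fin 3, ‖S.M j t‖ / (|S.l j t - S.l (j + 1) t| * |S.l j t - S.l (j + 2) t|))
      + (∫ t in (0 : ℝ)..T, ∑ k : Fin 2, √(‖S.N k t‖ / S.delta t)) + T := by
  obtain ⟨h1, h2, h3, h4, h5, h6⟩ := S.intervalIntegrable_summands hT hN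
  unfold rate
  rw [intervalIntegral.integral_add (((((h1.add h2).add h3).add h4).add h5).add h6)
      intervalIntegrable_const,
    intervalIntegral.integral_add ((((h1.add h2).add h3).add h4).add h5) h6,
    intervalIntegral.integral_add (((h1.add h2).add h3).add h4) h5,
    intervalIntegral.integral_add ((h1.add h2).add h3) h4,
    intervalIntegral.integral_add (h1.add h2) h3, intervalIntegral.integral_add h1 h2]
  simp

end SymbolData


/-! ### Polynomial bounds in the frequency -/

/-- Polynomial growth in the frequency, uniformly in time. -/
def PolyBounded {d : ℕ} (T : ℝ) (F : Space d → ℝ → ℝ) : Prop :=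
  ∃ C : ℝ, 0 ≤ C ∧ ∃ k : ℕ, ∀ ξ, ∀ t ∈ Icc 0 T, |F ξ t| ≤ C * (1 + ‖ξ‖) ^ k

namespace PolyBounded

variable {d : ℕ} {T : ℝ} {F G : Space d → ℝ → ℝ}

theorem of_le (hF : PolyBounded T F) (h : ∀ ξ, ∀ t ∈ Icc 0 T, |G ξ t| ≤ F ξ t) :
    PolyBounded T G :=
  let ⟨C, hC, k, hk⟩ := hF
  ⟨C, hC, k, fun ξ t ht => (h ξ t ht).trans ((le_abs_self _).trans (hk ξ t ht))⟩

theorem const (c : ℝ) : PolyBounded T fun (_ : Space d) _ => c :=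
  ⟨|c|, abs_nonneg c, 0, fun ξ t _ => by simp⟩

theorem add (hF : PolyBounded T F) (hG : PolyBounded T G) :
    PolyBounded T fun ξ t => F ξ t + G ξ t := by
  obtain ⟨C, hC, k, hk⟩ := hF
  obtain ⟨C', hC', k', hk'⟩ := hG
  refine ⟨C + C', by positivity, k + k', fun ξ t ht => (abs_add_le _ _).trans ?_⟩
  have h1 : 1 ≤ 1 + ‖ξ‖ := by linarith [norm_nonneg ξ]
  rw [add_mul]
  refine add_le_add ((hk ξ t ht).trans ?_) ((hk' ξ t ht).trans ?_)
  · gcongr; omega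
  · gcongr; omega

theorem mul (hF : PolyBounded T F) (hG : PolyBounded T G) :
    PolyBounded T fun ξ t => F ξ t * G ξ t := by
  obtain ⟨C, hC, k, hk⟩ := hF
  obtain ⟨C', hC', k', hk'⟩ := hG
  refine ⟨C * C', by positivity, k + k', fun ξ t ht => ?_⟩
  rw [abs_mul, pow_add, mul_mul_mul_comm]
  exact mul_le_mul (hk ξ t ht) (hk' ξ t ht) (abs_nonneg _) (by positivity)

theorem sum {ι : Type*} (s : Finset ι) {F : ι → Space d → ℝ → ℝ} (h : ∀ i, PolyBounded T (F i)) :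
    PolyBounded T fun ξ t => ∑ i ∈ s, F i ξ t := by
  classical
  induction s using Finset.induction_on with
  | empty => simpa using const 0
  | insert i s hi ih => simpa only [Finset.sum_insert hi] using (h i).add ih

end PolyBounded

/-! ### Polynomial bounds of the roots and of the symbols along them -/

namespace Regular

variable {d : ℕ} {T : ℝ} {a : Coeffs d ℝ} {b : Coeffs d ℂ}

theorem polyBounded_symCoef {K : Type} [RCLike K] {c : Coeffs d K} {j k : ℕ}
    (h : ∀ α, ∑ i, α i = k → ContinuousOn (c j α) (Icc 0 T)) :
    PolyBounded T fun ξ t => ‖symCoef c j k ξ t‖ := by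
  obtain ⟨C, hC, hb⟩ := exists_norm_symCoef_le h
  exact ⟨C, hC, k, fun ξ t ht => by rw [abs_norm]; exact hb ξ t ht⟩

theorem polyBounded_symCoef_a (h : Regular T a b) {n j k : ℕ} (hn : n ≤ 2) (hj : j ≤ 2)
    (hjk : j + k = 3) : PolyBounded T fun ξ t => ‖symCoef (coeffDeriv T n a) j k ξ t‖ :=
  polyBounded_symCoef fun α hα => (h.contDiffOn_a j α hj
    (by omega)).continuousOn_iteratedDerivWithin (m := n) (by exact_mod_cast hn)
    (uniqueDiffOn_Icc h.pos)

theorem polyBounded_symCoef_b (h : Regular T a b) {n j k : ℕ} (hn : n ≤ 1)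
    (hjk : j + k = 2 ∨ j + k = 1) :
    PolyBounded T fun ξ t => ‖symCoef (coeffDeriv T n b) j k ξ t‖ :=
  polyBounded_symCoef fun α hα => (h.contDiffOn_b j α
    (by omega)).continuousOn_iteratedDerivWithin (m := n) (by exact_mod_cast hn)
    (uniqueDiffOn_Icc h.pos)

theorem coeffDeriv_zero {K : Type} [RCLike K] (c : Coeffs d K) : coeffDeriv T 0 c = c := by
  funext j α t
  rw [coeffDeriv, iteratedDerivWithin_zero]

/-- The sum of the squares of the roots is `c₂² - 2(c₁ - 6)`, and `|λ| ≤ λ² + 1`; hence the constant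
`13 = 12 + 1`. -/
theorem polyBounded_lam (h : Regular T a b) (j : Fin 3) :
    PolyBounded T fun ξ t => |lam a j t ξ| := by
  have h2 := h.polyBounded_symCoef_a (n := 0) (j := 2) (k := 1) (by norm_num) le_rfl rfl
  have h1 := h.polyBounded_symCoef_a (n := 0) (j := 1) (k := 2) (by norm_num) (by norm_num) rfl
  rw [coeffDeriv_zero] at h1 h2
  refine (((h2.mul h2).add ((PolyBounded.const 2).mul h1)).add (PolyBounded.const 13)).of_le
    fun ξ t ht => ?_
  obtain ⟨-, -, -, -, e2, e1, -⟩ := h.lam_spec ξ ht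
  simp only [Real.norm_eq_abs, abs_abs, abs_mul_abs_self]
  have hj : lam a j t ξ ^ 2 ≤ lam a 0 t ξ ^ 2 + lam a 1 t ξ ^ 2 + lam a 2 t ξ ^ 2 := by
    have s0 := sq_nonneg (lam a 0 t ξ)
    have s1 := sq_nonneg (lam a 1 t ξ)
    have s2 := sq_nonneg (lam a 2 t ξ)
    fin_cases j <;> simp only [Fin.zero_eta, Fin.mk_one, Fin.reduceFinMk] <;> linarith
  have e : lam a 0 t ξ ^ 2 + lam a 1 t ξ ^ 2 + lam a 2 t ξ ^ 2 =
      symCoef a 2 1 ξ t * symCoef a 2 1 ξ t - 2 * (symCoef a 1 2 ξ t - 6) := by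
    rw [e1, e2]; ring
  have := neg_abs_le (symCoef a 1 2 ξ t)
  have := sq_abs (lam a j t ξ)
  nlinarith [sq_nonneg (|lam a j t ξ| - 1), abs_nonneg (lam a j t ξ)]

theorem polyBounded_tDeriv_lam (h : Regular T a b) (j : Fin 3) :
    PolyBounded T fun ξ t => |tDeriv T 1 (lam a j) t ξ| := by
  have h2 := h.polyBounded_symCoef_a (n := 1) (j := 2) (k := 1) (by norm_num) le_rfl rfl
  have h1 := h.polyBounded_symCoef_a (n := 1) (j := 1) (k := 2) (by norm_num) (by norm_num) rfl
  have h0 := h.polyBounded_symCoef_a (n := 1) (j := 0) (k := 3) (by norm_num) (by norm_num) rfl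
  have hl := h.polyBounded_lam j
  refine (((h2.mul (hl.mul hl)).add (h1.mul hl)).add
    (h0.add ((PolyBounded.const 2).mul h2))).of_le fun ξ t ht => ?_
  simp only [Real.norm_eq_abs, abs_abs]
  rw [h.tDeriv_lam_eq ξ ht, abs_div, abs_neg]
  refine (div_le_self (abs_nonneg _) (h.lam_simple ξ ht j)).trans ?_
  refine (abs_add_le _ _).trans (add_le_add ((abs_add_le _ _).trans (add_le_add ?_ ?_))
    ((abs_sub _ _).trans (add_le_add le_rfl ?_)))
  · rw [abs_mul, pow_two, abs_mul]
  · rw [abs_mul]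
  · rw [abs_mul, abs_two]

theorem polyBounded_mu (h : Regular T a b) (k : Fin 2) :
    PolyBounded T fun ξ t => |mu a k t ξ| := by
  have hs := PolyBounded.sum Finset.univ h.polyBounded_lam
  refine (hs.add ((PolyBounded.const 1).add (hs.mul hs))).of_le fun ξ t ht => ?_
  rw [abs_abs, h.mu_eq ξ ht]
  have hsum : ∑ j, (lam a j t ξ - lam a (j + 1) t ξ) ^ 2 = (lam a 0 t ξ - lam a 1 t ξ) ^ 2
      + (lam a 1 t ξ - lam a 2 t ξ) ^ 2 + (lam a 2 t ξ - lam a 0 t ξ) ^ 2 := by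
    rw [Fin.sum_univ_three]; rfl
  rw [hsum, Fin.sum_univ_three]
  set x := lam a 0 t ξ
  set y := lam a 1 t ξ
  set z := lam a 2 t ξ
  set D := √(2 / 9 * ((x - y) ^ 2 + (y - z) ^ 2 + (z - x) ^ 2)) with hD
  have hD2 : D ^ 2 = 2 / 9 * ((x - y) ^ 2 + (y - z) ^ 2 + (z - x) ^ 2) :=
    Real.sq_sqrt (by positivity)
  have hD0 : 0 ≤ D := Real.sqrt_nonneg _
  have hk : |(![-1, 1] : Fin 2 → ℝ) k| = 1 := by fin_cases k <;> simp
  refine (abs_add_le _ _).trans (add_le_add ?_ ?_)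
  · rw [abs_div, abs_of_pos (by norm_num : (0 : ℝ) < 3)]
    exact (div_le_self (abs_nonneg _) (by norm_num)).trans (abs_add_three x y z)
  · rw [abs_div, abs_mul, hk, one_mul, abs_of_nonneg hD0, abs_two]
    have hx := abs_mul_abs_self x
    have hy := abs_mul_abs_self y
    have hz := abs_mul_abs_self z
    have h1 : (x - y) ^ 2 + (y - z) ^ 2 + (z - x) ^ 2 ≤ 3 * (x ^ 2 + y ^ 2 + z ^ 2) := by
      nlinarith [sq_nonneg (x + y + z)]
    nlinarith [sq_nonneg (D - 1), mul_nonneg (abs_nonneg x) (abs_nonneg y),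
      mul_nonneg (abs_nonneg x) (abs_nonneg z), mul_nonneg (abs_nonneg y) (abs_nonneg z)]

theorem polyBounded_checkMLam (h : Regular T a b) (j : Fin 3) :
    PolyBounded T fun ξ t => ‖checkMLam T a b j t ξ‖ := by
  have h2 := h.polyBounded_symCoef_a (n := 1) (j := 2) (k := 1) (by norm_num) le_rfl rfl
  have h1 := h.polyBounded_symCoef_a (n := 1) (j := 1) (k := 2) (by norm_num) (by norm_num) rfl
  have b2 := h.polyBounded_symCoef_b (n := 0) (j := 2) (k := 0) (by norm_num) (by norm_num)
  have b1 := h.polyBounded_symCoef_b (n := 0) (j := 1) (k := 1) (by norm_num) (by norm_num)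
  have b0 := h.polyBounded_symCoef_b (n := 0) (j := 0) (k := 2) (by norm_num) (by norm_num)
  rw [coeffDeriv_zero] at b2 b1 b0
  have hl := h.polyBounded_lam j
  refine (((((b2.mul (hl.mul hl)).add (b1.mul hl)).add b0)).add ((h2.mul hl).add h1)).of_le
    fun ξ t ht => ?_
  rw [abs_norm, checkMLam, eval_checkM]
  refine (norm_sub_le _ _).trans (add_le_add ((norm_add_le _ _).trans (add_le_add
    ((norm_add_le _ _).trans (add_le_add ?_ ?_)) le_rfl)) ?_)
  · rw [norm_mul, norm_pow, Complex.norm_real, Real.norm_eq_abs, pow_two]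
  · rw [norm_mul, Complex.norm_real, Real.norm_eq_abs]
  · rw [mul_add]
    refine (norm_add_le _ _).trans (add_le_add (le_of_eq ?_) ?_)
    · rw [← mul_assoc, ← mul_assoc]; norm_num [Real.norm_eq_abs]
    · rw [norm_mul, Complex.norm_real]
      norm_num
      linarith [abs_nonneg (symCoef (coeffDeriv T 1 a) 1 2 ξ t)]

theorem polyBounded_checkNMu (h : Regular T a b) (k : Fin 2) :
    PolyBounded T fun ξ t => ‖checkNMu T a b k t ξ‖ := by
  have h2 := h.polyBounded_symCoef_a (n := 2) (j := 2) (k := 1) (by norm_num) le_rfl rfl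
  have c1 := h.polyBounded_symCoef_b (n := 0) (j := 1) (k := 0) (by norm_num) (by norm_num)
  have c0 := h.polyBounded_symCoef_b (n := 0) (j := 0) (k := 1) (by norm_num) (by norm_num)
  have b2 := h.polyBounded_symCoef_b (n := 1) (j := 2) (k := 0) (by norm_num) (by norm_num)
  have b1 := h.polyBounded_symCoef_b (n := 1) (j := 1) (k := 1) (by norm_num) (by norm_num)
  rw [coeffDeriv_zero] at c1 c0
  have hm := h.polyBounded_mu k
  refine ((((c1.mul hm).add c0).add ((b2.mul hm).add b1)).add h2).of_le fun ξ t ht => ?_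
  rw [abs_norm, checkNMu, eval_checkN]
  refine (norm_add_le _ _).trans (add_le_add ((norm_sub_le _ _).trans (add_le_add
    ((norm_add_le _ _).trans (add_le_add ?_ le_rfl)) ?_)) ?_)
  · rw [norm_mul, Complex.norm_real, Real.norm_eq_abs]
  · rw [mul_add]
    refine (norm_add_le _ _).trans (add_le_add (le_of_eq ?_) ?_)
    · rw [← mul_assoc, ← mul_assoc]; norm_num
    · rw [norm_mul]
      norm_num
      linarith [norm_nonneg (symCoef (coeffDeriv T 1 b) 1 1 ξ t)]
  · rw [norm_mul, Complex.norm_real]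
    norm_num
    linarith [abs_nonneg (symCoef (coeffDeriv T 2 a) 2 1 ξ t)]

end Regular

/-! ### Comparison of the energy with the size of `(u, u', u'')` -/

namespace SymbolData

variable {T : ℝ} (S : SymbolData T)

/-- All the symbols at the time `t` are bounded by `Λ`. -/
structure BoundedBy (t Λ : ℝ) : Prop where
  one_le : 1 ≤ Λ
  l : ∀ j, |S.l j t| ≤ Λ
  l' : ∀ j, |S.l' j t| ≤ Λ
  mu : ∀ k, |S.mu k t| ≤ Λ
  M : ∀ j, ‖S.M j t‖ ≤ Λ
  N : ∀ k, ‖S.N k t‖ ≤ Λ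

variable {S}

theorem norm_firstFactor_le_of_bound {r Λ m : ℝ} (hΛ : 1 ≤ Λ) (hr : |r| ≤ Λ) {z₀ z₁ : ℂ}
    (h0 : ‖z₀‖ ≤ m) (h1 : ‖z₁‖ ≤ m) : ‖firstFactor r z₀ z₁‖ ≤ 2 * Λ * m := by
  have hm : 0 ≤ m := (norm_nonneg _).trans h0
  rw [firstFactor]
  refine (norm_sub_le _ _).trans ?_
  rw [norm_mul, norm_mul, Complex.norm_I, one_mul, Complex.norm_real, Real.norm_eq_abs]
  have : |r| * ‖z₀‖ ≤ Λ * m := mul_le_mul hr h0 (norm_nonneg _) (by linarith)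
  nlinarith

theorem norm_secondFactor_sub_le {l l' : Fin 3 → ℝ} {Λ : ℝ} (hΛ : 1 ≤ Λ) (hl : ∀ j, |l j| ≤ Λ)
    (hl' : ∀ j, |l' j| ≤ Λ) (z₀ z₁ z₂ : ℂ) (j : Fin 3) :
    ‖secondFactor l l' z₀ z₁ z₂ j - z₂‖ ≤ 2 * Λ * ‖z₁‖ + 2 * Λ ^ 2 * ‖z₀‖ := by
  have e : secondFactor l l' z₀ z₁ z₂ j - z₂ = -(Complex.I * (l (j + 1) + l (j + 2)) * z₁)
      - l (j + 1) * l (j + 2) * z₀ - Complex.I / 2 * (l' (j + 1) + l' (j + 2)) * z₀ := by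
    rw [secondFactor]; ring
  have hs : ∀ (r : Fin 3 → ℝ), (∀ j, |r j| ≤ Λ) → ‖(r (j + 1) + r (j + 2) : ℂ)‖ ≤ 2 * Λ := by
    intro r hr
    refine (norm_add_le _ _).trans ?_
    rw [Complex.norm_real, Complex.norm_real, Real.norm_eq_abs, Real.norm_eq_abs]
    linarith [hr (j + 1), hr (j + 2)]
  rw [e]
  refine (norm_sub_le _ _).trans ((add_le_add (norm_sub_le _ _) le_rfl).trans ?_)
  have n1 : ‖-(Complex.I * (l (j + 1) + l (j + 2)) * z₁)‖ ≤ 2 * Λ * ‖z₁‖ := by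
    rw [norm_neg, norm_mul, norm_mul, Complex.norm_I, one_mul]
    exact mul_le_mul_of_nonneg_right (hs l hl) (norm_nonneg _)
  have n2 : ‖(l (j + 1) * l (j + 2) * z₀ : ℂ)‖ ≤ Λ ^ 2 * ‖z₀‖ := by
    rw [norm_mul, norm_mul, Complex.norm_real, Complex.norm_real, Real.norm_eq_abs,
      Real.norm_eq_abs, pow_two]
    exact mul_le_mul_of_nonneg_right (mul_le_mul (hl _) (hl _) (abs_nonneg _) (by linarith))
      (norm_nonneg _)
  have n3 : ‖Complex.I / 2 * (l' (j + 1) + l' (j + 2)) * z₀‖ ≤ Λ ^ 2 * ‖z₀‖ := by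
    rw [norm_mul, norm_mul, norm_div, Complex.norm_I]
    refine mul_le_mul_of_nonneg_right ?_ (norm_nonneg _)
    have h2 : ‖(2 : ℂ)‖ = 2 := by norm_num
    rw [h2]
    nlinarith [hs l' hl']
  linarith

theorem norm_term_le {t Λ m : ℝ} (hb : S.BoundedBy t Λ) {u₀ u₁ u₂ : ℝ → ℂ} (h0 : ‖u₀ t‖ ≤ m)
    (h1 : ‖u₁ t‖ ≤ m) (h2 : ‖u₂ t‖ ≤ m) (i : Index) : ‖S.term u₀ u₁ u₂ i t‖ ≤ 5 * Λ ^ 2 * m := by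
  have hm : 0 ≤ m := (norm_nonneg _).trans h0
  have hΛ := hb.one_le
  have hΛ2 : Λ ≤ Λ ^ 2 := by nlinarith
  have hf : 2 * Λ * m ≤ 5 * Λ ^ 2 * m := by gcongr; norm_num
  rcases i with (j | j) | (j | j) | k
  · have h := norm_secondFactor_sub_le hΛ hb.l hb.l' (u₀ t) (u₁ t) (u₂ t) j
    have h' := norm_le_norm_add_norm_sub' (S.term u₀ u₁ u₂ (.inl (.inl j)) t) (u₂ t)
    have e : ‖S.term u₀ u₁ u₂ (.inl (.inl j)) t - u₂ t‖ ≤ 2 * Λ * m + 2 * Λ ^ 2 * m :=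
      h.trans (by gcongr)
    have : m ≤ Λ ^ 2 * m := le_mul_of_one_le_left hm (by nlinarith)
    have : Λ * m ≤ Λ ^ 2 * m := by gcongr
    linarith
  · change ‖u₀ t‖ ≤ _
    exact h0.trans (le_mul_of_one_le_left hm (by nlinarith))
  · exact (norm_firstFactor_le_of_bound hΛ (hb.l _) h0 h1).trans hf
  · exact (norm_firstFactor_le_of_bound hΛ (hb.l _) h0 h1).trans hf
  · exact (norm_firstFactor_le_of_bound hΛ (hb.mu _) h0 h1).trans hf

theorem weight_le {t Λ : ℝ} (ht : t ∈ Icc 0 T) (hb : S.BoundedBy t Λ) (i : Index) :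
    S.weight i t ≤ 9 * Λ ^ 2 := by
  have hΛ := hb.one_le
  have hinv : ∀ x : ℝ, 1 ≤ |x| → ‖x⁻¹‖ + 0 ≤ 1 := fun x hx => by
    rw [add_zero, norm_inv, Real.norm_eq_abs]
    exact inv_le_one_of_one_le₀ hx
  have hMb : ∀ j, (‖S.M j t‖ + 1) * (‖(S.gaps j t)⁻¹‖ + 0) ≤ 2 * Λ := fun j => by
    have h1 := hinv _ (S.one_le_abs_gaps j ht)
    have h2 := hb.M j
    calc (‖S.M j t‖ + 1) * (‖(S.gaps j t)⁻¹‖ + 0) ≤ (‖S.M j t‖ + 1) * 1 := by gcongr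
      _ ≤ _ := by linarith
  have hsq : ∀ x y : ℝ, 0 ≤ x → x ≤ y → x * x ≤ y ^ 2 := fun x y h0 hxy => by nlinarith
  rcases i with (j | j) | (j | j) | k
  · change (1 : ℝ) ≤ _
    nlinarith
  · have h : ‖S.l' j t - S.l' (j + 1) t‖ + 1 ≤ 3 * Λ := by
      have := norm_sub_le (S.l' j t) (S.l' (j + 1) t)
      rw [Real.norm_eq_abs, Real.norm_eq_abs (S.l' j t), Real.norm_eq_abs (S.l' (j + 1) t)] at this
      rw [Real.norm_eq_abs]
      linarith [hb.l' j, hb.l' (j + 1)]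
    exact (hsq _ _ (by positivity) h).trans (by nlinarith)
  · exact (hsq _ _ (by positivity) (hMb j)).trans (by nlinarith)
  · exact (hsq _ _ (by positivity) (hMb j)).trans (by nlinarith)
  · have h1 := hinv (S.delta t) ((S.one_le_delta ht).trans (le_abs_self _))
    have h2 := hb.N k
    calc (‖S.N k t‖ + 1) * (‖(S.delta t)⁻¹‖ + 0) ≤ (‖S.N k t‖ + 1) * 1 := by gcongr
      _ ≤ _ := by nlinarith

theorem energy_le_of_boundedBy {t Λ m : ℝ} (ht : t ∈ Icc 0 T) (hb : S.BoundedBy t Λ)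
    {u₀ u₁ u₂ : ℝ → ℂ} (h0 : ‖u₀ t‖ ≤ m) (h1 : ‖u₁ t‖ ≤ m) (h2 : ‖u₂ t‖ ≤ m) :
    S.energy u₀ u₁ u₂ t ≤ 14 * (225 * Λ ^ 6 * m ^ 2) := by
  have hm : 0 ≤ m := (norm_nonneg _).trans h0
  -- Each of the `14` terms is at most `9Λ² · (5Λ²m)² = 225Λ⁶m²`.
  have h := Finset.sum_le_card_nsmul Finset.univ
    (fun i => S.weight i t * ‖S.term u₀ u₁ u₂ i t‖ ^ 2) (225 * Λ ^ 6 * m ^ 2) fun i _ => by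
      calc S.weight i t * ‖S.term u₀ u₁ u₂ i t‖ ^ 2
          ≤ 9 * Λ ^ 2 * (5 * Λ ^ 2 * m) ^ 2 := by
            gcongr
            · exact weight_le ht hb i
            · exact norm_term_le hb h0 h1 h2 i
        _ = 225 * Λ ^ 6 * m ^ 2 := by ring
  refine h.trans (le_of_eq ?_)
  rw [nsmul_eq_mul]
  norm_num [Finset.card_univ, Index]

/-- The unknowns are recovered one after the other: `u₀` because its weights are at least one, `u₁`
from a first order factor and `u₀`, and `u₂` from a second order factor and the previous two. -/
theorem norm_le_of_energy {t Λ : ℝ} (ht : t ∈ Icc 0 T) (hb : S.BoundedBy t Λ) (u₀ u₁ u₂ : ℝ → ℂ) :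
    ‖u₀ t‖ ≤ 11 * Λ ^ 2 * √(S.energy u₀ u₁ u₂ t) ∧ ‖u₁ t‖ ≤ 11 * Λ ^ 2 * √(S.energy u₀ u₁ u₂ t) ∧
      ‖u₂ t‖ ≤ 11 * Λ ^ 2 * √(S.energy u₀ u₁ u₂ t) := by
  have hΛ := hb.one_le
  set e := √(S.energy u₀ u₁ u₂ t) with he
  have he0 : 0 ≤ e := Real.sqrt_nonneg _
  have n0 : ‖u₀ t‖ ≤ e := by
    refine le_trans ?_ (S.norm_u₀_le u₀ u₁ u₂ ht 0)
    exact le_mul_of_one_le_left (norm_nonneg _) (by linarith [abs_nonneg (S.l' 0 t - S.l' (0 + 1) t)])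
  have n1 : ‖u₁ t‖ ≤ 4 * Λ * e := by
    have h1 := S.norm_firstFactor_le' u₀ u₁ u₂ ht 0
    have h2 : u₁ t = firstFactor (S.l 0 t) (u₀ t) (u₁ t) + Complex.I * S.l 0 t * u₀ t := by
      rw [firstFactor]; ring
    have h3 : ‖Complex.I * S.l 0 t * u₀ t‖ ≤ Λ * e := by
      rw [norm_mul, norm_mul, Complex.norm_I, one_mul, Complex.norm_real, Real.norm_eq_abs]
      exact mul_le_mul (hb.l 0) n0 (norm_nonneg _) (by linarith)
    rw [h2]
    refine (norm_add_le _ _).trans ?_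
    nlinarith
  have n2 : ‖u₂ t‖ ≤ 11 * Λ ^ 2 * e := by
    have h1 := S.norm_secondFactor_le u₀ u₁ u₂ ht 0
    have h2 := norm_secondFactor_sub_le hΛ hb.l hb.l' (u₀ t) (u₁ t) (u₂ t) 0
    have h3 := norm_le_norm_add_norm_sub
      (secondFactor (fun i => S.l i t) (fun i => S.l' i t) (u₀ t) (u₁ t) (u₂ t) 0) (u₂ t)
    have h4 : 2 * Λ * ‖u₁ t‖ + 2 * Λ ^ 2 * ‖u₀ t‖ ≤ 2 * Λ * (4 * Λ * e) + 2 * Λ ^ 2 * e := by gcongr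
    have h5 : e ≤ Λ ^ 2 * e := le_mul_of_one_le_left he0 (by nlinarith)
    nlinarith
  have hp : 0 ≤ Λ ^ 2 * e := by positivity
  have h5 : e ≤ Λ ^ 2 * e := le_mul_of_one_le_left he0 (by nlinarith)
  have h6 : Λ * e ≤ Λ ^ 2 * e := by gcongr; nlinarith
  exact ⟨by linarith, by linarith, n2⟩

end SymbolData


/-! ### The polynomial bound at real frequencies -/

namespace CoefData

variable {d : ℕ} {T : ℝ} (P : CoefData d T) (hT : 0 ≤ T)

theorem freqSource_sub (ζ : Fin d → ℂ) (y : Sol T) (t : Icc (0 : ℝ) T) :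
    P.freqSource hT ζ y t - ∑ j, P.c j 0 t * y j t =
      -∑ j : Fin 3, ∑ α ∈ indices d, P.c j α t * (freqMonomial α ζ * y j t) := by
  have h1 : P.freqSource hT ζ y t =
      -∑ α ∈ (indices d).erase 0, ∑ j : Fin 3, P.c j α t * (freqMonomial α ζ * y j t) := by
    rw [freqSource, ContinuousMap.sum_apply, ← Finset.sum_neg_distrib]
    refine Finset.sum_congr rfl fun α hα => ?_
    rw [ContinuousMap.smul_apply, q_apply_snd P hT (Finset.ne_of_mem_erase hα), smul_eq_mul, mul_neg,
      Finset.mul_sum]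
    congr 1
    exact Finset.sum_congr rfl fun j _ => by ring
  have h2 : ∑ j, P.c j 0 t * y j t = ∑ j : Fin 3, P.c j 0 t * (freqMonomial 0 ζ * y j t) := by
    simp [freqMonomial]
  rw [h1, h2, Finset.sum_comm, ← neg_add', ← Finset.sum_add_distrib]
  congr 1
  exact Finset.sum_congr rfl fun j _ => Finset.sum_erase_add _ _ zero_mem_indices

end CoefData

/-! ### The polynomial bound for the equation -/

namespace Regular

variable {d : ℕ} {T : ℝ} {a : Coeffs d ℝ} {b : Coeffs d ℂ}

/-- The equation as a Fourier system. -/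
def system (h : Regular T a b) : FourierSystem d (Data T) (Sol T) :=
  (coefData a b h.contDiffOn_a h.contDiffOn_b h.memLp).system h.pos.le

/-- The equation at a real frequency. -/
theorem rhs_eq (h : Regular T a b) (ξ : Space d)
    (hN : ∀ j : Fin 2, AbsolutelyContinuousOnInterval
      (fun t => checkNMu T a b j t ((2 * Real.pi) • ξ)) 0 T)
    (f : ℝ → ℂ) (y : Fin 3 → ℝ → ℂ) {t : ℝ} (ht : t ∈ Icc 0 T) :
    (h.symbolData ((2 * Real.pi) • ξ) hN).rhs f (b 0 0) (y 0) (y 1) (y 2) t =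
      f t - ∑ j : Fin 3, ∑ α ∈ indices d, coef a b j α t *
        (freqMonomial α (toComplex ξ) * y j t) := by
  have hz : ∀ j : Fin 3, y j t = (fun n : ℕ => if hn : n < 3 then y ⟨n, hn⟩ t else 0) j :=
    fun j => by simp
  have hs := sum_coef_freqMonomial a b t ξ (fun n : ℕ => if hn : n < 3 then y ⟨n, hn⟩ t else 0)
  simp only [← hz] at hs
  rw [hs]
  obtain ⟨-, -, -, -, e2, e1, e0⟩ := h.lam_spec ((2 * Real.pi) • ξ) ht
  have e1' : symCoef a 1 2 ((2 * Real.pi) • ξ) t = lam a 0 t ((2 * Real.pi) • ξ)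
      * lam a 1 t ((2 * Real.pi) • ξ) + lam a 0 t ((2 * Real.pi) • ξ)
      * lam a 2 t ((2 * Real.pi) • ξ) + lam a 1 t ((2 * Real.pi) • ξ)
      * lam a 2 t ((2 * Real.pi) • ξ) + 6 := by linarith
  have e0' : symCoef a 0 3 ((2 * Real.pi) • ξ) t = -(lam a 0 t ((2 * Real.pi) • ξ)
      * lam a 1 t ((2 * Real.pi) • ξ) * lam a 2 t ((2 * Real.pi) • ξ))
      - 2 * (lam a 0 t ((2 * Real.pi) • ξ) + lam a 1 t ((2 * Real.pi) • ξ)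
      + lam a 2 t ((2 * Real.pi) • ξ)) := by linarith
  rw [e1', e0', e2]
  simp only [SymbolData.rhs, symbolData, Nat.ofNat_pos, Nat.one_lt_ofNat, Nat.lt_add_one, dif_pos]
  have i2 := Complex.I_sq
  push_cast
  set x := (lam a 0 t ((2 * Real.pi) • ξ) : ℂ)
  set y' := (lam a 1 t ((2 * Real.pi) • ξ) : ℂ)
  set z := (lam a 2 t ((2 * Real.pi) • ξ) : ℂ)
  linear_combination (-(x * y' + x * z + y' * z) * y 1 t + Complex.I * x * y' * z * y 0 t) * i2

/-- The integral equations of the system at the frequency `ξ` are the ODE of `SymbolData.energy_le`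
at the frequency `2πξ`: the first two components are differentiable everywhere, the third one almost
everywhere. -/
theorem energy_frequency_le (h : Regular T a b) (ξ : Space d)
    (hN : ∀ j : Fin 2, AbsolutelyContinuousOnInterval
      (fun t => checkNMu T a b j t ((2 * Real.pi) • ξ)) 0 T)
    {p : ℝ} (hp0 : 0 ≤ p) (hp : ∀ᵐ s ∂(volume.restrict (Icc 0 T)), ‖b 0 0 s‖ ≤ p) (D : Data T)
    {t : ℝ} (ht : t ∈ Icc 0 T) :
    let S := h.symbolData ((2 * Real.pi) • ξ) hN
    let y := h.system.R (toComplex ξ) D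
    S.energy (extend h.pos.le (y 0)) (extend h.pos.le (y 1)) (extend h.pos.le (y 2)) t ≤
      Real.exp (29 * ((p + 40) * ∫ s in (0 : ℝ)..T, S.rate s) + 14 * T) *
        (S.energy (extend h.pos.le (y 0)) (extend h.pos.le (y 1)) (extend h.pos.le (y 2)) 0
          + 14 * T * ‖D‖ ^ 2) := by
  intro S y
  have hT := h.pos.le
  set P := coefData a b h.contDiffOn_a h.contDiffOn_b h.memLp with hP
  have hy : ∀ t ∈ Icc 0 T,
      extend hT (y 0) t = D.1 0 + ∫ s in (0 : ℝ)..t, extend hT (y 1) s ∧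
      extend hT (y 1) t = D.1 1 + ∫ s in (0 : ℝ)..t, extend hT (y 2) s ∧
      extend hT (y 2) t = D.1 2 + ∫ s in (0 : ℝ)..t,
        (extend hT (D.2 + P.freqSource hT (toComplex ξ) y) s
          - ∑ j, P.c j 0 s * extend hT (y j) s) := fun t ht => by
    have := P.R_components hT (toComplex ξ) D ⟨t, ht⟩
    exact ⟨(extend_of_mem hT _ ht).trans this.1, (extend_of_mem hT _ ht).trans this.2.1,
      (extend_of_mem hT _ ht).trans this.2.2⟩
  have hint := P.intervalIntegrable_rhs hT y (D.2 + P.freqSource hT (toComplex ξ) y)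
  refine S.energy_le h.pos (f := extend hT D.2) (p := b 0 0) hp0 (norm_nonneg D) ?_ ?_ ?_ ?_ ?_ ?_ ?_ ht
  · exact S.intervalIntegrable_rate hT fun k => intervalIntegrable_tDeriv hT (hN k)
  · exact fun t ht => hasDerivWithinAt_of_integral (continuous_extend hT _)
      (fun s hs => (hy s hs).1) ht
  · exact fun t ht => hasDerivWithinAt_of_integral (continuous_extend hT _)
      (fun s hs => (hy s hs).2.1) ht
  · refine absolutelyContinuousOnInterval_congr
      (absolutelyContinuousOnInterval_integral hT hint (D.1 2)) fun s hs => ?_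
    rw [uIcc_of_le hT] at hs
    exact (hy s hs).2.2
  · rw [ae_restrict_iff' measurableSet_Icc] at hp
    filter_upwards [hp] with s hs hmem using hs (Ioo_subset_Icc_self hmem)
  · intro s hs
    rw [extend_of_mem hT _ hs]
    exact (D.2.norm_coe_le_norm _).trans (norm_snd_le D)
  · filter_upwards [ae_hasDerivAt_integral hT hint (D.1 2)] with s hs hmem
    have hs' := Ioo_subset_Icc_self hmem
    have hd := (hs hmem).congr_of_eventuallyEq (f₁ := extend hT (y 2)) (by
      filter_upwards [Icc_mem_nhds hmem.1 hmem.2] with r hr using (hy r hr).2.2)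
    refine hd.congr_deriv ?_
    rw [h.rhs_eq ξ hN (extend hT D.2) (fun j => extend hT (y j)) hs']
    have := P.freqSource_sub hT (toComplex ξ) y ⟨s, hs'⟩
    simp only [extend_of_mem hT _ hs', ContinuousMap.add_apply]
    rw [add_sub_assoc, this, ← sub_eq_add_neg]
    rfl

/-- The symbols are polynomially bounded. -/
theorem exists_boundedBy (h : Regular T a b) : ∃ C : ℝ, 0 ≤ C ∧ ∃ k : ℕ, ∀ (ξ : Space d) hN,
    ∀ t ∈ Icc 0 T, (h.symbolData ξ hN).BoundedBy t (C * (1 + ‖ξ‖) ^ k) := by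
  have H := ((((PolyBounded.const (T := T) 1).add (PolyBounded.sum Finset.univ h.polyBounded_lam)).add
    (PolyBounded.sum Finset.univ h.polyBounded_tDeriv_lam)).add
    (PolyBounded.sum Finset.univ h.polyBounded_mu)).add
    ((PolyBounded.sum Finset.univ h.polyBounded_checkMLam).add
    (PolyBounded.sum Finset.univ h.polyBounded_checkNMu))
  obtain ⟨C, hC, k, hk⟩ := H
  refine ⟨C, hC, k, fun ξ hN t ht => ?_⟩
  have hb := (le_abs_self _).trans (hk ξ t ht)
  have s1 : 0 ≤ ∑ j, |lam a j t ξ| := Finset.sum_nonneg fun _ _ => abs_nonneg _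
  have s2 : 0 ≤ ∑ j, |tDeriv T 1 (lam a j) t ξ| := Finset.sum_nonneg fun _ _ => abs_nonneg _
  have s3 : 0 ≤ ∑ k, |mu a k t ξ| := Finset.sum_nonneg fun _ _ => abs_nonneg _
  have s4 : 0 ≤ ∑ j, ‖checkMLam T a b j t ξ‖ := Finset.sum_nonneg fun _ _ => norm_nonneg _
  have s5 : 0 ≤ ∑ k, ‖checkNMu T a b k t ξ‖ := Finset.sum_nonneg fun _ _ => norm_nonneg _
  refine ⟨by linarith, fun j => ?_, fun j => ?_, fun k => ?_, fun j => ?_, fun k => ?_⟩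
  · have := Finset.single_le_sum (f := fun j => |lam a j t ξ|) (fun _ _ => abs_nonneg _)
      (Finset.mem_univ j)
    change |lam a j t ξ| ≤ _
    linarith
  · have := Finset.single_le_sum (f := fun j => |tDeriv T 1 (lam a j) t ξ|)
      (fun _ _ => abs_nonneg _) (Finset.mem_univ j)
    change |tDeriv T 1 (lam a j) t ξ| ≤ _
    linarith
  · have := Finset.single_le_sum (f := fun k => |mu a k t ξ|)
      (fun _ _ => abs_nonneg _) (Finset.mem_univ k)
    have e : (h.symbolData ξ hN).mu k t = mu a k t ξ := (h.mu_eq ξ ht k).symm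
    rw [e]
    linarith
  · have := Finset.single_le_sum (f := fun j => ‖checkMLam T a b j t ξ‖)
      (fun _ _ => norm_nonneg _) (Finset.mem_univ j)
    change ‖checkMLam T a b j t ξ‖ ≤ _
    linarith
  · have := Finset.single_le_sum (f := fun k => ‖checkNMu T a b k t ξ‖)
      (fun _ _ => norm_nonneg _) (Finset.mem_univ k)
    change ‖checkNMu T a b k t ξ‖ ≤ _
    linarith

/-- A logarithmic bound of the integral of the rate. -/
def RateBound (h : Regular T a b) (C R : ℝ) : Prop :=
  ∀ ξ : Space d, R ≤ ‖ξ‖ → ∃ hN, ∫ t in (0 : ℝ)..T, (h.symbolData ξ hN).rate t ≤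
    C * Real.log (1 + ‖ξ‖) + T

theorem norm_toComplex_le (ξ : Space d) : ‖toComplex ξ‖ ≤ ‖ξ‖ :=
  (pi_norm_le_iff_of_nonneg (norm_nonneg ξ)).2 fun i => by
    rw [toComplex, Complex.norm_real]
    exact PiLp.norm_apply_le ξ i

/-- At large frequencies the energy estimate is used, with polynomial losses in comparing the energy
and the solution at both ends. At the remaining frequencies, a bounded set, the exponential bound
suffices. -/
theorem poly_bound (h : Regular T a b) {C R : ℝ} (hCR : h.RateBound C R) :
    ∃ C : ℝ, 0 ≤ C ∧ ∃ K : ℕ, ∀ ξ, ‖h.system.R (toComplex ξ)‖ ≤ C * (1 + ‖ξ‖) ^ K := by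
  have hT := h.pos.le
  obtain ⟨p, hp0, hp⟩ := (EssBounded.of_memLp h.memLp).bdd
  obtain ⟨C₁, hC₁, k, hk⟩ := h.exists_boundedBy
  obtain ⟨C₂, B, hC₂, hB, hexp⟩ :=
    (coefData a b h.contDiffOn_a h.contDiffOn_b h.memLp).exp_bound hT
  -- Chosen so that `exp(29(p + 40) C log(1 + |η|)) ≤ (1 + |η|)^n`.
  set n := ⌈29 * (p + 40) * C⌉₊ with hn
  set c₀ := 29 * (p + 40) * T + 14 * T with hc₀
  set Λ : Space d → ℝ := fun ξ => C₁ * (1 + ‖ξ‖) ^ k with hΛ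
  set Q : Space d → ℝ := fun ξ => Real.exp c₀ * (1 + ‖ξ‖) ^ n * ((3150 * Λ ξ ^ 6) + 14 * T) with hQ
  have hΛ0 : ∀ ξ, 0 ≤ Λ ξ := fun ξ => by positivity
  have hQ0 : ∀ ξ, 0 ≤ Q ξ := fun ξ => by positivity
  have large : ∀ ξ : Space d, R ≤ ‖(2 * Real.pi) • ξ‖ → ‖h.system.R (toComplex ξ)‖ ≤
      11 * Λ ((2 * Real.pi) • ξ) ^ 2 * (1 + Q ((2 * Real.pi) • ξ)) := by
    intro ξ hξ
    set η := (2 * Real.pi) • ξ with hη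
    obtain ⟨hN, hrate⟩ := hCR η hξ
    have hη0 := hΛ0 η
    have hη1 := hQ0 η
    refine ContinuousLinearMap.opNorm_le_bound _ (by positivity) fun D => ?_
    set S := h.symbolData η hN with hS
    set y := h.system.R (toComplex ξ) D with hy
    set E := S.energy (extend hT (y 0)) (extend hT (y 1)) (extend hT (y 2)) with hE
    have h0 : (0 : ℝ) ∈ Icc 0 T := ⟨le_rfl, hT⟩
    have hinit : E 0 ≤ 14 * (225 * Λ η ^ 6 * ‖D‖ ^ 2) := by
      obtain ⟨i0, i1, i2⟩ := (coefData a b h.contDiffOn_a h.contDiffOn_b h.memLp).R_components hT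
        (toComplex ξ) D ⟨0, h0⟩
      simp only [intervalIntegral.integral_same, add_zero] at i0 i1 i2
      have hD : ∀ j, ‖D.1 j‖ ≤ ‖D‖ := fun j => (norm_le_pi_norm D.1 j).trans (norm_fst_le D)
      refine SymbolData.energy_le_of_boundedBy h0 (hk η hN 0 h0) ?_ ?_ ?_
      · rw [extend_of_mem hT _ h0]; exact (congrArg norm i0).trans_le (hD 0)
      · rw [extend_of_mem hT _ h0]; exact (congrArg norm i1).trans_le (hD 1)
      · rw [extend_of_mem hT _ h0]; exact (congrArg norm i2).trans_le (hD 2)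
    have hgrow : Real.exp (29 * ((p + 40) * ∫ s in (0 : ℝ)..T, S.rate s) + 14 * T) ≤
        Real.exp c₀ * (1 + ‖η‖) ^ n := by
      have hpos : 0 < 1 + ‖η‖ := by positivity
      have hlog : 0 ≤ Real.log (1 + ‖η‖) := Real.log_nonneg (by linarith [norm_nonneg η])
      rw [← Real.exp_log (pow_pos hpos n), ← Real.exp_add, Real.exp_le_exp, Real.log_pow]
      have h1 : 29 * (p + 40) * C * Real.log (1 + ‖η‖) ≤ n * Real.log (1 + ‖η‖) :=
        mul_le_mul_of_nonneg_right (Nat.le_ceil _) hlog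
      have h2 : (p + 40) * ∫ s in (0 : ℝ)..T, S.rate s ≤
          (p + 40) * (C * Real.log (1 + ‖η‖) + T) :=
        mul_le_mul_of_nonneg_left hrate (by linarith)
      rw [hc₀]
      linarith
    have hEt : ∀ t ∈ Icc 0 T, E t ≤ Q η * ‖D‖ ^ 2 := by
      intro t ht
      refine (h.energy_frequency_le ξ hN hp0 hp D ht).trans ?_
      calc _ ≤ Real.exp c₀ * (1 + ‖η‖) ^ n * (14 * (225 * Λ η ^ 6 * ‖D‖ ^ 2) + 14 * T * ‖D‖ ^ 2) := by
            refine mul_le_mul hgrow (add_le_add hinit le_rfl) ?_ (by positivity)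
            have := S.energy_nonneg (extend hT (y 0)) (extend hT (y 1)) (extend hT (y 2)) h0
            positivity
        _ = Q η * ‖D‖ ^ 2 := by rw [hQ]; ring
    have hsqrt : ∀ t ∈ Icc 0 T, √(E t) ≤ (1 + Q η) * ‖D‖ := by
      intro t ht
      refine Real.sqrt_le_iff.2 ⟨by positivity, (hEt t ht).trans ?_⟩
      rw [mul_pow]
      gcongr
      nlinarith
    have hfin : ∀ (j : Fin 3) (t : Icc (0 : ℝ) T),
        ‖y j t‖ ≤ 11 * Λ η ^ 2 * (1 + Q η) * ‖D‖ := by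
      intro j t
      obtain ⟨n0, n1, n2⟩ := SymbolData.norm_le_of_energy t.2 (hk η hN t t.2)
        (extend hT (y 0)) (extend hT (y 1)) (extend hT (y 2))
      rw [extend_of_mem hT _ t.2] at n0 n1 n2
      have hs := mul_le_mul_of_nonneg_left (hsqrt t t.2) (by positivity : 0 ≤ 11 * Λ η ^ 2)
      rw [← mul_assoc] at hs
      fin_cases j
      · exact n0.trans hs
      · exact n1.trans hs
      · exact n2.trans hs
    refine (pi_norm_le_iff_of_nonneg (by positivity)).2 fun j => ?_
    exact (ContinuousMap.norm_le _ (by positivity)).2 fun t => hfin j t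
  have hPB : PolyBounded T fun (ξ : Space d) _ => 11 * Λ ξ ^ 2 * (1 + Q ξ) := by
    have hΛP : PolyBounded T fun (ξ : Space d) _ => Λ ξ :=
      ⟨C₁, hC₁, k, fun ξ _ _ => by rw [abs_of_nonneg (hΛ0 ξ)]⟩
    have hnP : PolyBounded T fun (ξ : Space d) _ => (1 + ‖ξ‖) ^ n :=
      ⟨1, zero_le_one, n, fun ξ _ _ => by rw [abs_of_nonneg (by positivity), one_mul]⟩
    have h2 := hΛP.mul hΛP
    have h6 := (h2.mul h2).mul h2
    refine (((PolyBounded.const 11).mul h2).mul ((PolyBounded.const 1).add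
      (((PolyBounded.const (Real.exp c₀)).mul hnP).mul (((PolyBounded.const 3150).mul h6).add
        (PolyBounded.const (14 * T)))))).of_le fun ξ t ht => ?_
    have := hΛ0 ξ
    have := hQ0 ξ
    rw [abs_of_nonneg (by positivity)]
    refine le_of_eq ?_
    simp only [hQ]
    ring
  obtain ⟨C₃, hC₃, K, hK⟩ := hPB
  -- The factor `7 > 2π` compares the frequencies `ξ` and `2πξ`.
  refine ⟨C₃ * 7 ^ K + C₂ * Real.exp (B * |R|), by positivity, K, fun ξ => ?_⟩
  have hpi := Real.pi_gt_three
  have hpi4 := Real.pi_lt_d2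
  have hnorm : ‖(2 * Real.pi) • ξ‖ = 2 * Real.pi * ‖ξ‖ := by
    rw [norm_smul, Real.norm_eq_abs, abs_of_pos (by positivity)]
  have hξ := norm_nonneg ξ
  have hone : 1 ≤ (1 + ‖ξ‖) ^ K := one_le_pow₀ (by linarith)
  rcases le_total R ‖(2 * Real.pi) • ξ‖ with hR | hR
  · refine (large ξ hR).trans ((le_abs_self _).trans ((hK _ 0 ⟨le_rfl, hT⟩).trans ?_))
    have h1 : 1 + ‖(2 * Real.pi) • ξ‖ ≤ 7 * (1 + ‖ξ‖) := by
      rw [hnorm]; nlinarith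
    calc C₃ * (1 + ‖(2 * Real.pi) • ξ‖) ^ K ≤ C₃ * (7 * (1 + ‖ξ‖)) ^ K := by gcongr
      _ = C₃ * 7 ^ K * (1 + ‖ξ‖) ^ K := by rw [mul_pow]; ring
      _ ≤ _ := by
        gcongr
        have : 0 ≤ C₂ * Real.exp (B * |R|) := by positivity
        linarith
  · refine (hexp _).trans ?_
    have h1 : ‖toComplex ξ‖ ≤ |R| := (norm_toComplex_le ξ).trans
      ((by rw [hnorm]; nlinarith : ‖ξ‖ ≤ ‖(2 * Real.pi) • ξ‖).trans (hR.trans (le_abs_self R)))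
    calc C₂ * Real.exp (B * ‖toComplex ξ‖) ≤ C₂ * Real.exp (B * |R|) := by gcongr
      _ ≤ C₃ * 7 ^ K + C₂ * Real.exp (B * |R|) := by
        have : 0 ≤ C₃ * 7 ^ K := by positivity
        linarith
      _ ≤ _ := le_mul_of_one_le_right (by positivity) hone

theorem hyperbolic (h : Regular T a b) {C R : ℝ} (hCR : h.RateBound C R) :
    h.system.Hyperbolic :=
  ⟨CoefData.isUnit_one_sub_W _ _, CoefData.exp_bound _ _, h.poly_bound hCR⟩

theorem exists_rateBound (h : Regular T a b)
    (h1 : LogBound T fun t (ξ : Space d) => ∑ j : Fin 3,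
      |tDeriv T 1 (lam a j) t ξ - tDeriv T 1 (lam a (j + 1)) t ξ|
        / |lam a j t ξ - lam a (j + 1) t ξ|)
    (h2 : LogBound T fun t (ξ : Space d) => ∑ j : Fin 3,
      |tDeriv T 2 (lam a j) t ξ - tDeriv T 2 (lam a (j + 1)) t ξ|
        / (|tDeriv T 1 (lam a j) t ξ - tDeriv T 1 (lam a (j + 1)) t ξ| + 1))
    (h3 : LogBound T fun t (ξ : Space d) => ∑ j : Fin 3,
      ‖tDeriv T 1 (checkMLam T a b j) t ξ‖ / (‖checkMLam T a b j t ξ‖ + 1))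
    (hN : ∃ R : ℝ, ∀ ξ : Space d, R ≤ ‖ξ‖ → ∀ j : Fin 2,
      AbsolutelyContinuousOnInterval (fun t => checkNMu T a b j t ξ) 0 T)
    (h4 : LogBound T fun t (ξ : Space d) => ∑ j : Fin 2,
      ‖tDeriv T 1 (checkNMu T a b j) t ξ‖ / (‖checkNMu T a b j t ξ‖ + 1))
    (h5 : LogBound T fun t (ξ : Space d) => ∑ j : Fin 3,
      ‖checkMLam T a b j t ξ‖
        / (|lam a j t ξ - lam a (j + 1) t ξ| * |lam a j t ξ - lam a (j + 2) t ξ|))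
    (h6 : LogBound T fun t (ξ : Space d) => ∑ j : Fin 2,
      √(‖checkNMu T a b j t ξ‖ / |mu a 1 t ξ - mu a 0 t ξ|)) :
    ∃ C R, h.RateBound C R := by
  obtain ⟨C₁, R₁, H1⟩ := h1
  obtain ⟨C₂, R₂, H2⟩ := h2
  obtain ⟨C₃, R₃, H3⟩ := h3
  obtain ⟨C₄, R₄, H4⟩ := h4
  obtain ⟨C₅, R₅, H5⟩ := h5
  obtain ⟨C₆, R₆, H6⟩ := h6
  obtain ⟨R₀, H0⟩ := hN
  refine ⟨|C₁ + C₂ + C₃ + C₄ + C₅ + C₆|, |R₀| + |R₁| + |R₂| + |R₃| + |R₄| + |R₅| + |R₆|,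
    fun ξ hξ => ?_⟩
  have a0 := abs_nonneg R₀
  have a1 := abs_nonneg R₁
  have a2 := abs_nonneg R₂
  have a3 := abs_nonneg R₃
  have a4 := abs_nonneg R₄
  have a5 := abs_nonneg R₅
  have a6 := abs_nonneg R₆
  refine ⟨H0 ξ (by linarith [le_abs_self R₀]), ?_⟩
  set S := h.symbolData ξ (H0 ξ (by linarith [le_abs_self R₀]))
  rw [S.integral_rate h.pos.le fun k => intervalIntegrable_tDeriv h.pos.le (S.N_ac k)]
  -- The sixth hypothesis is stated with `|μ₂ - μ₁|`, which is `delta` on `[0,T]`.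
  have e6 : ∫ t in (0 : ℝ)..T, ∑ k : Fin 2, √(‖S.N k t‖ / S.delta t) =
      ∫ t in (0 : ℝ)..T, ∑ j : Fin 2, √(‖checkNMu T a b j t ξ‖ / |mu a 1 t ξ - mu a 0 t ξ|) := by
    refine intervalIntegral.integral_congr fun t ht => ?_
    rw [uIcc_of_le h.pos.le] at ht
    have hδ : |mu a 1 t ξ - mu a 0 t ξ| = S.delta t := by
      rw [← abs_of_nonneg (S.delta_nonneg t), h.mu_eq ξ ht, h.mu_eq ξ ht]
      congr 1
      change _ = √(2 / 9 * ∑ j, (lam a j t ξ - lam a (j + 1) t ξ) ^ 2)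
      simp
      ring
    simp only [hδ]
    rfl
  rw [e6]
  have b1 := H1 ξ (by linarith [le_abs_self R₁])
  have b2 := H2 ξ (by linarith [le_abs_self R₂])
  have b3 := H3 ξ (by linarith [le_abs_self R₃])
  have b4 := H4 ξ (by linarith [le_abs_self R₄])
  have b5 := H5 ξ (by linarith [le_abs_self R₅])
  have b6 := H6 ξ (by linarith [le_abs_self R₆])
  have hlog : 0 ≤ Real.log (1 + ‖ξ‖) := Real.log_nonneg (by linarith [norm_nonneg ξ])
  have hsum := mul_le_mul_of_nonneg_right (le_abs_self (C₁ + C₂ + C₃ + C₄ + C₅ + C₆)) hlog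
  have key := add_le_add (add_le_add (add_le_add (add_le_add (add_le_add b1 b2) b3) b4) b5) b6
  refine add_le_add (key.trans (le_trans (le_of_eq ?_) hsum)) le_rfl
  ring

end Regular


/-! ### Solutions of the equation and solutions of the system -/

section Conversion

variable {d : ℕ}

theorem mDeriv_zero {F : Type*} [NormedAddCommGroup F] [NormedSpace ℝ F] (g : Space d → F) :
    mDeriv 0 g = g := by
  unfold mDeriv
  generalize List.finRange d = l
  induction l with
  | nil => rfl
  | cons i l ih => rw [List.foldr_cons, ih]; rfl

theorem mDeriv_apply {T : ℝ} {U : Space d → Sol T} (hU : ContDiff ℝ ∞ U) (α : Fin d → ℕ)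
    (x : Space d) (j : Fin 3) (t : Icc (0 : ℝ) T) :
    mDeriv α U x j t = mDeriv α (fun z => U z j t) x := by
  have h := mDeriv_clm ((ContinuousMap.evalCLM ℝ t : C(Icc (0 : ℝ) T, ℂ) →L[ℝ] ℂ).comp
    (ContinuousLinearMap.proj j : Sol T →L[ℝ] C(Icc (0 : ℝ) T, ℂ))) hU α
  exact (congrFun h x).symm

theorem contDiff_component {T : ℝ} {U : Space d → Sol T} (hU : ContDiff ℝ ∞ U) (j : Fin 3) :
    ContDiff ℝ ∞ fun x => U x j :=
  (ContinuousLinearMap.proj j : Sol T →L[ℝ] C(Icc (0 : ℝ) T, ℂ)).contDiff.comp hU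

theorem norm_iteratedFDeriv_component_le {T : ℝ} {U : Space d → Sol T} (hU : ContDiff ℝ ∞ U)
    (j : Fin 3) (n : ℕ) (x : Space d) :
    ‖iteratedFDeriv ℝ n (fun x => U x j) x‖ ≤ ‖iteratedFDeriv ℝ n U x‖ := by
  have h := (ContinuousLinearMap.proj j : Sol T →L[ℝ] C(Icc (0 : ℝ) T, ℂ)).iteratedFDeriv_comp_left
    (hU.contDiffAt (x := x)) (i := n) (by exact_mod_cast le_top)
  refine ContinuousMultilinearMap.opNorm_le_bound (norm_nonneg _) fun v => ?_
  have h' : iteratedFDeriv ℝ n (fun x => U x j) x v = iteratedFDeriv ℝ n U x v j :=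
    congrArg (fun A => A v) h
  rw [h']
  exact (norm_le_pi_norm _ j).trans (ContinuousMultilinearMap.le_opNorm _ v)

/-- The data of the system. -/
def dataOf {T : ℝ} (u₀ : Fin 3 → Space d → ℂ) {f : ℝ → Space d → ℂ} (hf : ContSmooth T f)
    (x : Space d) : Data T := (fun k => u₀ k x, hf.jointSmooth.curve x)

theorem contDiff_dataOf {T : ℝ} {u₀ : Fin 3 → Space d → ℂ} (hu : ∀ k, ContDiff ℝ ∞ (u₀ k))
    {f : ℝ → Space d → ℂ} (hf : ContSmooth T f) : ContDiff ℝ ∞ (dataOf u₀ hf) :=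
  (contDiff_pi.2 hu).prodMk hf.jointSmooth.contDiff_curve

theorem norm_iteratedFDeriv_dataOf_le {T : ℝ} {u₀ : Fin 3 → Space d → ℂ}
    (hu : ∀ k, ContDiff ℝ ∞ (u₀ k)) {f : ℝ → Space d → ℂ} (hf : ContSmooth T f) {n : ℕ}
    {x : Space d} {B : ℝ} (h1 : ∀ k, ‖iteratedFDeriv ℝ n (u₀ k) x‖ ≤ B)
    (h2 : ∀ t ∈ Icc 0 T, ‖iteratedFDeriv ℝ n (f t) x‖ ≤ B) :
    ‖iteratedFDeriv ℝ n (dataOf u₀ hf) x‖ ≤ B := by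
  have hB : 0 ≤ B := (norm_nonneg _).trans (h1 0)
  have hD := contDiff_dataOf hu hf
  refine ContinuousMultilinearMap.opNorm_le_bound hB fun v => ?_
  refine max_le ((pi_norm_le_iff_of_nonneg (by positivity)).2 fun k => ?_) ?_
  · have h := ((ContinuousLinearMap.proj k : (Fin 3 → ℂ) →L[ℝ] ℂ).comp
      (ContinuousLinearMap.fst ℝ (Fin 3 → ℂ) C(Icc (0 : ℝ) T, ℂ))).iteratedFDeriv_comp_left
      (hD.contDiffAt (x := x)) (i := n) (by exact_mod_cast le_top)
    have h' : iteratedFDeriv ℝ n (u₀ k) x v = (iteratedFDeriv ℝ n (dataOf u₀ hf) x v).1 k :=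
      congrArg (fun A => A v) h
    rw [← h']
    exact (ContinuousMultilinearMap.le_opNorm _ v).trans (by gcongr; exact h1 k)
  · have h := (ContinuousLinearMap.snd ℝ (Fin 3 → ℂ) C(Icc (0 : ℝ) T, ℂ)).iteratedFDeriv_comp_left
      (hD.contDiffAt (x := x)) (i := n) (by exact_mod_cast le_top)
    have h' : iteratedFDeriv ℝ n hf.jointSmooth.curve x v =
        (iteratedFDeriv ℝ n (dataOf u₀ hf) x v).2 := congrArg (fun A => A v) h
    rw [← h']
    refine (ContinuousMultilinearMap.le_opNorm _ v).trans ?_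
    gcongr
    exact norm_iteratedFDeriv_le_of_eval hf.jointSmooth.contDiff_curve hB n x fun t => h2 t t.2

namespace CoefData

variable {T : ℝ} (P : CoefData d T) (hT : 0 ≤ T)

/-- The right hand side and the terms with space derivatives. -/
def source (U : Space d → Sol T) (F : C(Icc (0 : ℝ) T, ℂ)) (x : Space d) : C(Icc (0 : ℝ) T, ℂ) :=
  F + ∑ α ∈ (indices d).erase 0, ((P.system hT).q α (mDeriv α U x)).2

theorem solves_iff (U : Space d → Sol T) (D : Space d → Data T) :
    (P.system hT).Solves D U ↔ ∀ x, ∀ t : Icc (0 : ℝ) T,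
      U x 0 t = (D x).1 0 + ∫ s in (0 : ℝ)..t, extend hT (U x 1) s ∧
      U x 1 t = (D x).1 1 + ∫ s in (0 : ℝ)..t, extend hT (U x 2) s ∧
      U x 2 t = (D x).1 2 + ∫ s in (0 : ℝ)..t, (extend hT (P.source hT U (D x).2 x) s
        - ∑ j, P.c j 0 s * extend hT (U x j) s) := by
  refine forall_congr' fun x => ?_
  rw [← P.eq_J_add_Q₀_iff hT (U x) (D x).1]
  have e : D x + ∑ α ∈ (P.system hT).A, (P.system hT).q α (mDeriv α U x) =
      ((D x).1, P.source hT U (D x).2 x) := by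
    refine Prod.ext ?_ ?_
    · rw [Prod.fst_add, Prod.fst_sum]
      exact (congrArg _ (Finset.sum_eq_zero fun α _ => P.q_apply_fst hT α _)).trans (add_zero _)
    · rw [Prod.snd_add, Prod.snd_sum]
      rfl
  rw [← e, map_add, add_right_comm]

theorem source_sub {U : Space d → Sol T} (hU : ContDiff ℝ ∞ U) (F : C(Icc (0 : ℝ) T, ℂ))
    (x : Space d) {t : ℝ} (ht : t ∈ Icc 0 T) :
    extend hT (P.source hT U F x) t - ∑ j, P.c j 0 t * extend hT (U x j) t =
      F ⟨t, ht⟩ - ∑ j : Fin 3, ∑ α ∈ indices d,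
        P.c j α t * mDeriv α (fun z => U z j ⟨t, ht⟩) x := by
  have h1 : P.source hT U F x ⟨t, ht⟩ = F ⟨t, ht⟩ - ∑ α ∈ (indices d).erase 0, ∑ j : Fin 3,
      P.c j α t * mDeriv α (fun z => U z j ⟨t, ht⟩) x := by
    rw [source, ContinuousMap.add_apply, ContinuousMap.sum_apply, sub_eq_add_neg,
      ← Finset.sum_neg_distrib]
    congr 1
    refine Finset.sum_congr rfl fun α hα => ?_
    rw [q_apply_snd P hT (Finset.ne_of_mem_erase hα)]
    simp only [mDeriv_apply hU]
  have h2 : ∑ j, P.c j 0 t * U x j ⟨t, ht⟩ =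
      ∑ j, P.c j 0 t * mDeriv 0 (fun z => U z j ⟨t, ht⟩) x := by
    simp only [mDeriv_zero]
  simp only [extend_of_mem hT _ ht]
  rw [h1, h2, Finset.sum_comm, sub_sub, ← Finset.sum_add_distrib]
  congr 1
  exact Finset.sum_congr rfl fun j _ => Finset.sum_erase_add _ _ zero_mem_indices

end CoefData

end Conversion

/-! ### Solutions of the equation solve the system -/

namespace IsSolution

variable {d : ℕ} {T : ℝ} {a : Coeffs d ℝ} {b : Coeffs d ℂ} {f : ℝ → Space d → ℂ}
  {u₀ : Fin 3 → Space d → ℂ} {u : ℝ → Space d → ℂ}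

/-- A solution of the equation as a function with values in the curves. -/
def toSystem (hu : IsSolution T a b f u₀ u) (x : Space d) : Sol T :=
  fun k => (hu.contSmooth k).jointSmooth.curve x

theorem contDiff_toSystem (hu : IsSolution T a b f u₀ u) : ContDiff ℝ ∞ hu.toSystem :=
  contDiff_pi.2 fun k => (hu.contSmooth k).jointSmooth.contDiff_curve

/-- The first two components are integrated by the fundamental theorem of calculus for continuous
derivatives. The third uses the absolute continuity of `∂_t² u`, since the equation gives its
derivative only almost everywhere. -/
theorem solves (hu : IsSolution T a b f u₀ u) (h : Regular T a b) (hf : ContSmooth T f) :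
    h.system.Solves (dataOf u₀ hf) hu.toSystem := by
  have hT := h.pos.le
  set P := coefData a b h.contDiffOn_a h.contDiffOn_b h.memLp with hP
  refine (P.solves_iff hT _ _).2 fun x t => ?_
  have hext : ∀ (k : Fin 3), ∀ s ∈ Icc 0 T, extend hT (hu.toSystem x k) s = tDeriv T k u s x :=
    fun k s hs => by rw [extend_of_mem hT _ hs]; rfl
  have hcont : ∀ k : Fin 3, ContinuousOn (fun t => tDeriv T k u t x) (Icc 0 T) := fun k =>
    (continuous_extend hT (hu.toSystem x k)).continuousOn.congr fun s hs => (hext k s hs).symm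
  have hint : ∀ k : Fin 3, ∫ s in (0 : ℝ)..t, extend hT (hu.toSystem x k) s =
      ∫ s in (0 : ℝ)..t, tDeriv T k u s x := fun k =>
    intervalIntegral.integral_congr fun s hs => by
      rw [uIcc_of_le t.2.1] at hs
      exact hext k s ⟨hs.1, hs.2.trans t.2.2⟩
  have e0 : (fun t => tDeriv T 0 u t x) = fun t => u t x := by
    funext t
    rw [tDeriv, iteratedDerivWithin_zero]
  refine ⟨?_, ?_, ?_⟩
  · rw [hint]
    have h1 := eq_integral_of_hasDerivWithinAt hT (hcont 1) (u := fun t => tDeriv T 0 u t x)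
      (fun s hs => by
        rw [e0]
        exact hasDerivWithinAt_iteratedDerivWithin_one h.pos (n := 2) (hu.contDiffOn x)
          (by norm_num) hs) t.2
    have h2 := hu.initial 0 x
    exact h1.trans (congrArg (· + _) h2)
  · rw [hint]
    have h1 := eq_integral_of_hasDerivWithinAt hT (hcont 2) (u := fun t => tDeriv T 1 u t x)
      (fun s hs => hasDerivWithinAt_iteratedDerivWithin h.pos (n := 2) (m := 1) (hu.contDiffOn x)
          (by norm_num) hs) t.2
    have h2 := hu.initial 1 x
    exact h1.trans (congrArg (· + _) h2)
  · have h2 := hu.initial 2 x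
    refine (eq_integral_of_ae_hasDerivAt hT (u := fun t => tDeriv T 2 u t x)
      (P.intervalIntegrable_rhs hT _ _) (hu.absCont x) ?_ t.2).trans (congrArg (· + _) h2)
    have heq := hu.equation x
    rw [ae_restrict_iff' measurableSet_Icc] at heq
    filter_upwards [heq, ae_hasDerivAt_of_absolutelyContinuous (hu.absCont x)] with s hs hd hmem
    have hs' := Ioo_subset_Icc_self hmem
    have hd' := (hd (by rwa [uIcc_of_le hT])).hasDerivAt
    refine hd'.congr_deriv ?_
    have e3 : tDeriv T 3 u s x = deriv (fun t => tDeriv T 2 u t x) s := by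
      rw [tDeriv, iteratedDerivWithin_succ, derivWithin_of_mem_nhds (Icc_mem_nhds hmem.1 hmem.2)]
      rfl
    rw [P.source_sub hT hu.contDiff_toSystem _ x hs', ← e3]
    have h3 := hs hs'
    rw [operator_eq, ← eq_sub_iff_add_eq] at h3
    exact h3

theorem norm_iteratedFDeriv_le (hu : IsSolution T a b f u₀ u) (k : Fin 3) (n : ℕ) {t : ℝ}
    (ht : t ∈ Icc 0 T) (x : Space d) :
    ‖iteratedFDeriv ℝ n (tDeriv T k u t) x‖ ≤ ‖iteratedFDeriv ℝ n hu.toSystem x‖ :=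
  (norm_iteratedFDeriv_eval_le (contDiff_component hu.contDiff_toSystem k) ⟨t, ht⟩ n x).trans
    (norm_iteratedFDeriv_component_le hu.contDiff_toSystem k n x)

end IsSolution

/-! ### Solutions of the system solve the equation; well-posedness -/

namespace Regular

variable {d : ℕ} {T : ℝ} {a : Coeffs d ℝ} {b : Coeffs d ℂ} {f : ℝ → Space d → ℂ}
  {u₀ : Fin 3 → Space d → ℂ}

/-- The integral equations identify the components of `U` with the time derivatives of the first
one. The third is a primitive of an integrable function, so it is absolutely continuous and the
equation holds almost everywhere. -/
theorem isSolution (h : Regular T a b) (hf : ContSmooth T f) {U : Space d → Sol T}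
    (hU : ContDiff ℝ ∞ U) (hs : h.system.Solves (dataOf u₀ hf) U) :
    IsSolution T a b f u₀ fun t x => extend h.pos.le (U x 0) t := by
  have hT := h.pos.le
  set P := coefData a b h.contDiffOn_a h.contDiffOn_b h.memLp with hP
  have hcomp := (P.solves_iff hT _ _).1 hs
  have hy : ∀ x, ∀ t ∈ Icc 0 T,
      extend hT (U x 0) t = u₀ 0 x + ∫ s in (0 : ℝ)..t, extend hT (U x 1) s ∧
      extend hT (U x 1) t = u₀ 1 x + ∫ s in (0 : ℝ)..t, extend hT (U x 2) s ∧
      extend hT (U x 2) t = u₀ 2 x + ∫ s in (0 : ℝ)..t,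
        (extend hT (P.source hT U (hf.jointSmooth.curve x) x) s
          - ∑ j, P.c j 0 s * extend hT (U x j) s) := fun x t ht => by
    have := hcomp x ⟨t, ht⟩
    exact ⟨(extend_of_mem hT _ ht).trans this.1, (extend_of_mem hT _ ht).trans this.2.1,
      (extend_of_mem hT _ ht).trans this.2.2⟩
  set u : ℝ → Space d → ℂ := fun t x => extend hT (U x 0) t with hu
  have t0 : ∀ t x, tDeriv T 0 u t x = extend hT (U x 0) t := fun t x => by
    rw [tDeriv, iteratedDerivWithin_zero]
  have d0 : ∀ x, ∀ t ∈ Icc 0 T,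
      HasDerivWithinAt (extend hT (U x 0)) (extend hT (U x 1) t) (Icc 0 T) t := fun x t ht =>
    hasDerivWithinAt_of_integral (continuous_extend hT _) (fun s hs => (hy x s hs).1) ht
  have d1 : ∀ x, ∀ t ∈ Icc 0 T,
      HasDerivWithinAt (extend hT (U x 1)) (extend hT (U x 2) t) (Icc 0 T) t := fun x t ht =>
    hasDerivWithinAt_of_integral (continuous_extend hT _) (fun s hs => (hy x s hs).2.1) ht
  have t1 : ∀ x, ∀ t ∈ Icc 0 T, tDeriv T 1 u t x = extend hT (U x 1) t := fun x t ht =>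
    iteratedDerivWithin_one_eq h.pos ht (d0 x t ht)
  have d1' : ∀ x, ∀ t ∈ Icc 0 T,
      HasDerivWithinAt (iteratedDerivWithin 1 (fun s => u s x) (Icc 0 T)) (extend hT (U x 2) t)
        (Icc 0 T) t := fun x t ht => (d1 x t ht).congr (t1 x) (t1 x t ht)
  have t2 : ∀ x, ∀ t ∈ Icc 0 T, tDeriv T 2 u t x = extend hT (U x 2) t := fun x t ht => by
    rw [tDeriv, iteratedDerivWithin_succ]
    exact (d1' x t ht).derivWithin (uniqueDiffOn_Icc h.pos t ht)
  have tk : ∀ (k : Fin 3) x, ∀ t ∈ Icc 0 T, tDeriv T k u t x = extend hT (U x k) t := by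
    intro k x t ht
    fin_cases k
    · exact t0 t x
    · exact t1 x t ht
    · exact t2 x t ht
  have tk' : ∀ (k : Fin 3) (t : Icc (0 : ℝ) T), tDeriv T k u t = fun x => U x k t :=
    fun k t => funext fun x => (tk k x t t.2).trans (extend_of_mem hT _ t.2)
  have hrhs : ∀ x, IntervalIntegrable (fun s =>
      extend hT (P.source hT U (hf.jointSmooth.curve x) x) s
        - ∑ j, P.c j 0 s * extend hT (U x j) s) volume 0 T :=
    fun x => P.intervalIntegrable_rhs hT _ _
  refine ⟨fun x => ?_, fun k => ?_, fun x => ?_, fun x => ?_, fun k x => ?_⟩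
  · refine contDiffOn_of_continuousOn_differentiableOn_deriv (n := 2) (fun m hm => ?_)
      fun m hm => ?_
    · have hm' : m ≤ 2 := by exact_mod_cast hm
      exact (continuous_extend hT (U x ⟨m, by omega⟩)).continuousOn.congr
        (tk ⟨m, by omega⟩ x)
    · have hm' : m < 2 := by exact_mod_cast hm
      interval_cases m
      · rw [iteratedDerivWithin_zero]
        exact fun t ht => (d0 x t ht).differentiableWithinAt
      · exact fun t ht => (d1' x t ht).differentiableWithinAt
  · exact (jointSmooth_of_contDiff (contDiff_component hU k)).contSmooth hT (tk' k)
  · refine absolutelyContinuousOnInterval_congr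
      (absolutelyContinuousOnInterval_integral hT (hrhs x) (u₀ 2 x)) fun t ht => ?_
    rw [uIcc_of_le hT] at ht
    exact (t2 x t ht).trans (hy x t ht).2.2
  · rw [ae_restrict_iff' measurableSet_Icc]
    filter_upwards [ae_hasDerivAt_integral hT (hrhs x) (u₀ 2 x), Measure.ae_ne volume (0 : ℝ),
      Measure.ae_ne volume T] with t hd hne0 hneT ht
    have hI : t ∈ Ioo 0 T := ⟨lt_of_le_of_ne ht.1 (Ne.symm hne0), lt_of_le_of_ne ht.2 hneT⟩
    have hd' : HasDerivWithinAt (iteratedDerivWithin 2 (fun s => u s x) (Icc 0 T)) _ (Icc 0 T) t :=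
      (hd hI).hasDerivWithinAt.congr (fun s hs => (t2 x s hs).trans (hy x s hs).2.2)
        ((t2 x t ht).trans (hy x t ht).2.2)
    have t3 : tDeriv T 3 u t x =
        derivWithin (iteratedDerivWithin 2 (fun s => u s x) (Icc 0 T)) (Icc 0 T) t := by
      rw [tDeriv, iteratedDerivWithin_succ]
    rw [operator_eq, t3, hd'.derivWithin (uniqueDiffOn_Icc h.pos t ht), P.source_sub hT hU _ x ht]
    have e : ∀ k : Fin 3, tDeriv T k u t = fun z => U z k ⟨t, ht⟩ := fun k => tk' k ⟨t, ht⟩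
    simp only [e]
    exact sub_add_cancel _ _
  · have h0 : (0 : ℝ) ∈ Icc 0 T := ⟨le_rfl, hT⟩
    rw [tk k x 0 h0]
    obtain ⟨i0, i1, i2⟩ := hy x 0 h0
    simp only [intervalIntegral.integral_same, add_zero] at i0 i1 i2
    fin_cases k
    · exact i0
    · exact i1
    · exact i2

theorem wellPosed (h : Regular T a b) (hS : h.system.Hyperbolic) : WellPosed T a b where
  existence f u₀ hf hu₀ := by
    obtain ⟨U, hU, hs⟩ := hS.exists_solution (contDiff_dataOf hu₀ hf)
    exact ⟨_, h.isSolution hf hU hs⟩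
  uniqueness f u₀ hf hu₀ u v hu hv t ht := by
    have e := hS.unique (contDiff_dataOf hu₀ hf) hu.contDiff_toSystem hv.contDiff_toSystem
      (hu.solves h hf) (hv.solves h hf)
    funext x
    have e' : tDeriv T 0 u t x = tDeriv T 0 v t x :=
      congrArg (fun U : Space d → Sol T => U x 0 ⟨t, ht⟩) e
    simpa only [tDeriv, iteratedDerivWithin_zero] using e'
  continuity S m hc := by
    -- Each order `n ≤ m` of differentiation has its own radius, order and constant; their sums over
    -- `n` dominate all of them.
    choose r M C hr hC hdep using fun n => hS.continuous_dependence hc.isBounded n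
    refine ⟨Metric.closedBall 0 (∑ n ∈ Finset.range (m + 1), r n),
      ∑ n ∈ Finset.range (m + 1), M n, ∑ n ∈ Finset.range (m + 1), C n,
      isCompact_closedBall _ _, fun f u₀ u hf hu₀ hu B hB k n hn t ht x hx => ?_⟩
    have hmem : n ∈ Finset.range (m + 1) := Finset.mem_range.2 (by omega)
    have hB0 : 0 ≤ B := (norm_nonneg _).trans ((hB 0 (Nat.zero_le _) 0
      (Metric.mem_closedBall_self (Finset.sum_nonneg fun n _ => (hr n).le))).1 0)
    have hr' := Finset.single_le_sum (f := r) (fun n _ => (hr n).le) hmem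
    have hM' := Finset.single_le_sum (f := M) (fun n _ => Nat.zero_le _) hmem
    have hC' := Finset.single_le_sum (f := C) (fun n _ => hC n) hmem
    refine (hu.norm_iteratedFDeriv_le k n ht x).trans ((hdep n _ _ (contDiff_dataOf hu₀ hf)
      hu.contDiff_toSystem (hu.solves h hf) B (fun l hl y hy => ?_) x hx).trans
      (mul_le_mul_of_nonneg_right hC' hB0))
    obtain ⟨b1, b2⟩ := hB l (hl.trans hM') y (Metric.closedBall_subset_closedBall hr' hy)
    exact norm_iteratedFDeriv_dataOf_le hu₀ hf b1 b2

end Regular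

end ThirdOrder

end

theorem theorem2 {d : ℕ} (T : ℝ) (hT : 0 < T) (a : Coeffs d ℝ) (b : Coeffs d ℂ)
    -- regularity of the coefficients of `L`, of `M` and `N`, and of `p`
    (hL : ∀ j α, j ≤ 2 → j + ∑ i, α i = 3 → ContDiffOn ℝ 2 (a j α) (Icc 0 T))
    (hMN : ∀ j α, j + ∑ i, α i = 2 ∨ j + ∑ i, α i = 1 → ContDiffOn ℝ 1 (b j α) (Icc 0 T))
    (hp : MemLp (b 0 0) ⊤ (volume.restrict (Icc 0 T)))
    -- weak hyperbolicity: all the roots of `L` in `τ` are real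
    (hyp : ∀ t ∈ Icc 0 T, ∀ ξ : Space d, (symbolL a t ξ).Splits)
    (h1 : LogBound T fun t (ξ : Space d) => ∑ j : Fin 3,
      |tDeriv T 1 (lam a j) t ξ - tDeriv T 1 (lam a (j + 1)) t ξ|
        / |lam a j t ξ - lam a (j + 1) t ξ|)
    (h2 : LogBound T fun t (ξ : Space d) => ∑ j : Fin 3,
      |tDeriv T 2 (lam a j) t ξ - tDeriv T 2 (lam a (j + 1)) t ξ|
        / (|tDeriv T 1 (lam a j) t ξ - tDeriv T 1 (lam a (j + 1)) t ξ| + 1))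
    (h3 : LogBound T fun t (ξ : Space d) => ∑ j : Fin 3,
      ‖tDeriv T 1 (checkMLam T a b j) t ξ‖ / (‖checkMLam T a b j t ξ‖ + 1))
    -- the derivative in the next condition exists in the sense of absolutely continuous functions
    (hN : ∃ R : ℝ, ∀ ξ : Space d, R ≤ ‖ξ‖ → ∀ j : Fin 2,
      AbsolutelyContinuousOnInterval (fun t => checkNMu T a b j t ξ) 0 T)
    (h4 : LogBound T fun t (ξ : Space d) => ∑ j : Fin 2,
      ‖tDeriv T 1 (checkNMu T a b j) t ξ‖ / (‖checkNMu T a b j t ξ‖ + 1))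
    (h5 : LogBound T fun t (ξ : Space d) => ∑ j : Fin 3,
      ‖checkMLam T a b j t ξ‖
        / (|lam a j t ξ - lam a (j + 1) t ξ| * |lam a j t ξ - lam a (j + 2) t ξ|))
    (h6 : LogBound T fun t (ξ : Space d) => ∑ j : Fin 2,
      √(‖checkNMu T a b j t ξ‖ / |mu a 1 t ξ - mu a 0 t ξ|)) :
    WellPosed T a b := by
  have h : Regular T a b := ⟨hT, hL, hMN, hp, hyp⟩
  obtain ⟨C, R, hCR⟩ := h.exists_rateBound h1 h2 h3 hN h4 h5 h6
  exact h.wellPosed (h.hyperbolic hCR)
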